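/- **Conventions.** A *multiple set* $X$ indexed by a linearly ordered set $N$ consists of sets $X_{\mathbf i}$ for the finite subsets (multi-indices) $\mathbf i\subset N$, faces $\partial^\alpha_i\colon X_{\mathbf i}\to X_{\mathbf i|i}$ and degeneracies $e_i\colon X_{\mathbf i|i}\to X_{\mathbf i}$ (for $i\in\mathbf i$, $\mathbf i|i=\mathbf i\setminus\{i\}$, $\alpha=\pm$) satisfying, for $i\ne j$, $\partial^\alpha_i\partial^\beta_j=\partial^\beta_j\partial^\alpha_i$, $e_ie_j=e_je_i$, $\partial^\alpha_ie_j=e_j\partial^\alpha_i$, $\partial^\alpha_ie_i=\mathrm{id}$. A (strict) *multiple category* indexed by $N$ has moreover compositions $x+_iy$ of $\mathbf i$-cells with $\partial^+_ix=\partial^-_iy$ (for $i\in\mathbf i$) which satisfy $\partial^-_i(x+_iy)=\partial^-_ix$, $\partial^+_i(x+_iy)=\partial^+_iy$, $\partial^\alpha_j(x+_iy)=\partial^\alpha_jx+_i\partial^\alpha_jy$ and $e_j(x+_iy)=e_jx+_ie_jy$ ($j\neq i$), are associative and unitary with units $e_i$, and satisfy the middle-four interchange in each pair of directions. A (strict)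 multiple functor preserves faces, degeneracies and compositions. **Multiple objects in $\mathbf{Cat}$.** Let $\mathrm{Mlt}(\mathbf{Cat})$ be the strict 2-category whose objects are the multiple objects in the category of small categories indexed by $\mathbb N^*=\{1,2,\dots\}$ (categories $A_{\mathbf i}$ for finite $\mathbf i\subset\mathbb N^*$, with functors $\partial^\alpha_i$, $e_i$ satisfying the relations above), whose arrows are the families of functors $F_{\mathbf i}\colon A_{\mathbf i}\to B_{\mathbf i}$ commuting with faces, and whose 2-cells are the families of natural transformations $\varphi_{\mathbf i}\colon F_{\mathbf i}\to G_{\mathbf i}$ with $\partial^\alpha_i(\varphi x)=\varphi(\partial^\alpha_ix)$. **Chiral multiple categories.** A (small) chiral multiple category $\mathcal A$ consists of a multiple object $\mathrm{tv}(\mathcal A)=(\mathrm{tv}_{\mathbf i}\mathcal A)_{\mathbf i}$ in $\mathbf{Cat}$ indexed by $\mathbb N^*$ (the objects and arrows of $\mathrm{tv}_{\mathbf i}\mathcal A$ are the $\mathbf i$-cubes and the transversal $\mathbf i$-maps, their composition is $+_0$), with compositions $x+_iy$, $f+_ig$ of $i$-consecutive $\mathbf i$-cubes and $\mathbf i$-maps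 ($i\in\mathbf i$), which are strictly consistent with domains, codomains, identities and composites of transversal maps, with faces, and with degeneracies in the other directions; and with transversal maps $$\lambda_ix\colon e_i\partial^-_ix+_ix\to x,\qquad \rho_ix\colon x+_ie_i\partial^+_ix\to x,\qquad \kappa_i(x,y,z)\colon x+_i(y+_iz)\to(x+_iy)+_iz,$$ $$\chi_{ij}(x,y,z,u)\colon(x+_iy)+_j(z+_iu)\to(x+_jz)+_i(y+_ju)\qquad(0<i<j).$$ The comparisons $\lambda_i,\rho_i,\kappa_i$ are invertible, the $\chi_{ij}$ need not be. All are natural, special ($\lambda_i,\rho_i,\kappa_i$ have identity $i$-faces, $\chi_{ij}$ has identity $i$- and $j$-faces), consistent with faces and degeneracies in the other directions, and coherent: the pentagon axiom for $\kappa_i$, the unit axiom for $\kappa_i,\lambda_i,\rho_i$, the coherence of $\chi_{ij}$ with $\kappa_i$, $\kappa_j$, $\lambda_i$, $\rho_i$, $\lambda_j$, $\rho_j$, and the hexagon of $\chi_{ij},\chi_{ik},\chi_{jk}$ for $i<j<k$. **Arrows.** A *0-morphism* $F\colon\mathcal A\to_0\mathcal B$ is a strict multiple functor (it strictly preserves all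 the structure). For $1\le p\le\infty$, a *$p$-morphism* $R\colon\mathcal A\to_p\mathcal B$ is a functor of mixed laxity: a family of functors $R_{\mathbf i}\colon\mathrm{tv}_{\mathbf i}\mathcal A\to\mathrm{tv}_{\mathbf i}\mathcal B$ commuting with faces, with $i$-special comparison maps, natural, commuting with the faces in the other directions, and directed as $$e_iR(t)\to R(e_it),\quad R(x)+_iR(y)\to R(x+_iy)\quad(i\ge p)\qquad\text{(lax)},$$ $$R(e_it)\to e_iR(t),\quad R(x+_iy)\to R(x)+_iR(y)\quad(0<i<p)\qquad\text{(colax)},$$ coherent with $\lambda_i,\rho_i,\kappa_i$ (in the lax form for $i\ge p$, in the dual form for $i<p$) and with $\chi_{ij}$ for $i<j$ (in three forms: $p\le i$; $i<p\le j$; $j<p$). So $R$ is lax for $p=1$ and colax for $p=\infty$. Comparisons of $p$-morphisms are composed separately. **Two-dimensional cells.** Let $0\le p<q\le\infty$, and let $R\colon\mathcal A\to_p\mathcal B$, $S\colon\mathcal C\to_p\mathcal D$, $U\colon\mathcal A\to_q\mathcal C$, $V\colon\mathcal B\to_q\mathcal D$. For $p=0$, a $0q$-cell with this boundary is a commutative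 square $VR=SU$ of $q$-morphisms, comparisons included. For $p\ge1$, a $pq$-cube $\varphi\colon(U\,{}^R_S\,V)$ is a generalised quintet $\varphi\colon VR\dashrightarrow SU$: a family of natural transformations $\varphi_{\mathbf i}\colon V_{\mathbf i}R_{\mathbf i}\to S_{\mathbf i}U_{\mathbf i}$ with $\partial^\alpha_i(\varphi x)=\varphi(\partial^\alpha_ix)$, coherent with the comparisons of $R,S,U,V$ in each positive direction $i$, for degeneracies and compositions, in the three cases $i\ge q$ (all lax), $p\le i<q$ ($R,S$ lax and $U,V$ colax), $i<p$ (all colax). Cubes are composed by $$(\varphi+_p\psi)(x)=S'(\varphi x)\cdot\psi(Rx),\qquad(\varphi+_q\sigma)(x)=\sigma(Ux)\cdot V'(\varphi x),$$ where $\psi\colon(V\,{}^{R'}_{S'}\,W)$ and $\sigma\colon(U'\,{}^S_T\,V')$. **Higher cells.** For $0\le p<q<r\le\infty$, a $pqr$-cell is a commutative cube: a face-consistent family of $pq$-cells $\varphi,\psi$ (the faces $\partial^-_r,\partial^+_r$), $pr$-cells $\pi,\rho$ (the faces $\partial^-_q,\partial^+_q$) and $qr$-cells $\omega,\zeta$ (the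 faces $\partial^-_p,\partial^+_p$), with $\varphi\colon(U\,{}^R_S\,V)$, $\psi\colon(U'\,{}^{R'}_{S'}\,V')$, $\pi\colon(X\,{}^R_{R'}\,X')$, $\rho\colon(Y\,{}^S_{S'}\,Y')$, $\omega\colon(X\,{}^U_{U'}\,Y)$, $\zeta\colon(X'\,{}^V_{V'}\,Y')$, such that for every cube $x$ of the initial vertex $$S'(\omega x)\cdot\rho(Ux)\cdot Y'(\varphi x)=\psi(Xx)\cdot V'(\pi x)\cdot\zeta(Rx)\colon\ Y'VR(x)\to S'U'X(x).$$ (For $p=0$ this says $S'(\omega x)=\zeta(Rx)$.) A cell of dimension $n\ge4$ is an $n$-dimensional cube of objects, arrows and two-dimensional cells all of whose three-dimensional faces are commutative cubes. Faces are the geometric ones; degeneracies and compositions are computed on the arrows and the two-dimensional faces. For a 2-category $\mathbf C$, let $\mathcal Q(\mathbf C)$, here indexed by $\omega+1$, be the analogous structure in which the $p$-arrows are the arrows of $\mathbf C$ for every $p$, the $pq$-cells are the quintets (2-cells $\varphi\colon vr\to su$ of $\mathbf C$), and the higher cells are cubes of quintets all of whose three-dimensional faces commute. **Theorem.** 1.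 The items above (objects: small chiral multiple categories; $p$-arrows: $p$-morphisms, $0\le p\le\infty$; two-dimensional and higher cells as described) form, with the faces, degeneracies and compositions described, a strict multiple category $\mathsf{Cmc}$ indexed by the ordinal $\omega+1=\{0,1,\dots,\infty\}$. Similarly, $\mathcal Q(\mathrm{Mlt}(\mathbf{Cat}))$ is a strict multiple category. 2. There is a multiple functor $\mathrm{tv}\colon\mathsf{Cmc}\to\mathcal Q(\mathrm{Mlt}(\mathbf{Cat}))$ which sends a chiral multiple category $\mathcal A$ to $\mathrm{tv}(\mathcal A)$, a $p$-morphism $R$ to $(R_{\mathbf i})_{\mathbf i}$, a $pq$-cell $\varphi$ to $(\varphi_{\mathbf i})_{\mathbf i}$ and a higher cell to the cell obtained by acting on its vertices, arrows and two-dimensional faces. It makes $\mathsf{Cmc}$ a multiple category of quintet type: two parallel cells of $\mathsf{Cmc}$, of the same multi-index of dimension at least $2$, with the same faces and the same image under $\mathrm{tv}$, coincide. 3. $\mathsf{Cmc}$ has coskeletal dimension $3$, i.e. $3$ is the least natural number $n$ such that, for every multi-index $\mathbf p$ of dimension greater than $n$, each face-consistent family $(x^\alpha_p)_{p\in\mathbf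 p,\,\alpha=\pm}$ (of $\mathbf p|p$-cells $x^\alpha_p$ with $\partial^\beta_qx^\alpha_p=\partial^\alpha_px^\beta_q$ for $p\ne q$) is the family of faces of exactly one $\mathbf p$-cell. -/

import Mathlib

open CategoryTheory
open scoped Bicategory

universe u v w

/-! ## Multiple sets and strict multiple categories -/

/-- `IsExt j k i`: the multi-index `i` is `k ∪ {j}` with `j ∉ k`; equivalently `j ∈ i` and
`k = i \ {j}`. -/
def IsExt {I : Type} [DecidableEq I] (j : I) (k i : Finset I) : Prop :=
  j ∉ k ∧ i = insert j k

/-- The structure of a multiple set, indexed by `I`, on a family `X` of sets indexed by the finite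
subsets of `I`: faces `∂^α_j : X_i → X_{i|j}` (with `α = false` for `-` and `α = true` for `+`)
and degeneracies `e_j : X_{i|j} → X_i`, satisfying the multiple relations. In each relation the
two directions `j`, `l` are automatically distinct. -/
structure MultipleSet {I : Type} [DecidableEq I] (X : Finset I → Type u) where
  face : Bool → ∀ {j : I} {k i : Finset I}, IsExt j k i → X i → X k
  deg : ∀ {j : I} {k i : Finset I}, IsExt j k i → X k → X i
  face_face : ∀ (α β : Bool) {j l : I} {m k n i : Finset I} (hj : IsExt j m k) (hl : IsExt l k i)
    (hl' : IsExt l m n) (hj' : IsExt j n i) (x : X i),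
    face α hj (face β hl x) = face β hl' (face α hj' x)
  deg_deg : ∀ {j l : I} {m k n i : Finset I} (hj : IsExt j m k) (hl : IsExt l k i)
    (hl' : IsExt l m n) (hj' : IsExt j n i) (x : X m),
    deg hl (deg hj x) = deg hj' (deg hl' x)
  face_deg_ne : ∀ (α : Bool) {j l : I} {m k n i : Finset I} (hj : IsExt j m k) (hl : IsExt l k i)
    (hl' : IsExt l m n) (hj' : IsExt j n i) (x : X n),
    face α hl (deg hj' x) = deg hj (face α hl' x)
  face_deg : ∀ (α : Bool) {j : I} {k i : Finset I} (h : IsExt j k i) (x : X k),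
    face α h (deg h x) = x

/-- `x` and `y` are `j`-consecutive: `∂⁺_j x = ∂⁻_j y`. -/
abbrev MultipleSet.Consec {I : Type} [DecidableEq I] {X : Finset I → Type u} (S : MultipleSet X)
    {j : I} {k i : Finset I} (h : IsExt j k i) (x y : X i) : Prop :=
  S.face true h x = S.face false h y

/-- A (strict) multiple category indexed by `I`, with set of `i`-cells `X i`. The `j`-composition
`x +_j y` is defined for `j`-consecutive cells. -/
structure MultipleCategory {I : Type} [LinearOrder I] (X : Finset I → Type u) extends
    MultipleSet X where
  comp : ∀ {j : I} {k i : Finset I} (h : IsExt j k i) (x y : X i),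
    face true h x = face false h y → X i
  face_comp_fst : ∀ {j : I} {k i : Finset I} (h : IsExt j k i) (x y : X i)
    (hxy : face true h x = face false h y), face false h (comp h x y hxy) = face false h x
  face_comp_snd : ∀ {j : I} {k i : Finset I} (h : IsExt j k i) (x y : X i)
    (hxy : face true h x = face false h y), face true h (comp h x y hxy) = face true h y
  face_comp_ne : ∀ (α : Bool) {j l : I} {m k n i : Finset I} (hl : IsExt l k i) (hj : IsExt j n i)
    (hj' : IsExt j m k) (x y : X i) (hxy : face true hj x = face false hj y)
    (hxy' : face true hj' (face α hl x) = face false hj' (face α hl y)),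
    face α hl (comp hj x y hxy) = comp hj' (face α hl x) (face α hl y) hxy'
  deg_comp_ne : ∀ {j l : I} {m k n i : Finset I} (hl : IsExt l k i) (hj : IsExt j n i)
    (hj' : IsExt j m k) (x y : X k) (hxy : face true hj' x = face false hj' y)
    (hxy' : face true hj (deg hl x) = face false hj (deg hl y)),
    deg hl (comp hj' x y hxy) = comp hj (deg hl x) (deg hl y) hxy'
  id_comp : ∀ {j : I} {k i : Finset I} (h : IsExt j k i) (x : X i)
    (hx : face true h (deg h (face false h x)) = face false h x),
    comp h (deg h (face false h x)) x hx = x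
  comp_id : ∀ {j : I} {k i : Finset I} (h : IsExt j k i) (x : X i)
    (hx : face true h x = face false h (deg h (face true h x))),
    comp h x (deg h (face true h x)) hx = x
  assoc : ∀ {j : I} {k i : Finset I} (h : IsExt j k i) (x y z : X i)
    (hxy : face true h x = face false h y) (hyz : face true h y = face false h z)
    (h₁ : face true h (comp h x y hxy) = face false h z)
    (h₂ : face true h x = face false h (comp h y z hyz)),
    comp h (comp h x y hxy) z h₁ = comp h x (comp h y z hyz) h₂
  interchange : ∀ {j l : I} {k n i : Finset I}, j < l → ∀ (hj : IsExt j k i) (hl : IsExt l n i)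
    (x y z t : X i)
    (hxy : face true hj x = face false hj y) (hzt : face true hj z = face false hj t)
    (hxz : face true hl x = face false hl z) (hyt : face true hl y = face false hl t)
    (h₁ : face true hl (comp hj x y hxy) = face false hl (comp hj z t hzt))
    (h₂ : face true hj (comp hl x z hxz) = face false hj (comp hl y t hyt)),
    comp hl (comp hj x y hxy) (comp hj z t hzt) h₁ =
      comp hj (comp hl x z hxz) (comp hl y t hyt) h₂

/-- A (strict) multiple functor. -/
structure MultipleFunctor {I : Type} [LinearOrder I] {X : Finset I → Type u}
    {Y : Finset I → Type v} (M : MultipleCategory X) (N : MultipleCategory Y) where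
  map : ∀ {i : Finset I}, X i → Y i
  map_face : ∀ (α : Bool) {j : I} {k i : Finset I} (h : IsExt j k i) (x : X i),
    map (M.face α h x) = N.face α h (map x)
  map_deg : ∀ {j : I} {k i : Finset I} (h : IsExt j k i) (x : X k),
    map (M.deg h x) = N.deg h (map x)
  map_comp : ∀ {j : I} {k i : Finset I} (h : IsExt j k i) (x y : X i)
    (hxy : M.face true h x = M.face false h y)
    (hxy' : N.face true h (map x) = N.face false h (map y)),
    map (M.comp h x y hxy) = N.comp h (map x) (map y) hxy'

/-- Two-dimensional faithfulness of a multiple functor: each cell of dimension two or higher of the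
domain is determined by its boundary and its image. -/
def MultipleFunctor.IsTwoFaithful {I : Type} [LinearOrder I] {X : Finset I → Type u}
    {Y : Finset I → Type v} {M : MultipleCategory X} {N : MultipleCategory Y}
    (F : MultipleFunctor M N) : Prop :=
  ∀ (i : Finset I), 2 ≤ i.card → ∀ x y : X i,
    (∀ (α : Bool) {j : I} {k : Finset I} (h : IsExt j k i), M.face α h x = M.face α h y) →
    F.map x = F.map y → x = y

/-- A face-consistent `i`-family: an `i|j`-cell `c^α_j` for all `j ∈ i` and `α = ±`, such that
`∂^β_l c^α_j = ∂^α_j c^β_l` for `j ≠ l`. -/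
structure FaceFamily {I : Type} [DecidableEq I] {X : Finset I → Type u} (M : MultipleSet X)
    (i : Finset I) where
  cell : Bool → ∀ {j : I} {k : Finset I}, IsExt j k i → X k
  consistent : ∀ (α β : Bool) {j l : I} {m k n : Finset I} (hj : IsExt j k i) (hl : IsExt l n i)
    (hl' : IsExt l m k) (hj' : IsExt j m n),
    M.face β hl' (cell α hj) = M.face α hj' (cell β hl)

/-- The coskeletal dimension is at most `n`: the cells of each dimension greater than `n` are, via
their boundaries, in bijection with the face-consistent families of cells of one dimension less.
This says that the canonical multiple functor to the `n`-coskeleton of the `n`-truncation is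
bijective on cells. -/
def MultipleSet.CoskeletalDimLE {I : Type} [DecidableEq I] {X : Finset I → Type u}
    (M : MultipleSet X) (n : ℕ) : Prop :=
  ∀ (i : Finset I), n < i.card → ∀ c : FaceFamily M i,
    ∃! x : X i, ∀ (α : Bool) {j : I} {k : Finset I} (h : IsExt j k i), M.face α h x = c.cell α h

/-! ## The 2-category of multiple objects in `Cat` -/

/-- A multiple object in the category of small categories, indexed by the finite subsets of the
positive integers. The category of index `i` has set of objects `cube i` and set of arrows `map i`,
with domain `src`, codomain `tgt`, identities `one` and composition `comp f g` (first `f`, then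
`g`); faces and degeneracies are functors. -/
structure MultCat : Type (u + 1) where
  cube : Finset ℕ+ → Type u
  map : Finset ℕ+ → Type u
  cubes : MultipleSet cube
  maps : MultipleSet map
  src : ∀ {i : Finset ℕ+}, map i → cube i
  tgt : ∀ {i : Finset ℕ+}, map i → cube i
  one : ∀ {i : Finset ℕ+}, cube i → map i
  comp : ∀ {i : Finset ℕ+} (f g : map i), tgt f = src g → map i
  src_one : ∀ {i : Finset ℕ+} (x : cube i), src (one x) = x
  tgt_one : ∀ {i : Finset ℕ+} (x : cube i), tgt (one x) = x
  src_comp : ∀ {i : Finset ℕ+} (f g : map i) (h : tgt f = src g), src (comp f g h) = src f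
  tgt_comp : ∀ {i : Finset ℕ+} (f g : map i) (h : tgt f = src g), tgt (comp f g h) = tgt g
  one_comp : ∀ {i : Finset ℕ+} (f : map i) (h : tgt (one (src f)) = src f),
    comp (one (src f)) f h = f
  comp_one : ∀ {i : Finset ℕ+} (f : map i) (h : tgt f = src (one (tgt f))),
    comp f (one (tgt f)) h = f
  comp_assoc : ∀ {i : Finset ℕ+} (f g k : map i) (h : tgt f = src g) (h' : tgt g = src k)
    (h₁ : tgt (comp f g h) = src k) (h₂ : tgt f = src (comp g k h')),
    comp (comp f g h) k h₁ = comp f (comp g k h') h₂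
  src_face : ∀ (α : Bool) {j : ℕ+} {k i : Finset ℕ+} (h : IsExt j k i) (f : map i),
    src (maps.face α h f) = cubes.face α h (src f)
  tgt_face : ∀ (α : Bool) {j : ℕ+} {k i : Finset ℕ+} (h : IsExt j k i) (f : map i),
    tgt (maps.face α h f) = cubes.face α h (tgt f)
  face_one : ∀ (α : Bool) {j : ℕ+} {k i : Finset ℕ+} (h : IsExt j k i) (x : cube i),
    maps.face α h (one x) = one (cubes.face α h x)
  face_comp : ∀ (α : Bool) {j : ℕ+} {k i : Finset ℕ+} (h : IsExt j k i) (f g : map i)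
    (hfg : tgt f = src g) (hfg' : tgt (maps.face α h f) = src (maps.face α h g)),
    maps.face α h (comp f g hfg) = comp (maps.face α h f) (maps.face α h g) hfg'
  src_deg : ∀ {j : ℕ+} {k i : Finset ℕ+} (h : IsExt j k i) (f : map k),
    src (maps.deg h f) = cubes.deg h (src f)
  tgt_deg : ∀ {j : ℕ+} {k i : Finset ℕ+} (h : IsExt j k i) (f : map k),
    tgt (maps.deg h f) = cubes.deg h (tgt f)
  deg_one : ∀ {j : ℕ+} {k i : Finset ℕ+} (h : IsExt j k i) (x : cube k),
    maps.deg h (one x) = one (cubes.deg h x)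
  deg_comp : ∀ {j : ℕ+} {k i : Finset ℕ+} (h : IsExt j k i) (f g : map k)
    (hfg : tgt f = src g) (hfg' : tgt (maps.deg h f) = src (maps.deg h g)),
    maps.deg h (comp f g hfg) = comp (maps.deg h f) (maps.deg h g) hfg'

namespace MultCat

/-- `f` is an arrow from `x` to `y`. -/
def IsHom (A : MultCat.{u}) {i : Finset ℕ+} (f : A.map i) (x y : A.cube i) : Prop :=
  A.src f = x ∧ A.tgt f = y

/-- `A.IsComposite l c`: the arrows of the nonempty list `l` form a path, with composite `c`. -/
inductive IsComposite (A : MultCat.{u}) {i : Finset ℕ+} : List (A.map i) → A.map i → Prop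
  | single (f : A.map i) : IsComposite A [f] f
  | cons (f : A.map i) (l : List (A.map i)) (c : A.map i) (hc : IsComposite A l c)
      (h : A.tgt f = A.src c) : IsComposite A (f :: l) (A.comp f c h)

theorem isComposite_pair {A : MultCat.{u}} {i : Finset ℕ+} {f g c : A.map i}
    (H : A.IsComposite [f, g] c) : ∃ h : A.tgt f = A.src g, A.comp f g h = c := by
  cases H with
  | cons _ _ c' hc h =>
    cases hc with
    | single => exact ⟨h, rfl⟩
    | cons _ _ _ hc' => nomatch hc'

/-- Two lists of consecutive arrows are paths with the same composite. -/
def Commutes (A : MultCat.{u}) {i : Finset ℕ+} (l l' : List (A.map i)) : Prop :=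
  ∃ c : A.map i, A.IsComposite l c ∧ A.IsComposite l' c

/-- `f` is an isomorphism. -/
def IsInvertible (A : MultCat.{u}) {i : Finset ℕ+} (f : A.map i) : Prop :=
  ∃ (g : A.map i) (h : A.tgt f = A.src g) (h' : A.tgt g = A.src f),
    A.comp f g h = A.one (A.src f) ∧ A.comp g f h' = A.one (A.tgt f)

/-- `f` is special in direction `j`: its `j`-faces are transversal identities. -/
def IsSpecial (A : MultCat.{u}) {j : ℕ+} {k i : Finset ℕ+} (h : IsExt j k i) (f : A.map i) : Prop :=
  ∀ α : Bool, A.maps.face α h f = A.one (A.cubes.face α h (A.src f))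

/-- A morphism of multiple objects in `Cat`, as needed for lax and colax functors: a family of
functors `F_i` consistent with faces (but not necessarily with degeneracies). -/
@[ext]
structure Hom (A B : MultCat.{u}) : Type u where
  obj : ∀ {i : Finset ℕ+}, A.cube i → B.cube i
  mor : ∀ {i : Finset ℕ+}, A.map i → B.map i
  src_mor : ∀ {i : Finset ℕ+} (f : A.map i), B.src (mor f) = obj (A.src f)
  tgt_mor : ∀ {i : Finset ℕ+} (f : A.map i), B.tgt (mor f) = obj (A.tgt f)
  mor_one : ∀ {i : Finset ℕ+} (x : A.cube i), mor (A.one x) = B.one (obj x)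
  mor_comp : ∀ {i : Finset ℕ+} (f g : A.map i) (h : A.tgt f = A.src g)
    (h' : B.tgt (mor f) = B.src (mor g)), mor (A.comp f g h) = B.comp (mor f) (mor g) h'
  face_obj : ∀ (α : Bool) {j : ℕ+} {k i : Finset ℕ+} (h : IsExt j k i) (x : A.cube i),
    B.cubes.face α h (obj x) = obj (A.cubes.face α h x)
  face_mor : ∀ (α : Bool) {j : ℕ+} {k i : Finset ℕ+} (h : IsExt j k i) (f : A.map i),
    B.maps.face α h (mor f) = mor (A.maps.face α h f)

/-- A 2-cell between morphisms of multiple objects in `Cat`: a face-consistent family of natural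
transformations `F_i → G_i`. -/
@[ext]
structure Trans {A B : MultCat.{u}} (F G : Hom A B) : Type u where
  app : ∀ {i : Finset ℕ+}, A.cube i → B.map i
  src_app : ∀ {i : Finset ℕ+} (x : A.cube i), B.src (app x) = F.obj x
  tgt_app : ∀ {i : Finset ℕ+} (x : A.cube i), B.tgt (app x) = G.obj x
  naturality : ∀ {i : Finset ℕ+} (f : A.map i)
    (h : B.tgt (F.mor f) = B.src (app (A.tgt f))) (h' : B.tgt (app (A.src f)) = B.src (G.mor f)),
    B.comp (F.mor f) (app (A.tgt f)) h = B.comp (app (A.src f)) (G.mor f) h'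
  face_app : ∀ (α : Bool) {j : ℕ+} {k i : Finset ℕ+} (h : IsExt j k i) (x : A.cube i),
    B.maps.face α h (app x) = app (A.cubes.face α h x)

/-- The identity morphism. -/
def Hom.id (A : MultCat.{u}) : Hom A A where
  obj x := x
  mor f := f
  src_mor _ := rfl
  tgt_mor _ := rfl
  mor_one _ := rfl
  mor_comp _ _ _ _ := rfl
  face_obj _ _ _ _ _ _ := rfl
  face_mor _ _ _ _ _ _ := rfl

/-- Composition of morphisms, in diagrammatic order. -/
def Hom.comp {A B C : MultCat.{u}} (F : Hom A B) (G : Hom B C) : Hom A C where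
  obj x := G.obj (F.obj x)
  mor f := G.mor (F.mor f)
  src_mor f := by rw [G.src_mor, F.src_mor]
  tgt_mor f := by rw [G.tgt_mor, F.tgt_mor]
  mor_one x := by rw [F.mor_one, G.mor_one]
  mor_comp f g h h' := by
    rw [F.mor_comp f g h (by rw [F.tgt_mor, F.src_mor, h])]
    exact G.mor_comp _ _ _ _
  face_obj α _ _ _ h x := by rw [G.face_obj, F.face_obj]
  face_mor α _ _ _ h x := by rw [G.face_mor, F.face_mor]

/-- The identity 2-cell. -/
def Trans.id {A B : MultCat.{u}} (F : Hom A B) : Trans F F where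
  app x := B.one (F.obj x)
  src_app x := B.src_one _
  tgt_app x := B.tgt_one _
  naturality f h h' := by
    have e₁ : F.obj (A.tgt f) = B.tgt (F.mor f) := (F.tgt_mor f).symm
    have e₂ : F.obj (A.src f) = B.src (F.mor f) := (F.src_mor f).symm
    simp only [e₁, e₂, B.comp_one, B.one_comp]
  face_app α _ _ _ h x := by rw [B.face_one, F.face_obj]

/-- Vertical composition of 2-cells. -/
def Trans.comp {A B : MultCat.{u}} {F G H : Hom A B} (φ : Trans F G) (ψ : Trans G H) :
    Trans F H where
  app x := B.comp (φ.app x) (ψ.app x) (by rw [φ.tgt_app, ψ.src_app])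
  src_app x := by rw [B.src_comp, φ.src_app]
  tgt_app x := by rw [B.tgt_comp, ψ.tgt_app]
  naturality f h h' := by
    have h₁ : B.tgt (F.mor f) = B.src (φ.app (A.tgt f)) := by rw [F.tgt_mor, φ.src_app]
    have h₂ : B.tgt (φ.app (A.src f)) = B.src (G.mor f) := by rw [φ.tgt_app, G.src_mor]
    have h₃ : B.tgt (G.mor f) = B.src (ψ.app (A.tgt f)) := by rw [G.tgt_mor, ψ.src_app]
    have h₄ : B.tgt (ψ.app (A.src f)) = B.src (H.mor f) := by rw [ψ.tgt_app, H.src_mor]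
    rw [← B.comp_assoc _ _ _ h₁ (by rw [φ.tgt_app, ψ.src_app])
      (by rw [B.tgt_comp, φ.tgt_app, ψ.src_app])]
    simp only [φ.naturality f h₁ h₂]
    rw [B.comp_assoc _ _ _ h₂ h₃ _ (by rw [B.src_comp, φ.tgt_app, G.src_mor])]
    simp only [ψ.naturality f h₃ h₄]
    rw [← B.comp_assoc]
  face_app α _ _ _ h x := by
    rw [B.face_comp _ _ _ _ _ (by rw [B.tgt_face, B.src_face, φ.tgt_app, ψ.src_app])]
    simp only [φ.face_app, ψ.face_app]

instance (A B : MultCat.{u}) : Category (Hom A B) where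
  Hom F G := Trans F G
  id F := Trans.id F
  comp φ ψ := Trans.comp φ ψ
  id_comp {F G} φ := by
    refine Trans.ext ?_
    funext i x
    change B.comp (B.one (F.obj x)) (φ.app x) _ = φ.app x
    have e : F.obj x = B.src (φ.app x) := (φ.src_app x).symm
    simp only [e, B.one_comp]
  comp_id {F G} φ := by
    refine Trans.ext ?_
    funext i x
    change B.comp (φ.app x) (B.one (G.obj x)) _ = φ.app x
    have e : G.obj x = B.tgt (φ.app x) := (φ.tgt_app x).symm
    simp only [e, B.comp_one]
  assoc φ ψ χ := by
    refine Trans.ext ?_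
    funext i x
    exact B.comp_assoc _ _ _ _ _ _ _

/-- Whiskering `F ◁ φ`, with components `φ(F x)`. -/
def Trans.whiskerLeft {A B C : MultCat.{u}} (F : Hom A B) {G H : Hom B C} (φ : Trans G H) :
    Trans (F.comp G) (F.comp H) where
  app x := φ.app (F.obj x)
  src_app x := φ.src_app _
  tgt_app x := φ.tgt_app _
  naturality f h h' := by
    have := φ.naturality (F.mor f)
    simp only [F.src_mor, F.tgt_mor] at this
    exact this h h'
  face_app α _ _ _ h x := by rw [φ.face_app, F.face_obj]

/-- Whiskering `φ ▷ H`, with components `H(φ x)`. -/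
def Trans.whiskerRight {A B C : MultCat.{u}} {F G : Hom A B} (φ : Trans F G) (H : Hom B C) :
    Trans (F.comp H) (G.comp H) where
  app x := H.mor (φ.app x)
  src_app x := by rw [H.src_mor, φ.src_app]; rfl
  tgt_app x := by rw [H.tgt_mor, φ.tgt_app]; rfl
  naturality f h h' := by
    have h₁ : B.tgt (F.mor f) = B.src (φ.app (A.tgt f)) := by rw [F.tgt_mor, φ.src_app]
    have h₂ : B.tgt (φ.app (A.src f)) = B.src (G.mor f) := by rw [φ.tgt_app, G.src_mor]
    exact ((H.mor_comp _ _ h₁ h).symm.trans (congrArg H.mor (φ.naturality f h₁ h₂))).trans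
      (H.mor_comp _ _ h₂ h')
  face_app α _ _ _ h x := by rw [H.face_mor, φ.face_app]

theorem Trans.hom_ext {A B : MultCat.{u}} {F G : Hom A B} {φ ψ : F ⟶ G}
    (h : ∀ {i : Finset ℕ+} (x : A.cube i), Trans.app φ x = Trans.app ψ x) : φ = ψ := by
  refine Trans.ext ?_
  funext i x
  exact h x

theorem Trans.id_comp {A B : MultCat.{u}} {F G : Hom A B} (φ : Trans F G) :
    Trans.comp (Trans.id F) φ = φ :=
  Category.id_comp (obj := Hom A B) (X := F) (Y := G) φ

theorem Trans.comp_id {A B : MultCat.{u}} {F G : Hom A B} (φ : Trans F G) :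
    Trans.comp φ (Trans.id G) = φ :=
  Category.comp_id (obj := Hom A B) (X := F) (Y := G) φ

theorem Trans.id_whiskerRight {A B C : MultCat.{u}} (F : Hom A B) (G : Hom B C) :
    Trans.whiskerRight (Trans.id F) G = Trans.id (F.comp G) :=
  Trans.hom_ext fun _ => G.mor_one _

/-- The 2-category of multiple objects in `Cat`, indexed by the positive integers. -/
instance : Bicategory MultCat.{u} where
  Hom A B := Hom A B
  id A := Hom.id A
  comp F G := Hom.comp F G
  homCategory A B := inferInstanceAs (Category (Hom A B))
  whiskerLeft F _ _ φ := Trans.whiskerLeft F φ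
  whiskerRight φ H := Trans.whiskerRight φ H
  associator F G H :=
    { hom := Trans.id (F.comp (G.comp H))
      inv := Trans.id (F.comp (G.comp H))
      hom_inv_id := Trans.id_comp _
      inv_hom_id := Trans.id_comp _ }
  leftUnitor F :=
    { hom := Trans.id F
      inv := Trans.id F
      hom_inv_id := Trans.id_comp _
      inv_hom_id := Trans.id_comp _ }
  rightUnitor F :=
    { hom := Trans.id F
      inv := Trans.id F
      hom_inv_id := Trans.id_comp _
      inv_hom_id := Trans.id_comp _ }
  whiskerLeft_id F G := rfl
  whiskerLeft_comp F _ _ _ φ ψ := rfl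
  id_whiskerLeft φ := ((Trans.id_comp _).trans (Trans.comp_id _)).symm
  comp_whiskerLeft F G _ _ φ := ((Trans.id_comp _).trans (Trans.comp_id _)).symm
  id_whiskerRight F G := Trans.hom_ext fun _ => G.mor_one _
  comp_whiskerRight φ ψ F := Trans.hom_ext fun _ => F.mor_comp _ _ _ _
  whiskerRight_id φ := ((Trans.id_comp _).trans (Trans.comp_id _)).symm
  whiskerRight_comp φ G H := ((Trans.id_comp _).trans (Trans.comp_id _)).symm
  whisker_assoc F _ _ φ H := ((Trans.id_comp _).trans (Trans.comp_id _)).symm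
  whisker_exchange {_ _ _ _ _ H₀ H₁} φ ψ := Trans.hom_ext fun x => by
    have h := ψ.naturality (φ.app x)
    simp only [φ.src_app, φ.tgt_app] at h
    exact (h ((H₀.tgt_mor _).trans ((congrArg H₀.obj (φ.tgt_app x)).trans (ψ.src_app _).symm))
      ((ψ.tgt_app _).trans ((congrArg H₁.obj (φ.src_app x)).symm.trans (H₁.src_mor _).symm))).symm
  pentagon F G H K := by
    change Trans.comp (Trans.whiskerRight (Trans.id (F.comp (G.comp H))) K)
      (Trans.comp (Trans.id _) (Trans.whiskerLeft F (Trans.id (G.comp (H.comp K))))) =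
      Trans.comp (Trans.id _) (Trans.id _)
    rw [Trans.id_whiskerRight]
    exact Trans.id_comp _
  triangle F G := by
    change Trans.comp (Trans.id _) (Trans.whiskerLeft F (Trans.id G)) =
      Trans.whiskerRight (Trans.id F) G
    rw [Trans.id_whiskerRight]
    exact Trans.id_comp _

theorem eqToHom_app {A B : MultCat.{u}} {F G : A ⟶ B} (h : F = G) {i : Finset ℕ+}
    (x : A.cube i) : Trans.app (eqToHom h) x = B.one (Hom.obj F x) := by
  subst h
  rfl

instance : Bicategory.Strict MultCat.{u} where
  id_comp _ := rfl
  comp_id _ := rfl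
  assoc _ _ _ := rfl
  leftUnitor_eqToIso F := Iso.ext (Trans.hom_ext fun x =>
    (eqToHom_app (F := 𝟙 _ ≫ F) (G := F) rfl x).symm)
  rightUnitor_eqToIso F := Iso.ext (Trans.hom_ext fun x =>
    (eqToHom_app (F := F ≫ 𝟙 _) (G := F) rfl x).symm)
  associator_eqToIso F G H := Iso.ext (Trans.hom_ext fun x =>
    (eqToHom_app (F := (F ≫ G) ≫ H) (G := F ≫ G ≫ H) rfl x).symm)

end MultCat

/-! ## Chiral multiple categories -/

/-- The data of a (small) chiral multiple category `A` over its underlying multiple object in `Cat`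
(the family of transversal categories `tv_i(A)`): the compositions `x +_j y` of `j`-consecutive
cubes and `f +_j g` of `j`-consecutive maps, in the positive directions, and the comparisons
`λ_j`, `ρ_j`, `κ_j` and `χ_ab`, for `a < b`. All strict laws are part of this structure; all the
laws which hold up to comparisons are in `ChiralMultipleCategory`. The `∀`-bound equations that
follow the choice of consecutive cells in an axiom are consequences of the previous ones; they only
express that the terms of the axiom are defined. -/
structure PreChiral : Type (u + 1) extends MultCat.{u} where
  add : ∀ {j : ℕ+} {k i : Finset ℕ+} (h : IsExt j k i) (x y : cube i),
    cubes.Consec h x y → cube i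
  addM : ∀ {j : ℕ+} {k i : Finset ℕ+} (h : IsExt j k i) (f g : map i),
    maps.Consec h f g → map i
  -- the transversal composition has a strict interchange with the positive ones
  src_addM : ∀ {j : ℕ+} {k i : Finset ℕ+} (h : IsExt j k i) (f g : map i) (hfg : maps.Consec h f g)
    (hs : cubes.Consec h (src f) (src g)),
    src (addM h f g hfg) = add h (src f) (src g) hs
  tgt_addM : ∀ {j : ℕ+} {k i : Finset ℕ+} (h : IsExt j k i) (f g : map i) (hfg : maps.Consec h f g)
    (ht : cubes.Consec h (tgt f) (tgt g)),
    tgt (addM h f g hfg) = add h (tgt f) (tgt g) ht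
  addM_one : ∀ {j : ℕ+} {k i : Finset ℕ+} (h : IsExt j k i) (x y : cube i)
    (hxy : cubes.Consec h x y) (h' : maps.Consec h (one x) (one y)),
    addM h (one x) (one y) h' = one (add h x y hxy)
  addM_comp : ∀ {j : ℕ+} {k i : Finset ℕ+} (h : IsExt j k i) (f f' g g' : map i)
    (hf : tgt f = src f') (hg : tgt g = src g') (hfg : maps.Consec h f g)
    (hfg' : maps.Consec h f' g') (h₁ : maps.Consec h (comp f f' hf) (comp g g' hg))
    (h₂ : tgt (addM h f g hfg) = src (addM h f' g' hfg')),
    addM h (comp f f' hf) (comp g g' hg) h₁ = comp (addM h f g hfg) (addM h f' g' hfg') h₂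
  -- faces and degeneracies of a composite
  face_add_fst : ∀ {j : ℕ+} {k i : Finset ℕ+} (h : IsExt j k i) (x y : cube i)
    (hxy : cubes.Consec h x y),
    cubes.face false h (add h x y hxy) = cubes.face false h x
  face_add_snd : ∀ {j : ℕ+} {k i : Finset ℕ+} (h : IsExt j k i) (x y : cube i)
    (hxy : cubes.Consec h x y),
    cubes.face true h (add h x y hxy) = cubes.face true h y
  face_add_ne : ∀ (α : Bool) {j l : ℕ+} {m k n i : Finset ℕ+} (hl : IsExt l k i) (hj : IsExt j n i)
    (hj' : IsExt j m k) (x y : cube i) (hxy : cubes.Consec hj x y)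
    (hxy' : cubes.Consec hj' (cubes.face α hl x) (cubes.face α hl y)),
    cubes.face α hl (add hj x y hxy) = add hj' (cubes.face α hl x) (cubes.face α hl y) hxy'
  deg_add_ne : ∀ {j l : ℕ+} {m k n i : Finset ℕ+} (hl : IsExt l k i) (hj : IsExt j n i)
    (hj' : IsExt j m k) (x y : cube k) (hxy : cubes.Consec hj' x y)
    (hxy' : cubes.Consec hj (cubes.deg hl x) (cubes.deg hl y)),
    cubes.deg hl (add hj' x y hxy) = add hj (cubes.deg hl x) (cubes.deg hl y) hxy'
  face_addM_fst : ∀ {j : ℕ+} {k i : Finset ℕ+} (h : IsExt j k i) (f g : map i)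
    (hfg : maps.Consec h f g),
    maps.face false h (addM h f g hfg) = maps.face false h f
  face_addM_snd : ∀ {j : ℕ+} {k i : Finset ℕ+} (h : IsExt j k i) (f g : map i)
    (hfg : maps.Consec h f g),
    maps.face true h (addM h f g hfg) = maps.face true h g
  face_addM_ne : ∀ (α : Bool) {j l : ℕ+} {m k n i : Finset ℕ+} (hl : IsExt l k i) (hj : IsExt j n i)
    (hj' : IsExt j m k) (f g : map i) (hfg : maps.Consec hj f g)
    (hfg' : maps.Consec hj' (maps.face α hl f) (maps.face α hl g)),
    maps.face α hl (addM hj f g hfg) = addM hj' (maps.face α hl f) (maps.face α hl g) hfg'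
  deg_addM_ne : ∀ {j l : ℕ+} {m k n i : Finset ℕ+} (hl : IsExt l k i) (hj : IsExt j n i)
    (hj' : IsExt j m k) (f g : map k) (hfg : maps.Consec hj' f g)
    (hfg' : maps.Consec hj (maps.deg hl f) (maps.deg hl g)),
    maps.deg hl (addM hj' f g hfg) = addM hj (maps.deg hl f) (maps.deg hl g) hfg'
  -- left unitor `λ_j x : (e_j ∂⁻_j x) +_j x → x`
  lam : ∀ {j : ℕ+} {k i : Finset ℕ+}, IsExt j k i → cube i → map i
  lam_isHom : ∀ {j : ℕ+} {k i : Finset ℕ+} (h : IsExt j k i) (x : cube i)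
    (hx : cubes.Consec h (cubes.deg h (cubes.face false h x)) x),
    toMultCat.IsHom (lam h x) (add h (cubes.deg h (cubes.face false h x)) x hx) x
  -- right unitor `ρ_j x : x +_j (e_j ∂⁺_j x) → x`
  rho : ∀ {j : ℕ+} {k i : Finset ℕ+}, IsExt j k i → cube i → map i
  rho_isHom : ∀ {j : ℕ+} {k i : Finset ℕ+} (h : IsExt j k i) (x : cube i)
    (hx : cubes.Consec h x (cubes.deg h (cubes.face true h x))),
    toMultCat.IsHom (rho h x) (add h x (cubes.deg h (cubes.face true h x)) hx) x
  -- associator `κ_j(x, y, z) : x +_j (y +_j z) → (x +_j y) +_j z`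
  kap : ∀ {j : ℕ+} {k i : Finset ℕ+} (h : IsExt j k i) (x y z : cube i),
    cubes.Consec h x y → cubes.Consec h y z → map i
  kap_isHom : ∀ {j : ℕ+} {k i : Finset ℕ+} (h : IsExt j k i) (x y z : cube i)
    (hxy : cubes.Consec h x y) (hyz : cubes.Consec h y z) (h₁ : cubes.Consec h x (add h y z hyz))
    (h₂ : cubes.Consec h (add h x y hxy) z),
    toMultCat.IsHom (kap h x y z hxy hyz) (add h x (add h y z hyz) h₁)
      (add h (add h x y hxy) z h₂)
  -- interchanger `χ_ab(x, y, z, t) : (x +_a y) +_b (z +_a t) → (x +_b z) +_a (y +_b t)`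
  chi : ∀ {a b : ℕ+} {ka kb i : Finset ℕ+}, a < b → ∀ (ha : IsExt a ka i) (hb : IsExt b kb i)
    (x y z t : cube i), cubes.Consec ha x y →
    cubes.Consec ha z t → cubes.Consec hb x z →
    cubes.Consec hb y t → map i
  chi_isHom : ∀ {a b : ℕ+} {ka kb i : Finset ℕ+} (hab : a < b) (ha : IsExt a ka i)
    (hb : IsExt b kb i) (x y z t : cube i) (hxy : cubes.Consec ha x y) (hzt : cubes.Consec ha z t)
    (hxz : cubes.Consec hb x z) (hyt : cubes.Consec hb y t)
    (h₁ : cubes.Consec hb (add ha x y hxy) (add ha z t hzt))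
    (h₂ : cubes.Consec ha (add hb x z hxz) (add hb y t hyt)),
    toMultCat.IsHom (chi hab ha hb x y z t hxy hzt hxz hyt)
      (add hb (add ha x y hxy) (add ha z t hzt) h₁) (add ha (add hb x z hxz) (add hb y t hyt) h₂)

/-- A (small) chiral multiple category: the comparisons `λ_j`, `ρ_j`, `κ_j` are invertible,
the interchangers `χ_ab` are not assumed to be invertible; all are natural, special in their own
directions, consistent with faces and degeneracies in the other directions, and coherent. -/
structure ChiralMultipleCategory : Type (u + 1) extends PreChiral.{u} where
  lam_invertible : ∀ {j : ℕ+} {k i : Finset ℕ+} (h : IsExt j k i) (x : cube i),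
    toMultCat.IsInvertible (lam h x)
  rho_invertible : ∀ {j : ℕ+} {k i : Finset ℕ+} (h : IsExt j k i) (x : cube i),
    toMultCat.IsInvertible (rho h x)
  kap_invertible : ∀ {j : ℕ+} {k i : Finset ℕ+} (h : IsExt j k i) (x y z : cube i)
    (hxy : cubes.Consec h x y) (hyz : cubes.Consec h y z),
    toMultCat.IsInvertible (kap h x y z hxy hyz)
  -- naturality
  lam_natural : ∀ {j : ℕ+} {k i : Finset ℕ+} (h : IsExt j k i) (f : map i)
    (hf : maps.Consec h (maps.deg h (maps.face false h f)) f),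
    toMultCat.Commutes [addM h (maps.deg h (maps.face false h f)) f hf, lam h (tgt f)]
      [lam h (src f), f]
  rho_natural : ∀ {j : ℕ+} {k i : Finset ℕ+} (h : IsExt j k i) (f : map i)
    (hf : maps.Consec h f (maps.deg h (maps.face true h f))),
    toMultCat.Commutes [addM h f (maps.deg h (maps.face true h f)) hf, rho h (tgt f)]
      [rho h (src f), f]
  kap_natural : ∀ {j : ℕ+} {k i : Finset ℕ+} (h : IsExt j k i) (f g l : map i)
    (hfg : maps.Consec h f g) (hgl : maps.Consec h g l) (h₁ : maps.Consec h f (addM h g l hgl))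
    (h₂ : maps.Consec h (addM h f g hfg) l) (s₁ : cubes.Consec h (src f) (src g))
    (s₂ : cubes.Consec h (src g) (src l)) (t₁ : cubes.Consec h (tgt f) (tgt g))
    (t₂ : cubes.Consec h (tgt g) (tgt l)),
    toMultCat.Commutes
      [addM h f (addM h g l hgl) h₁, kap h (tgt f) (tgt g) (tgt l) t₁ t₂]
      [kap h (src f) (src g) (src l) s₁ s₂, addM h (addM h f g hfg) l h₂]
  chi_natural : ∀ {a b : ℕ+} {ka kb i : Finset ℕ+} (hab : a < b) (ha : IsExt a ka i)
    (hb : IsExt b kb i) (f g l m : map i) (hfg : maps.Consec ha f g) (hlm : maps.Consec ha l m)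
    (hfl : maps.Consec hb f l) (hgm : maps.Consec hb g m)
    (h₁ : maps.Consec hb (addM ha f g hfg) (addM ha l m hlm))
    (h₂ : maps.Consec ha (addM hb f l hfl) (addM hb g m hgm)) (s₁ : cubes.Consec ha (src f) (src g))
    (s₂ : cubes.Consec ha (src l) (src m)) (s₃ : cubes.Consec hb (src f) (src l))
    (s₄ : cubes.Consec hb (src g) (src m)) (t₁ : cubes.Consec ha (tgt f) (tgt g))
    (t₂ : cubes.Consec ha (tgt l) (tgt m)) (t₃ : cubes.Consec hb (tgt f) (tgt l))
    (t₄ : cubes.Consec hb (tgt g) (tgt m)),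
    toMultCat.Commutes
      [addM hb (addM ha f g hfg) (addM ha l m hlm) h₁,
        chi hab ha hb (tgt f) (tgt g) (tgt l) (tgt m) t₁ t₂ t₃ t₄]
      [chi hab ha hb (src f) (src g) (src l) (src m) s₁ s₂ s₃ s₄,
        addM ha (addM hb f l hfl) (addM hb g m hgm) h₂]
  -- the comparisons are special in their own directions
  lam_special : ∀ {j : ℕ+} {k i : Finset ℕ+} (h : IsExt j k i) (x : cube i),
    toMultCat.IsSpecial h (lam h x)
  rho_special : ∀ {j : ℕ+} {k i : Finset ℕ+} (h : IsExt j k i) (x : cube i),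
    toMultCat.IsSpecial h (rho h x)
  kap_special : ∀ {j : ℕ+} {k i : Finset ℕ+} (h : IsExt j k i) (x y z : cube i)
    (hxy : cubes.Consec h x y) (hyz : cubes.Consec h y z),
    toMultCat.IsSpecial h (kap h x y z hxy hyz)
  chi_special : ∀ {a b : ℕ+} {ka kb i : Finset ℕ+} (hab : a < b) (ha : IsExt a ka i)
    (hb : IsExt b kb i) (x y z t : cube i) (hxy : cubes.Consec ha x y) (hzt : cubes.Consec ha z t)
    (hxz : cubes.Consec hb x z) (hyt : cubes.Consec hb y t),
    toMultCat.IsSpecial ha (chi hab ha hb x y z t hxy hzt hxz hyt) ∧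
      toMultCat.IsSpecial hb (chi hab ha hb x y z t hxy hzt hxz hyt)
  -- consistency with faces and degeneracies in the other directions
  lam_face : ∀ (α : Bool) {j l : ℕ+} {m k n i : Finset ℕ+} (hl : IsExt l k i) (hj : IsExt j n i)
    (hj' : IsExt j m k) (x : cube i),
    maps.face α hl (lam hj x) = lam hj' (cubes.face α hl x)
  lam_deg : ∀ {j l : ℕ+} {m k n i : Finset ℕ+} (hl : IsExt l k i) (hj : IsExt j n i)
    (hj' : IsExt j m k) (x : cube k),
    maps.deg hl (lam hj' x) = lam hj (cubes.deg hl x)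
  rho_face : ∀ (α : Bool) {j l : ℕ+} {m k n i : Finset ℕ+} (hl : IsExt l k i) (hj : IsExt j n i)
    (hj' : IsExt j m k) (x : cube i),
    maps.face α hl (rho hj x) = rho hj' (cubes.face α hl x)
  rho_deg : ∀ {j l : ℕ+} {m k n i : Finset ℕ+} (hl : IsExt l k i) (hj : IsExt j n i)
    (hj' : IsExt j m k) (x : cube k),
    maps.deg hl (rho hj' x) = rho hj (cubes.deg hl x)
  kap_face : ∀ (α : Bool) {j l : ℕ+} {m k n i : Finset ℕ+} (hl : IsExt l k i) (hj : IsExt j n i)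
    (hj' : IsExt j m k) (x y z : cube i) (hxy : cubes.Consec hj x y) (hyz : cubes.Consec hj y z)
    (hxy' : cubes.Consec hj' (cubes.face α hl x) (cubes.face α hl y))
    (hyz' : cubes.Consec hj' (cubes.face α hl y) (cubes.face α hl z)),
    maps.face α hl (kap hj x y z hxy hyz) =
      kap hj' (cubes.face α hl x) (cubes.face α hl y) (cubes.face α hl z) hxy' hyz'
  kap_deg : ∀ {j l : ℕ+} {m k n i : Finset ℕ+} (hl : IsExt l k i) (hj : IsExt j n i)
    (hj' : IsExt j m k) (x y z : cube k) (hxy : cubes.Consec hj' x y) (hyz : cubes.Consec hj' y z)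
    (hxy' : cubes.Consec hj (cubes.deg hl x) (cubes.deg hl y))
    (hyz' : cubes.Consec hj (cubes.deg hl y) (cubes.deg hl z)),
    maps.deg hl (kap hj' x y z hxy hyz) =
      kap hj (cubes.deg hl x) (cubes.deg hl y) (cubes.deg hl z) hxy' hyz'
  chi_face : ∀ (α : Bool) {a b l : ℕ+} {ka kb ka' kb' k i : Finset ℕ+} (hab : a < b)
    (hl : IsExt l k i) (ha : IsExt a ka i) (hb : IsExt b kb i) (ha' : IsExt a ka' k)
    (hb' : IsExt b kb' k) (x y z t : cube i) (hxy : cubes.Consec ha x y) (hzt : cubes.Consec ha z t)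
    (hxz : cubes.Consec hb x z) (hyt : cubes.Consec hb y t)
    (hxy' : cubes.Consec ha' (cubes.face α hl x) (cubes.face α hl y))
    (hzt' : cubes.Consec ha' (cubes.face α hl z) (cubes.face α hl t))
    (hxz' : cubes.Consec hb' (cubes.face α hl x) (cubes.face α hl z))
    (hyt' : cubes.Consec hb' (cubes.face α hl y) (cubes.face α hl t)),
    maps.face α hl (chi hab ha hb x y z t hxy hzt hxz hyt) =
      chi hab ha' hb' (cubes.face α hl x) (cubes.face α hl y) (cubes.face α hl z)
        (cubes.face α hl t) hxy' hzt' hxz' hyt'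
  chi_deg : ∀ {a b l : ℕ+} {ka kb ka' kb' k i : Finset ℕ+} (hab : a < b) (hl : IsExt l k i)
    (ha : IsExt a ka i) (hb : IsExt b kb i) (ha' : IsExt a ka' k) (hb' : IsExt b kb' k)
    (x y z t : cube k) (hxy : cubes.Consec ha' x y) (hzt : cubes.Consec ha' z t)
    (hxz : cubes.Consec hb' x z) (hyt : cubes.Consec hb' y t)
    (hxy' : cubes.Consec ha (cubes.deg hl x) (cubes.deg hl y))
    (hzt' : cubes.Consec ha (cubes.deg hl z) (cubes.deg hl t))
    (hxz' : cubes.Consec hb (cubes.deg hl x) (cubes.deg hl z))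
    (hyt' : cubes.Consec hb (cubes.deg hl y) (cubes.deg hl t)),
    maps.deg hl (chi hab ha' hb' x y z t hxy hzt hxz hyt) =
      chi hab ha hb (cubes.deg hl x) (cubes.deg hl y) (cubes.deg hl z) (cubes.deg hl t)
        hxy' hzt' hxz' hyt'
  -- coherence of `κ_j` (pentagon), and of `κ_j` with the unitors
  pentagon : ∀ {j : ℕ+} {k i : Finset ℕ+} (h : IsExt j k i) (x y z t : cube i)
    (hxy : cubes.Consec h x y) (hyz : cubes.Consec h y z) (hzt : cubes.Consec h z t)
    (h₁ : cubes.Consec h y (add h z t hzt)) (h₂ : cubes.Consec h (add h x y hxy) z)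
    (h₃ : cubes.Consec h x (add h y z hyz)) (h₄ : cubes.Consec h (add h y z hyz) t)
    (h₅ : maps.Consec h (one x) (kap h y z t hyz hzt))
    (h₆ : maps.Consec h (kap h x y z hxy hyz) (one t)),
    toMultCat.Commutes
      [kap h x y (add h z t hzt) hxy h₁, kap h (add h x y hxy) z t h₂ hzt]
      [addM h (one x) (kap h y z t hyz hzt) h₅, kap h x (add h y z hyz) t h₃ h₄,
        addM h (kap h x y z hxy hyz) (one t) h₆]
  triangle : ∀ {j : ℕ+} {k i : Finset ℕ+} (h : IsExt j k i) (x y : cube i)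
    (_hxy : cubes.Consec h x y) (h₁ : cubes.Consec h x (cubes.deg h (cubes.face true h x)))
    (h₂ : cubes.Consec h (cubes.deg h (cubes.face true h x)) y)
    (h₃ : maps.Consec h (rho h x) (one y)) (h₄ : maps.Consec h (one x) (lam h y)),
    toMultCat.Commutes
      [kap h x (cubes.deg h (cubes.face true h x)) y h₁ h₂, addM h (rho h x) (one y) h₃]
      [addM h (one x) (lam h y) h₄]
  -- coherence of `χ_ab` with `κ_a` and with `κ_b`
  chi_kap_fst : ∀ {a b : ℕ+} {ka kb i : Finset ℕ+} (hab : a < b) (ha : IsExt a ka i)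
    (hb : IsExt b kb i) (x y z x' y' z' : cube i) (hxy : cubes.Consec ha x y)
    (hyz : cubes.Consec ha y z) (hxy' : cubes.Consec ha x' y') (hyz' : cubes.Consec ha y' z')
    (hx : cubes.Consec hb x x') (hy : cubes.Consec hb y y') (hz : cubes.Consec hb z z')
    (h₁ : cubes.Consec ha x (add ha y z hyz)) (h₂ : cubes.Consec ha x' (add ha y' z' hyz'))
    (h₃ : cubes.Consec hb (add ha y z hyz) (add ha y' z' hyz'))
    (h₄ : maps.Consec ha (one (add hb x x' hx)) (chi hab ha hb y z y' z' hyz hyz' hy hz))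
    (h₅ : cubes.Consec ha (add hb x x' hx) (add hb y y' hy))
    (h₆ : cubes.Consec ha (add hb y y' hy) (add hb z z' hz))
    (h₇ : maps.Consec hb (kap ha x y z hxy hyz) (kap ha x' y' z' hxy' hyz'))
    (h₈ : cubes.Consec ha (add ha x y hxy) z) (h₉ : cubes.Consec ha (add ha x' y' hxy') z')
    (h₁₀ : cubes.Consec hb (add ha x y hxy) (add ha x' y' hxy'))
    (h₁₁ : maps.Consec ha (chi hab ha hb x y x' y' hxy hxy' hx hy) (one (add hb z z' hz))),
    toMultCat.Commutes
      [chi hab ha hb x (add ha y z hyz) x' (add ha y' z' hyz') h₁ h₂ hx h₃,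
        addM ha (one (add hb x x' hx)) (chi hab ha hb y z y' z' hyz hyz' hy hz) h₄,
        kap ha (add hb x x' hx) (add hb y y' hy) (add hb z z' hz) h₅ h₆]
      [addM hb (kap ha x y z hxy hyz) (kap ha x' y' z' hxy' hyz') h₇,
        chi hab ha hb (add ha x y hxy) z (add ha x' y' hxy') z' h₈ h₉ h₁₀ hz,
        addM ha (chi hab ha hb x y x' y' hxy hxy' hx hy) (one (add hb z z' hz)) h₁₁]
  chi_kap_snd : ∀ {a b : ℕ+} {ka kb i : Finset ℕ+} (hab : a < b) (ha : IsExt a ka i)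
    (hb : IsExt b kb i) (x y z x' y' z' : cube i) (hxy : cubes.Consec hb x y)
    (hyz : cubes.Consec hb y z) (hxy' : cubes.Consec hb x' y') (hyz' : cubes.Consec hb y' z')
    (hx : cubes.Consec ha x x') (hy : cubes.Consec ha y y') (hz : cubes.Consec ha z z')
    (h₁ : maps.Consec hb (one (add ha x x' hx)) (chi hab ha hb y y' z z' hy hz hyz hyz'))
    (h₂ : cubes.Consec ha (add hb y z hyz) (add hb y' z' hyz'))
    (h₃ : cubes.Consec hb x (add hb y z hyz)) (h₄ : cubes.Consec hb x' (add hb y' z' hyz'))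
    (h₅ : maps.Consec ha (kap hb x y z hxy hyz) (kap hb x' y' z' hxy' hyz'))
    (h₆ : cubes.Consec hb (add ha x x' hx) (add ha y y' hy))
    (h₇ : cubes.Consec hb (add ha y y' hy) (add ha z z' hz))
    (h₈ : maps.Consec hb (chi hab ha hb x x' y y' hx hy hxy hxy') (one (add ha z z' hz)))
    (h₉ : cubes.Consec ha (add hb x y hxy) (add hb x' y' hxy'))
    (h₁₀ : cubes.Consec hb (add hb x y hxy) z) (h₁₁ : cubes.Consec hb (add hb x' y' hxy') z'),
    toMultCat.Commutes
      [addM hb (one (add ha x x' hx)) (chi hab ha hb y y' z z' hy hz hyz hyz') h₁,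
        chi hab ha hb x x' (add hb y z hyz) (add hb y' z' hyz') hx h₂ h₃ h₄,
        addM ha (kap hb x y z hxy hyz) (kap hb x' y' z' hxy' hyz') h₅]
      [kap hb (add ha x x' hx) (add ha y y' hy) (add ha z z' hz) h₆ h₇,
        addM hb (chi hab ha hb x x' y y' hx hy hxy hxy') (one (add ha z z' hz)) h₈,
        chi hab ha hb (add hb x y hxy) (add hb x' y' hxy') z z' h₉ hz h₁₀ h₁₁]
  -- coherence of `χ_ab` with the unitors of direction `a`, for `x +_b y`
  chi_lam_fst : ∀ {a b : ℕ+} {ka kb i : Finset ℕ+} (hab : a < b) (ha : IsExt a ka i)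
    (hb : IsExt b kb i) (x y : cube i) (hxy : cubes.Consec hb x y)
    (h₁ : cubes.Consec ha (cubes.deg ha (cubes.face false ha x)) x)
    (h₂ : cubes.Consec ha (cubes.deg ha (cubes.face false ha y)) y)
    (h₃ : cubes.Consec hb (cubes.deg ha (cubes.face false ha x)) (cubes.deg ha (cubes.face false ha y)))
    (h₄ : maps.Consec hb (lam ha x) (lam ha y)),
    toMultCat.Commutes
      [chi hab ha hb (cubes.deg ha (cubes.face false ha x)) x
        (cubes.deg ha (cubes.face false ha y)) y h₁ h₂ h₃ hxy, lam ha (add hb x y hxy)]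
      [addM hb (lam ha x) (lam ha y) h₄]
  chi_rho_fst : ∀ {a b : ℕ+} {ka kb i : Finset ℕ+} (hab : a < b) (ha : IsExt a ka i)
    (hb : IsExt b kb i) (x y : cube i) (hxy : cubes.Consec hb x y)
    (h₁ : cubes.Consec ha x (cubes.deg ha (cubes.face true ha x)))
    (h₂ : cubes.Consec ha y (cubes.deg ha (cubes.face true ha y)))
    (h₃ : cubes.Consec hb (cubes.deg ha (cubes.face true ha x)) (cubes.deg ha (cubes.face true ha y)))
    (h₄ : maps.Consec hb (rho ha x) (rho ha y)),
    toMultCat.Commutes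
      [chi hab ha hb x (cubes.deg ha (cubes.face true ha x)) y
        (cubes.deg ha (cubes.face true ha y)) h₁ h₂ hxy h₃, rho ha (add hb x y hxy)]
      [addM hb (rho ha x) (rho ha y) h₄]
  -- coherence of `χ_ab` with the unitors of direction `b`, for `x +_a y`
  chi_lam_snd : ∀ {a b : ℕ+} {ka kb i : Finset ℕ+} (hab : a < b) (ha : IsExt a ka i)
    (hb : IsExt b kb i) (x y : cube i) (hxy : cubes.Consec ha x y)
    (h₁ : cubes.Consec ha (cubes.deg hb (cubes.face false hb x)) (cubes.deg hb (cubes.face false hb y)))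
    (h₂ : cubes.Consec hb (cubes.deg hb (cubes.face false hb x)) x)
    (h₃ : cubes.Consec hb (cubes.deg hb (cubes.face false hb y)) y)
    (h₄ : maps.Consec ha (lam hb x) (lam hb y)),
    toMultCat.Commutes
      [chi hab ha hb (cubes.deg hb (cubes.face false hb x))
        (cubes.deg hb (cubes.face false hb y)) x y h₁ hxy h₂ h₃, addM ha (lam hb x) (lam hb y) h₄]
      [lam hb (add ha x y hxy)]
  chi_rho_snd : ∀ {a b : ℕ+} {ka kb i : Finset ℕ+} (hab : a < b) (ha : IsExt a ka i)
    (hb : IsExt b kb i) (x y : cube i) (hxy : cubes.Consec ha x y)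
    (h₁ : cubes.Consec ha (cubes.deg hb (cubes.face true hb x)) (cubes.deg hb (cubes.face true hb y)))
    (h₂ : cubes.Consec hb x (cubes.deg hb (cubes.face true hb x)))
    (h₃ : cubes.Consec hb y (cubes.deg hb (cubes.face true hb y)))
    (h₄ : maps.Consec ha (rho hb x) (rho hb y)),
    toMultCat.Commutes
      [chi hab ha hb x y (cubes.deg hb (cubes.face true hb x))
        (cubes.deg hb (cubes.face true hb y)) hxy h₁ h₂ h₃, addM ha (rho hb x) (rho hb y) h₄]
      [rho hb (add ha x y hxy)]
  -- coherence hexagon of `χ_ab`, `χ_ac`, `χ_bc`, for `a < b < c`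
  chi_hexagon : ∀ {a b c : ℕ+} {ka kb kc i : Finset ℕ+} (hab : a < b) (hbc : b < c) (hac : a < c)
    (ha : IsExt a ka i) (hb : IsExt b kb i) (hc : IsExt c kc i) (x y z t x' y' z' t' : cube i)
    (hxy : cubes.Consec ha x y) (hzt : cubes.Consec ha z t) (hxz : cubes.Consec hb x z)
    (hyt : cubes.Consec hb y t) (hxy' : cubes.Consec ha x' y') (hzt' : cubes.Consec ha z' t')
    (hxz' : cubes.Consec hb x' z') (hyt' : cubes.Consec hb y' t') (hx : cubes.Consec hc x x')
    (hy : cubes.Consec hc y y') (hz : cubes.Consec hc z z') (ht : cubes.Consec hc t t')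
    (h₁ : maps.Consec hc (chi hab ha hb x y z t hxy hzt hxz hyt) (chi hab ha hb x' y' z' t' hxy' hzt' hxz' hyt'))
    (h₂ : cubes.Consec ha (add hb x z hxz) (add hb y t hyt))
    (h₃ : cubes.Consec ha (add hb x' z' hxz') (add hb y' t' hyt'))
    (h₄ : cubes.Consec hc (add hb x z hxz) (add hb x' z' hxz'))
    (h₅ : cubes.Consec hc (add hb y t hyt) (add hb y' t' hyt'))
    (h₆ : maps.Consec ha (chi hbc hb hc x z x' z' hxz hxz' hx hz) (chi hbc hb hc y t y' t' hyt hyt' hy ht))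
    (h₇ : cubes.Consec hb (add ha x y hxy) (add ha z t hzt))
    (h₈ : cubes.Consec hb (add ha x' y' hxy') (add ha z' t' hzt'))
    (h₉ : cubes.Consec hc (add ha x y hxy) (add ha x' y' hxy'))
    (h₁₀ : cubes.Consec hc (add ha z t hzt) (add ha z' t' hzt'))
    (h₁₁ : maps.Consec hb (chi hac ha hc x y x' y' hxy hxy' hx hy) (chi hac ha hc z t z' t' hzt hzt' hz ht))
    (h₁₂ : cubes.Consec ha (add hc x x' hx) (add hc y y' hy))
    (h₁₃ : cubes.Consec ha (add hc z z' hz) (add hc t t' ht))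
    (h₁₄ : cubes.Consec hb (add hc x x' hx) (add hc z z' hz))
    (h₁₅ : cubes.Consec hb (add hc y y' hy) (add hc t t' ht)),
    toMultCat.Commutes
      [addM hc (chi hab ha hb x y z t hxy hzt hxz hyt)
          (chi hab ha hb x' y' z' t' hxy' hzt' hxz' hyt') h₁,
        chi hac ha hc (add hb x z hxz) (add hb y t hyt) (add hb x' z' hxz') (add hb y' t' hyt')
          h₂ h₃ h₄ h₅,
        addM ha (chi hbc hb hc x z x' z' hxz hxz' hx hz)
          (chi hbc hb hc y t y' t' hyt hyt' hy ht) h₆]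
      [chi hbc hb hc (add ha x y hxy) (add ha z t hzt) (add ha x' y' hxy') (add ha z' t' hzt')
          h₇ h₈ h₉ h₁₀,
        addM hb (chi hac ha hc x y x' y' hxy hxy' hx hy)
          (chi hac ha hc z t z' t' hzt hzt' hz ht) h₁₁,
        chi hab ha hb (add hc x x' hx) (add hc y y' hy) (add hc z z' hz) (add hc t t' ht)
          h₁₂ h₁₃ h₁₄ h₁₅]

/-! ## Mixed-laxity functors and generalised quintets -/

/-- A `p`-morphism `R : A →_p B` of chiral multiple categories, for `0 ≤ p ≤ ∞`: a functor of mixed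
laxity, consisting of ordinary functors `R_i : tv_i(A) → tv_i(B)` consistent with faces, with
comparisons `unit` (for the degeneracies) and `mul` (for the compositions) in each direction `j`,
which are colax for `j < p` and lax for `p ≤ j`. A `0`-morphism is a strict multiple functor: all
its comparisons are transversal identities (so that it preserves degeneracies, compositions,
`λ`, `ρ`, `κ` and `χ`). -/
structure MixedFunctor (p : ℕ∞) (A B : ChiralMultipleCategory.{u}) : Type u extends
    MultCat.Hom A.toMultCat B.toMultCat where
  unit : ∀ {j : ℕ+} {k i : Finset ℕ+}, IsExt j k i → A.cube k → B.map i
  mul : ∀ {j : ℕ+} {k i : Finset ℕ+} (h : IsExt j k i) (x y : A.cube i),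
    A.cubes.Consec h x y → B.map i
  unit_lax : ∀ {j : ℕ+} {k i : Finset ℕ+} (h : IsExt j k i) (t : A.cube k), p ≤ (j : ℕ) →
    B.IsHom (unit h t) (B.cubes.deg h (obj t)) (obj (A.cubes.deg h t))
  unit_colax : ∀ {j : ℕ+} {k i : Finset ℕ+} (h : IsExt j k i) (t : A.cube k), ((j : ℕ) : ℕ∞) < p →
    B.IsHom (unit h t) (obj (A.cubes.deg h t)) (B.cubes.deg h (obj t))
  mul_lax : ∀ {j : ℕ+} {k i : Finset ℕ+} (h : IsExt j k i) (x y : A.cube i)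
    (hxy : A.cubes.Consec h x y) (h₁ : B.cubes.Consec h (obj x) (obj y)), p ≤ (j : ℕ) →
    B.IsHom (mul h x y hxy) (B.add h (obj x) (obj y) h₁) (obj (A.add h x y hxy))
  mul_colax : ∀ {j : ℕ+} {k i : Finset ℕ+} (h : IsExt j k i) (x y : A.cube i)
    (hxy : A.cubes.Consec h x y) (h₁ : B.cubes.Consec h (obj x) (obj y)), ((j : ℕ) : ℕ∞) < p →
    B.IsHom (mul h x y hxy) (obj (A.add h x y hxy)) (B.add h (obj x) (obj y) h₁)
  -- the comparisons are special in direction `j` and consistent with the other faces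
  unit_special : ∀ {j : ℕ+} {k i : Finset ℕ+} (h : IsExt j k i) (t : A.cube k),
    B.IsSpecial h (unit h t)
  mul_special : ∀ {j : ℕ+} {k i : Finset ℕ+} (h : IsExt j k i) (x y : A.cube i)
    (hxy : A.cubes.Consec h x y), B.IsSpecial h (mul h x y hxy)
  unit_face : ∀ (α : Bool) {j l : ℕ+} {m k n i : Finset ℕ+} (hl : IsExt l k i) (hj : IsExt j n i)
    (hj' : IsExt j m k) (hl' : IsExt l m n) (t : A.cube n),
    B.maps.face α hl (unit hj t) = unit hj' (A.cubes.face α hl' t)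
  mul_face : ∀ (α : Bool) {j l : ℕ+} {m k n i : Finset ℕ+} (hl : IsExt l k i) (hj : IsExt j n i)
    (hj' : IsExt j m k) (x y : A.cube i) (hxy : A.cubes.Consec hj x y)
    (hxy' : A.cubes.Consec hj' (A.cubes.face α hl x) (A.cubes.face α hl y)),
    B.maps.face α hl (mul hj x y hxy) = mul hj' (A.cubes.face α hl x) (A.cubes.face α hl y) hxy'
  -- naturality
  unit_natural_lax : ∀ {j : ℕ+} {k i : Finset ℕ+} (h : IsExt j k i) (f : A.map k), p ≤ (j : ℕ) →
    B.Commutes [unit h (A.src f), mor (A.maps.deg h f)]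
      [B.maps.deg h (mor f), unit h (A.tgt f)]
  unit_natural_colax : ∀ {j : ℕ+} {k i : Finset ℕ+} (h : IsExt j k i) (f : A.map k),
    ((j : ℕ) : ℕ∞) < p →
    B.Commutes [mor (A.maps.deg h f), unit h (A.tgt f)]
      [unit h (A.src f), B.maps.deg h (mor f)]
  mul_natural_lax : ∀ {j : ℕ+} {k i : Finset ℕ+} (h : IsExt j k i) (f g : A.map i)
    (hfg : A.maps.Consec h f g) (hs : A.cubes.Consec h (A.src f) (A.src g))
    (ht : A.cubes.Consec h (A.tgt f) (A.tgt g))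
    (hR : B.maps.Consec h (mor f) (mor g)), p ≤ (j : ℕ) →
    B.Commutes [mul h (A.src f) (A.src g) hs, mor (A.addM h f g hfg)]
      [B.addM h (mor f) (mor g) hR, mul h (A.tgt f) (A.tgt g) ht]
  mul_natural_colax : ∀ {j : ℕ+} {k i : Finset ℕ+} (h : IsExt j k i) (f g : A.map i)
    (hfg : A.maps.Consec h f g) (hs : A.cubes.Consec h (A.src f) (A.src g))
    (ht : A.cubes.Consec h (A.tgt f) (A.tgt g))
    (hR : B.maps.Consec h (mor f) (mor g)), ((j : ℕ) : ℕ∞) < p →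
    B.Commutes [mor (A.addM h f g hfg), mul h (A.tgt f) (A.tgt g) ht]
      [mul h (A.src f) (A.src g) hs, B.addM h (mor f) (mor g) hR]
  -- coherence with the unitors
  lam_lax : ∀ {j : ℕ+} {k i : Finset ℕ+} (h : IsExt j k i) (x : A.cube i)
    (hx : A.cubes.Consec h (A.cubes.deg h (A.cubes.face false h x)) x)
    (hR : B.maps.Consec h (unit h (A.cubes.face false h x)) (B.one (obj x))), p ≤ (j : ℕ) →
    B.Commutes
      [B.addM h (unit h (A.cubes.face false h x)) (B.one (obj x)) hR,
        mul h (A.cubes.deg h (A.cubes.face false h x)) x hx, mor (A.lam h x)]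
      [B.lam h (obj x)]
  lam_colax : ∀ {j : ℕ+} {k i : Finset ℕ+} (h : IsExt j k i) (x : A.cube i)
    (hx : A.cubes.Consec h (A.cubes.deg h (A.cubes.face false h x)) x)
    (hR : B.maps.Consec h (unit h (A.cubes.face false h x)) (B.one (obj x))), ((j : ℕ) : ℕ∞) < p →
    B.Commutes
      [mul h (A.cubes.deg h (A.cubes.face false h x)) x hx,
        B.addM h (unit h (A.cubes.face false h x)) (B.one (obj x)) hR, B.lam h (obj x)]
      [mor (A.lam h x)]
  rho_lax : ∀ {j : ℕ+} {k i : Finset ℕ+} (h : IsExt j k i) (x : A.cube i)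
    (hx : A.cubes.Consec h x (A.cubes.deg h (A.cubes.face true h x)))
    (hR : B.maps.Consec h (B.one (obj x)) (unit h (A.cubes.face true h x))), p ≤ (j : ℕ) →
    B.Commutes
      [B.addM h (B.one (obj x)) (unit h (A.cubes.face true h x)) hR,
        mul h x (A.cubes.deg h (A.cubes.face true h x)) hx, mor (A.rho h x)]
      [B.rho h (obj x)]
  rho_colax : ∀ {j : ℕ+} {k i : Finset ℕ+} (h : IsExt j k i) (x : A.cube i)
    (hx : A.cubes.Consec h x (A.cubes.deg h (A.cubes.face true h x)))
    (hR : B.maps.Consec h (B.one (obj x)) (unit h (A.cubes.face true h x))), ((j : ℕ) : ℕ∞) < p →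
    B.Commutes
      [mul h x (A.cubes.deg h (A.cubes.face true h x)) hx,
        B.addM h (B.one (obj x)) (unit h (A.cubes.face true h x)) hR, B.rho h (obj x)]
      [mor (A.rho h x)]
  -- coherence with the associators
  kap_lax : ∀ {j : ℕ+} {k i : Finset ℕ+} (h : IsExt j k i) (x y z : A.cube i)
    (hxy : A.cubes.Consec h x y) (hyz : A.cubes.Consec h y z)
    (h₁ : B.cubes.Consec h (obj x) (obj y)) (h₂ : B.cubes.Consec h (obj y) (obj z))
    (h₃ : B.maps.Consec h (mul h x y hxy) (B.one (obj z)))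
    (h₄ : A.cubes.Consec h (A.add h x y hxy) z)
    (h₅ : B.maps.Consec h (B.one (obj x)) (mul h y z hyz))
    (h₆ : A.cubes.Consec h x (A.add h y z hyz)), p ≤ (j : ℕ) →
    B.Commutes
      [B.kap h (obj x) (obj y) (obj z) h₁ h₂, B.addM h (mul h x y hxy) (B.one (obj z)) h₃,
        mul h (A.add h x y hxy) z h₄]
      [B.addM h (B.one (obj x)) (mul h y z hyz) h₅, mul h x (A.add h y z hyz) h₆,
        mor (A.kap h x y z hxy hyz)]
  kap_colax : ∀ {j : ℕ+} {k i : Finset ℕ+} (h : IsExt j k i) (x y z : A.cube i)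
    (hxy : A.cubes.Consec h x y) (hyz : A.cubes.Consec h y z)
    (h₁ : B.cubes.Consec h (obj x) (obj y)) (h₂ : B.cubes.Consec h (obj y) (obj z))
    (h₃ : B.maps.Consec h (mul h x y hxy) (B.one (obj z)))
    (h₄ : A.cubes.Consec h (A.add h x y hxy) z)
    (h₅ : B.maps.Consec h (B.one (obj x)) (mul h y z hyz))
    (h₆ : A.cubes.Consec h x (A.add h y z hyz)), ((j : ℕ) : ℕ∞) < p →
    B.Commutes
      [mul h x (A.add h y z hyz) h₆, B.addM h (B.one (obj x)) (mul h y z hyz) h₅,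
        B.kap h (obj x) (obj y) (obj z) h₁ h₂]
      [mor (A.kap h x y z hxy hyz), mul h (A.add h x y hxy) z h₄,
        B.addM h (mul h x y hxy) (B.one (obj z)) h₃]
  -- coherence with the interchanger `χ_ab`: lax-lax, colax-lax and colax-colax case
  chi_lax_lax : ∀ {a b : ℕ+} {ka kb i : Finset ℕ+} (hab : a < b) (ha : IsExt a ka i)
    (hb : IsExt b kb i) (x y z t : A.cube i) (hxy : A.cubes.Consec ha x y)
    (hzt : A.cubes.Consec ha z t) (hxz : A.cubes.Consec hb x z) (hyt : A.cubes.Consec hb y t)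
    (hxy' : B.cubes.Consec ha (obj x) (obj y)) (hzt' : B.cubes.Consec ha (obj z) (obj t))
    (hxz' : B.cubes.Consec hb (obj x) (obj z)) (hyt' : B.cubes.Consec hb (obj y) (obj t))
    (h₁ : B.maps.Consec ha (mul hb x z hxz) (mul hb y t hyt))
    (h₂ : A.cubes.Consec ha (A.add hb x z hxz) (A.add hb y t hyt))
    (h₃ : B.maps.Consec hb (mul ha x y hxy) (mul ha z t hzt))
    (h₄ : A.cubes.Consec hb (A.add ha x y hxy) (A.add ha z t hzt)),
    p ≤ (a : ℕ) →
    B.Commutes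
      [B.chi hab ha hb (obj x) (obj y) (obj z) (obj t) hxy' hzt' hxz' hyt',
        B.addM ha (mul hb x z hxz) (mul hb y t hyt) h₁,
        mul ha (A.add hb x z hxz) (A.add hb y t hyt) h₂]
      [B.addM hb (mul ha x y hxy) (mul ha z t hzt) h₃,
        mul hb (A.add ha x y hxy) (A.add ha z t hzt) h₄,
        mor (A.chi hab ha hb x y z t hxy hzt hxz hyt)]
  chi_colax_lax : ∀ {a b : ℕ+} {ka kb i : Finset ℕ+} (hab : a < b) (ha : IsExt a ka i)
    (hb : IsExt b kb i) (x y z t : A.cube i) (hxy : A.cubes.Consec ha x y)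
    (hzt : A.cubes.Consec ha z t) (hxz : A.cubes.Consec hb x z) (hyt : A.cubes.Consec hb y t)
    (hxy' : B.cubes.Consec ha (obj x) (obj y)) (hzt' : B.cubes.Consec ha (obj z) (obj t))
    (hxz' : B.cubes.Consec hb (obj x) (obj z)) (hyt' : B.cubes.Consec hb (obj y) (obj t))
    (h₁ : B.maps.Consec ha (mul hb x z hxz) (mul hb y t hyt))
    (h₂ : A.cubes.Consec ha (A.add hb x z hxz) (A.add hb y t hyt))
    (h₃ : B.maps.Consec hb (mul ha x y hxy) (mul ha z t hzt))
    (h₄ : A.cubes.Consec hb (A.add ha x y hxy) (A.add ha z t hzt)),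
    ((a : ℕ) : ℕ∞) < p → p ≤ (b : ℕ) →
    B.Commutes
      [B.addM hb (mul ha x y hxy) (mul ha z t hzt) h₃,
        B.chi hab ha hb (obj x) (obj y) (obj z) (obj t) hxy' hzt' hxz' hyt',
        B.addM ha (mul hb x z hxz) (mul hb y t hyt) h₁]
      [mul hb (A.add ha x y hxy) (A.add ha z t hzt) h₄,
        mor (A.chi hab ha hb x y z t hxy hzt hxz hyt),
        mul ha (A.add hb x z hxz) (A.add hb y t hyt) h₂]
  chi_colax_colax : ∀ {a b : ℕ+} {ka kb i : Finset ℕ+} (hab : a < b) (ha : IsExt a ka i)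
    (hb : IsExt b kb i) (x y z t : A.cube i) (hxy : A.cubes.Consec ha x y)
    (hzt : A.cubes.Consec ha z t) (hxz : A.cubes.Consec hb x z) (hyt : A.cubes.Consec hb y t)
    (hxy' : B.cubes.Consec ha (obj x) (obj y)) (hzt' : B.cubes.Consec ha (obj z) (obj t))
    (hxz' : B.cubes.Consec hb (obj x) (obj z)) (hyt' : B.cubes.Consec hb (obj y) (obj t))
    (h₁ : B.maps.Consec ha (mul hb x z hxz) (mul hb y t hyt))
    (h₂ : A.cubes.Consec ha (A.add hb x z hxz) (A.add hb y t hyt))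
    (h₃ : B.maps.Consec hb (mul ha x y hxy) (mul ha z t hzt))
    (h₄ : A.cubes.Consec hb (A.add ha x y hxy) (A.add ha z t hzt)),
    ((b : ℕ) : ℕ∞) < p →
    B.Commutes
      [mul hb (A.add ha x y hxy) (A.add ha z t hzt) h₄,
        B.addM hb (mul ha x y hxy) (mul ha z t hzt) h₃,
        B.chi hab ha hb (obj x) (obj y) (obj z) (obj t) hxy' hzt' hxz' hyt']
      [mor (A.chi hab ha hb x y z t hxy hzt hxz hyt),
        mul ha (A.add hb x z hxz) (A.add hb y t hyt) h₂,
        B.addM ha (mul hb x z hxz) (mul hb y t hyt) h₁]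
  -- the strict case `p = 0`
  unit_strict : p = 0 → ∀ {j : ℕ+} {k i : Finset ℕ+} (h : IsExt j k i) (t : A.cube k),
    unit h t = B.one (B.cubes.deg h (obj t))
  mul_strict : p = 0 → ∀ {j : ℕ+} {k i : Finset ℕ+} (h : IsExt j k i) (x y : A.cube i)
    (hxy : A.cubes.Consec h x y) (h₁ : B.cubes.Consec h (obj x) (obj y)),
    mul h x y hxy = B.one (B.add h (obj x) (obj y) h₁)

namespace MixedFunctor

/-- `R` is the identity `p`-morphism of `A`. -/
structure IsIdentity {p : ℕ∞} {A : ChiralMultipleCategory.{u}} (R : MixedFunctor p A A) :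
    Prop where
  obj : ∀ {i : Finset ℕ+} (x : A.cube i), R.obj x = x
  mor : ∀ {i : Finset ℕ+} (f : A.map i), R.mor f = f
  unit : ∀ {j : ℕ+} {k i : Finset ℕ+} (h : IsExt j k i) (t : A.cube k),
    R.unit h t = A.one (A.cubes.deg h t)
  mul : ∀ {j : ℕ+} {k i : Finset ℕ+} (h : IsExt j k i) (x y : A.cube i)
    (hxy : A.cubes.Consec h x y),
    R.mul h x y hxy = A.one (A.add h x y hxy)

/-- `T` is the composite `SR : A →_p C` of `R : A →_p B` and `S : B →_p C`: the functors and the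
comparisons are separately composed. -/
structure IsComposition {p : ℕ∞} {A B C : ChiralMultipleCategory.{u}} (R : MixedFunctor p A B)
    (S : MixedFunctor p B C) (T : MixedFunctor p A C) : Prop where
  obj : ∀ {i : Finset ℕ+} (x : A.cube i), T.obj x = S.obj (R.obj x)
  mor : ∀ {i : Finset ℕ+} (f : A.map i), T.mor f = S.mor (R.mor f)
  unit_lax : ∀ {j : ℕ+} {k i : Finset ℕ+} (h : IsExt j k i) (t : A.cube k), p ≤ (j : ℕ) →
    C.IsComposite [S.unit h (R.obj t), S.mor (R.unit h t)] (T.unit h t)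
  unit_colax : ∀ {j : ℕ+} {k i : Finset ℕ+} (h : IsExt j k i) (t : A.cube k),
    ((j : ℕ) : ℕ∞) < p →
    C.IsComposite [S.mor (R.unit h t), S.unit h (R.obj t)] (T.unit h t)
  mul_lax : ∀ {j : ℕ+} {k i : Finset ℕ+} (h : IsExt j k i) (x y : A.cube i)
    (hxy : A.cubes.Consec h x y) (h₁ : B.cubes.Consec h (R.obj x) (R.obj y)), p ≤ (j : ℕ) →
    C.IsComposite [S.mul h (R.obj x) (R.obj y) h₁, S.mor (R.mul h x y hxy)] (T.mul h x y hxy)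
  mul_colax : ∀ {j : ℕ+} {k i : Finset ℕ+} (h : IsExt j k i) (x y : A.cube i)
    (hxy : A.cubes.Consec h x y) (h₁ : B.cubes.Consec h (R.obj x) (R.obj y)), ((j : ℕ) : ℕ∞) < p →
    C.IsComposite [S.mor (R.mul h x y hxy), S.mul h (R.obj x) (R.obj y) h₁] (T.mul h x y hxy)

end MixedFunctor

/-- A `pq`-cube `φ : (U ^R_S V)` of chiral multiple categories, for `0 ≤ p < q ≤ ∞`: a generalised
quintet `φ : VR ⇢ SU`, for `p`-morphisms `R : A → B`, `S : C → D` and `q`-morphisms `U : A → C`,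
`V : B → D`. It is a face-consistent family of natural transformations `V_i R_i → S_i U_i`, coherent
with the comparisons of `R, S, U, V` in each direction `j`: where all are lax (`q ≤ j`), where
`R, S` are lax and `U, V` are colax (`p ≤ j < q`), and where all are colax (`j < p`).
A `0q`-cell is a commutative square `VR = SU` of `q`-morphisms, inhabited by identities. -/
@[ext]
structure MixedSquare {p q : ℕ∞} {A B C D : ChiralMultipleCategory.{u}} (R : MixedFunctor p A B)
    (S : MixedFunctor p C D) (U : MixedFunctor q A C) (V : MixedFunctor q B D) : Type u where
  app : ∀ {i : Finset ℕ+}, A.cube i → D.map i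
  src_app : ∀ {i : Finset ℕ+} (x : A.cube i), D.src (app x) = V.obj (R.obj x)
  tgt_app : ∀ {i : Finset ℕ+} (x : A.cube i), D.tgt (app x) = S.obj (U.obj x)
  face_app : ∀ (α : Bool) {j : ℕ+} {k i : Finset ℕ+} (h : IsExt j k i) (x : A.cube i),
    D.maps.face α h (app x) = app (A.cubes.face α h x)
  naturality : ∀ {i : Finset ℕ+} (f : A.map i),
    D.Commutes [V.mor (R.mor f), app (A.tgt f)] [app (A.src f), S.mor (U.mor f)]
  unit_lax_lax : ∀ {j : ℕ+} {k i : Finset ℕ+} (h : IsExt j k i) (t : A.cube k), q ≤ (j : ℕ) →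
    D.Commutes [V.unit h (R.obj t), V.mor (R.unit h t), app (A.cubes.deg h t)]
      [D.maps.deg h (app t), S.unit h (U.obj t), S.mor (U.unit h t)]
  unit_lax_colax : ∀ {j : ℕ+} {k i : Finset ℕ+} (h : IsExt j k i) (t : A.cube k), p ≤ (j : ℕ) →
    ((j : ℕ) : ℕ∞) < q →
    D.Commutes [V.unit h (R.obj t), D.maps.deg h (app t), S.unit h (U.obj t)]
      [V.mor (R.unit h t), app (A.cubes.deg h t), S.mor (U.unit h t)]
  unit_colax_colax : ∀ {j : ℕ+} {k i : Finset ℕ+} (h : IsExt j k i) (t : A.cube k),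
    ((j : ℕ) : ℕ∞) < p →
    D.Commutes [V.mor (R.unit h t), V.unit h (R.obj t), D.maps.deg h (app t)]
      [app (A.cubes.deg h t), S.mor (U.unit h t), S.unit h (U.obj t)]
  mul_lax_lax : ∀ {j : ℕ+} {k i : Finset ℕ+} (h : IsExt j k i) (x y : A.cube i)
    (hxy : A.cubes.Consec h x y) (hR : B.cubes.Consec h (R.obj x) (R.obj y))
    (hU : C.cubes.Consec h (U.obj x) (U.obj y))
    (hφ : D.maps.Consec h (app x) (app y)), q ≤ (j : ℕ) →
    D.Commutes
      [V.mul h (R.obj x) (R.obj y) hR, V.mor (R.mul h x y hxy), app (A.add h x y hxy)]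
      [D.addM h (app x) (app y) hφ, S.mul h (U.obj x) (U.obj y) hU, S.mor (U.mul h x y hxy)]
  mul_lax_colax : ∀ {j : ℕ+} {k i : Finset ℕ+} (h : IsExt j k i) (x y : A.cube i)
    (hxy : A.cubes.Consec h x y) (hR : B.cubes.Consec h (R.obj x) (R.obj y))
    (hU : C.cubes.Consec h (U.obj x) (U.obj y))
    (hφ : D.maps.Consec h (app x) (app y)), p ≤ (j : ℕ) →
    ((j : ℕ) : ℕ∞) < q →
    D.Commutes
      [V.mul h (R.obj x) (R.obj y) hR, D.addM h (app x) (app y) hφ,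
        S.mul h (U.obj x) (U.obj y) hU]
      [V.mor (R.mul h x y hxy), app (A.add h x y hxy), S.mor (U.mul h x y hxy)]
  mul_colax_colax : ∀ {j : ℕ+} {k i : Finset ℕ+} (h : IsExt j k i) (x y : A.cube i)
    (hxy : A.cubes.Consec h x y) (hR : B.cubes.Consec h (R.obj x) (R.obj y))
    (hU : C.cubes.Consec h (U.obj x) (U.obj y))
    (hφ : D.maps.Consec h (app x) (app y)), ((j : ℕ) : ℕ∞) < p →
    D.Commutes
      [V.mor (R.mul h x y hxy), V.mul h (R.obj x) (R.obj y) hR, D.addM h (app x) (app y) hφ]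
      [app (A.add h x y hxy), S.mor (U.mul h x y hxy), S.mul h (U.obj x) (U.obj y) hU]
  app_strict : p = 0 → ∀ {i : Finset ℕ+} (x : A.cube i), app x = D.one (V.obj (R.obj x))

/-! ## Cubes of generalised quintets -/

/-- The low-dimensional notions from which a multiple category of generalised quintets indexed by
`I` is assembled: objects, `p`-arrows, `pq`-cells (for `p < q`) with their four boundary arrows,
the relations of being an identity or a composite, and the commutativity of a cube of six
cells. -/
structure QuintetSystem (I : Type) where
  Obj : Type v
  Arr : I → Type w
  dom : ∀ {p : I}, Arr p → Obj
  cod : ∀ {p : I}, Arr p → Obj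
  Sq : I → I → Type w
  /-- the faces `∂⁻_q` and `∂⁺_q` of a `pq`-cell -/
  top : ∀ {p q : I}, Sq p q → Arr p
  bot : ∀ {p q : I}, Sq p q → Arr p
  /-- the faces `∂⁻_p` and `∂⁺_p` of a `pq`-cell -/
  left : ∀ {p q : I}, Sq p q → Arr q
  right : ∀ {p q : I}, Sq p q → Arr q
  /-- `IsId A R` means `R = e_p(A)` -/
  IsId : ∀ {p : I}, Obj → Arr p → Prop
  /-- `IsComp R S T` means `T = R +_p S` -/
  IsComp : ∀ {p : I}, Arr p → Arr p → Arr p → Prop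
  /-- `IsIdFst U φ` means `φ = e_p(U)`, and `IsIdSnd R φ` means `φ = e_q(R)` -/
  IsIdFst : ∀ {p q : I}, Arr q → Sq p q → Prop
  IsIdSnd : ∀ {p q : I}, Arr p → Sq p q → Prop
  /-- `IsCompFst φ ψ σ` means `σ = φ +_p ψ`, and `IsCompSnd φ ψ σ` means `σ = φ +_q ψ` -/
  IsCompFst : ∀ {p q : I}, Sq p q → Sq p q → Sq p q → Prop
  IsCompSnd : ∀ {p q : I}, Sq p q → Sq p q → Sq p q → Prop
  /-- commutativity of a cube with faces `∂^∓_r = φ, ψ`, `∂^∓_q = π, ρ`, `∂^∓_p = ω, ζ` -/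
  Comm : ∀ {p q r : I}, Sq p q → Sq p q → Sq p r → Sq p r → Sq q r → Sq q r → Prop

/-- A cell with multi-index `P`: a cube of dimension `|P|`, whose vertices are indexed by the
subsets `v ⊆ P` (the directions in which the coordinate of the vertex is `+`). It has a `p`-arrow
`v → v ∪ {p}` for each edge, a `pq`-cell for each two-dimensional face, and each three-dimensional
face must be a commutative cube. In dimension 0, 1, 2 this is an object, an arrow, a
`pq`-cell. -/
@[ext]
structure Cell {I : Type} [LinearOrder I] (K : QuintetSystem.{v, w} I) (P : Finset I) :
    Type (max v w) where
  obj : ∀ v : Finset I, v ⊆ P → K.Obj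
  arr : ∀ (p : I) (v : Finset I), p ∈ P → v ⊆ P → p ∉ v → K.Arr p
  sq : ∀ (p q : I) (v : Finset I), p < q → p ∈ P → q ∈ P → v ⊆ P → p ∉ v → q ∉ v → K.Sq p q
  dom_arr : ∀ (p : I) (v : Finset I) (hp : p ∈ P) (hv : v ⊆ P) (hpv : p ∉ v),
    K.dom (arr p v hp hv hpv) = obj v hv
  cod_arr : ∀ (p : I) (v : Finset I) (hp : p ∈ P) (hv : v ⊆ P) (hpv : p ∉ v),
    K.cod (arr p v hp hv hpv) = obj (insert p v) (Finset.insert_subset hp hv)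
  top_sq : ∀ (p q : I) (v : Finset I) (hpq : p < q) (hp : p ∈ P) (hq : q ∈ P) (hv : v ⊆ P)
    (hpv : p ∉ v) (hqv : q ∉ v), K.top (sq p q v hpq hp hq hv hpv hqv) = arr p v hp hv hpv
  bot_sq : ∀ (p q : I) (v : Finset I) (hpq : p < q) (hp : p ∈ P) (hq : q ∈ P) (hv : v ⊆ P)
    (hpv : p ∉ v) (hqv : q ∉ v), K.bot (sq p q v hpq hp hq hv hpv hqv) =
      arr p (insert q v) hp (Finset.insert_subset hq hv) (by simp [hpq.ne, hpv])
  left_sq : ∀ (p q : I) (v : Finset I) (hpq : p < q) (hp : p ∈ P) (hq : q ∈ P) (hv : v ⊆ P)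
    (hpv : p ∉ v) (hqv : q ∉ v), K.left (sq p q v hpq hp hq hv hpv hqv) = arr q v hq hv hqv
  right_sq : ∀ (p q : I) (v : Finset I) (hpq : p < q) (hp : p ∈ P) (hq : q ∈ P) (hv : v ⊆ P)
    (hpv : p ∉ v) (hqv : q ∉ v), K.right (sq p q v hpq hp hq hv hpv hqv) =
      arr q (insert p v) hq (Finset.insert_subset hp hv) (by simp [hpq.ne', hqv])
  comm : ∀ (p q r : I) (v : Finset I) (hpq : p < q) (hqr : q < r) (hp : p ∈ P) (hq : q ∈ P)
    (hr : r ∈ P) (hv : v ⊆ P) (hpv : p ∉ v) (hqv : q ∉ v) (hrv : r ∉ v),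
    K.Comm (sq p q v hpq hp hq hv hpv hqv)
      (sq p q (insert r v) hpq hp hq (Finset.insert_subset hr hv)
        (by simp [(hpq.trans hqr).ne, hpv]) (by simp [hqr.ne, hqv]))
      (sq p r v (hpq.trans hqr) hp hr hv hpv hrv)
      (sq p r (insert q v) (hpq.trans hqr) hp hr (Finset.insert_subset hq hv)
        (by simp [hpq.ne, hpv]) (by simp [hqr.ne', hrv]))
      (sq q r v hqr hq hr hv hqv hrv)
      (sq q r (insert p v) hqr hq hr (Finset.insert_subset hp hv)
        (by simp [hpq.ne', hqv]) (by simp [(hpq.trans hqr).ne', hrv]))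

/-- The vertex (or edge, or two-dimensional face) `v` of the face `∂^α_j` of a cube, as a vertex
(edge, two-dimensional face) of the cube. -/
def shift {I : Type} [DecidableEq I] (α : Bool) (j : I) (v : Finset I) : Finset I :=
  if α then insert j v else v

/-- `M` is the multiple category of the cells of `K`, with the geometrical faces, and with
degeneracies and compositions given by those of the low-dimensional items of `K`. (These conditions
determine `M`. The `∀`-bound memberships only express that the terms are defined.) -/
structure QuintetSystem.IsMultipleCategoryOf {I : Type} [LinearOrder I] (K : QuintetSystem.{v, w} I)
    (M : MultipleCategory (Cell K)) : Prop where
  face_obj : ∀ (α : Bool) {j : I} {k i : Finset I} (h : IsExt j k i) (x : Cell K i)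
    (v : Finset I) (hv : v ⊆ k) (hv' : shift α j v ⊆ i),
    (M.face α h x).obj v hv = x.obj (shift α j v) hv'
  face_arr : ∀ (α : Bool) {j : I} {k i : Finset I} (h : IsExt j k i) (x : Cell K i) (p : I)
    (v : Finset I) (hp : p ∈ k) (hv : v ⊆ k) (hpv : p ∉ v) (hp' : p ∈ i) (hv' : shift α j v ⊆ i)
    (hpv' : p ∉ shift α j v),
    (M.face α h x).arr p v hp hv hpv = x.arr p (shift α j v) hp' hv' hpv'
  face_sq : ∀ (α : Bool) {j : I} {k i : Finset I} (h : IsExt j k i) (x : Cell K i) (p q : I)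
    (v : Finset I) (hpq : p < q) (hp : p ∈ k) (hq : q ∈ k) (hv : v ⊆ k) (hpv : p ∉ v) (hqv : q ∉ v)
    (hp' : p ∈ i) (hq' : q ∈ i) (hv' : shift α j v ⊆ i) (hpv' : p ∉ shift α j v)
    (hqv' : q ∉ shift α j v),
    (M.face α h x).sq p q v hpq hp hq hv hpv hqv =
      x.sq p q (shift α j v) hpq hp' hq' hv' hpv' hqv'
  deg_obj : ∀ {j : I} {k i : Finset I} (h : IsExt j k i) (x : Cell K k) (v : Finset I)
    (hv : v ⊆ i) (hv' : v.erase j ⊆ k), (M.deg h x).obj v hv = x.obj (v.erase j) hv'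
  deg_arr : ∀ {j : I} {k i : Finset I} (h : IsExt j k i) (x : Cell K k) (v : Finset I)
    (hj : j ∈ i) (hv : v ⊆ i) (hjv : j ∉ v) (hv' : v ⊆ k),
    K.IsId (x.obj v hv') ((M.deg h x).arr j v hj hv hjv)
  deg_arr_ne : ∀ {j : I} {k i : Finset I} (h : IsExt j k i) (x : Cell K k) (p : I)
    (v : Finset I) (hp : p ∈ i) (hv : v ⊆ i) (hpv : p ∉ v) (hp' : p ∈ k) (hv' : v.erase j ⊆ k)
    (hpv' : p ∉ v.erase j),
    (M.deg h x).arr p v hp hv hpv = x.arr p (v.erase j) hp' hv' hpv'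
  deg_sq_fst : ∀ {j : I} {k i : Finset I} (h : IsExt j k i) (x : Cell K k) (q : I)
    (v : Finset I) (hjq : j < q) (hj : j ∈ i) (hq : q ∈ i) (hv : v ⊆ i) (hjv : j ∉ v) (hqv : q ∉ v)
    (hq' : q ∈ k) (hv' : v ⊆ k),
    K.IsIdFst (x.arr q v hq' hv' hqv) ((M.deg h x).sq j q v hjq hj hq hv hjv hqv)
  deg_sq_snd : ∀ {j : I} {k i : Finset I} (h : IsExt j k i) (x : Cell K k) (p : I)
    (v : Finset I) (hpj : p < j) (hp : p ∈ i) (hj : j ∈ i) (hv : v ⊆ i) (hpv : p ∉ v) (hjv : j ∉ v)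
    (hp' : p ∈ k) (hv' : v ⊆ k),
    K.IsIdSnd (x.arr p v hp' hv' hpv) ((M.deg h x).sq p j v hpj hp hj hv hpv hjv)
  deg_sq_ne : ∀ {j : I} {k i : Finset I} (h : IsExt j k i) (x : Cell K k) (p q : I)
    (v : Finset I) (hpq : p < q) (hp : p ∈ i) (hq : q ∈ i) (hv : v ⊆ i) (hpv : p ∉ v) (hqv : q ∉ v)
    (hp' : p ∈ k) (hq' : q ∈ k) (hv' : v.erase j ⊆ k) (hpv' : p ∉ v.erase j)
    (hqv' : q ∉ v.erase j),
    (M.deg h x).sq p q v hpq hp hq hv hpv hqv = x.sq p q (v.erase j) hpq hp' hq' hv' hpv' hqv'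
  comp_obj : ∀ {j : I} {k i : Finset I} (h : IsExt j k i) (x y : Cell K i)
    (hxy : M.face true h x = M.face false h y) (v : Finset I) (hv : v ⊆ i),
    (M.comp h x y hxy).obj v hv = if j ∈ v then y.obj v hv else x.obj v hv
  comp_arr : ∀ {j : I} {k i : Finset I} (h : IsExt j k i) (x y : Cell K i)
    (hxy : M.face true h x = M.face false h y) (v : Finset I) (hj : j ∈ i) (hv : v ⊆ i)
    (hjv : j ∉ v),
    K.IsComp (x.arr j v hj hv hjv) (y.arr j v hj hv hjv) ((M.comp h x y hxy).arr j v hj hv hjv)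
  comp_arr_ne : ∀ {j : I} {k i : Finset I} (h : IsExt j k i) (x y : Cell K i)
    (hxy : M.face true h x = M.face false h y) (p : I) (v : Finset I) (hp : p ∈ i) (hv : v ⊆ i)
    (hpv : p ∉ v), p ≠ j →
    (M.comp h x y hxy).arr p v hp hv hpv =
      if j ∈ v then y.arr p v hp hv hpv else x.arr p v hp hv hpv
  comp_sq_fst : ∀ {j : I} {k i : Finset I} (h : IsExt j k i) (x y : Cell K i)
    (hxy : M.face true h x = M.face false h y) (q : I) (v : Finset I) (hjq : j < q) (hj : j ∈ i)
    (hq : q ∈ i) (hv : v ⊆ i) (hjv : j ∉ v) (hqv : q ∉ v),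
    K.IsCompFst (x.sq j q v hjq hj hq hv hjv hqv) (y.sq j q v hjq hj hq hv hjv hqv)
      ((M.comp h x y hxy).sq j q v hjq hj hq hv hjv hqv)
  comp_sq_snd : ∀ {j : I} {k i : Finset I} (h : IsExt j k i) (x y : Cell K i)
    (hxy : M.face true h x = M.face false h y) (p : I) (v : Finset I) (hpj : p < j) (hp : p ∈ i)
    (hj : j ∈ i) (hv : v ⊆ i) (hpv : p ∉ v) (hjv : j ∉ v),
    K.IsCompSnd (x.sq p j v hpj hp hj hv hpv hjv) (y.sq p j v hpj hp hj hv hpv hjv)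
      ((M.comp h x y hxy).sq p j v hpj hp hj hv hpv hjv)
  comp_sq_ne : ∀ {j : I} {k i : Finset I} (h : IsExt j k i) (x y : Cell K i)
    (hxy : M.face true h x = M.face false h y) (p q : I) (v : Finset I) (hpq : p < q) (hp : p ∈ i)
    (hq : q ∈ i) (hv : v ⊆ i) (hpv : p ∉ v) (hqv : q ∉ v), p ≠ j → q ≠ j →
    (M.comp h x y hxy).sq p q v hpq hp hq hv hpv hqv =
      if j ∈ v then y.sq p q v hpq hp hq hv hpv hqv else x.sq p q v hpq hp hq hv hpv hqv

/-! ## The multiple category of quintets over a 2-category -/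

/-- An arrow of a 2-category, with its domain and codomain. -/
structure QArr (C : Type v) [Bicategory.{w, w} C] : Type (max v w) where
  dom : C
  cod : C
  hom : dom ⟶ cod

/-- A quintet `φ : v r → s u` of a 2-category, with its boundary. -/
structure QSq (C : Type v) [Bicategory.{w, w} C] : Type (max v w) where
  {A B C' D : C}
  r : A ⟶ B
  s : C' ⟶ D
  u : A ⟶ C'
  v : B ⟶ D
  cell : r ≫ v ⟶ u ≫ s

namespace Quintet

variable {C : Type v} [Bicategory.{w, w} C]

inductive IsId : C → QArr C → Prop
  | mk (A : C) : IsId A ⟨A, A, 𝟙 A⟩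

inductive IsComp : QArr C → QArr C → QArr C → Prop
  | mk {A B D : C} (f : A ⟶ B) (g : B ⟶ D) : IsComp ⟨A, B, f⟩ ⟨B, D, g⟩ ⟨A, D, f ≫ g⟩

inductive IsIdFst : QArr C → QSq C → Prop
  | mk {A B : C} (u : A ⟶ B) : IsIdFst ⟨A, B, u⟩ ⟨𝟙 A, 𝟙 B, u, u, (λ_ u).hom ≫ (ρ_ u).inv⟩

inductive IsIdSnd : QArr C → QSq C → Prop
  | mk {A B : C} (r : A ⟶ B) : IsIdSnd ⟨A, B, r⟩ ⟨r, r, 𝟙 A, 𝟙 B, (ρ_ r).hom ≫ (λ_ r).inv⟩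

/-- The pasting `w r' r → s' v r → s' s u`. -/
inductive IsCompFst : QSq C → QSq C → QSq C → Prop
  | mk {A₁ A₂ A₃ B₁ B₂ B₃ : C} (r : A₁ ⟶ A₂) (r' : A₂ ⟶ A₃) (s : B₁ ⟶ B₂) (s' : B₂ ⟶ B₃)
      (u : A₁ ⟶ B₁) (v : A₂ ⟶ B₂) (w : A₃ ⟶ B₃) (φ : r ≫ v ⟶ u ≫ s) (ψ : r' ≫ w ⟶ v ≫ s') :
      IsCompFst ⟨r, s, u, v, φ⟩ ⟨r', s', v, w, ψ⟩
        ⟨r ≫ r', s ≫ s', u, w,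
          (α_ r r' w).hom ≫ r ◁ ψ ≫ (α_ r v s').inv ≫ φ ▷ s' ≫ (α_ u s s').hom⟩

/-- The pasting `v' v r → v' s u → t u' u`. -/
inductive IsCompSnd : QSq C → QSq C → QSq C → Prop
  | mk {A₁ A₂ A₃ B₁ B₂ B₃ : C} (r : A₁ ⟶ B₁) (s : A₂ ⟶ B₂) (t : A₃ ⟶ B₃) (u : A₁ ⟶ A₂)
      (u' : A₂ ⟶ A₃) (v : B₁ ⟶ B₂) (v' : B₂ ⟶ B₃) (φ : r ≫ v ⟶ u ≫ s) (σ : s ≫ v' ⟶ u' ≫ t) :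
      IsCompSnd ⟨r, s, u, v, φ⟩ ⟨s, t, u', v', σ⟩
        ⟨r, t, u ≫ u', v ≫ v',
          (α_ r v v').inv ≫ φ ▷ v' ≫ (α_ u s v').hom ≫ u ◁ σ ≫ (α_ u u' t).inv⟩

/-- The commutativity `y'φ ⊗ ρu ⊗ s'ω = ζr ⊗ v'π ⊗ ψx : y' v r → s' u' x` of a cube of
quintets. -/
inductive Comm : QSq C → QSq C → QSq C → QSq C → QSq C → QSq C → Prop
  | mk {A₁ A₂ A₃ A₄ B₁ B₂ B₃ B₄ : C}
      (r : A₁ ⟶ A₂) (s : A₃ ⟶ A₄) (r' : B₁ ⟶ B₂) (s' : B₃ ⟶ B₄)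
      (u : A₁ ⟶ A₃) (v : A₂ ⟶ A₄) (u' : B₁ ⟶ B₃) (v' : B₂ ⟶ B₄)
      (x : A₁ ⟶ B₁) (x' : A₂ ⟶ B₂) (y : A₃ ⟶ B₃) (y' : A₄ ⟶ B₄)
      (φ : r ≫ v ⟶ u ≫ s) (ψ : r' ≫ v' ⟶ u' ≫ s') (π : r ≫ x' ⟶ x ≫ r') (ρ : s ≫ y' ⟶ y ≫ s')
      (ω : u ≫ y ⟶ x ≫ u') (ζ : v ≫ y' ⟶ x' ≫ v')
      (h : φ ▷ y' ≫ (α_ u s y').hom ≫ u ◁ ρ ≫ (α_ u y s').inv ≫ ω ▷ s' =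
        (α_ r v y').hom ≫ r ◁ ζ ≫ (α_ r x' v').inv ≫ π ▷ v' ≫ (α_ x r' v').hom ≫ x ◁ ψ ≫
          (α_ x u' s').inv) :
      Comm ⟨r, s, u, v, φ⟩ ⟨r', s', u', v', ψ⟩ ⟨r, r', x, x', π⟩ ⟨s, s', y, y', ρ⟩
        ⟨u, u', x, y, ω⟩ ⟨v, v', x', y', ζ⟩

end Quintet

/-- The data of the multiple category `Q(C)` of (higher) quintets over a 2-category `C`, indexed by
`I`: all directions have the same arrows. -/
def quintets (I : Type) (C : Type v) [Bicategory.{w, w} C] [Bicategory.Strict C] :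
    QuintetSystem.{v, max v w} I where
  Obj := C
  Arr _ := QArr C
  dom f := f.dom
  cod f := f.cod
  Sq _ _ := QSq C
  top φ := ⟨_, _, φ.r⟩
  bot φ := ⟨_, _, φ.s⟩
  left φ := ⟨_, _, φ.u⟩
  right φ := ⟨_, _, φ.v⟩
  IsId := Quintet.IsId
  IsComp := Quintet.IsComp
  IsIdFst := Quintet.IsIdFst
  IsIdSnd := Quintet.IsIdSnd
  IsCompFst := Quintet.IsCompFst
  IsCompSnd := Quintet.IsCompSnd
  Comm := Quintet.Comm

/-! ## The multiple category of chiral multiple categories -/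

/-- A `p`-morphism of chiral multiple categories, with its domain and codomain. -/
structure CmcArr (p : ℕ∞) : Type (u + 1) where
  dom : ChiralMultipleCategory.{u}
  cod : ChiralMultipleCategory.{u}
  hom : MixedFunctor p dom cod

/-- A `pq`-cube of chiral multiple categories, with its boundary. -/
structure CmcSq (p q : ℕ∞) : Type (u + 1) where
  {A B C D : ChiralMultipleCategory.{u}}
  R : MixedFunctor p A B
  S : MixedFunctor p C D
  U : MixedFunctor q A C
  V : MixedFunctor q B D
  cell : MixedSquare R S U V

namespace Cmc

inductive IsId {p : ℕ∞} : ChiralMultipleCategory.{u} → CmcArr.{u} p → Prop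
  | mk (A : ChiralMultipleCategory.{u}) (R : MixedFunctor p A A) (h : R.IsIdentity) :
      IsId A ⟨A, A, R⟩

inductive IsComp {p : ℕ∞} : CmcArr.{u} p → CmcArr.{u} p → CmcArr.{u} p → Prop
  | mk {A B C : ChiralMultipleCategory.{u}} (R : MixedFunctor p A B) (S : MixedFunctor p B C)
      (T : MixedFunctor p A C) (h : R.IsComposition S T) : IsComp ⟨A, B, R⟩ ⟨B, C, S⟩ ⟨A, C, T⟩

/-- The identity cube of a `q`-morphism `U`, with components `id (U x)`. -/
inductive IsIdFst {p q : ℕ∞} : CmcArr.{u} q → CmcSq.{u} p q → Prop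
  | mk {A B : ChiralMultipleCategory.{u}} (U : MixedFunctor q A B) (R : MixedFunctor p A A)
      (S : MixedFunctor p B B) (hR : R.IsIdentity) (hS : S.IsIdentity) (φ : MixedSquare R S U U)
      (hφ : ∀ {i : Finset ℕ+} (x : A.cube i), φ.app x = B.one (U.obj x)) :
      IsIdFst ⟨A, B, U⟩ ⟨R, S, U, U, φ⟩

/-- The identity cube of a `p`-morphism `R`, with components `id (R x)`. -/
inductive IsIdSnd {p q : ℕ∞} : CmcArr.{u} p → CmcSq.{u} p q → Prop
  | mk {A B : ChiralMultipleCategory.{u}} (R : MixedFunctor p A B) (U : MixedFunctor q A A)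
      (V : MixedFunctor q B B) (hU : U.IsIdentity) (hV : V.IsIdentity) (φ : MixedSquare R R U V)
      (hφ : ∀ {i : Finset ℕ+} (x : A.cube i), φ.app x = B.one (R.obj x)) :
      IsIdSnd ⟨A, B, R⟩ ⟨R, R, U, V, φ⟩

/-- The composition `(φ +_p ψ)(x) = ψ(R x) +_0 S'(φ x) : W R' R x → S' V R x → S' S U x`. -/
inductive IsCompFst {p q : ℕ∞} : CmcSq.{u} p q → CmcSq.{u} p q → CmcSq.{u} p q → Prop
  | mk {A₁ A₂ A₃ B₁ B₂ B₃ : ChiralMultipleCategory.{u}}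
      (R : MixedFunctor p A₁ A₂) (R' : MixedFunctor p A₂ A₃) (R'' : MixedFunctor p A₁ A₃)
      (S : MixedFunctor p B₁ B₂) (S' : MixedFunctor p B₂ B₃) (S'' : MixedFunctor p B₁ B₃)
      (U : MixedFunctor q A₁ B₁) (V : MixedFunctor q A₂ B₂) (W : MixedFunctor q A₃ B₃)
      (hR : R.IsComposition R' R'') (hS : S.IsComposition S' S'')
      (φ : MixedSquare R S U V) (ψ : MixedSquare R' S' V W) (σ : MixedSquare R'' S'' U W)
      (hσ : ∀ {i : Finset ℕ+} (x : A₁.cube i),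
        B₃.IsComposite [ψ.app (R.obj x), S'.mor (φ.app x)] (σ.app x)) :
      IsCompFst ⟨R, S, U, V, φ⟩ ⟨R', S', V, W, ψ⟩ ⟨R'', S'', U, W, σ⟩

/-- The composition `(φ +_q σ)(x) = V'(φ x) +_0 σ(U x) : V' V R x → V' S U x → T U' U x`. -/
inductive IsCompSnd {p q : ℕ∞} : CmcSq.{u} p q → CmcSq.{u} p q → CmcSq.{u} p q → Prop
  | mk {A₁ A₂ A₃ B₁ B₂ B₃ : ChiralMultipleCategory.{u}}
      (R : MixedFunctor p A₁ B₁) (S : MixedFunctor p A₂ B₂) (T : MixedFunctor p A₃ B₃)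
      (U : MixedFunctor q A₁ A₂) (U' : MixedFunctor q A₂ A₃) (U'' : MixedFunctor q A₁ A₃)
      (V : MixedFunctor q B₁ B₂) (V' : MixedFunctor q B₂ B₃) (V'' : MixedFunctor q B₁ B₃)
      (hU : U.IsComposition U' U'') (hV : V.IsComposition V' V'')
      (φ : MixedSquare R S U V) (σ : MixedSquare S T U' V') (τ : MixedSquare R T U'' V'')
      (hτ : ∀ {i : Finset ℕ+} (x : A₁.cube i),
        B₃.IsComposite [V'.mor (φ.app x), σ.app (U.obj x)] (τ.app x)) :
      IsCompSnd ⟨R, S, U, V, φ⟩ ⟨S, T, U', V', σ⟩ ⟨R, T, U'', V'', τ⟩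

/-- The commutativity of a cube: the transversal composites
`Y' V R x → Y' S U x → S' Y U x → S' U' X x` and `Y' V R x → V' X' R x → V' R' X x → S' U' X x`
coincide. -/
inductive Comm {p q r : ℕ∞} : CmcSq.{u} p q → CmcSq.{u} p q → CmcSq.{u} p r → CmcSq.{u} p r →
    CmcSq.{u} q r → CmcSq.{u} q r → Prop
  | mk {A₁ A₂ A₃ A₄ B₁ B₂ B₃ B₄ : ChiralMultipleCategory.{u}}
      (R : MixedFunctor p A₁ A₂) (S : MixedFunctor p A₃ A₄) (R' : MixedFunctor p B₁ B₂)
      (S' : MixedFunctor p B₃ B₄)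
      (U : MixedFunctor q A₁ A₃) (V : MixedFunctor q A₂ A₄) (U' : MixedFunctor q B₁ B₃)
      (V' : MixedFunctor q B₂ B₄)
      (X : MixedFunctor r A₁ B₁) (X' : MixedFunctor r A₂ B₂) (Y : MixedFunctor r A₃ B₃)
      (Y' : MixedFunctor r A₄ B₄)
      (φ : MixedSquare R S U V) (ψ : MixedSquare R' S' U' V')
      (π : MixedSquare R R' X X') (ρ : MixedSquare S S' Y Y')
      (ω : MixedSquare U U' X Y) (ζ : MixedSquare V V' X' Y')
      (h : ∀ {i : Finset ℕ+} (x : A₁.cube i),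
        B₄.Commutes [Y'.mor (φ.app x), ρ.app (U.obj x), S'.mor (ω.app x)]
          [ζ.app (R.obj x), V'.mor (π.app x), ψ.app (X.obj x)]) :
      Comm ⟨R, S, U, V, φ⟩ ⟨R', S', U', V', ψ⟩ ⟨R, R', X, X', π⟩ ⟨S, S', Y, Y', ρ⟩
        ⟨U, U', X, Y, ω⟩ ⟨V, V', X', Y', ζ⟩

end Cmc

/-- The data of the multiple category `Cmc` of chiral multiple categories, indexed by
`{0, 1, ..., ∞}`. -/
def cmc : QuintetSystem.{u + 1, u + 1} ℕ∞ where
  Obj := ChiralMultipleCategory.{u}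
  Arr := CmcArr.{u}
  dom R := R.dom
  cod R := R.cod
  Sq := CmcSq.{u}
  top φ := ⟨_, _, φ.R⟩
  bot φ := ⟨_, _, φ.S⟩
  left φ := ⟨_, _, φ.U⟩
  right φ := ⟨_, _, φ.V⟩
  IsId := Cmc.IsId
  IsComp := Cmc.IsComp
  IsIdFst := Cmc.IsIdFst
  IsIdSnd := Cmc.IsIdSnd
  IsCompFst := Cmc.IsCompFst
  IsCompSnd := Cmc.IsCompSnd
  Comm := Cmc.Comm

/-! ## The transversal functor -/

/-- The morphism `tv(R)` of multiple objects in `Cat` underlying a `p`-morphism `R`. -/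
def tvHom {p : ℕ∞} {A B : ChiralMultipleCategory.{u}} (R : MixedFunctor p A B) :
    A.toMultCat ⟶ B.toMultCat :=
  R.toHom

/-- The 2-cell `tv(φ) : tv(V) tv(R) → tv(S) tv(U)` underlying a `pq`-cube `φ`. -/
def tvSquare {p q : ℕ∞} {A B C D : ChiralMultipleCategory.{u}} {R : MixedFunctor p A B}
    {S : MixedFunctor p C D} {U : MixedFunctor q A C} {V : MixedFunctor q B D}
    (φ : MixedSquare R S U V) : tvHom R ≫ tvHom V ⟶ tvHom U ≫ tvHom S :=
  MultCat.Trans.mk (F := MultCat.Hom.comp R.toHom V.toHom) (G := MultCat.Hom.comp U.toHom S.toHom)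
    φ.app φ.src_app φ.tgt_app
    (fun f h h' => by
      obtain ⟨c, hc, hc'⟩ := φ.naturality f
      obtain ⟨h₁, rfl⟩ := MultCat.isComposite_pair hc
      obtain ⟨h₂, h₃⟩ := MultCat.isComposite_pair hc'
      exact h₃.symm)
    φ.face_app

def tvArr {p : ℕ∞} (R : CmcArr.{u} p) : QArr MultCat.{u} :=
  ⟨R.dom.toMultCat, R.cod.toMultCat, tvHom R.hom⟩

def tvSq {p q : ℕ∞} (φ : CmcSq.{u} p q) : QSq MultCat.{u} :=
  ⟨tvHom φ.R, tvHom φ.S, tvHom φ.U, tvHom φ.V, tvSquare φ.cell⟩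

/-- `T` is the transversal functor `tv`: it sends a cell of `Cmc` to the cell of quintets obtained
by acting on its objects, arrows and two-dimensional faces. -/
structure IsTransversalFunctor {M : MultipleCategory (Cell cmc.{u})}
    {N : MultipleCategory (Cell (quintets ℕ∞ MultCat.{u}))} (T : MultipleFunctor M N) : Prop where
  obj : ∀ {P : Finset ℕ∞} (x : Cell cmc.{u} P) (v : Finset ℕ∞) (hv : v ⊆ P),
    (T.map x).obj v hv =
    (show ChiralMultipleCategory.{u} from x.obj v hv).toMultCat
  arr : ∀ {P : Finset ℕ∞} (x : Cell cmc.{u} P) (p : ℕ∞) (v : Finset ℕ∞) (hp : p ∈ P)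
    (hv : v ⊆ P) (hpv : p ∉ v), (T.map x).arr p v hp hv hpv = tvArr (x.arr p v hp hv hpv)
  sq : ∀ {P : Finset ℕ∞} (x : Cell cmc.{u} P) (p q : ℕ∞) (v : Finset ℕ∞) (hpq : p < q)
    (hp : p ∈ P) (hq : q ∈ P) (hv : v ⊆ P) (hpv : p ∉ v) (hqv : q ∉ v),
    (T.map x).sq p q v hpq hp hq hv hpv hqv = tvSq (x.sq p q v hpq hp hq hv hpv hqv)

/-! A cell has data only on vertices, edges and two-dimensional faces, and a property on
three-dimensional faces. The statement therefore reduces to finitely many laws on a quintet system.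
`Typed` collects the category laws of the arrows in each direction, together with the existence and
the boundaries of identity and composite squares. `Lawful` adds the uniqueness, unit, associativity
and interchange laws of squares, and the closure of commutative cubes under degeneracy and pasting.
Over a lawful system (`Lawful.multipleCategory`) faces are restrictions, while degeneracies and
compositions are computed edge by edge and square by square. An axiom of multiple categories is then
checked on each vertex, edge and square, and a square involves at most two directions.

The laws are verified for quintets over `Mlt(Cat)` (`Quintet.lawful_quintets`), where a 2-cell is
its family of components: the interchange law, and the pasting of commutative cubes in each
direction, come down to the naturality of these families. They are not verified again for `cmc`. The
transversal map `Cmc.tvMap` is a `FaithfulMap`: a square of `cmc` is determined by its boundary and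
its components, and a cube commutes exactly when its faces fit together and its image commutes. By
`FaithfulMap.lawful` such a map reflects all the laws of squares and cubes, so only `Cmc.typed_cmc`
remains to be proved.

This is where the coherence of chiral multiple categories enters. Composites of `p`-morphisms
(`MixedFunctor.comp`), and identity and composite squares (`MixedSquare.idFst`, `MixedSquare.idSnd`,
`MixedSquare.compFst`, `MixedSquare.compSnd`), must be shown to satisfy all their axioms. Each axiom
for a composite is a pasting of the axiom of one factor, taken at an image of the other, with the
image of the axiom of that other factor; the two are glued by naturality. To carry this out without
carrying proofs of composability, the arrows of each index are embedded in a semigroup with zero,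
`MultCat.Par`, in which non-consecutive arrows have product zero. Commutative diagrams become
equations between products (`isComposite_iff`), and composability has to be checked on one side
only.

Two-dimensional faithfulness holds because, in dimension at least two, every vertex and edge lies in
a proper face, so that a cell with known boundary can only vary in its squares, which `tvMap`
distinguishes. The coskeletal dimension is at most three because, in dimension greater than three,
all vertices, edges, squares and three-dimensional faces of a cube lie in proper faces: a consistent
family can be glued in one way, and the result is automatically a cell (`FaceFamily.exists_cell`).
It is not smaller because commutativity is a genuine condition in dimension three: over a chiral
multiple category with one cube and transversal maps in `ℤ/2`, a cube with one nontrivial face and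
five identity faces has a consistent boundary but does not commute (`not_coskeletalDimLE_two`). -/

/-! ## Lawful quintet systems -/

namespace QuintetSystem

/-- The laws of arrows, and the existence and typing laws of two-dimensional cells. -/
structure Typed {I : Type} [LinearOrder I] (K : QuintetSystem.{v, w} I) : Prop where
  id_dom : ∀ {p : I} {A : K.Obj} {R : K.Arr p}, K.IsId A R → K.dom R = A
  id_cod : ∀ {p : I} {A : K.Obj} {R : K.Arr p}, K.IsId A R → K.cod R = A
  exists_id : ∀ (p : I) (A : K.Obj), ∃ R : K.Arr p, K.IsId A R
  id_unique : ∀ {p : I} {A : K.Obj} {R R' : K.Arr p}, K.IsId A R → K.IsId A R' → R = R'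
  comp_dom : ∀ {p : I} {R S T : K.Arr p}, K.IsComp R S T → K.dom T = K.dom R
  comp_cod : ∀ {p : I} {R S T : K.Arr p}, K.IsComp R S T → K.cod T = K.cod S
  exists_comp : ∀ {p : I} {R S : K.Arr p}, K.cod R = K.dom S → ∃ T, K.IsComp R S T
  comp_unique : ∀ {p : I} {R S T T' : K.Arr p}, K.IsComp R S T → K.IsComp R S T' → T = T'
  id_comp : ∀ {p : I} {E R T : K.Arr p}, K.IsId (K.dom R) E → K.IsComp E R T → T = R
  comp_id : ∀ {p : I} {E R T : K.Arr p}, K.IsId (K.cod R) E → K.IsComp R E T → T = R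
  assoc : ∀ {p : I} {R S T X Y Z W : K.Arr p}, K.IsComp R S X → K.IsComp X T Y →
    K.IsComp S T Z → K.IsComp R Z W → Y = W
  dom_top : ∀ {p q : I} (φ : K.Sq p q), K.dom (K.top φ) = K.dom (K.left φ)
  cod_top : ∀ {p q : I} (φ : K.Sq p q), K.cod (K.top φ) = K.dom (K.right φ)
  dom_bot : ∀ {p q : I} (φ : K.Sq p q), K.dom (K.bot φ) = K.cod (K.left φ)
  cod_bot : ∀ {p q : I} (φ : K.Sq p q), K.cod (K.bot φ) = K.cod (K.right φ)
  -- Existence is required only for `p < q`: coherence in a direction `j` is checked by comparing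
  -- `j` with both indices, and uses that being lax for `q` implies being lax for `p`, and being
  -- colax for `p` implies being colax for `q`.
  exists_idFst : ∀ {p q : I}, p < q → ∀ U : K.Arr q, ∃ φ : K.Sq p q, K.IsIdFst U φ
  idFst_top : ∀ {p q : I} {U : K.Arr q} {φ : K.Sq p q}, K.IsIdFst U φ → K.IsId (K.dom U) (K.top φ)
  idFst_bot : ∀ {p q : I} {U : K.Arr q} {φ : K.Sq p q}, K.IsIdFst U φ → K.IsId (K.cod U) (K.bot φ)
  idFst_left : ∀ {p q : I} {U : K.Arr q} {φ : K.Sq p q}, K.IsIdFst U φ → K.left φ = U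
  idFst_right : ∀ {p q : I} {U : K.Arr q} {φ : K.Sq p q}, K.IsIdFst U φ → K.right φ = U
  exists_idSnd : ∀ {p q : I}, p < q → ∀ R : K.Arr p, ∃ φ : K.Sq p q, K.IsIdSnd R φ
  idSnd_top : ∀ {p q : I} {R : K.Arr p} {φ : K.Sq p q}, K.IsIdSnd R φ → K.top φ = R
  idSnd_bot : ∀ {p q : I} {R : K.Arr p} {φ : K.Sq p q}, K.IsIdSnd R φ → K.bot φ = R
  idSnd_left : ∀ {p q : I} {R : K.Arr p} {φ : K.Sq p q}, K.IsIdSnd R φ →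
    K.IsId (K.dom R) (K.left φ)
  idSnd_right : ∀ {p q : I} {R : K.Arr p} {φ : K.Sq p q}, K.IsIdSnd R φ →
    K.IsId (K.cod R) (K.right φ)
  exists_compFst : ∀ {p q : I} {φ ψ : K.Sq p q}, p < q → K.right φ = K.left ψ →
    ∃ σ, K.IsCompFst φ ψ σ
  compFst_top : ∀ {p q : I} {φ ψ σ : K.Sq p q}, K.IsCompFst φ ψ σ →
    K.IsComp (K.top φ) (K.top ψ) (K.top σ)
  compFst_bot : ∀ {p q : I} {φ ψ σ : K.Sq p q}, K.IsCompFst φ ψ σ →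
    K.IsComp (K.bot φ) (K.bot ψ) (K.bot σ)
  compFst_left : ∀ {p q : I} {φ ψ σ : K.Sq p q}, K.IsCompFst φ ψ σ → K.left σ = K.left φ
  compFst_right : ∀ {p q : I} {φ ψ σ : K.Sq p q}, K.IsCompFst φ ψ σ → K.right σ = K.right ψ
  exists_compSnd : ∀ {p q : I} {φ ψ : K.Sq p q}, p < q → K.bot φ = K.top ψ →
    ∃ σ, K.IsCompSnd φ ψ σ
  compSnd_top : ∀ {p q : I} {φ ψ σ : K.Sq p q}, K.IsCompSnd φ ψ σ → K.top σ = K.top φ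
  compSnd_bot : ∀ {p q : I} {φ ψ σ : K.Sq p q}, K.IsCompSnd φ ψ σ → K.bot σ = K.bot ψ
  compSnd_left : ∀ {p q : I} {φ ψ σ : K.Sq p q}, K.IsCompSnd φ ψ σ →
    K.IsComp (K.left φ) (K.left ψ) (K.left σ)
  compSnd_right : ∀ {p q : I} {φ ψ σ : K.Sq p q}, K.IsCompSnd φ ψ σ →
    K.IsComp (K.right φ) (K.right ψ) (K.right σ)

/-- All the laws which make the cubes over a quintet system a multiple category. -/
structure Lawful {I : Type} [LinearOrder I] (K : QuintetSystem.{v, w} I) : Prop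
    extends Typed K where
  idFst_unique : ∀ {p q : I} {U : K.Arr q} {φ φ' : K.Sq p q}, K.IsIdFst U φ → K.IsIdFst U φ' →
    φ = φ'
  idSnd_unique : ∀ {p q : I} {R : K.Arr p} {φ φ' : K.Sq p q}, K.IsIdSnd R φ → K.IsIdSnd R φ' →
    φ = φ'
  compFst_unique : ∀ {p q : I} {φ ψ σ σ' : K.Sq p q}, K.IsCompFst φ ψ σ → K.IsCompFst φ ψ σ' →
    σ = σ'
  compSnd_unique : ∀ {p q : I} {φ ψ σ σ' : K.Sq p q}, K.IsCompSnd φ ψ σ → K.IsCompSnd φ ψ σ' →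
    σ = σ'
  id_compFst : ∀ {p q : I} {φ η σ : K.Sq p q}, K.IsIdFst (K.left φ) η → K.IsCompFst η φ σ → σ = φ
  compFst_id : ∀ {p q : I} {φ η σ : K.Sq p q}, K.IsIdFst (K.right φ) η → K.IsCompFst φ η σ → σ = φ
  id_compSnd : ∀ {p q : I} {φ η σ : K.Sq p q}, K.IsIdSnd (K.top φ) η → K.IsCompSnd η φ σ → σ = φ
  compSnd_id : ∀ {p q : I} {φ η σ : K.Sq p q}, K.IsIdSnd (K.bot φ) η → K.IsCompSnd φ η σ → σ = φ
  assocFst : ∀ {p q : I} {φ ψ χ a b c d : K.Sq p q}, K.IsCompFst φ ψ a → K.IsCompFst a χ b →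
    K.IsCompFst ψ χ c → K.IsCompFst φ c d → b = d
  assocSnd : ∀ {p q : I} {φ ψ χ a b c d : K.Sq p q}, K.IsCompSnd φ ψ a → K.IsCompSnd a χ b →
    K.IsCompSnd ψ χ c → K.IsCompSnd φ c d → b = d
  interchange : ∀ {p q : I} {φ φ' ψ ψ' a b c d e f : K.Sq p q}, K.IsCompFst φ φ' a →
    K.IsCompFst ψ ψ' b → K.IsCompSnd φ ψ c → K.IsCompSnd φ' ψ' d → K.IsCompSnd a b e →
    K.IsCompFst c d f → e = f
  idFst_comp : ∀ {p q : I} {U U' U'' : K.Arr q} {φ φ' σ τ : K.Sq p q}, K.IsIdFst U φ →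
    K.IsIdFst U' φ' → K.IsComp U U' U'' → K.IsIdFst U'' τ → K.IsCompSnd φ φ' σ → τ = σ
  idSnd_comp : ∀ {p q : I} {R R' R'' : K.Arr p} {φ φ' σ τ : K.Sq p q}, K.IsIdSnd R φ →
    K.IsIdSnd R' φ' → K.IsComp R R' R'' → K.IsIdSnd R'' τ → K.IsCompFst φ φ' σ → τ = σ
  -- The two ways of degenerating an object twice agree; this is what `deg_deg` requires on the
  -- square spanned by the two degenerate directions.
  idFst_id : ∀ {p q : I} {A : K.Obj} {R : K.Arr p} {U : K.Arr q} {φ ψ : K.Sq p q}, K.IsId A R →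
    K.IsId A U → K.IsIdFst U φ → K.IsIdSnd R ψ → φ = ψ
  comm_deg_fst : ∀ {p q r : I} {φ ψ : K.Sq p q} {π ρ : K.Sq p r} {ω : K.Sq q r},
    K.IsIdFst (K.top ω) φ → K.IsIdFst (K.bot ω) ψ → K.IsIdFst (K.left ω) π →
    K.IsIdFst (K.right ω) ρ → K.Comm φ ψ π ρ ω ω
  comm_deg_mid : ∀ {p q r : I} {φ ψ : K.Sq p q} {π : K.Sq p r} {ω ζ : K.Sq q r},
    K.IsIdSnd (K.top π) φ → K.IsIdSnd (K.bot π) ψ → K.IsIdFst (K.left π) ω →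
    K.IsIdFst (K.right π) ζ → K.Comm φ ψ π π ω ζ
  comm_deg_trd : ∀ {p q r : I} {φ : K.Sq p q} {π ρ : K.Sq p r} {ω ζ : K.Sq q r},
    K.IsIdSnd (K.top φ) π → K.IsIdSnd (K.bot φ) ρ → K.IsIdSnd (K.left φ) ω →
    K.IsIdSnd (K.right φ) ζ → K.Comm φ φ π ρ ω ζ
  comm_comp_fst : ∀ {p q r : I} {φ φ' φ'' ψ ψ' ψ'' : K.Sq p q} {π π' π'' ρ ρ' ρ'' : K.Sq p r}
    {ω ζ ξ : K.Sq q r}, K.Comm φ ψ π ρ ω ζ → K.Comm φ' ψ' π' ρ' ζ ξ → K.IsCompFst φ φ' φ'' →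
    K.IsCompFst ψ ψ' ψ'' → K.IsCompFst π π' π'' → K.IsCompFst ρ ρ' ρ'' →
    K.Comm φ'' ψ'' π'' ρ'' ω ξ
  comm_comp_mid : ∀ {p q r : I} {φ φ' φ'' ψ ψ' ψ'' : K.Sq p q} {π ρ σ : K.Sq p r}
    {ω ω' ω'' ζ ζ' ζ'' : K.Sq q r}, K.Comm φ ψ π ρ ω ζ → K.Comm φ' ψ' ρ σ ω' ζ' →
    K.IsCompSnd φ φ' φ'' → K.IsCompSnd ψ ψ' ψ'' → K.IsCompFst ω ω' ω'' → K.IsCompFst ζ ζ' ζ'' →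
    K.Comm φ'' ψ'' π σ ω'' ζ''
  comm_comp_trd : ∀ {p q r : I} {φ ψ χ : K.Sq p q} {π π' π'' ρ ρ' ρ'' : K.Sq p r}
    {ω ω' ω'' ζ ζ' ζ'' : K.Sq q r}, K.Comm φ ψ π ρ ω ζ → K.Comm ψ χ π' ρ' ω' ζ' →
    K.IsCompSnd π π' π'' → K.IsCompSnd ρ ρ' ρ'' → K.IsCompSnd ω ω' ω'' → K.IsCompSnd ζ ζ' ζ'' →
    K.Comm φ χ π'' ρ'' ω'' ζ''

variable {I : Type} [LinearOrder I] {K : QuintetSystem.{v, w} I}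

open Classical in
/-- The composite of two arrows, with a junk value where they are not consecutive. -/
noncomputable def compArr (K : QuintetSystem.{v, w} I) {p : I} (R S : K.Arr p) : K.Arr p :=
  if h : ∃ T, K.IsComp R S T then h.choose else R

open Classical in
/-- The composite in the first direction, with a junk value where undefined. -/
noncomputable def compFst (K : QuintetSystem.{v, w} I) {p q : I} (φ ψ : K.Sq p q) : K.Sq p q :=
  if h : ∃ σ, K.IsCompFst φ ψ σ then h.choose else φ

open Classical in
/-- The composite in the second direction, with a junk value where undefined. -/
noncomputable def compSnd (K : QuintetSystem.{v, w} I) {p q : I} (φ ψ : K.Sq p q) : K.Sq p q :=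
  if h : ∃ σ, K.IsCompSnd φ ψ σ then h.choose else φ

namespace Typed

/-- The identity arrow. -/
noncomputable def idArr (L : K.Typed) (p : I) (A : K.Obj) : K.Arr p := (L.exists_id p A).choose

/-- The identity cell in the first direction. -/
noncomputable def idFst (L : K.Typed) {p q : I} (hpq : p < q) (U : K.Arr q) : K.Sq p q :=
  (L.exists_idFst hpq U).choose

/-- The identity cell in the second direction. -/
noncomputable def idSnd (L : K.Typed) {p q : I} (hpq : p < q) (R : K.Arr p) : K.Sq p q :=
  (L.exists_idSnd hpq R).choose

theorem isId_idArr (L : K.Typed) (p : I) (A : K.Obj) : K.IsId A (L.idArr p A) :=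
  (L.exists_id p A).choose_spec

theorem isIdFst_idFst (L : K.Typed) {p q : I} (hpq : p < q) (U : K.Arr q) :
    K.IsIdFst U (L.idFst hpq U) :=
  (L.exists_idFst hpq U).choose_spec

theorem isIdSnd_idSnd (L : K.Typed) {p q : I} (hpq : p < q) (R : K.Arr p) :
    K.IsIdSnd R (L.idSnd hpq R) :=
  (L.exists_idSnd hpq R).choose_spec

theorem isComp_compArr (L : K.Typed) {p : I} {R S : K.Arr p} (h : K.cod R = K.dom S) :
    K.IsComp R S (K.compArr R S) := by
  have h' := L.exists_comp h
  rw [compArr, dif_pos h']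
  exact h'.choose_spec

theorem isCompFst_compFst (L : K.Typed) {p q : I} (hpq : p < q) {φ ψ : K.Sq p q}
    (h : K.right φ = K.left ψ) : K.IsCompFst φ ψ (K.compFst φ ψ) := by
  have h' := L.exists_compFst hpq h
  rw [compFst, dif_pos h']
  exact h'.choose_spec

theorem isCompSnd_compSnd (L : K.Typed) {p q : I} (hpq : p < q) {φ ψ : K.Sq p q}
    (h : K.bot φ = K.top ψ) : K.IsCompSnd φ ψ (K.compSnd φ ψ) := by
  have h' := L.exists_compSnd hpq h
  rw [compSnd, dif_pos h']
  exact h'.choose_spec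

theorem compArr_eq (L : K.Typed) {p : I} {R S T : K.Arr p} (h : K.IsComp R S T) :
    K.compArr R S = T := by
  have h' : ∃ T, K.IsComp R S T := ⟨T, h⟩
  rw [compArr, dif_pos h']
  exact L.comp_unique h'.choose_spec h

theorem idArr_eq (L : K.Typed) {p : I} {A : K.Obj} {R : K.Arr p} (h : K.IsId A R) :
    L.idArr p A = R :=
  L.id_unique (L.isId_idArr p A) h

end Typed

end QuintetSystem

/-! ## Multi-indices -/

section Index

variable {I : Type} [DecidableEq I] {j : I} {k i v : Finset I}

theorem IsExt.mem (h : IsExt j k i) : j ∈ i := h.2 ▸ Finset.mem_insert_self j k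

theorem IsExt.mem_of_mem (h : IsExt j k i) {p : I} (hp : p ∈ k) : p ∈ i :=
  h.2 ▸ Finset.mem_insert_of_mem hp

theorem IsExt.ne_of_mem (h : IsExt j k i) {p : I} (hp : p ∈ k) : p ≠ j :=
  fun e => h.1 (e ▸ hp)

theorem IsExt.mem_of_ne (h : IsExt j k i) {p : I} (hp : p ∈ i) (hpj : p ≠ j) : p ∈ k := by
  have := h.2 ▸ hp
  exact (Finset.mem_insert.1 this).resolve_left hpj

theorem IsExt.eq_erase (h : IsExt j k i) : k = i.erase j := by
  rw [h.2, Finset.erase_insert h.1]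

theorem IsExt.erase_subset (h : IsExt j k i) (hv : v ⊆ i) : v.erase j ⊆ k := by
  rw [h.eq_erase]
  exact Finset.erase_subset_erase j hv

theorem IsExt.subset (h : IsExt j k i) : k ⊆ i := fun _ hp => h.mem_of_mem hp

theorem IsExt.shift_subset (h : IsExt j k i) (α : Bool) (hv : v ⊆ k) : shift α j v ⊆ i := by
  cases α
  · exact hv.trans h.subset
  · exact Finset.insert_subset h.mem (hv.trans h.subset)

theorem isExt_erase (hj : j ∈ i) : IsExt j (i.erase j) i :=
  ⟨Finset.notMem_erase j i, (Finset.insert_erase hj).symm⟩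

theorem mem_shift_of_ne {α : Bool} {p : I} (hpj : p ≠ j) : p ∈ shift α j v ↔ p ∈ v := by
  cases α <;> simp [shift, hpj]

theorem notMem_shift {α : Bool} {p : I} (hpj : p ≠ j) (hp : p ∉ v) : p ∉ shift α j v :=
  fun h => hp ((mem_shift_of_ne hpj).1 h)

theorem insert_shift (α : Bool) (p : I) : insert p (shift α j v) = shift α j (insert p v) := by
  cases α
  · rfl
  · exact Finset.insert_comm p j v

theorem shift_shift (α β : Bool) {l : I} :
    shift α j (shift β l v) = shift β l (shift α j v) := by
  cases α <;> cases β <;> simp [shift, Finset.insert_comm]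

theorem erase_shift_self (α : Bool) (hj : j ∉ v) : (shift α j v).erase j = v := by
  cases α <;> simp [shift, hj]

theorem erase_shift_of_ne (α : Bool) {l : I} (h : l ≠ j) :
    (shift α l v).erase j = shift α l (v.erase j) := by
  cases α
  · rfl
  · exact Finset.erase_insert_of_ne h

/-- Of the two faces normal to `j`, the vertex `v` lies on the positive one exactly when `j ∈ v`.
Through this identity the values of a cube are read off its faces. -/
theorem shift_erase (j : I) (v : Finset I) : shift (decide (j ∈ v)) j (v.erase j) = v := by
  by_cases h : j ∈ v <;> simp [shift, h]

end Index

/-! ### Cubes over a quintet system: extensionality, faces, degeneracies. -/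

namespace Cell

variable {I : Type} [LinearOrder I] {K : QuintetSystem.{v, w} I} {j : I} {k i : Finset I}

/-- A vertex also occurs in the types of the membership proofs, which blocks rewriting it in place.
This lemma and the next two move the vertex and these proofs together. -/
theorem obj_congr (x : Cell K i) {v v' : Finset I} (e : v = v') (hv : v ⊆ i) :
    x.obj v hv = x.obj v' (e ▸ hv) := by
  subst e; rfl

theorem arr_congr (x : Cell K i) {p : I} {v v' : Finset I} (e : v = v') (hp : p ∈ i) (hv : v ⊆ i)
    (hpv : p ∉ v) : x.arr p v hp hv hpv = x.arr p v' hp (e ▸ hv) (e ▸ hpv) := by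
  subst e; rfl

theorem sq_congr (x : Cell K i) {p q : I} {v v' : Finset I} (e : v = v') (hpq : p < q) (hp : p ∈ i)
    (hq : q ∈ i) (hv : v ⊆ i) (hpv : p ∉ v) (hqv : q ∉ v) : x.sq p q v hpq hp hq hv hpv hqv =
      x.sq p q v' hpq hp hq (e ▸ hv) (e ▸ hpv) (e ▸ hqv) := by
  subst e; rfl

theorem ext_of {x y : Cell K i} (obj : ∀ v hv, x.obj v hv = y.obj v hv)
    (arr : ∀ p v hp hv hpv, x.arr p v hp hv hpv = y.arr p v hp hv hpv)
    (sq : ∀ p q v hpq hp hq hv hpv hqv,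
      x.sq p q v hpq hp hq hv hpv hqv = y.sq p q v hpq hp hq hv hpv hqv) : x = y :=
  Cell.ext (by funext v hv; exact obj v hv) (by funext p v hp hv hpv; exact arr p v hp hv hpv)
    (by funext p q v hpq hp hq hv hpv hqv; exact sq p q v hpq hp hq hv hpv hqv)

/-- The faces of a cube. -/
def face (α : Bool) (h : IsExt j k i) (x : Cell K i) : Cell K k where
  obj v hv := x.obj (shift α j v) (h.shift_subset α hv)
  arr p v hp hv hpv := x.arr p (shift α j v) (h.mem_of_mem hp) (h.shift_subset α hv)
    (notMem_shift (h.ne_of_mem hp) hpv)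
  sq p q v hpq hp hq hv hpv hqv := x.sq p q (shift α j v) hpq (h.mem_of_mem hp) (h.mem_of_mem hq)
    (h.shift_subset α hv) (notMem_shift (h.ne_of_mem hp) hpv) (notMem_shift (h.ne_of_mem hq) hqv)
  dom_arr p v hp hv hpv := x.dom_arr _ _ _ _ _
  cod_arr p v hp hv hpv := (x.cod_arr _ _ _ _ _).trans (x.obj_congr (insert_shift α p) _)
  top_sq p q v hpq hp hq hv hpv hqv := x.top_sq _ _ _ _ _ _ _ _ _
  bot_sq p q v hpq hp hq hv hpv hqv :=
    (x.bot_sq _ _ _ _ _ _ _ _ _).trans (x.arr_congr (insert_shift α q) _ _ _)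
  left_sq p q v hpq hp hq hv hpv hqv := x.left_sq _ _ _ _ _ _ _ _ _
  right_sq p q v hpq hp hq hv hpv hqv :=
    (x.right_sq _ _ _ _ _ _ _ _ _).trans (x.arr_congr (insert_shift α p) _ _ _)
  comm p q r v hpq hqr hp hq hr hv hpv hqv hrv := by
    have := x.comm p q r (shift α j v) hpq hqr (h.mem_of_mem hp) (h.mem_of_mem hq)
      (h.mem_of_mem hr) (h.shift_subset α hv) (notMem_shift (h.ne_of_mem hp) hpv)
      (notMem_shift (h.ne_of_mem hq) hqv) (notMem_shift (h.ne_of_mem hr) hrv)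
    simpa only [insert_shift] using this

/-- The degeneracies of a cube. -/
noncomputable def deg (L : K.Lawful) (h : IsExt j k i) (x : Cell K k) : Cell K i where
  obj v hv := x.obj (v.erase j) (h.erase_subset hv)
  arr p v hp hv hpv := if hpj : p = j then L.idArr p (x.obj (v.erase j) (h.erase_subset hv)) else
    x.arr p (v.erase j) (h.mem_of_ne hp hpj) (h.erase_subset hv)
      (fun e => hpv (Finset.mem_of_mem_erase e))
  sq p q v hpq hp hq hv hpv hqv :=
    if hpj : p = j then
      L.idFst hpq (x.arr q (v.erase j) (h.mem_of_ne hq (hpj ▸ hpq.ne')) (h.erase_subset hv)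
        (fun e => hqv (Finset.mem_of_mem_erase e)))
    else if hqj : q = j then
      L.idSnd hpq (x.arr p (v.erase j) (h.mem_of_ne hp hpj) (h.erase_subset hv)
        (fun e => hpv (Finset.mem_of_mem_erase e)))
    else x.sq p q (v.erase j) hpq (h.mem_of_ne hp hpj) (h.mem_of_ne hq hqj) (h.erase_subset hv)
      (fun e => hpv (Finset.mem_of_mem_erase e)) (fun e => hqv (Finset.mem_of_mem_erase e))
  dom_arr p v hp hv hpv := by
    split_ifs with hpj
    · exact L.id_dom (L.isId_idArr _ _)
    · exact x.dom_arr _ _ _ _ _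
  cod_arr p v hp hv hpv := by
    split_ifs with hpj
    · subst hpj
      refine (L.id_cod (L.isId_idArr _ _)).trans (x.obj_congr ?_ _)
      simp [hpv]
    · refine (x.cod_arr _ _ _ _ _).trans (x.obj_congr ?_ _)
      exact (Finset.erase_insert_of_ne hpj).symm
  top_sq p q v hpq hp hq hv hpv hqv := by
    by_cases hpj : p = j
    · subst hpj
      simp only [dite_true]
      -- The edge is the chosen identity arrow and the boundary of the square is some identity
      -- arrow; uniqueness identifies them.
      refine (L.idArr_eq ?_).symm
      rw [← x.dom_arr q (v.erase p) (h.mem_of_ne hq hpq.ne') (h.erase_subset hv)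
        (fun e => hqv (Finset.mem_of_mem_erase e))]
      exact L.idFst_top (L.isIdFst_idFst _ _)
    · by_cases hqj : q = j
      · simp only [hpj, hqj, dite_true, dite_false]
        exact L.idSnd_top (L.isIdSnd_idSnd _ _)
      · simp only [hpj, hqj, dite_false]
        exact x.top_sq _ _ _ _ _ _ _ _ _
  bot_sq p q v hpq hp hq hv hpv hqv := by
    by_cases hpj : p = j
    · subst hpj
      simp only [dite_true, Finset.erase_insert_of_ne hpq.ne']
      refine (L.idArr_eq ?_).symm
      rw [← x.cod_arr q (v.erase p) (h.mem_of_ne hq hpq.ne') (h.erase_subset hv)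
        (fun e => hqv (Finset.mem_of_mem_erase e))]
      exact L.idFst_bot (L.isIdFst_idFst _ _)
    · by_cases hqj : q = j
      · subst hqj
        simp only [hpj, dite_true, dite_false]
        refine (L.idSnd_bot (L.isIdSnd_idSnd _ _)).trans (x.arr_congr ?_ _ _ _)
        simp [hqv]
      · simp only [hpj, hqj, dite_false, Finset.erase_insert_of_ne hqj]
        exact x.bot_sq _ _ _ _ _ _ _ _ _
  left_sq p q v hpq hp hq hv hpv hqv := by
    by_cases hpj : p = j
    · subst hpj
      simp only [hpq.ne', dite_true, dite_false]
      exact L.idFst_left (L.isIdFst_idFst _ _)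
    · by_cases hqj : q = j
      · simp only [hpj, hqj, dite_true, dite_false]
        refine (L.idArr_eq ?_).symm
        rw [← x.dom_arr p (v.erase j) (h.mem_of_ne hp hpj) (h.erase_subset hv)
          (fun e => hpv (Finset.mem_of_mem_erase e))]
        exact L.idSnd_left (L.isIdSnd_idSnd _ _)
      · simp only [hpj, hqj, dite_false]
        exact x.left_sq _ _ _ _ _ _ _ _ _
  right_sq p q v hpq hp hq hv hpv hqv := by
    by_cases hpj : p = j
    · subst hpj
      simp only [hpq.ne', dite_true, dite_false]
      refine (L.idFst_right (L.isIdFst_idFst _ _)).trans (x.arr_congr ?_ _ _ _)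
      simp [hpv]
    · by_cases hqj : q = j
      · subst hqj
        simp only [hpj, dite_true, dite_false, Finset.erase_insert_of_ne hpq.ne]
        refine (L.idArr_eq ?_).symm
        rw [← x.cod_arr p (v.erase q) (h.mem_of_ne hp hpj) (h.erase_subset hv)
          (fun e => hpv (Finset.mem_of_mem_erase e))]
        exact L.idSnd_right (L.isIdSnd_idSnd _ _)
      · simp only [hpj, hqj, dite_false, Finset.erase_insert_of_ne hpj]
        exact x.right_sq _ _ _ _ _ _ _ _ _
  comm p q r v hpq hqr hp hq hr hv hpv hqv hrv := by
    have hpr := hpq.trans hqr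
    -- If `j` is one of the three directions, erasing it identifies the two opposite faces normal to
    -- `j`, and the four others are identity squares. The position of `j` in `p < q < r` selects the
    -- degenerate cube law to be used.
    by_cases hpj : p = j
    · subst hpj
      simp only [hpq.ne', hpr.ne', dite_true, dite_false, Finset.erase_insert_of_ne hpq.ne',
        Finset.erase_insert_of_ne hpr.ne', Finset.erase_insert_eq_erase]
      refine L.comm_deg_fst ?_ ?_ ?_ ?_
      · rw [x.top_sq]; exact L.isIdFst_idFst _ _
      · rw [x.bot_sq]; exact L.isIdFst_idFst _ _
      · rw [x.left_sq]; exact L.isIdFst_idFst _ _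
      · rw [x.right_sq]; exact L.isIdFst_idFst _ _
    · by_cases hqj : q = j
      · subst hqj
        simp only [hpj, hqr.ne', dite_true, dite_false, Finset.erase_insert_of_ne hpj,
          Finset.erase_insert_of_ne hqr.ne', Finset.erase_insert_eq_erase]
        refine L.comm_deg_mid ?_ ?_ ?_ ?_
        · rw [x.top_sq]; exact L.isIdSnd_idSnd _ _
        · rw [x.bot_sq]; exact L.isIdSnd_idSnd _ _
        · rw [x.left_sq]; exact L.isIdFst_idFst _ _
        · rw [x.right_sq]; exact L.isIdFst_idFst _ _
      · by_cases hrj : r = j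
        · subst hrj
          simp only [hpj, hqj, dite_true, dite_false, Finset.erase_insert_of_ne hpj,
            Finset.erase_insert_of_ne hqj, Finset.erase_insert_eq_erase]
          refine L.comm_deg_trd ?_ ?_ ?_ ?_
          · rw [x.top_sq]; exact L.isIdSnd_idSnd _ _
          · rw [x.bot_sq]; exact L.isIdSnd_idSnd _ _
          · rw [x.left_sq]; exact L.isIdSnd_idSnd _ _
          · rw [x.right_sq]; exact L.isIdSnd_idSnd _ _
        · simp only [hpj, hqj, hrj, dite_false, Finset.erase_insert_of_ne hpj,
            Finset.erase_insert_of_ne hqj, Finset.erase_insert_of_ne hrj]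
          exact x.comm p q r (v.erase j) hpq hqr (h.mem_of_ne hp hpj) (h.mem_of_ne hq hqj)
            (h.mem_of_ne hr hrj) (h.erase_subset hv) (fun e => hpv (Finset.mem_of_mem_erase e))
            (fun e => hqv (Finset.mem_of_mem_erase e)) (fun e => hrv (Finset.mem_of_mem_erase e))

section Comp

variable {x y : Cell K i}

/-- The common face is evaluated at `v`: as a positive face of `x` it sits at `insert j v`, as a
negative face of `y` at `v` itself. -/
theorem obj_of_consec (h : IsExt j k i) (hxy : face true h x = face false h y) {v : Finset I}
    (hjv : j ∉ v) (hv : insert j v ⊆ i) :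
    x.obj (insert j v) hv = y.obj v ((Finset.subset_insert j v).trans hv) := by
  have hv' : v ⊆ k := by
    rw [h.eq_erase, Finset.subset_erase]
    exact ⟨(Finset.subset_insert j v).trans hv, hjv⟩
  have := congrFun (congrFun (congrArg Cell.obj hxy) v) hv'
  exact this

theorem arr_of_consec (h : IsExt j k i) (hxy : face true h x = face false h y) {p : I}
    {v : Finset I} (hjv : j ∉ v) (hp : p ∈ i) (hv : insert j v ⊆ i) (hpv : p ∉ insert j v) :
    x.arr p (insert j v) hp hv hpv = y.arr p v hp ((Finset.subset_insert j v).trans hv)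
      (fun e => hpv (Finset.mem_insert_of_mem e)) := by
  have hv' : v ⊆ k := by
    rw [h.eq_erase, Finset.subset_erase]
    exact ⟨(Finset.subset_insert j v).trans hv, hjv⟩
  have hp' : p ∈ k := h.mem_of_ne hp (fun e => hpv (e ▸ Finset.mem_insert_self _ _))
  exact congrFun (congrFun (congrFun (congrFun (congrFun (congrArg Cell.arr hxy) p) v) hp') hv')
    (fun e => hpv (Finset.mem_insert_of_mem e))

theorem sq_of_consec (h : IsExt j k i) (hxy : face true h x = face false h y) {p q : I}
    {v : Finset I} (hjv : j ∉ v) (hpq : p < q) (hp : p ∈ i) (hq : q ∈ i) (hv : insert j v ⊆ i)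
    (hpv : p ∉ insert j v) (hqv : q ∉ insert j v) :
    x.sq p q (insert j v) hpq hp hq hv hpv hqv =
      y.sq p q v hpq hp hq ((Finset.subset_insert j v).trans hv)
        (fun e => hpv (Finset.mem_insert_of_mem e)) (fun e => hqv (Finset.mem_insert_of_mem e)) := by
  have hv' : v ⊆ k := by
    rw [h.eq_erase, Finset.subset_erase]
    exact ⟨(Finset.subset_insert j v).trans hv, hjv⟩
  have hp' : p ∈ k := h.mem_of_ne hp (fun e => hpv (e ▸ Finset.mem_insert_self _ _))
  have hq' : q ∈ k := h.mem_of_ne hq (fun e => hqv (e ▸ Finset.mem_insert_self _ _))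
  exact congrFun (congrFun (congrFun (congrFun (congrFun (congrFun (congrFun (congrFun
    (congrFun (congrArg Cell.sq hxy) p) q) v) hpq) hp') hq') hv')
    (fun e => hpv (Finset.mem_insert_of_mem e))) (fun e => hqv (Finset.mem_insert_of_mem e))

end Comp

end Cell

/-! ### Composition of cubes. -/

namespace Cell

variable {I : Type} [LinearOrder I] {K : QuintetSystem.{v, w} I} {j : I} {k i : Finset I}

section Comp

variable {x y : Cell K i}

theorem cod_eq_dom (h : IsExt j k i) (hxy : face true h x = face false h y) {v : Finset I}
    (hjv : j ∉ v) (hv : v ⊆ i) :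
    K.cod (x.arr j v h.mem hv hjv) = K.dom (y.arr j v h.mem hv hjv) := by
  rw [x.cod_arr, y.dom_arr]
  exact obj_of_consec h hxy hjv _

theorem right_eq_left (h : IsExt j k i) (hxy : face true h x = face false h y) {q : I}
    {v : Finset I} (hjv : j ∉ v) (hjq : j < q) (hq : q ∈ i) (hv : v ⊆ i) (hqv : q ∉ v) :
    K.right (x.sq j q v hjq h.mem hq hv hjv hqv) = K.left (y.sq j q v hjq h.mem hq hv hjv hqv) := by
  rw [x.right_sq, y.left_sq]
  exact arr_of_consec h hxy hjv _ _ _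

theorem bot_eq_top (h : IsExt j k i) (hxy : face true h x = face false h y) {p : I}
    {v : Finset I} (hjv : j ∉ v) (hpj : p < j) (hp : p ∈ i) (hv : v ⊆ i) (hpv : p ∉ v) :
    K.bot (x.sq p j v hpj hp h.mem hv hpv hjv) = K.top (y.sq p j v hpj hp h.mem hv hpv hjv) := by
  rw [x.bot_sq, y.top_sq]
  exact arr_of_consec h hxy hjv _ _ _

/-- The composite of two consecutive cubes. -/
noncomputable def comp (L : K.Lawful) (h : IsExt j k i) (x y : Cell K i)
    (hxy : face true h x = face false h y) : Cell K i where
  obj v hv := if j ∈ v then y.obj v hv else x.obj v hv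
  arr p v hp hv hpv :=
    if p = j then K.compArr (x.arr p v hp hv hpv) (y.arr p v hp hv hpv)
    else if j ∈ v then y.arr p v hp hv hpv else x.arr p v hp hv hpv
  sq p q v hpq hp hq hv hpv hqv :=
    if p = j then K.compFst (x.sq p q v hpq hp hq hv hpv hqv) (y.sq p q v hpq hp hq hv hpv hqv)
    else if q = j then
      K.compSnd (x.sq p q v hpq hp hq hv hpv hqv) (y.sq p q v hpq hp hq hv hpv hqv)
    else if j ∈ v then y.sq p q v hpq hp hq hv hpv hqv else x.sq p q v hpq hp hq hv hpv hqv
  dom_arr p v hp hv hpv := by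
    by_cases hpj : p = j
    · subst hpj
      simp only [if_true, hpv, if_false]
      rw [L.comp_dom (L.isComp_compArr (cod_eq_dom h hxy hpv hv)), x.dom_arr]
    · simp only [hpj, if_false]
      split_ifs
      · exact y.dom_arr _ _ _ _ _
      · exact x.dom_arr _ _ _ _ _
  cod_arr p v hp hv hpv := by
    by_cases hpj : p = j
    · subst hpj
      simp only [if_true, Finset.mem_insert_self]
      rw [L.comp_cod (L.isComp_compArr (cod_eq_dom h hxy hpv hv)), y.cod_arr]
    · simp only [hpj, if_false, Finset.mem_insert, Ne.symm hpj, false_or]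
      split_ifs
      · exact y.cod_arr _ _ _ _ _
      · exact x.cod_arr _ _ _ _ _
  top_sq p q v hpq hp hq hv hpv hqv := by
    by_cases hpj : p = j
    · subst hpj
      simp only [if_true]
      have := L.compFst_top (L.isCompFst_compFst hpq (right_eq_left h hxy hpv hpq hq hv hqv))
      rw [x.top_sq, y.top_sq] at this
      exact (L.compArr_eq this).symm
    · by_cases hqj : q = j
      · subst hqj
        simp only [hpj, hqv, if_true, if_false]
        rw [L.compSnd_top (L.isCompSnd_compSnd hpq (bot_eq_top h hxy hqv hpq hp hv hpv)), x.top_sq]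
      · simp only [hpj, hqj, if_false]
        split_ifs
        · exact y.top_sq _ _ _ _ _ _ _ _ _
        · exact x.top_sq _ _ _ _ _ _ _ _ _
  bot_sq p q v hpq hp hq hv hpv hqv := by
    by_cases hpj : p = j
    · subst hpj
      simp only [if_true]
      have := L.compFst_bot (L.isCompFst_compFst hpq (right_eq_left h hxy hpv hpq hq hv hqv))
      rw [x.bot_sq, y.bot_sq] at this
      exact (L.compArr_eq this).symm
    · by_cases hqj : q = j
      · subst hqj
        simp only [hpj, Finset.mem_insert_self, if_true, if_false]
        rw [L.compSnd_bot (L.isCompSnd_compSnd hpq (bot_eq_top h hxy hqv hpq hp hv hpv)), y.bot_sq]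
      · simp only [hpj, hqj, if_false, Finset.mem_insert, Ne.symm hqj, false_or]
        split_ifs
        · exact y.bot_sq _ _ _ _ _ _ _ _ _
        · exact x.bot_sq _ _ _ _ _ _ _ _ _
  left_sq p q v hpq hp hq hv hpv hqv := by
    by_cases hpj : p = j
    · subst hpj
      simp only [hpv, hpq.ne', if_true, if_false]
      rw [L.compFst_left (L.isCompFst_compFst hpq (right_eq_left h hxy hpv hpq hq hv hqv)),
        x.left_sq]
    · by_cases hqj : q = j
      · subst hqj
        simp only [hpj, if_true, if_false]
        have := L.compSnd_left (L.isCompSnd_compSnd hpq (bot_eq_top h hxy hqv hpq hp hv hpv))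
        rw [x.left_sq, y.left_sq] at this
        exact (L.compArr_eq this).symm
      · simp only [hpj, hqj, if_false]
        split_ifs
        · exact y.left_sq _ _ _ _ _ _ _ _ _
        · exact x.left_sq _ _ _ _ _ _ _ _ _
  right_sq p q v hpq hp hq hv hpv hqv := by
    by_cases hpj : p = j
    · subst hpj
      simp only [Finset.mem_insert_self, hpq.ne', if_true, if_false]
      rw [L.compFst_right (L.isCompFst_compFst hpq (right_eq_left h hxy hpv hpq hq hv hqv)),
        y.right_sq]
    · by_cases hqj : q = j
      · subst hqj
        simp only [hpj, if_true, if_false]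
        have := L.compSnd_right (L.isCompSnd_compSnd hpq (bot_eq_top h hxy hqv hpq hp hv hpv))
        rw [x.right_sq, y.right_sq] at this
        exact (L.compArr_eq this).symm
      · simp only [hpj, hqj, if_false, Finset.mem_insert, Ne.symm hpj, false_or]
        split_ifs
        · exact y.right_sq _ _ _ _ _ _ _ _ _
        · exact x.right_sq _ _ _ _ _ _ _ _ _
  comm p q r v hpq hqr hp hq hr hv hpv hqv hrv := by
    have hpr := hpq.trans hqr
    by_cases hpj : p = j
    · subst hpj
      simp only [hpq.ne', hpr.ne', if_true, if_false, hpv, Finset.mem_insert_self]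
      -- The face along which the two cubes are pasted occurs in `x` at `insert p v` and in `y` at
      -- `v`; consecutivity identifies these two squares.
      refine L.comm_comp_fst (x.comm p q r v hpq hqr hp hq hr hv hpv hqv hrv)
        ((sq_of_consec h hxy hpv hqr hq hr _ _ _).symm ▸
          y.comm p q r v hpq hqr hp hq hr hv hpv hqv hrv) ?_ ?_ ?_ ?_
      all_goals exact L.isCompFst_compFst (by assumption) (right_eq_left h hxy _ _ _ _ _)
    · by_cases hqj : q = j
      · subst hqj
        simp only [hpj, hqr.ne', if_true, if_false, hqv, Finset.mem_insert_self]
        refine L.comm_comp_mid (x.comm p q r v hpq hqr hp hq hr hv hpv hqv hrv)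
          ((sq_of_consec h hxy hqv hpr hp hr _ _ _).symm ▸
            y.comm p q r v hpq hqr hp hq hr hv hpv hqv hrv) ?_ ?_ ?_ ?_
        · exact L.isCompSnd_compSnd (by assumption) (bot_eq_top h hxy _ _ _ _ _)
        · exact L.isCompSnd_compSnd (by assumption) (bot_eq_top h hxy _ _ _ _ _)
        · exact L.isCompFst_compFst (by assumption) (right_eq_left h hxy _ _ _ _ _)
        · exact L.isCompFst_compFst (by assumption) (right_eq_left h hxy _ _ _ _ _)
      · by_cases hrj : r = j
        · subst hrj
          simp only [hpj, hqj, if_true, if_false, hrv, Finset.mem_insert_self]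
          refine L.comm_comp_trd (x.comm p q r v hpq hqr hp hq hr hv hpv hqv hrv)
            ((sq_of_consec h hxy hrv hpq hp hq _ _ _).symm ▸
              y.comm p q r v hpq hqr hp hq hr hv hpv hqv hrv) ?_ ?_ ?_ ?_
          all_goals exact L.isCompSnd_compSnd (by assumption) (bot_eq_top h hxy _ _ _ _ _)
        · simp only [hpj, hqj, hrj, if_false, Finset.mem_insert, Ne.symm hpj, Ne.symm hqj,
            Ne.symm hrj, false_or]
          split_ifs
          · exact y.comm _ _ _ _ _ _ _ _ _ _ _ _ _
          · exact x.comm _ _ _ _ _ _ _ _ _ _ _ _ _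

end Comp

end Cell

/-! ### The laws as equations between chosen identities and composites. -/

namespace QuintetSystem.Lawful

variable {I : Type} [LinearOrder I] {K : QuintetSystem.{v, w} I}

/-- The object `A` is kept as a separate variable because the vertex recorded by a cube equals
`K.dom R` only propositionally. The same form is used in the other unit laws. -/
theorem id_compArr (L : K.Lawful) {p : I} {R : K.Arr p} {A : K.Obj} (h : K.dom R = A) :
    K.compArr (L.idArr p A) R = R := by
  subst h
  exact L.id_comp (L.isId_idArr _ _) (L.isComp_compArr (L.id_cod (L.isId_idArr _ _)))

theorem compArr_id (L : K.Lawful) {p : I} {R : K.Arr p} {A : K.Obj} (h : K.cod R = A) :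
    K.compArr R (L.idArr p A) = R := by
  subst h
  exact L.comp_id (L.isId_idArr _ _) (L.isComp_compArr (L.id_dom (L.isId_idArr _ _)).symm)

theorem compArr_assoc (L : K.Lawful) {p : I} {R S T : K.Arr p} (h : K.cod R = K.dom S)
    (h' : K.cod S = K.dom T) :
    K.compArr (K.compArr R S) T = K.compArr R (K.compArr S T) := by
  have h₁ := L.isComp_compArr h
  have h₂ := L.isComp_compArr h'
  exact L.assoc h₁ (L.isComp_compArr ((L.comp_cod h₁).trans h')) h₂
    (L.isComp_compArr (h.trans (L.comp_dom h₂).symm))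

theorem id_compFst' (L : K.Lawful) {p q : I} (hpq : p < q) {φ : K.Sq p q} {U : K.Arr q}
    (h : K.left φ = U) : K.compFst (L.idFst hpq U) φ = φ := by
  subst h
  exact L.id_compFst (L.isIdFst_idFst hpq _)
    (L.isCompFst_compFst hpq (L.idFst_right (L.isIdFst_idFst hpq _)))

theorem compFst_id' (L : K.Lawful) {p q : I} (hpq : p < q) {φ : K.Sq p q} {U : K.Arr q}
    (h : K.right φ = U) : K.compFst φ (L.idFst hpq U) = φ := by
  subst h
  exact L.compFst_id (L.isIdFst_idFst hpq _)
    (L.isCompFst_compFst hpq (L.idFst_left (L.isIdFst_idFst hpq _)).symm)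

theorem id_compSnd' (L : K.Lawful) {p q : I} (hpq : p < q) {φ : K.Sq p q} {U : K.Arr p}
    (h : K.top φ = U) : K.compSnd (L.idSnd hpq U) φ = φ := by
  subst h
  exact L.id_compSnd (L.isIdSnd_idSnd hpq _)
    (L.isCompSnd_compSnd hpq (L.idSnd_bot (L.isIdSnd_idSnd hpq _)))

theorem compSnd_id' (L : K.Lawful) {p q : I} (hpq : p < q) {φ : K.Sq p q} {U : K.Arr p}
    (h : K.bot φ = U) : K.compSnd φ (L.idSnd hpq U) = φ := by
  subst h
  exact L.compSnd_id (L.isIdSnd_idSnd hpq _)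
    (L.isCompSnd_compSnd hpq (L.idSnd_top (L.isIdSnd_idSnd hpq _)).symm)

theorem compFst_assoc (L : K.Lawful) {p q : I} (hpq : p < q) {φ ψ χ : K.Sq p q}
    (h : K.right φ = K.left ψ) (h' : K.right ψ = K.left χ) :
    K.compFst (K.compFst φ ψ) χ = K.compFst φ (K.compFst ψ χ) := by
  have h₁ := L.isCompFst_compFst hpq h
  have h₂ := L.isCompFst_compFst hpq h'
  exact L.assocFst h₁ (L.isCompFst_compFst hpq ((L.compFst_right h₁).trans h')) h₂
    (L.isCompFst_compFst hpq (h.trans (L.compFst_left h₂).symm))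

theorem compSnd_assoc (L : K.Lawful) {p q : I} (hpq : p < q) {φ ψ χ : K.Sq p q}
    (h : K.bot φ = K.top ψ) (h' : K.bot ψ = K.top χ) :
    K.compSnd (K.compSnd φ ψ) χ = K.compSnd φ (K.compSnd ψ χ) := by
  have h₁ := L.isCompSnd_compSnd hpq h
  have h₂ := L.isCompSnd_compSnd hpq h'
  exact L.assocSnd h₁ (L.isCompSnd_compSnd hpq ((L.compSnd_bot h₁).trans h')) h₂
    (L.isCompSnd_compSnd hpq (h.trans (L.compSnd_top h₂).symm))

theorem comp_interchange (L : K.Lawful) {p q : I} (hpq : p < q) {φ φ' ψ ψ' : K.Sq p q}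
    (h₁ : K.right φ = K.left φ') (h₂ : K.right ψ = K.left ψ') (h₃ : K.bot φ = K.top ψ)
    (h₄ : K.bot φ' = K.top ψ') :
    K.compSnd (K.compFst φ φ') (K.compFst ψ ψ') = K.compFst (K.compSnd φ ψ) (K.compSnd φ' ψ') := by
  have a := L.isCompFst_compFst hpq h₁
  have b := L.isCompFst_compFst hpq h₂
  have c := L.isCompSnd_compSnd hpq h₃
  have d := L.isCompSnd_compSnd hpq h₄
  refine L.interchange a b c d (L.isCompSnd_compSnd hpq ?_) (L.isCompFst_compFst hpq ?_)
  -- The outer composites are defined: the bottom of the first row and the top of the second are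
  -- composites of the same two arrows, and composites are unique.
  · have e := L.compFst_bot a
    have f := L.compFst_top b
    rw [h₃, h₄] at e
    exact L.comp_unique e f
  · have e := L.compSnd_right c
    have f := L.compSnd_left d
    rw [h₁, h₂] at e
    exact L.comp_unique e f

theorem idFst_compArr (L : K.Lawful) {p q : I} (hpq : p < q) {U U' : K.Arr q}
    (h : K.cod U = K.dom U') :
    L.idFst hpq (K.compArr U U') = K.compSnd (L.idFst hpq U) (L.idFst hpq U') := by
  have a := L.isIdFst_idFst hpq U
  have b := L.isIdFst_idFst hpq U'
  refine L.idFst_comp a b (L.isComp_compArr h) (L.isIdFst_idFst hpq _) (L.isCompSnd_compSnd hpq ?_)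
  have c := L.idFst_bot a
  rw [h] at c
  exact L.id_unique c (L.idFst_top b)

theorem idSnd_compArr (L : K.Lawful) {p q : I} (hpq : p < q) {U U' : K.Arr p}
    (h : K.cod U = K.dom U') :
    L.idSnd hpq (K.compArr U U') = K.compFst (L.idSnd hpq U) (L.idSnd hpq U') := by
  have a := L.isIdSnd_idSnd hpq U
  have b := L.isIdSnd_idSnd hpq U'
  refine L.idSnd_comp a b (L.isComp_compArr h) (L.isIdSnd_idSnd hpq _) (L.isCompFst_compFst hpq ?_)
  have c := L.idSnd_right a
  rw [h] at c
  exact L.id_unique c (L.idSnd_left b)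

theorem idFst_idArr (L : K.Lawful) {p q : I} (hpq : p < q) (A : K.Obj) :
    L.idFst hpq (L.idArr q A) = L.idSnd hpq (L.idArr p A) :=
  L.idFst_id (L.isId_idArr p A) (L.isId_idArr q A) (L.isIdFst_idFst hpq _) (L.isIdSnd_idSnd hpq _)

end QuintetSystem.Lawful

section Index

variable {I : Type} [DecidableEq I] {j l : I} {m k n i v : Finset I}

theorem IsExt.ne_of_isExt (hj : IsExt j m k) (hl : IsExt l k i) : j ≠ l :=
  hl.ne_of_mem hj.mem

theorem IsExt.notMem_of_subset (h : IsExt j k i) (hv : v ⊆ k) : j ∉ v := fun e => h.1 (hv e)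

end Index

/-! ### The multiple category of cubes. -/

namespace QuintetSystem.Lawful

open Cell

variable {I : Type} [LinearOrder I] {K : QuintetSystem.{v, w} I}

/-- The multiple set of cubes over a lawful quintet system. -/
noncomputable def multipleSet (L : K.Lawful) : MultipleSet (Cell K) where
  face α _ _ _ h x := face α h x
  deg h x := deg L h x
  face_face α β j l m k n i hj hl hl' hj' x := by
    refine ext_of (fun v hv => ?_) (fun p v hp hv hpv => ?_)
      (fun p q v hpq hp hq hv hpv hqv => ?_)
    · exact x.obj_congr (shift_shift β α) _
    · exact x.arr_congr (shift_shift β α) _ _ _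
    · exact x.sq_congr (shift_shift β α) _ _ _ _ _ _
  deg_deg {j l m k n i} hj hl hl' hj' x := by
    have hjl := hj.ne_of_isExt hl
    refine ext_of (fun v hv => ?_) (fun p v hp hv hpv => ?_)
      (fun p q v hpq hp hq hv hpv hqv => ?_)
    · exact x.obj_congr Finset.erase_right_comm _
    · by_cases h₁ : p = l
      · subst h₁
        simp [deg, hjl.symm, Finset.erase_right_comm (a := p)]
      · by_cases h₂ : p = j
        · subst h₂
          simp [deg, hjl, Finset.erase_right_comm (a := p)]
        · simp [deg, h₁, h₂, Finset.erase_right_comm (a := j)]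
    · by_cases h₁ : p = l
      · subst h₁
        by_cases h₂ : q = j
        · subst h₂
          -- Both directions of the square are degenerate. The two orders give identity squares on
          -- identity arrows of different directions, and these coincide.
          simp [deg, hjl.symm, Finset.erase_right_comm (a := p), L.idFst_idArr]
        · simp [deg, hjl.symm, h₂, Finset.erase_right_comm (a := p)]
      · by_cases h₂ : p = j
        · subst h₂
          by_cases h₃ : q = l
          · subst h₃
            simp [deg, hjl, Finset.erase_right_comm (a := p), L.idFst_idArr]
          · simp [deg, hjl, h₃, Finset.erase_right_comm (a := p)]
        · by_cases h₃ : q = l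
          · subst h₃
            simp [deg, hjl.symm, h₁, h₂, Finset.erase_right_comm (a := q)]
          · by_cases h₄ : q = j
            · subst h₄
              simp [deg, hjl, h₁, h₂, Finset.erase_right_comm (a := q)]
            · simp [deg, h₁, h₂, h₃, h₄, Finset.erase_right_comm (a := j)]
  face_deg_ne α {j l m k n i} hj hl hl' hj' x := by
    have hjl := hj.ne_of_isExt hl
    refine ext_of (fun v hv => ?_) (fun p v hp hv hpv => ?_)
      (fun p q v hpq hp hq hv hpv hqv => ?_)
    · exact x.obj_congr (erase_shift_of_ne α hjl.symm) _
    · by_cases h₂ : p = j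
      · subst h₂
        simp [deg, face, erase_shift_of_ne α hjl.symm]
      · simp [deg, face, h₂, erase_shift_of_ne α hjl.symm]
    · by_cases h₂ : p = j
      · subst h₂
        simp [deg, face, erase_shift_of_ne α hjl.symm]
      · by_cases h₄ : q = j
        · subst h₄
          simp [deg, face, h₂, erase_shift_of_ne α hjl.symm]
        · simp [deg, face, h₂, h₄, erase_shift_of_ne α hjl.symm]
  face_deg α {j k i} h x := by
    refine ext_of (fun v hv => ?_) (fun p v hp hv hpv => ?_)
      (fun p q v hpq hp hq hv hpv hqv => ?_)
    · exact x.obj_congr (erase_shift_self α (h.notMem_of_subset hv)) _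
    · have h₂ : p ≠ j := h.ne_of_mem hp
      simp [deg, face, h₂, erase_shift_self α (h.notMem_of_subset hv)]
    · have h₂ : p ≠ j := h.ne_of_mem hp
      have h₃ : q ≠ j := h.ne_of_mem hq
      simp [deg, face, h₂, h₃, erase_shift_self α (h.notMem_of_subset hv)]

/-- The multiple category of cubes over a lawful quintet system. -/
noncomputable def multipleCategory (L : K.Lawful) : MultipleCategory (Cell K) where
  toMultipleSet := L.multipleSet
  comp h x y hxy := comp L h x y hxy
  face_comp_fst {j k i} h x y hxy := by
    refine ext_of (fun v hv => ?_) (fun p v hp hv hpv => ?_)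
      (fun p q v hpq hp hq hv hpv hqv => ?_)
    · have hj := h.notMem_of_subset hv
      simp [multipleSet, comp, face, shift, hj]
    · have hj := h.notMem_of_subset hv
      simp [multipleSet, comp, face, shift, hj, h.ne_of_mem hp]
    · have hj := h.notMem_of_subset hv
      simp [multipleSet, comp, face, shift, hj, h.ne_of_mem hp, h.ne_of_mem hq]
  face_comp_snd {j k i} h x y hxy := by
    refine ext_of (fun v hv => ?_) (fun p v hp hv hpv => ?_)
      (fun p q v hpq hp hq hv hpv hqv => ?_)
    · simp [multipleSet, comp, face, shift]
    · simp [multipleSet, comp, face, shift, h.ne_of_mem hp]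
    · simp [multipleSet, comp, face, shift, h.ne_of_mem hp, h.ne_of_mem hq]
  face_comp_ne α {j l m k n i} hl hj hj' x y hxy hxy' := by
    have hjl := hj'.ne_of_isExt hl
    refine ext_of (fun v hv => ?_) (fun p v hp hv hpv => ?_)
      (fun p q v hpq hp hq hv hpv hqv => ?_)
    · simp [multipleSet, comp, face, mem_shift_of_ne hjl]
    · simp [multipleSet, comp, face, mem_shift_of_ne hjl]
    · simp [multipleSet, comp, face, mem_shift_of_ne hjl]
  deg_comp_ne {j l m k n i} hl hj hj' x y hxy hxy' := by
    have hjl := hj'.ne_of_isExt hl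
    refine ext_of (fun v hv => ?_) (fun p v hp hv hpv => ?_)
      (fun p q v hpq hp hq hv hpv hqv => ?_)
    · simp [multipleSet, comp, deg, hjl]
    · by_cases h₁ : p = l
      · subst h₁
        simp only [multipleSet, comp, deg, hjl, hjl.symm, dite_true, if_false, Finset.mem_erase, ne_eq,
          not_false_eq_true, true_and]
        split_ifs <;> rfl
      · simp [multipleSet, comp, deg, hjl, h₁]
    · by_cases h₁ : p = l
      · subst h₁
        by_cases h₂ : q = j
        · subst h₂
          simp only [multipleSet, comp, deg, hjl.symm, dite_true, if_false, if_true]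
          -- One direction is degenerate and the other is composed: the identity of a composite is
          -- compared with the composite of the identities.
          exact L.idFst_compArr hpq (cod_eq_dom hj' hxy _ _)
        · simp only [multipleSet, comp, deg, hjl, hjl.symm, h₂, dite_true, if_false,
            Finset.mem_erase, ne_eq, not_false_eq_true, true_and]
          split_ifs <;> rfl
      · by_cases h₃ : q = l
        · subst h₃
          by_cases h₂ : p = j
          · subst h₂
            simp only [multipleSet, comp, deg, hjl, dite_true, dite_false, if_true]
            exact L.idSnd_compArr hpq (cod_eq_dom hj' hxy _ _)
          · simp only [multipleSet, comp, deg, hjl, hjl.symm, h₁, h₂, dite_true, dite_false,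
              if_false, Finset.mem_erase, ne_eq, not_false_eq_true, true_and]
            split_ifs <;> rfl
        · simp [multipleSet, comp, deg, hjl, h₁, h₃]
  id_comp {j k i} h x hx := by
    refine ext_of (fun v hv => ?_) (fun p v hp hv hpv => ?_)
      (fun p q v hpq hp hq hv hpv hqv => ?_)
    · by_cases hjv : j ∈ v
      · simp [multipleSet, comp, hjv]
      · simp [multipleSet, comp, deg, face, shift, hjv]
    · by_cases hpj : p = j
      · subst hpj
        simp only [multipleSet, comp, deg, face, shift, if_true, dite_true]
        refine L.id_compArr ((x.dom_arr _ _ _ _ _).trans (x.obj_congr ?_ _))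
        simp [hpv]
      · by_cases hjv : j ∈ v
        · simp [multipleSet, comp, hpj, hjv]
        · simp [multipleSet, comp, deg, face, shift, hpj, hjv]
    · by_cases hpj : p = j
      · subst hpj
        simp only [multipleSet, comp, deg, face, shift, if_true, dite_true]
        refine L.id_compFst' _ ((x.left_sq _ _ _ _ _ _ _ _ _).trans (x.arr_congr ?_ _ _ _))
        simp [hpv]
      · by_cases hqj : q = j
        · subst hqj
          simp only [multipleSet, comp, deg, face, shift, hpj, if_true, dite_true, if_false,
            dite_false]
          refine L.id_compSnd' _ ((x.top_sq _ _ _ _ _ _ _ _ _).trans (x.arr_congr ?_ _ _ _))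
          simp [hqv]
        · by_cases hjv : j ∈ v
          · simp [multipleSet, comp, hpj, hqj, hjv]
          · simp [multipleSet, comp, deg, face, shift, hpj, hqj, hjv]
  comp_id {j k i} h x hx := by
    refine ext_of (fun v hv => ?_) (fun p v hp hv hpv => ?_)
      (fun p q v hpq hp hq hv hpv hqv => ?_)
    · by_cases hjv : j ∈ v
      · simp [multipleSet, comp, deg, face, shift, hjv]
      · simp [multipleSet, comp, hjv]
    · by_cases hpj : p = j
      · subst hpj
        simp only [multipleSet, comp, deg, face, shift, if_true, dite_true]
        refine L.compArr_id ((x.cod_arr _ _ _ _ _).trans (x.obj_congr ?_ _))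
        rw [Finset.erase_eq_of_notMem hpv]
      · by_cases hjv : j ∈ v
        · simp [multipleSet, comp, deg, face, shift, hpj, hjv]
        · simp [multipleSet, comp, hpj, hjv]
    · by_cases hpj : p = j
      · subst hpj
        simp only [multipleSet, comp, deg, face, shift, if_true, dite_true]
        refine L.compFst_id' _ ((x.right_sq _ _ _ _ _ _ _ _ _).trans (x.arr_congr ?_ _ _ _))
        rw [Finset.erase_eq_of_notMem hpv]
      · by_cases hqj : q = j
        · subst hqj
          simp only [multipleSet, comp, deg, face, shift, hpj, if_true, dite_true, if_false,
            dite_false]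
          refine L.compSnd_id' _ ((x.bot_sq _ _ _ _ _ _ _ _ _).trans (x.arr_congr ?_ _ _ _))
          rw [Finset.erase_eq_of_notMem hqv]
        · by_cases hjv : j ∈ v
          · simp [multipleSet, comp, deg, face, shift, hpj, hqj, hjv]
          · simp [multipleSet, comp, hpj, hqj, hjv]
  assoc {j k i} h x y z hxy hyz h₁ h₂ := by
    refine ext_of (fun v hv => ?_) (fun p v hp hv hpv => ?_)
      (fun p q v hpq hp hq hv hpv hqv => ?_)
    · by_cases hjv : j ∈ v <;> simp [comp, hjv]
    · by_cases hpj : p = j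
      · subst hpj
        simp only [comp, if_true]
        exact L.compArr_assoc (cod_eq_dom h hxy _ _) (cod_eq_dom h hyz _ _)
      · by_cases hjv : j ∈ v <;> simp [comp, hpj, hjv]
    · by_cases hpj : p = j
      · subst hpj
        simp only [comp, if_true]
        exact L.compFst_assoc hpq (right_eq_left h hxy _ _ _ _ _) (right_eq_left h hyz _ _ _ _ _)
      · by_cases hqj : q = j
        · subst hqj
          simp only [comp, hpj, if_true, if_false]
          exact L.compSnd_assoc hpq (bot_eq_top h hxy _ _ _ _ _) (bot_eq_top h hyz _ _ _ _ _)
        · by_cases hjv : j ∈ v <;> simp [comp, hpj, hqj, hjv]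
  interchange {j l k n i} hjl hj hl x y z t hxy hzt hxz hyt h₁ h₂ := by
    refine ext_of (fun v hv => ?_) (fun p v hp hv hpv => ?_)
      (fun p q v hpq hp hq hv hpv hqv => ?_)
    · by_cases hjv : j ∈ v <;> by_cases hlv : l ∈ v <;> simp [comp, hjv, hlv]
    · by_cases hpj : p = j
      · subst hpj
        by_cases hlv : l ∈ v <;> simp [comp, hjl.ne, hlv]
      · by_cases hjv : j ∈ v <;> by_cases hlv : l ∈ v <;> simp [comp, hpj, hjv, hlv]
    · by_cases hpj : p = j
      · subst hpj
        by_cases hql : q = l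
        · subst hql
          -- Only the squares in directions `j` and `l` involve both compositions. Everywhere else
          -- at least one of them is a mere selection between two cubes.
          simp only [comp, hjl.ne, if_true, if_false]
          exact L.comp_interchange hpq (right_eq_left hj hxy _ _ _ _ _)
            (right_eq_left hj hzt _ _ _ _ _) (bot_eq_top hl hxz _ _ _ _ _)
            (bot_eq_top hl hyt _ _ _ _ _)
        · by_cases hlv : l ∈ v <;> simp [comp, hjl.ne, hlv, hql]
      · by_cases hqj : q = j
        · subst hqj
          by_cases hlv : l ∈ v <;> simp [comp, hjl.ne, (hpq.trans hjl).ne, hlv, hpj]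
        · by_cases hjv : j ∈ v <;> by_cases hlv : l ∈ v <;> simp [comp, hpj, hqj, hjv, hlv]

theorem isMultipleCategoryOf (L : K.Lawful) : K.IsMultipleCategoryOf L.multipleCategory where
  face_obj _ _ _ _ _ _ _ _ _ := rfl
  face_arr _ _ _ _ _ _ _ _ _ _ _ _ _ _ := rfl
  face_sq _ _ _ _ _ _ _ _ _ _ _ _ _ _ _ _ _ _ _ _ := rfl
  deg_obj _ _ _ _ _ := rfl
  deg_arr {j k i} h x v hj hv hjv hv' := by
    have := L.isId_idArr j (x.obj v hv')
    simpa [multipleCategory, multipleSet, deg, hjv] using this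
  deg_arr_ne {j k i} h x p v hp hv hpv hp' hv' hpv' := by
    simp [multipleCategory, multipleSet, deg, h.ne_of_mem hp']
  deg_sq_fst {j k i} h x q v hjq hj hq hv hjv hqv hq' hv' := by
    have := L.isIdFst_idFst hjq (x.arr q v hq' hv' hqv)
    simpa [multipleCategory, multipleSet, deg, hjv] using this
  deg_sq_snd {j k i} h x p v hpj hp hj hv hpv hjv hp' hv' := by
    have := L.isIdSnd_idSnd hpj (x.arr p v hp' hv' hpv)
    simpa [multipleCategory, multipleSet, deg, hjv, hpj.ne] using this
  deg_sq_ne {j k i} h x p q v hpq hp hq hv hpv hqv hp' hq' hv' hpv' hqv' := by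
    simp [multipleCategory, multipleSet, deg, h.ne_of_mem hp', h.ne_of_mem hq']
  comp_obj _ _ _ _ _ _ := rfl
  comp_arr {j k i} h x y hxy v hj hv hjv := by
    have := L.isComp_compArr (cod_eq_dom h hxy hjv hv)
    simpa [multipleCategory, comp] using this
  comp_arr_ne {j k i} h x y hxy p v hp hv hpv hpj := by
    simp [multipleCategory, comp, hpj]
  comp_sq_fst {j k i} h x y hxy q v hjq hj hq hv hjv hqv := by
    have := L.isCompFst_compFst hjq (right_eq_left h hxy hjv hjq hq hv hqv)
    simpa [multipleCategory, comp] using this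
  comp_sq_snd {j k i} h x y hxy p v hpj hp hj hv hpv hjv := by
    have := L.isCompSnd_compSnd hpj (bot_eq_top h hxy hjv hpj hp hv hpv)
    simpa [multipleCategory, comp, hpj.ne] using this
  comp_sq_ne {j k i} h x y hxy p q v hpq hp hq hv hpv hqv hpj hqj := by
    simp [multipleCategory, comp, hpj, hqj]

end QuintetSystem.Lawful

universe v' w'

/-! ## Faithful maps of quintet systems -/

namespace QuintetSystem

variable {I : Type} [LinearOrder I]

/-- The compatibility of the boundaries of six cells which form a cube. -/
structure CubeBoundary (K : QuintetSystem.{v, w} I) {p q r : I} (φ ψ : K.Sq p q) (π ρ : K.Sq p r)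
    (ω ζ : K.Sq q r) : Prop where
  top_top : K.top φ = K.top π
  bot_top : K.bot φ = K.top ρ
  top_bot : K.top ψ = K.bot π
  bot_bot : K.bot ψ = K.bot ρ
  left_top : K.left φ = K.top ω
  right_top : K.right φ = K.top ζ
  left_bot : K.left ψ = K.bot ω
  right_bot : K.right ψ = K.bot ζ
  left_left : K.left π = K.left ω
  right_left : K.right π = K.left ζ
  left_right : K.left ρ = K.right ω
  right_right : K.right ρ = K.right ζ

/-- A map of quintet systems which is faithful on two-dimensional cells and reflects the
commutativity of cubes. -/
structure FaithfulMap (K : QuintetSystem.{v, w} I) (L : QuintetSystem.{v', w'} I) where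
  obj : K.Obj → L.Obj
  arr : ∀ {p : I}, K.Arr p → L.Arr p
  sq : ∀ {p q : I}, K.Sq p q → L.Sq p q
  dom_arr : ∀ {p : I} (R : K.Arr p), L.dom (arr R) = obj (K.dom R)
  cod_arr : ∀ {p : I} (R : K.Arr p), L.cod (arr R) = obj (K.cod R)
  top_sq : ∀ {p q : I} (φ : K.Sq p q), L.top (sq φ) = arr (K.top φ)
  bot_sq : ∀ {p q : I} (φ : K.Sq p q), L.bot (sq φ) = arr (K.bot φ)
  left_sq : ∀ {p q : I} (φ : K.Sq p q), L.left (sq φ) = arr (K.left φ)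
  right_sq : ∀ {p q : I} (φ : K.Sq p q), L.right (sq φ) = arr (K.right φ)
  isId : ∀ {p : I} {A : K.Obj} {R : K.Arr p}, K.IsId A R → L.IsId (obj A) (arr R)
  isComp : ∀ {p : I} {R S T : K.Arr p}, K.IsComp R S T → L.IsComp (arr R) (arr S) (arr T)
  isIdFst : ∀ {p q : I} {U : K.Arr q} {φ : K.Sq p q}, K.IsIdFst U φ → L.IsIdFst (arr U) (sq φ)
  isIdSnd : ∀ {p q : I} {R : K.Arr p} {φ : K.Sq p q}, K.IsIdSnd R φ → L.IsIdSnd (arr R) (sq φ)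
  isCompFst : ∀ {p q : I} {φ ψ σ : K.Sq p q}, K.IsCompFst φ ψ σ →
    L.IsCompFst (sq φ) (sq ψ) (sq σ)
  isCompSnd : ∀ {p q : I} {φ ψ σ : K.Sq p q}, K.IsCompSnd φ ψ σ →
    L.IsCompSnd (sq φ) (sq ψ) (sq σ)
  sq_injective : ∀ {p q : I} {φ ψ : K.Sq p q}, K.top φ = K.top ψ → K.bot φ = K.bot ψ →
    K.left φ = K.left ψ → K.right φ = K.right ψ → sq φ = sq ψ → φ = ψ
  -- The boundary condition cannot be dropped for `tv`: it forgets the comparisons of `p`-morphisms,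
  -- so the image of a cube may have matching edges when the original edges differ.
  comm_iff : ∀ {p q r : I} {φ ψ : K.Sq p q} {π ρ : K.Sq p r} {ω ζ : K.Sq q r},
    K.Comm φ ψ π ρ ω ζ ↔ K.CubeBoundary φ ψ π ρ ω ζ ∧
      L.Comm (sq φ) (sq ψ) (sq π) (sq ρ) (sq ω) (sq ζ)

namespace FaithfulMap

variable {K : QuintetSystem.{v, w} I} {L : QuintetSystem.{v', w'} I}

/-- A faithful map into a lawful system reflects the laws of two-dimensional cells. -/
theorem lawful (F : FaithfulMap K L) (T : K.Typed) (H : L.Lawful) : K.Lawful where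
  toTyped := T
  -- Every equation of squares is proved in this way: the four boundary arrows agree by the typing
  -- laws of `K`, and the images agree by the corresponding law of `L`.
  idFst_unique h h' := F.sq_injective
    (T.id_unique (T.idFst_top h) (T.idFst_top h')) (T.id_unique (T.idFst_bot h) (T.idFst_bot h'))
    ((T.idFst_left h).trans (T.idFst_left h').symm)
    ((T.idFst_right h).trans (T.idFst_right h').symm) (H.idFst_unique (F.isIdFst h) (F.isIdFst h'))
  idSnd_unique h h' := F.sq_injective
    ((T.idSnd_top h).trans (T.idSnd_top h').symm) ((T.idSnd_bot h).trans (T.idSnd_bot h').symm)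
    (T.id_unique (T.idSnd_left h) (T.idSnd_left h'))
    (T.id_unique (T.idSnd_right h) (T.idSnd_right h')) (H.idSnd_unique (F.isIdSnd h) (F.isIdSnd h'))
  compFst_unique h h' := F.sq_injective
    (T.comp_unique (T.compFst_top h) (T.compFst_top h'))
    (T.comp_unique (T.compFst_bot h) (T.compFst_bot h'))
    ((T.compFst_left h).trans (T.compFst_left h').symm)
    ((T.compFst_right h).trans (T.compFst_right h').symm)
    (H.compFst_unique (F.isCompFst h) (F.isCompFst h'))
  compSnd_unique h h' := F.sq_injective
    ((T.compSnd_top h).trans (T.compSnd_top h').symm)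
    ((T.compSnd_bot h).trans (T.compSnd_bot h').symm)
    (T.comp_unique (T.compSnd_left h) (T.compSnd_left h'))
    (T.comp_unique (T.compSnd_right h) (T.compSnd_right h'))
    (H.compSnd_unique (F.isCompSnd h) (F.isCompSnd h'))
  id_compFst {p q φ η σ} hη hσ := F.sq_injective
    (T.id_comp (T.dom_top φ ▸ T.idFst_top hη) (T.compFst_top hσ))
    (T.id_comp (T.dom_bot φ ▸ T.idFst_bot hη) (T.compFst_bot hσ))
    ((T.compFst_left hσ).trans (T.idFst_left hη)) (T.compFst_right hσ)
    (H.id_compFst (F.left_sq φ ▸ F.isIdFst hη) (F.isCompFst hσ))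
  compFst_id {p q φ η σ} hη hσ := F.sq_injective
    (T.comp_id (T.cod_top φ ▸ T.idFst_top hη) (T.compFst_top hσ))
    (T.comp_id (T.cod_bot φ ▸ T.idFst_bot hη) (T.compFst_bot hσ))
    (T.compFst_left hσ) ((T.compFst_right hσ).trans (T.idFst_right hη))
    (H.compFst_id (F.right_sq φ ▸ F.isIdFst hη) (F.isCompFst hσ))
  id_compSnd {p q φ η σ} hη hσ := F.sq_injective
    ((T.compSnd_top hσ).trans (T.idSnd_top hη)) (T.compSnd_bot hσ)
    (T.id_comp (T.dom_top φ ▸ T.idSnd_left hη) (T.compSnd_left hσ))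
    (T.id_comp (T.cod_top φ ▸ T.idSnd_right hη) (T.compSnd_right hσ))
    (H.id_compSnd (F.top_sq φ ▸ F.isIdSnd hη) (F.isCompSnd hσ))
  compSnd_id {p q φ η σ} hη hσ := F.sq_injective
    (T.compSnd_top hσ) ((T.compSnd_bot hσ).trans (T.idSnd_bot hη))
    (T.comp_id (T.dom_bot φ ▸ T.idSnd_left hη) (T.compSnd_left hσ))
    (T.comp_id (T.cod_bot φ ▸ T.idSnd_right hη) (T.compSnd_right hσ))
    (H.compSnd_id (F.bot_sq φ ▸ F.isIdSnd hη) (F.isCompSnd hσ))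
  assocFst h₁ h₂ h₃ h₄ := F.sq_injective
    (T.assoc (T.compFst_top h₁) (T.compFst_top h₂) (T.compFst_top h₃) (T.compFst_top h₄))
    (T.assoc (T.compFst_bot h₁) (T.compFst_bot h₂) (T.compFst_bot h₃) (T.compFst_bot h₄))
    (by rw [T.compFst_left h₂, T.compFst_left h₁, T.compFst_left h₄])
    (by rw [T.compFst_right h₂, T.compFst_right h₄, T.compFst_right h₃])
    (H.assocFst (F.isCompFst h₁) (F.isCompFst h₂) (F.isCompFst h₃) (F.isCompFst h₄))
  assocSnd h₁ h₂ h₃ h₄ := F.sq_injective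
    (by rw [T.compSnd_top h₂, T.compSnd_top h₁, T.compSnd_top h₄])
    (by rw [T.compSnd_bot h₂, T.compSnd_bot h₄, T.compSnd_bot h₃])
    (T.assoc (T.compSnd_left h₁) (T.compSnd_left h₂) (T.compSnd_left h₃) (T.compSnd_left h₄))
    (T.assoc (T.compSnd_right h₁) (T.compSnd_right h₂) (T.compSnd_right h₃) (T.compSnd_right h₄))
    (H.assocSnd (F.isCompSnd h₁) (F.isCompSnd h₂) (F.isCompSnd h₃) (F.isCompSnd h₄))
  interchange {p q φ φ' ψ ψ' a b c d e f} ha hb hc hd he hf := by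
    refine F.sq_injective ?_ ?_ ?_ ?_ (H.interchange (F.isCompFst ha) (F.isCompFst hb)
      (F.isCompSnd hc) (F.isCompSnd hd) (F.isCompSnd he) (F.isCompFst hf))
    -- On each side of the boundary, both squares have composites of the same two arrows, so
    -- `comp_unique` applies.
    · rw [T.compSnd_top he]
      have := T.compFst_top hf
      rw [T.compSnd_top hc, T.compSnd_top hd] at this
      exact T.comp_unique (T.compFst_top ha) this
    · rw [T.compSnd_bot he]
      have := T.compFst_bot hf
      rw [T.compSnd_bot hc, T.compSnd_bot hd] at this
      exact T.comp_unique (T.compFst_bot hb) this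
    · rw [T.compFst_left hf]
      have := T.compSnd_left he
      rw [T.compFst_left ha, T.compFst_left hb] at this
      exact T.comp_unique this (T.compSnd_left hc)
    · rw [T.compFst_right hf]
      have := T.compSnd_right he
      rw [T.compFst_right ha, T.compFst_right hb] at this
      exact T.comp_unique this (T.compSnd_right hd)
  idFst_comp {p q U U' U'' φ φ' σ τ} hφ hφ' hU hτ hσ := by
    refine F.sq_injective ?_ ?_ ?_ ?_ (H.idFst_comp (F.isIdFst hφ) (F.isIdFst hφ') (F.isComp hU)
      (F.isIdFst hτ) (F.isCompSnd hσ))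
    · rw [T.compSnd_top hσ]
      have := T.idFst_top hτ
      rw [T.comp_dom hU] at this
      exact T.id_unique this (T.idFst_top hφ)
    · rw [T.compSnd_bot hσ]
      have := T.idFst_bot hτ
      rw [T.comp_cod hU] at this
      exact T.id_unique this (T.idFst_bot hφ')
    · rw [T.idFst_left hτ]
      have := T.compSnd_left hσ
      rw [T.idFst_left hφ, T.idFst_left hφ'] at this
      exact T.comp_unique hU this
    · rw [T.idFst_right hτ]
      have := T.compSnd_right hσ
      rw [T.idFst_right hφ, T.idFst_right hφ'] at this
      exact T.comp_unique hU this
  idSnd_comp {p q U U' U'' φ φ' σ τ} hφ hφ' hU hτ hσ := by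
    refine F.sq_injective ?_ ?_ ?_ ?_ (H.idSnd_comp (F.isIdSnd hφ) (F.isIdSnd hφ') (F.isComp hU)
      (F.isIdSnd hτ) (F.isCompFst hσ))
    · rw [T.idSnd_top hτ]
      have := T.compFst_top hσ
      rw [T.idSnd_top hφ, T.idSnd_top hφ'] at this
      exact T.comp_unique hU this
    · rw [T.idSnd_bot hτ]
      have := T.compFst_bot hσ
      rw [T.idSnd_bot hφ, T.idSnd_bot hφ'] at this
      exact T.comp_unique hU this
    · rw [T.compFst_left hσ]
      have := T.idSnd_left hτ
      rw [T.comp_dom hU] at this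
      exact T.id_unique this (T.idSnd_left hφ)
    · rw [T.compFst_right hσ]
      have := T.idSnd_right hτ
      rw [T.comp_cod hU] at this
      exact T.id_unique this (T.idSnd_right hφ')
  idFst_id {p q A R U φ ψ} hR hU hφ hψ := by
    refine F.sq_injective ?_ ?_ ?_ ?_
      (H.idFst_id (F.isId hR) (F.isId hU) (F.isIdFst hφ) (F.isIdSnd hψ))
    · rw [T.idSnd_top hψ]
      have := T.idFst_top hφ
      rw [T.id_dom hU] at this
      exact T.id_unique this hR
    · rw [T.idSnd_bot hψ]
      have := T.idFst_bot hφ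
      rw [T.id_cod hU] at this
      exact T.id_unique this hR
    · rw [T.idFst_left hφ]
      have := T.idSnd_left hψ
      rw [T.id_dom hR] at this
      exact T.id_unique hU this
    · rw [T.idFst_right hφ]
      have := T.idSnd_right hψ
      rw [T.id_cod hR] at this
      exact T.id_unique hU this
  -- For cubes the proof splits along `comm_iff`: the twelve common edges are computed in `K`, and
  -- the commutativity of the image is taken from `L`.
  comm_deg_fst {p q r φ ψ π ρ ω} h₁ h₂ h₃ h₄ := F.comm_iff.2
    ⟨⟨T.id_unique (T.idFst_top h₁) (T.dom_top ω ▸ T.idFst_top h₃),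
      T.id_unique (T.idFst_bot h₁) (T.cod_top ω ▸ T.idFst_top h₄),
      T.id_unique (T.idFst_top h₂) (T.dom_bot ω ▸ T.idFst_bot h₃),
      T.id_unique (T.idFst_bot h₂) (T.cod_bot ω ▸ T.idFst_bot h₄),
      T.idFst_left h₁, T.idFst_right h₁, T.idFst_left h₂, T.idFst_right h₂,
      T.idFst_left h₃, T.idFst_right h₃, T.idFst_left h₄, T.idFst_right h₄⟩,
    H.comm_deg_fst (F.top_sq ω ▸ F.isIdFst h₁) (F.bot_sq ω ▸ F.isIdFst h₂)
      (F.left_sq ω ▸ F.isIdFst h₃) (F.right_sq ω ▸ F.isIdFst h₄)⟩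
  comm_deg_mid {p q r φ ψ π ω ζ} h₁ h₂ h₃ h₄ := F.comm_iff.2
    ⟨⟨T.idSnd_top h₁, T.idSnd_bot h₁, T.idSnd_top h₂, T.idSnd_bot h₂,
      T.id_unique (T.idSnd_left h₁) (T.dom_top π ▸ T.idFst_top h₃),
      T.id_unique (T.idSnd_right h₁) (T.cod_top π ▸ T.idFst_top h₄),
      T.id_unique (T.idSnd_left h₂) (T.dom_bot π ▸ T.idFst_bot h₃),
      T.id_unique (T.idSnd_right h₂) (T.cod_bot π ▸ T.idFst_bot h₄),
      (T.idFst_left h₃).symm, (T.idFst_left h₄).symm, (T.idFst_right h₃).symm,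
      (T.idFst_right h₄).symm⟩,
    H.comm_deg_mid (F.top_sq π ▸ F.isIdSnd h₁) (F.bot_sq π ▸ F.isIdSnd h₂)
      (F.left_sq π ▸ F.isIdFst h₃) (F.right_sq π ▸ F.isIdFst h₄)⟩
  comm_deg_trd {p q r φ π ρ ω ζ} h₁ h₂ h₃ h₄ := F.comm_iff.2
    ⟨⟨(T.idSnd_top h₁).symm, (T.idSnd_top h₂).symm, (T.idSnd_bot h₁).symm, (T.idSnd_bot h₂).symm,
      (T.idSnd_top h₃).symm, (T.idSnd_top h₄).symm, (T.idSnd_bot h₃).symm, (T.idSnd_bot h₄).symm,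
      T.id_unique (T.idSnd_left h₁) (T.dom_top φ ▸ T.idSnd_left h₃),
      T.id_unique (T.idSnd_right h₁) (T.cod_top φ ▸ T.idSnd_left h₄),
      T.id_unique (T.idSnd_left h₂) (T.dom_bot φ ▸ T.idSnd_right h₃),
      T.id_unique (T.idSnd_right h₂) (T.cod_bot φ ▸ T.idSnd_right h₄)⟩,
    H.comm_deg_trd (F.top_sq φ ▸ F.isIdSnd h₁) (F.bot_sq φ ▸ F.isIdSnd h₂)
      (F.left_sq φ ▸ F.isIdSnd h₃) (F.right_sq φ ▸ F.isIdSnd h₄)⟩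
  comm_comp_fst {p q r φ φ' φ'' ψ ψ' ψ'' π π' π'' ρ ρ' ρ'' ω ζ ξ} h h' h₁ h₂ h₃ h₄ := by
    obtain ⟨b, c⟩ := F.comm_iff.1 h
    obtain ⟨b', c'⟩ := F.comm_iff.1 h'
    refine F.comm_iff.2 ⟨?_, H.comm_comp_fst c c' (F.isCompFst h₁) (F.isCompFst h₂)
      (F.isCompFst h₃) (F.isCompFst h₄)⟩
    constructor
    · have := T.compFst_top h₁
      rw [b.top_top, b'.top_top] at this
      exact T.comp_unique this (T.compFst_top h₃)
    · have := T.compFst_bot h₁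
      rw [b.bot_top, b'.bot_top] at this
      exact T.comp_unique this (T.compFst_top h₄)
    · have := T.compFst_top h₂
      rw [b.top_bot, b'.top_bot] at this
      exact T.comp_unique this (T.compFst_bot h₃)
    · have := T.compFst_bot h₂
      rw [b.bot_bot, b'.bot_bot] at this
      exact T.comp_unique this (T.compFst_bot h₄)
    · rw [T.compFst_left h₁, b.left_top]
    · rw [T.compFst_right h₁, b'.right_top]
    · rw [T.compFst_left h₂, b.left_bot]
    · rw [T.compFst_right h₂, b'.right_bot]
    · rw [T.compFst_left h₃, b.left_left]
    · rw [T.compFst_right h₃, b'.right_left]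
    · rw [T.compFst_left h₄, b.left_right]
    · rw [T.compFst_right h₄, b'.right_right]
  comm_comp_mid {p q r φ φ' φ'' ψ ψ' ψ'' π ρ σ ω ω' ω'' ζ ζ' ζ''} h h' h₁ h₂ h₃ h₄ := by
    obtain ⟨b, c⟩ := F.comm_iff.1 h
    obtain ⟨b', c'⟩ := F.comm_iff.1 h'
    refine F.comm_iff.2 ⟨?_, H.comm_comp_mid c c' (F.isCompSnd h₁) (F.isCompSnd h₂)
      (F.isCompFst h₃) (F.isCompFst h₄)⟩
    constructor
    · rw [T.compSnd_top h₁, b.top_top]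
    · rw [T.compSnd_bot h₁, b'.bot_top]
    · rw [T.compSnd_top h₂, b.top_bot]
    · rw [T.compSnd_bot h₂, b'.bot_bot]
    · have := T.compSnd_left h₁
      rw [b.left_top, b'.left_top] at this
      exact T.comp_unique this (T.compFst_top h₃)
    · have := T.compSnd_right h₁
      rw [b.right_top, b'.right_top] at this
      exact T.comp_unique this (T.compFst_top h₄)
    · have := T.compSnd_left h₂
      rw [b.left_bot, b'.left_bot] at this
      exact T.comp_unique this (T.compFst_bot h₃)
    · have := T.compSnd_right h₂
      rw [b.right_bot, b'.right_bot] at this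
      exact T.comp_unique this (T.compFst_bot h₄)
    · rw [T.compFst_left h₃, b.left_left]
    · rw [T.compFst_left h₄, b.right_left]
    · rw [T.compFst_right h₃, b'.left_right]
    · rw [T.compFst_right h₄, b'.right_right]
  comm_comp_trd {p q r φ ψ χ π π' π'' ρ ρ' ρ'' ω ω' ω'' ζ ζ' ζ''} h h' h₁ h₂ h₃ h₄ := by
    obtain ⟨b, c⟩ := F.comm_iff.1 h
    obtain ⟨b', c'⟩ := F.comm_iff.1 h'
    refine F.comm_iff.2 ⟨?_, H.comm_comp_trd c c' (F.isCompSnd h₁) (F.isCompSnd h₂)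
      (F.isCompSnd h₃) (F.isCompSnd h₄)⟩
    constructor
    · rw [T.compSnd_top h₁, b.top_top]
    · rw [T.compSnd_top h₂, b.bot_top]
    · rw [T.compSnd_bot h₁, b'.top_bot]
    · rw [T.compSnd_bot h₂, b'.bot_bot]
    · rw [T.compSnd_top h₃, b.left_top]
    · rw [T.compSnd_top h₄, b.right_top]
    · rw [T.compSnd_bot h₃, b'.left_bot]
    · rw [T.compSnd_bot h₄, b'.right_bot]
    · have := T.compSnd_left h₁
      rw [b.left_left, b'.left_left] at this
      exact T.comp_unique this (T.compSnd_left h₃)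
    · have := T.compSnd_right h₁
      rw [b.right_left, b'.right_left] at this
      exact T.comp_unique this (T.compSnd_left h₄)
    · have := T.compSnd_left h₂
      rw [b.left_right, b'.left_right] at this
      exact T.comp_unique this (T.compSnd_right h₃)
    · have := T.compSnd_right h₂
      rw [b.right_right, b'.right_right] at this
      exact T.comp_unique this (T.compSnd_right h₄)

/-- The action of a map of quintet systems on cubes. -/
def mapCell (F : FaithfulMap K L) {i : Finset I} (x : Cell K i) : Cell L i where
  obj v hv := F.obj (x.obj v hv)
  arr p v hp hv hpv := F.arr (x.arr p v hp hv hpv)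
  sq p q v hpq hp hq hv hpv hqv := F.sq (x.sq p q v hpq hp hq hv hpv hqv)
  dom_arr p v hp hv hpv := by rw [F.dom_arr, x.dom_arr]
  cod_arr p v hp hv hpv := by rw [F.cod_arr, x.cod_arr]
  top_sq p q v hpq hp hq hv hpv hqv := by rw [F.top_sq, x.top_sq]
  bot_sq p q v hpq hp hq hv hpv hqv := by rw [F.bot_sq, x.bot_sq]
  left_sq p q v hpq hp hq hv hpv hqv := by rw [F.left_sq, x.left_sq]
  right_sq p q v hpq hp hq hv hpv hqv := by rw [F.right_sq, x.right_sq]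
  comm _ _ _ _ _ _ _ _ _ _ _ _ _ := (F.comm_iff.1 (x.comm _ _ _ _ _ _ _ _ _ _ _ _ _)).2

/-- Identities and composites are arbitrary choices on both sides. Uniqueness in the target makes
these choices compatible with `F`, here and in the next five lemmas. -/
theorem map_idArr (F : FaithfulMap K L) (H : K.Lawful) (H' : L.Lawful) {p : I} (A : K.Obj) :
    F.arr (H.idArr p A) = H'.idArr p (F.obj A) :=
  H'.id_unique (F.isId (H.isId_idArr p A)) (H'.isId_idArr _ _)

theorem map_idFst (F : FaithfulMap K L) (H : K.Lawful) (H' : L.Lawful) {p q : I} (hpq : p < q)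
    (U : K.Arr q) : F.sq (H.idFst hpq U) = H'.idFst hpq (F.arr U) :=
  H'.idFst_unique (F.isIdFst (H.isIdFst_idFst hpq U)) (H'.isIdFst_idFst _ _)

theorem map_idSnd (F : FaithfulMap K L) (H : K.Lawful) (H' : L.Lawful) {p q : I} (hpq : p < q)
    (U : K.Arr p) : F.sq (H.idSnd hpq U) = H'.idSnd hpq (F.arr U) :=
  H'.idSnd_unique (F.isIdSnd (H.isIdSnd_idSnd hpq U)) (H'.isIdSnd_idSnd _ _)

theorem map_compArr (F : FaithfulMap K L) (H : K.Lawful) (H' : L.Lawful) {p : I} {R S : K.Arr p}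
    (h : K.cod R = K.dom S) : F.arr (K.compArr R S) = L.compArr (F.arr R) (F.arr S) :=
  (H'.compArr_eq (F.isComp (H.isComp_compArr h))).symm

theorem map_compFst (F : FaithfulMap K L) (H : K.Lawful) (H' : L.Lawful) {p q : I} (hpq : p < q)
    {φ ψ : K.Sq p q} (h : K.right φ = K.left ψ) :
    F.sq (K.compFst φ ψ) = L.compFst (F.sq φ) (F.sq ψ) :=
  H'.compFst_unique (F.isCompFst (H.isCompFst_compFst hpq h))
    (H'.isCompFst_compFst hpq (by rw [F.right_sq, F.left_sq, h]))

theorem map_compSnd (F : FaithfulMap K L) (H : K.Lawful) (H' : L.Lawful) {p q : I} (hpq : p < q)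
    {φ ψ : K.Sq p q} (h : K.bot φ = K.top ψ) :
    F.sq (K.compSnd φ ψ) = L.compSnd (F.sq φ) (F.sq ψ) :=
  H'.compSnd_unique (F.isCompSnd (H.isCompSnd_compSnd hpq h))
    (H'.isCompSnd_compSnd hpq (by rw [F.bot_sq, F.top_sq, h]))

open Cell in
/-- The multiple functor induced by a map of quintet systems. -/
noncomputable def multipleFunctor (F : FaithfulMap K L) (H : K.Lawful) (H' : L.Lawful) :
    MultipleFunctor H.multipleCategory H'.multipleCategory where
  map x := F.mapCell x
  map_face _ _ _ _ _ _ := rfl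
  map_deg {j k i} h x := by
    refine ext_of (fun v hv => rfl) (fun p v hp hv hpv => ?_)
      (fun p q v hpq hp hq hv hpv hqv => ?_)
    · by_cases hpj : p = j
      · simp [mapCell, Lawful.multipleCategory, Lawful.multipleSet, deg, hpj, F.map_idArr H H']
      · simp [mapCell, Lawful.multipleCategory, Lawful.multipleSet, deg, hpj]
    · by_cases hpj : p = j
      · subst hpj
        simp [mapCell, Lawful.multipleCategory, Lawful.multipleSet, deg, F.map_idFst H H']
      · by_cases hqj : q = j
        · subst hqj
          simp [mapCell, Lawful.multipleCategory, Lawful.multipleSet, deg, hpj, F.map_idSnd H H']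
        · simp [mapCell, Lawful.multipleCategory, Lawful.multipleSet, deg, hpj, hqj]
  map_comp {j k i} h x y hxy hxy' := by
    refine ext_of (fun v hv => ?_) (fun p v hp hv hpv => ?_)
      (fun p q v hpq hp hq hv hpv hqv => ?_)
    · exact apply_ite F.obj (j ∈ v) _ _
    · by_cases hpj : p = j
      · subst hpj
        simp only [mapCell, Lawful.multipleCategory, comp, if_true]
        exact F.map_compArr H H' (cod_eq_dom h hxy _ _)
      · simp only [mapCell, Lawful.multipleCategory, comp, hpj, if_false]
        exact apply_ite F.arr (j ∈ v) _ _
    · by_cases hpj : p = j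
      · subst hpj
        simp only [mapCell, Lawful.multipleCategory, comp, if_true]
        exact F.map_compFst H H' hpq (right_eq_left h hxy _ _ _ _ _)
      · by_cases hqj : q = j
        · subst hqj
          simp only [mapCell, Lawful.multipleCategory, comp, hpj, if_true, if_false]
          exact F.map_compSnd H H' hpq (bot_eq_top h hxy _ _ _ _ _)
        · simp only [mapCell, Lawful.multipleCategory, comp, hpj, hqj, if_false]
          exact apply_ite F.sq (j ∈ v) _ _

end FaithfulMap

end QuintetSystem

/-! ## Faces and coskeletal dimension -/

namespace Cell

variable {I : Type} [LinearOrder I] {K : QuintetSystem.{v, w} I} {i : Finset I}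

theorem obj_eq_face (x : Cell K i) {j : I} (hj : j ∈ i) (v : Finset I) (hv : v ⊆ i) :
    x.obj v hv = (face (decide (j ∈ v)) (isExt_erase hj) x).obj (v.erase j)
      (Finset.erase_subset_erase j hv) :=
  x.obj_congr (shift_erase j v).symm _

theorem arr_eq_face (x : Cell K i) {j p : I} (hj : j ∈ i) (hpj : p ≠ j) (v : Finset I)
    (hp : p ∈ i) (hv : v ⊆ i) (hpv : p ∉ v) :
    x.arr p v hp hv hpv = (face (decide (j ∈ v)) (isExt_erase hj) x).arr p (v.erase j)
      (Finset.mem_erase_of_ne_of_mem hpj hp) (Finset.erase_subset_erase j hv)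
      (fun e => hpv (Finset.mem_of_mem_erase e)) :=
  x.arr_congr (shift_erase j v).symm _ _ _

theorem sq_eq_face (x : Cell K i) {j p q : I} (hj : j ∈ i) (hpj : p ≠ j) (hqj : q ≠ j)
    (v : Finset I) (hpq : p < q) (hp : p ∈ i) (hq : q ∈ i) (hv : v ⊆ i) (hpv : p ∉ v)
    (hqv : q ∉ v) :
    x.sq p q v hpq hp hq hv hpv hqv = (face (decide (j ∈ v)) (isExt_erase hj) x).sq p q (v.erase j)
      hpq (Finset.mem_erase_of_ne_of_mem hpj hp) (Finset.mem_erase_of_ne_of_mem hqj hq)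
      (Finset.erase_subset_erase j hv) (fun e => hpv (Finset.mem_of_mem_erase e))
      (fun e => hqv (Finset.mem_of_mem_erase e)) :=
  x.sq_congr (shift_erase j v).symm _ _ _ _ _ _

end Cell

namespace QuintetSystem

open Cell

variable {I : Type} [LinearOrder I] {K : QuintetSystem.{v, w} I} {L : QuintetSystem.{v', w'} I}

/-- In dimension at least two each vertex, and each edge, lies in a proper face and is therefore
known from the boundary. For squares this fails in dimension two, but their four boundary arrows are
known edges, and `sq_injective` recovers them from their images. -/
theorem FaithfulMap.isTwoFaithful (F : FaithfulMap K L) (H : K.Lawful) (H' : L.Lawful) :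
    (F.multipleFunctor H H').IsTwoFaithful := by
  intro i hi x y hface hmap
  have hf : ∀ α {j} (hj : j ∈ i), face α (isExt_erase hj) x = face α (isExt_erase hj) y :=
    fun α j hj => hface α (isExt_erase hj)
  have harr : ∀ p v hp hv hpv, x.arr p v hp hv hpv = y.arr p v hp hv hpv := by
    intro p v hp hv hpv
    obtain ⟨j, hj, hpj⟩ := Finset.exists_mem_ne (s := i) (by omega) p
    rw [x.arr_eq_face hj hpj.symm, y.arr_eq_face hj hpj.symm, hf _ hj]
  refine ext_of (fun v hv => ?_) harr (fun p q v hpq hp hq hv hpv hqv => ?_)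
  · obtain ⟨j, hj⟩ := Finset.card_pos.1 (by omega : 0 < i.card)
    rw [x.obj_eq_face hj, y.obj_eq_face hj, hf _ hj]
  · refine F.sq_injective ?_ ?_ ?_ ?_ ?_
    · rw [x.top_sq, y.top_sq, harr]
    · rw [x.bot_sq, y.bot_sq, harr]
    · rw [x.left_sq, y.left_sq, harr]
    · rw [x.right_sq, y.right_sq, harr]
    · exact congrFun (congrFun (congrFun (congrFun (congrFun (congrFun (congrFun (congrFun
        (congrFun (congrArg Cell.sq hmap) p) q) v) hpq) hp) hq) hv) hpv) hqv

end QuintetSystem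

section Index

variable {I : Type} [DecidableEq I] {j : I} {u w : Finset I}

/-- Opposite faces of a cube are disjoint, so a vertex lies on only one of the two, at one position.
-/
theorem shift_inj {α β : Bool} (hw : j ∉ w) (hu : j ∉ u) (h : shift α j w = shift β j u) :
    α = β ∧ w = u := by
  have h' : w = u := by rw [← erase_shift_self α hw, h, erase_shift_self β hu]
  refine ⟨?_, h'⟩
  subst h'
  cases α <;> cases β
  · rfl
  · exact absurd (h ▸ Finset.mem_insert_self j w : j ∈ shift false j w) hw
  · exact absurd (h ▸ Finset.mem_insert_self j w : j ∈ shift false j w) hw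
  · rfl

end Index

/-! ### Filling a face-consistent family above dimension three. -/

namespace FaceFamily

open Cell QuintetSystem

variable {I : Type} [LinearOrder I] {K : QuintetSystem.{v, w} I} {H : K.Lawful} {i : Finset I}
  (c : FaceFamily H.multipleSet i)

/-- The cell of a face family, for a given direction. -/
def cellAt (α : Bool) {j : I} (hj : j ∈ i) : Cell K (i.erase j) := c.cell α (isExt_erase hj)

theorem face_cellAt (α β : Bool) {j l : I} (hj : j ∈ i) (hl : l ∈ i)
    (h₁ : IsExt l ((i.erase j).erase l) (i.erase j))
    (h₂ : IsExt j ((i.erase j).erase l) (i.erase l)) :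
    face β h₁ (c.cellAt α hj) = face α h₂ (c.cellAt β hl) :=
  c.consistent α β (isExt_erase hj) (isExt_erase hl) h₁ h₂

/-- Two faces in different directions `j` and `l` meet in a face of codimension two. A vertex common
to both comes from the vertex `t` of that intersection, obtained by removing `j` and `l`. -/
theorem exists_overlap {α β : Bool} {j l : I} (hj : j ∈ i) (hl : l ∈ i) {w u : Finset I}
    (hw : w ⊆ i.erase j) (hu : u ⊆ i.erase l) (e : shift α j w = shift β l u) (hjl : j ≠ l) :
    ∃ t, t ⊆ (i.erase j).erase l ∧ w = shift β l t ∧ u = shift α j t ∧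
      IsExt l ((i.erase j).erase l) (i.erase j) ∧ IsExt j ((i.erase j).erase l) (i.erase l) := by
  have hjw : j ∉ w := fun h => Finset.notMem_erase j i (hw h)
  have hlu : l ∉ u := fun h => Finset.notMem_erase l i (hu h)
  have e₁ : w = shift β l (u.erase j) := by
    rw [← erase_shift_of_ne β hjl.symm, ← e, erase_shift_self α hjw]
  have e₂ : u = shift α j (w.erase l) := by
    rw [← erase_shift_of_ne α hjl, e, erase_shift_self β hlu]
  refine ⟨w.erase l, Finset.erase_subset_erase l hw, ?_, e₂,
    isExt_erase (Finset.mem_erase_of_ne_of_mem hjl.symm hl), ?_⟩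
  · conv_lhs => rw [e₁]
    conv_rhs => rw [e₁, erase_shift_self β (fun h => hlu (Finset.mem_of_mem_erase h))]
  · rw [Finset.erase_right_comm]
    exact isExt_erase (Finset.mem_erase_of_ne_of_mem hjl hj)

/-- The value at a vertex does not depend on the face through which it is read: two faces of the
same direction that share a vertex are equal, and otherwise consistency applies on their
intersection. The next two lemmas extend this to edges and squares. -/
theorem obj_cellAt {α β : Bool} {j l : I} (hj : j ∈ i) (hl : l ∈ i) {w u : Finset I}
    (hw : w ⊆ i.erase j) (hu : u ⊆ i.erase l) (e : shift α j w = shift β l u) :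
    (c.cellAt α hj).obj w hw = (c.cellAt β hl).obj u hu := by
  by_cases hjl : j = l
  · subst hjl
    obtain ⟨rfl, rfl⟩ := shift_inj (fun h => Finset.notMem_erase j i (hw h))
      (fun h => Finset.notMem_erase j i (hu h)) e
    rfl
  · obtain ⟨t, ht, rfl, rfl, h₁, h₂⟩ := exists_overlap hj hl hw hu e hjl
    exact congrFun (congrFun (congrArg Cell.obj (c.face_cellAt α β hj hl h₁ h₂)) t) ht

theorem arr_cellAt {α β : Bool} {j l p : I} (hj : j ∈ i) (hl : l ∈ i) {w u : Finset I}
    (hw : w ⊆ i.erase j) (hu : u ⊆ i.erase l) (e : shift α j w = shift β l u)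
    (hpj : p ∈ i.erase j) (hpl : p ∈ i.erase l) (hpw : p ∉ w) (hpu : p ∉ u) :
    (c.cellAt α hj).arr p w hpj hw hpw = (c.cellAt β hl).arr p u hpl hu hpu := by
  by_cases hjl : j = l
  · subst hjl
    obtain ⟨rfl, rfl⟩ := shift_inj (fun h => Finset.notMem_erase j i (hw h))
      (fun h => Finset.notMem_erase j i (hu h)) e
    rfl
  · obtain ⟨t, ht, rfl, rfl, h₁, h₂⟩ := exists_overlap hj hl hw hu e hjl
    have hp : p ∈ (i.erase j).erase l :=
      Finset.mem_erase_of_ne_of_mem (Finset.ne_of_mem_erase hpl) hpj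
    exact congrFun (congrFun (congrFun (congrFun (congrFun (congrArg Cell.arr
      (c.face_cellAt α β hj hl h₁ h₂)) p) t) hp) ht)
      (fun h => hpw ((mem_shift_of_ne (Finset.ne_of_mem_erase hp)).2 h))

theorem sq_cellAt {α β : Bool} {j l p q : I} (hpq : p < q) (hj : j ∈ i) (hl : l ∈ i) {w u : Finset I}
    (hw : w ⊆ i.erase j) (hu : u ⊆ i.erase l) (e : shift α j w = shift β l u)
    (hpj : p ∈ i.erase j) (hpl : p ∈ i.erase l) (hqj : q ∈ i.erase j) (hql : q ∈ i.erase l)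
    (hpw : p ∉ w) (hpu : p ∉ u) (hqw : q ∉ w) (hqu : q ∉ u) :
    (c.cellAt α hj).sq p q w hpq hpj hqj hw hpw hqw = (c.cellAt β hl).sq p q u hpq hpl hql hu hpu hqu := by
  by_cases hjl : j = l
  · subst hjl
    obtain ⟨rfl, rfl⟩ := shift_inj (fun h => Finset.notMem_erase j i (hw h))
      (fun h => Finset.notMem_erase j i (hu h)) e
    rfl
  · obtain ⟨t, ht, rfl, rfl, h₁, h₂⟩ := exists_overlap hj hl hw hu e hjl
    have hp : p ∈ (i.erase j).erase l :=
      Finset.mem_erase_of_ne_of_mem (Finset.ne_of_mem_erase hpl) hpj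
    have hq : q ∈ (i.erase j).erase l :=
      Finset.mem_erase_of_ne_of_mem (Finset.ne_of_mem_erase hql) hqj
    exact congrFun (congrFun (congrFun (congrFun (congrFun (congrFun (congrFun (congrFun
      (congrFun (congrArg Cell.sq (c.face_cellAt α β hj hl h₁ h₂)) p) q) t) hpq) hp) hq) ht)
      (fun h => hpw ((mem_shift_of_ne (Finset.ne_of_mem_erase hp)).2 h)))
      (fun h => hqw ((mem_shift_of_ne (Finset.ne_of_mem_erase hq)).2 h))

/-- Here `s` is the set of directions of a vertex, edge, square or three-dimensional face based at
`v`. A direction of the cube outside `s` is constant along it, so that the item is contained in a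
face normal to that direction. -/
theorem exists_shift_eq {s : Finset I} (hs : s.card < i.card) {v : Finset I} (hv : v ⊆ i) :
    ∃ (α : Bool) (j : I) (w : Finset I), j ∈ i ∧ j ∉ s ∧ w ⊆ i.erase j ∧ shift α j w = v ∧
      w ⊆ v := by
  obtain ⟨j, hj, hjs⟩ := Finset.exists_mem_notMem_of_card_lt_card hs
  exact ⟨decide (j ∈ v), j, v.erase j, hj, hjs, Finset.erase_subset_erase j hv, shift_erase j v,
    Finset.erase_subset j v⟩

/-- All the data are read from the cells of the family, consistently by the three lemmas above.
Since there are more than three directions, even a three-dimensional face is contained in one of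
these cells, which guarantees its commutativity. -/
theorem exists_cell (hi : 3 < i.card) :
    ∃ x : Cell K i, ∀ (α : Bool) {j : I} (hj : j ∈ i), face α (isExt_erase hj) x = c.cellAt α hj := by
  -- The existence of a common value over all the cells containing a given item is stated so that
  -- `choose` produces the filler with its defining property.
  have hO : ∀ v : Finset I, v ⊆ i → ∃ o, ∀ (α : Bool) (j : I) (hj : j ∈ i) (w : Finset I)
      (hw : w ⊆ i.erase j), shift α j w = v → (c.cellAt α hj).obj w hw = o := by
    intro v hv
    obtain ⟨α, j, w, hj, -, hw, e, -⟩ := exists_shift_eq (s := ∅) (i := i) (by rw [Finset.card_empty]; omega) hv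
    exact ⟨(c.cellAt α hj).obj w hw, fun β l hl u hu e' => c.obj_cellAt hl hj hu hw (e'.trans e.symm)⟩
  have hA : ∀ (p : I) (v : Finset I), p ∈ i → v ⊆ i → p ∉ v → ∃ a, ∀ (α : Bool) (j : I)
      (hj : j ∈ i) (w : Finset I) (hp : p ∈ i.erase j) (hw : w ⊆ i.erase j) (hpw : p ∉ w),
      shift α j w = v → (c.cellAt α hj).arr p w hp hw hpw = a := by
    intro p v hp hv hpv
    obtain ⟨α, j, w, hj, hjs, hw, e, hwv⟩ := exists_shift_eq (s := {p})
      (i := i) (by rw [Finset.card_singleton]; omega) hv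
    simp only [Finset.mem_singleton] at hjs
    exact ⟨(c.cellAt α hj).arr p w (Finset.mem_erase_of_ne_of_mem (Ne.symm hjs) hp) hw
      (fun h => hpv (hwv h)),
      fun β l hl u hpl hu hpu e' => c.arr_cellAt hl hj hu hw (e'.trans e.symm) _ _ _ _⟩
  have hS : ∀ (p q : I) (v : Finset I) (hpq : p < q), p ∈ i → q ∈ i → v ⊆ i → p ∉ v → q ∉ v →
      ∃ a, ∀ (α : Bool) (j : I) (hj : j ∈ i) (w : Finset I) (hp : p ∈ i.erase j)
      (hq : q ∈ i.erase j) (hw : w ⊆ i.erase j) (hpw : p ∉ w) (hqw : q ∉ w),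
      shift α j w = v → (c.cellAt α hj).sq p q w hpq hp hq hw hpw hqw = a := by
    intro p q v hpq hp hq hv hpv hqv
    obtain ⟨α, j, w, hj, hjs, hw, e, hwv⟩ := exists_shift_eq (s := {p, q})
      (by rw [Finset.card_pair hpq.ne]; omega) hv
    simp only [Finset.mem_insert, Finset.mem_singleton, not_or] at hjs
    exact ⟨(c.cellAt α hj).sq p q w hpq (Finset.mem_erase_of_ne_of_mem (Ne.symm hjs.1) hp)
      (Finset.mem_erase_of_ne_of_mem (Ne.symm hjs.2) hq) hw
      (fun h => hpv (hwv h)) (fun h => hqv (hwv h)),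
      fun β l hl u hpl hql hu hpu hqu e' =>
        c.sq_cellAt hpq hl hj hu hw (e'.trans e.symm) _ _ _ _ _ _ _ _⟩
  choose O hO using hO
  choose A hA using hA
  choose S hS using hS
  -- A face is picked that avoids up to three directions; repeated arguments serve for edges and
  -- squares.
  have pick : ∀ (p q r : I) {v : Finset I}, v ⊆ i → ∃ (α : Bool) (j : I) (w : Finset I), j ∈ i ∧
      (p ≠ j ∧ q ≠ j ∧ r ≠ j) ∧ w ⊆ i.erase j ∧ shift α j w = v ∧ w ⊆ v := by
    intro p q r v hv
    obtain ⟨α, j, w, hj, hjs, hw, e, hwv⟩ := exists_shift_eq (s := {p, q, r})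
      (lt_of_le_of_lt Finset.card_le_three hi) hv
    simp only [Finset.mem_insert, Finset.mem_singleton, not_or] at hjs
    exact ⟨α, j, w, hj, ⟨Ne.symm hjs.1, Ne.symm hjs.2.1, Ne.symm hjs.2.2⟩, hw, e, hwv⟩
  have ins : ∀ {α : Bool} {j p : I} {w v : Finset I}, shift α j w = v →
      shift α j (insert p w) = insert p v := fun e => by rw [← insert_shift, e]
  refine ⟨
    { obj := O
      arr := A
      sq := S
      dom_arr := fun p v hp hv hpv => ?_
      cod_arr := fun p v hp hv hpv => ?_
      top_sq := fun p q v hpq hp hq hv hpv hqv => ?_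
      bot_sq := fun p q v hpq hp hq hv hpv hqv => ?_
      left_sq := fun p q v hpq hp hq hv hpv hqv => ?_
      right_sq := fun p q v hpq hp hq hv hpv hqv => ?_
      comm := fun p q r v hpq hqr hp hq hr hv hpv hqv hrv => ?_ }, ?_⟩
  -- As for all the following axioms: every item that occurs is rewritten as an item of one cell of
  -- the family, where the axiom holds.
  · obtain ⟨α, j, w, hj, hne, hw, e, hwv⟩ := pick p p p hv
    have hp' := Finset.mem_erase_of_ne_of_mem hne.1 hp
    rw [← hA p v hp hv hpv α j hj w hp' hw (fun h => hpv (hwv h)) e, ← hO v hv α j hj w hw e]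
    exact (c.cellAt α hj).dom_arr _ _ _ _ _
  · obtain ⟨α, j, w, hj, hne, hw, e, hwv⟩ := pick p p p hv
    have hp' := Finset.mem_erase_of_ne_of_mem hne.1 hp
    rw [← hA p v hp hv hpv α j hj w hp' hw (fun h => hpv (hwv h)) e,
      ← hO _ _ α j hj _ (Finset.insert_subset hp' hw) (ins e)]
    exact (c.cellAt α hj).cod_arr _ _ _ _ _
  · obtain ⟨α, j, w, hj, hne, hw, e, hwv⟩ := pick p q q hv
    have hp' := Finset.mem_erase_of_ne_of_mem hne.1 hp
    have hq' := Finset.mem_erase_of_ne_of_mem hne.2.1 hq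
    have hpw : p ∉ w := fun h => hpv (hwv h)
    have hqw : q ∉ w := fun h => hqv (hwv h)
    rw [← hS p q v hpq hp hq hv hpv hqv α j hj w hp' hq' hw hpw hqw e,
      ← hA p v hp hv hpv α j hj w hp' hw hpw e]
    exact (c.cellAt α hj).top_sq _ _ _ _ _ _ _ _ _
  · obtain ⟨α, j, w, hj, hne, hw, e, hwv⟩ := pick p q q hv
    have hp' := Finset.mem_erase_of_ne_of_mem hne.1 hp
    have hq' := Finset.mem_erase_of_ne_of_mem hne.2.1 hq
    have hpw : p ∉ w := fun h => hpv (hwv h)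
    have hqw : q ∉ w := fun h => hqv (hwv h)
    rw [← hS p q v hpq hp hq hv hpv hqv α j hj w hp' hq' hw hpw hqw e,
      ← hA p _ hp _ _ α j hj _ hp' (Finset.insert_subset hq' hw) (by simp [hpq.ne, hpw]) (ins e)]
    exact (c.cellAt α hj).bot_sq _ _ _ _ _ _ _ _ _
  · obtain ⟨α, j, w, hj, hne, hw, e, hwv⟩ := pick p q q hv
    have hp' := Finset.mem_erase_of_ne_of_mem hne.1 hp
    have hq' := Finset.mem_erase_of_ne_of_mem hne.2.1 hq
    have hpw : p ∉ w := fun h => hpv (hwv h)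
    have hqw : q ∉ w := fun h => hqv (hwv h)
    rw [← hS p q v hpq hp hq hv hpv hqv α j hj w hp' hq' hw hpw hqw e,
      ← hA q v hq hv hqv α j hj w hq' hw hqw e]
    exact (c.cellAt α hj).left_sq _ _ _ _ _ _ _ _ _
  · obtain ⟨α, j, w, hj, hne, hw, e, hwv⟩ := pick p q q hv
    have hp' := Finset.mem_erase_of_ne_of_mem hne.1 hp
    have hq' := Finset.mem_erase_of_ne_of_mem hne.2.1 hq
    have hpw : p ∉ w := fun h => hpv (hwv h)
    have hqw : q ∉ w := fun h => hqv (hwv h)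
    rw [← hS p q v hpq hp hq hv hpv hqv α j hj w hp' hq' hw hpw hqw e,
      ← hA q _ hq _ _ α j hj _ hq' (Finset.insert_subset hp' hw) (by simp [hpq.ne', hqw]) (ins e)]
    exact (c.cellAt α hj).right_sq _ _ _ _ _ _ _ _ _
  · obtain ⟨α, j, w, hj, hne, hw, e, hwv⟩ := pick p q r hv
    have hp' := Finset.mem_erase_of_ne_of_mem hne.1 hp
    have hq' := Finset.mem_erase_of_ne_of_mem hne.2.1 hq
    have hr' := Finset.mem_erase_of_ne_of_mem hne.2.2 hr
    have hpw : p ∉ w := fun h => hpv (hwv h)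
    have hqw : q ∉ w := fun h => hqv (hwv h)
    have hrw : r ∉ w := fun h => hrv (hwv h)
    have hpr := hpq.trans hqr
    rw [← hS p q v hpq hp hq hv hpv hqv α j hj w hp' hq' hw hpw hqw e,
      ← hS p r v hpr hp hr hv hpv hrv α j hj w hp' hr' hw hpw hrw e,
      ← hS q r v hqr hq hr hv hqv hrv α j hj w hq' hr' hw hqw hrw e,
      ← hS p q _ hpq hp hq _ _ _ α j hj _ hp' hq' (Finset.insert_subset hr' hw)
        (by simp [hpr.ne, hpw]) (by simp [hqr.ne, hqw]) (ins e),
      ← hS p r _ hpr hp hr _ _ _ α j hj _ hp' hr' (Finset.insert_subset hq' hw)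
        (by simp [hpq.ne, hpw]) (by simp [hqr.ne', hrw]) (ins e),
      ← hS q r _ hqr hq hr _ _ _ α j hj _ hq' hr' (Finset.insert_subset hp' hw)
        (by simp [hpq.ne', hqw]) (by simp [hpr.ne', hrw]) (ins e)]
    exact (c.cellAt α hj).comm _ _ _ _ _ _ _ _ _ _ _ _ _
  · intro α j hj
    refine ext_of (fun v hv => ?_) (fun p v hp hv hpv => ?_)
      (fun p q v hpq hp hq hv hpv hqv => ?_)
    · exact (hO _ _ α j hj v hv rfl).symm
    · exact (hA p _ _ _ _ α j hj v hp hv hpv rfl).symm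
    · exact (hS p q _ hpq _ _ _ _ _ α j hj v hp hq hv hpv hqv rfl).symm

end FaceFamily

namespace QuintetSystem.Lawful

open Cell

variable {I : Type} [LinearOrder I] {K : QuintetSystem.{v, w} I}

/-- Existence is the gluing of `FaceFamily.exists_cell`. For uniqueness, a cube of dimension at
least three has all its vertices, edges and squares in proper faces. -/
theorem coskeletalDimLE_three (H : K.Lawful) : H.multipleCategory.CoskeletalDimLE 3 := by
  intro i hi c
  obtain ⟨x, hx⟩ := c.exists_cell hi
  -- The index of a face is forced to be `i.erase j`, so the conditions can be indexed by the
  -- directions alone.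
  have key : ∀ y : Cell K i, (∀ (α : Bool) {j : I} {k : Finset I} (h : IsExt j k i),
      H.multipleCategory.face α h y = c.cell α h) ↔
      ∀ (α : Bool) {j : I} (hj : j ∈ i), face α (isExt_erase hj) y = c.cellAt α hj := by
    intro y
    refine ⟨fun h α j hj => h α (isExt_erase hj), fun h α j k hk => ?_⟩
    obtain rfl := hk.eq_erase
    exact h α hk.mem
  refine ⟨x, (key x).2 hx, fun y hy => ?_⟩
  have hy := (key y).1 hy
  refine ext_of (fun v hv => ?_) (fun p v hp hv hpv => ?_) (fun p q v hpq hp hq hv hpv hqv => ?_)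
  · obtain ⟨j, hj⟩ := Finset.card_pos.1 (by omega : 0 < i.card)
    rw [x.obj_eq_face hj, y.obj_eq_face hj, hx _ hj, hy _ hj]
  · obtain ⟨j, hj, hpj⟩ := Finset.exists_mem_ne (s := i) (by omega) p
    rw [x.arr_eq_face hj hpj.symm, y.arr_eq_face hj hpj.symm, hx _ hj, hy _ hj]
  · obtain ⟨α, j, w, hj, hjs, -⟩ := FaceFamily.exists_shift_eq (s := {p, q})
      (by rw [Finset.card_pair hpq.ne]; omega) hv
    simp only [Finset.mem_insert, Finset.mem_singleton, not_or] at hjs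
    rw [x.sq_eq_face hj (Ne.symm hjs.1) (Ne.symm hjs.2),
      y.sq_eq_face hj (Ne.symm hjs.1) (Ne.symm hjs.2), hx _ hj, hy _ hj]

end QuintetSystem.Lawful

/-! ## Partial composition of arrows -/

namespace MultCat

/-- The semigroup with zero of arrows of index `i`: non-consecutive arrows have product zero. -/
def Par (A : MultCat.{u}) (i : Finset ℕ+) : Type u := Option (A.map i)

variable {A B C : MultCat.{u}} {i k : Finset ℕ+} {j : ℕ+}

/-- An arrow, as an element of the semigroup of arrows. -/
def par (f : A.map i) : A.Par i := some f

/-- The zero of the semigroup of arrows. -/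
def parZero : A.Par i := none

theorem par_injective {f g : A.map i} (h : par f = par g) : f = g := Option.some.inj h

open Classical in
/-- Partial composition. -/
noncomputable def Par.mul : A.Par i → A.Par i → A.Par i
  | some f, some g => if h : A.tgt f = A.src g then some (A.comp f g h) else none
  | _, _ => none

noncomputable instance : Mul (A.Par i) := ⟨Par.mul⟩

theorem par_mul_par {f g : A.map i} (h : A.tgt f = A.src g) : par f * par g = par (A.comp f g h) :=
  dif_pos h

theorem par_mul_par_of_ne {f g : A.map i} (h : ¬ A.tgt f = A.src g) :
    par f * par g = parZero :=
  dif_neg h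

theorem parZero_mul (x : A.Par i) : parZero * x = parZero := rfl

theorem mul_parZero (x : A.Par i) : x * parZero = parZero := by
  cases x <;> rfl

noncomputable instance : Semigroup (A.Par i) where
  mul_assoc x y z := by
    rcases x with _ | f
    · rfl
    rcases y with _ | g
    · rfl
    rcases z with _ | l
    · exact (mul_parZero _).trans ((congrArg _ (mul_parZero _)).trans (mul_parZero _)).symm
    change par f * par g * par l = par f * (par g * par l)
    by_cases h : A.tgt f = A.src g
    · rw [par_mul_par h]
      by_cases h' : A.tgt g = A.src l
      · rw [par_mul_par h', par_mul_par ((A.tgt_comp _ _ h).trans h'),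
          par_mul_par (h.trans (A.src_comp _ _ h').symm), A.comp_assoc]
      · rw [par_mul_par_of_ne h', mul_parZero, par_mul_par_of_ne (by rwa [A.tgt_comp])]
    · rw [par_mul_par_of_ne h, parZero_mul]
      by_cases h' : A.tgt g = A.src l
      · rw [par_mul_par h', par_mul_par_of_ne (by rwa [A.src_comp])]
      · rw [par_mul_par_of_ne h', mul_parZero]

/-- An element `par c` is nonzero, so an equation of this form already contains the composability of
its factors. Hence `par` equations can replace composites together with their side conditions. -/
theorem exists_comp_of_par {f g c : A.map i} (h : par c = par f * par g) :
    ∃ h : A.tgt f = A.src g, A.comp f g h = c := by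
  by_cases h' : A.tgt f = A.src g
  · rw [par_mul_par h'] at h
    exact ⟨h', (par_injective h).symm⟩
  · rw [par_mul_par_of_ne h'] at h
    cases h

theorem src_of_par {f g c : A.map i} (h : par c = par f * par g) : A.src c = A.src f := by
  obtain ⟨h', rfl⟩ := exists_comp_of_par h
  exact A.src_comp _ _ _

theorem tgt_of_par {f g c : A.map i} (h : par c = par f * par g) : A.tgt c = A.tgt g := by
  obtain ⟨h', rfl⟩ := exists_comp_of_par h
  exact A.tgt_comp _ _ _

theorem one_mul_par {f : A.map i} {x : A.cube i} (h : A.src f = x) :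
    par (A.one x) * par f = par f := by
  subst h
  rw [par_mul_par (A.tgt_one _), A.one_comp]

theorem par_mul_one {f : A.map i} {x : A.cube i} (h : A.tgt f = x) :
    par f * par (A.one x) = par f := by
  subst h
  rw [par_mul_par (A.src_one _).symm, A.comp_one]

open Classical in
/-- The composite of two arrows, with a junk value where they are not consecutive. -/
noncomputable def cmp (A : MultCat.{u}) (f g : A.map i) : A.map i :=
  if h : A.tgt f = A.src g then A.comp f g h else f

theorem par_cmp {f g : A.map i} (h : A.tgt f = A.src g) : par (A.cmp f g) = par f * par g := by
  rw [cmp, dif_pos h, par_mul_par h]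

/-- The composite of a list of arrows. -/
noncomputable def pprod : List (A.map i) → A.Par i
  -- No arrow is a composite of the empty list, so zero is the value that keeps `isComposite_iff`
  -- true.
  | [] => parZero
  | [f] => par f
  | f :: g :: l => par f * pprod (g :: l)

/-- This is the dictionary between the coherence axioms, stated through `IsComposite`, and
computations in a semigroup. A nonzero product forces every intermediate composite to exist. -/
theorem isComposite_iff {l : List (A.map i)} {c : A.map i} :
    A.IsComposite l c ↔ pprod l = par c := by
  constructor
  · intro h
    induction h with
    | single f => rfl
    | cons f l c hc h ih =>
      cases l with
      | nil => cases hc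
      | cons g l => rw [pprod, ih, par_mul_par h]
  · intro h
    induction l generalizing c with
    | nil => cases h
    | cons f l ih =>
      cases l with
      | nil =>
        cases par_injective h
        exact .single f
      | cons g l =>
        rw [pprod] at h
        match e : pprod (g :: l) with
        | none =>
          rw [e] at h
          cases (mul_parZero _).symm.trans h
        | some d =>
          rw [e] at h
          obtain ⟨h', rfl⟩ := exists_comp_of_par (g := d) h.symm
          exact .cons f (g :: l) d (ih e) h'

theorem isComposite_pair_iff {f g c : A.map i} : A.IsComposite [f, g] c ↔ par c = par f * par g :=
  isComposite_iff.trans eq_comm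

theorem Commutes.eq {l l' : List (A.map i)} (h : A.Commutes l l') : pprod l = pprod l' := by
  obtain ⟨c, h₁, h₂⟩ := h
  rw [isComposite_iff.1 h₁, isComposite_iff.1 h₂]

/-- Equality of products is weaker than commutativity only when both are zero. Composability of the
first list excludes this, and the equation transfers it to the second. -/
theorem commutes_of_eq {l l' : List (A.map i)} {c : A.map i} (h : pprod l = pprod l')
    (hc : pprod l = par c) : A.Commutes l l' :=
  ⟨c, isComposite_iff.2 hc, isComposite_iff.2 (h.symm.trans hc)⟩

/-- A list of three arrows is composable if it is a chain. -/
theorem exists_pprod_three {f g l : A.map i} (h : A.tgt f = A.src g) (h' : A.tgt g = A.src l) :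
    ∃ c, pprod [f, g, l] = par c := by
  refine ⟨A.comp f (A.comp g l h') (h.trans (A.src_comp _ _ _).symm), ?_⟩
  rw [pprod, pprod, pprod, par_mul_par h', par_mul_par]

theorem commutes_of_eq_par {l l' : List (A.map i)} {c : A.map i} (h : pprod l = par c)
    (h' : pprod l' = par c) : A.Commutes l l' :=
  commutes_of_eq (h.trans h'.symm) h

theorem commutes_one {f : A.map i} {l : List (A.map i)} (h : pprod l = par f) :
    A.Commutes l [f] := commutes_of_eq h h

theorem commutes_two {f g : A.map i} {l : List (A.map i)} (h₁ : A.tgt f = A.src g)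
    (h : par f * par g = pprod l) : A.Commutes [f, g] l :=
  commutes_of_eq h (par_mul_par h₁)

theorem commutes_three {f g k : A.map i} {l : List (A.map i)} (h₁ : A.tgt f = A.src g)
    (h₂ : A.tgt g = A.src k) (h : par f * (par g * par k) = pprod l) : A.Commutes [f, g, k] l :=
  have ⟨_, hc⟩ := exists_pprod_three h₁ h₂
  commutes_of_eq h hc

theorem IsComposite.map (F : Hom A B) {l : List (A.map i)} {c : A.map i}
    (h : A.IsComposite l c) : B.IsComposite (l.map F.mor) (F.mor c) := by
  induction h with
  | single f => exact .single _
  | cons f l c hc h ih =>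
    have h' : B.tgt (F.mor f) = B.src (F.mor c) := by rw [F.tgt_mor, F.src_mor, h]
    rw [F.mor_comp _ _ _ h']
    exact .cons _ _ _ ih h'

theorem Commutes.map (F : Hom A B) {l l' : List (A.map i)} (h : A.Commutes l l') :
    B.Commutes (l.map F.mor) (l'.map F.mor) := by
  obtain ⟨c, h₁, h₂⟩ := h
  exact ⟨F.mor c, h₁.map F, h₂.map F⟩

/-- Functoriality in a form where composability is carried by the equation. `par_deg` and `par_face`
do the same for degeneracies and faces. -/
theorem Hom.par_mor (F : Hom A B) {f g c : A.map i} (h : par c = par f * par g) :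
    par (F.mor c) = par (F.mor f) * par (F.mor g) := by
  obtain ⟨h', rfl⟩ := exists_comp_of_par h
  have h'' : B.tgt (F.mor f) = B.src (F.mor g) := by rw [F.tgt_mor, F.src_mor, h']
  rw [F.mor_comp _ _ _ h'', par_mul_par h'']

theorem par_deg (h : IsExt j k i) {f g c : A.map k} (e : par c = par f * par g) :
    par (A.maps.deg h c) = par (A.maps.deg h f) * par (A.maps.deg h g) := by
  obtain ⟨h', rfl⟩ := exists_comp_of_par e
  have h'' : A.tgt (A.maps.deg h f) = A.src (A.maps.deg h g) := by rw [A.tgt_deg, A.src_deg, h']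
  rw [A.deg_comp _ _ _ _ h'', par_mul_par h'']

theorem par_face (α : Bool) (h : IsExt j k i) {f g c : A.map i} (e : par c = par f * par g) :
    par (A.maps.face α h c) = par (A.maps.face α h f) * par (A.maps.face α h g) := by
  obtain ⟨h', rfl⟩ := exists_comp_of_par e
  have h'' : A.tgt (A.maps.face α h f) = A.src (A.maps.face α h g) := by
    rw [A.tgt_face, A.src_face, h']
  rw [A.face_comp _ _ _ _ _ h'', par_mul_par h'']

theorem isSpecial_one (h : IsExt j k i) (x : A.cube i) : A.IsSpecial h (A.one x) := fun α => by
  rw [A.face_one, A.src_one]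

theorem IsSpecial.face_tgt {h : IsExt j k i} {f : A.map i} (hf : A.IsSpecial h f) (α : Bool) :
    A.cubes.face α h (A.tgt f) = A.cubes.face α h (A.src f) := by
  rw [← A.tgt_face, hf α, A.tgt_one]

/-- The two factors have identity faces, and these sit on the same cube because a special arrow does
not change the `j`-faces of its domain. -/
theorem IsSpecial.of_par {h : IsExt j k i} {f g c : A.map i} (hf : A.IsSpecial h f)
    (hg : A.IsSpecial h g) (e : par c = par f * par g) : A.IsSpecial h c := fun α => by
  have e' := par_face α h e
  obtain ⟨h', -⟩ := exists_comp_of_par e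
  rw [hf α, hg α, ← h', hf.face_tgt α, one_mul_par (A.src_one _)] at e'
  rw [par_injective e', src_of_par e]

theorem IsSpecial.mor {h : IsExt j k i} {f : A.map i} (hf : A.IsSpecial h f) (F : Hom A B) :
    B.IsSpecial h (F.mor f) := fun α => by
  rw [F.face_mor, hf α, F.mor_one, F.src_mor, F.face_obj]

/-- The `j`-faces of special arrows are identities, so consecutivity in direction `j` is a matter of
their domains alone. This gives the definedness of the sums of comparisons in direction `j`. -/
theorem consec_of_isSpecial {h : IsExt j k i} {f g : A.map i} (hf : A.IsSpecial h f)
    (hg : A.IsSpecial h g) (e : A.cubes.Consec h (A.src f) (A.src g)) : A.maps.Consec h f g := by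
  have e : A.cubes.face true h (A.src f) = A.cubes.face false h (A.src g) := e
  change A.maps.face true h f = A.maps.face false h g
  rw [hf, hg, e]

theorem consec_src {h : IsExt j k i} {f g : A.map i} (e : A.maps.Consec h f g) :
    A.cubes.Consec h (A.src f) (A.src g) := by
  have e : A.maps.face true h f = A.maps.face false h g := e
  change A.cubes.face true h (A.src f) = A.cubes.face false h (A.src g)
  rw [← A.src_face, ← A.src_face, e]

theorem consec_tgt {h : IsExt j k i} {f g : A.map i} (e : A.maps.Consec h f g) :
    A.cubes.Consec h (A.tgt f) (A.tgt g) := by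
  have e : A.maps.face true h f = A.maps.face false h g := e
  change A.cubes.face true h (A.tgt f) = A.cubes.face false h (A.tgt g)
  rw [← A.tgt_face, ← A.tgt_face, e]

theorem Hom.consec_obj (F : Hom A B) {h : IsExt j k i} {x y : A.cube i}
    (e : A.cubes.Consec h x y) : B.cubes.Consec h (F.obj x) (F.obj y) := by
  have e : A.cubes.face true h x = A.cubes.face false h y := e
  change B.cubes.face true h (F.obj x) = B.cubes.face false h (F.obj y)
  rw [F.face_obj, F.face_obj, e]

theorem Hom.consec_mor (F : Hom A B) {h : IsExt j k i} {x y : A.map i}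
    (e : A.maps.Consec h x y) : B.maps.Consec h (F.mor x) (F.mor y) := by
  have e : A.maps.face true h x = A.maps.face false h y := e
  change B.maps.face true h (F.mor x) = B.maps.face false h (F.mor y)
  rw [F.face_mor, F.face_mor, e]

theorem Hom.comp_obj (F : Hom A B) (G : Hom B C) (x : A.cube i) :
    (F.comp G).obj x = G.obj (F.obj x) := rfl

theorem Hom.comp_mor (F : Hom A B) (G : Hom B C) (f : A.map i) :
    (F.comp G).mor f = G.mor (F.mor f) := rfl

theorem consec_deg_face (h : IsExt j k i) (x : A.cube i) :
    A.cubes.Consec h (A.cubes.deg h (A.cubes.face false h x)) x :=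
  A.cubes.face_deg _ _ _

theorem consec_face_deg (h : IsExt j k i) (x : A.cube i) :
    A.cubes.Consec h x (A.cubes.deg h (A.cubes.face true h x)) :=
  (A.cubes.face_deg _ _ _).symm

end MultCat

/-- The index with both directions removed is needed in order to apply the laws relating the faces
in direction `a` to the structure in direction `b`. -/
theorem IsExt.exists_square {I : Type} [DecidableEq I] {a b : I} {ka kb i : Finset I}
    (ha : IsExt a ka i) (hb : IsExt b kb i) (hab : a ≠ b) : ∃ m, IsExt b m ka ∧ IsExt a m kb := by
  have hbk : b ∈ ka := ha.mem_of_ne hb.mem hab.symm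
  refine ⟨ka.erase b, isExt_erase hbk, ?_⟩
  rw [ha.eq_erase, hb.eq_erase, Finset.erase_right_comm]
  exact isExt_erase (Finset.mem_erase_of_ne_of_mem hab ha.mem)

/-! ### Definedness and interchange of sums in a chiral multiple category. -/

namespace PreChiral

open MultCat

variable {A : PreChiral.{u}} {i k ka kb : Finset ℕ+} {j a b : ℕ+}

theorem src_addM' {h : IsExt j k i} {f g : A.map i} (e : A.maps.Consec h f g) :
    A.src (A.addM h f g e) = A.add h (A.src f) (A.src g) (consec_src e) :=
  A.src_addM _ _ _ _ _

theorem tgt_addM' {h : IsExt j k i} {f g : A.map i} (e : A.maps.Consec h f g) :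
    A.tgt (A.addM h f g e) = A.add h (A.tgt f) (A.tgt g) (consec_tgt e) :=
  A.tgt_addM _ _ _ _ _

theorem addM_one' {h : IsExt j k i} {x y : A.cube i} (e : A.maps.Consec h (A.one x) (A.one y))
    (e' : A.cubes.Consec h x y) : A.addM h (A.one x) (A.one y) e = A.one (A.add h x y e') :=
  A.addM_one _ _ _ _ _

theorem add_congr {h : IsExt j k i} {x y x' y' : A.cube i} (hx : x = x') (hy : y = y')
    (e : A.cubes.Consec h x y) (e' : A.cubes.Consec h x' y') : A.add h x y e = A.add h x' y' e' := by
  subst hx hy; rfl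

/-- The strict interchange of transversal composition with `+_j`, for composites known only through
their products. With it, a sum of composite comparisons is split into a product of two sums. -/
theorem par_addM {h : IsExt j k i} {f f' f'' g g' g'' : A.map i} (ef : par f'' = par f * par f')
    (eg : par g'' = par g * par g') (e'' : A.maps.Consec h f'' g'') (e : A.maps.Consec h f g)
    (e' : A.maps.Consec h f' g') :
    par (A.addM h f'' g'' e'') = par (A.addM h f g e) * par (A.addM h f' g' e') := by
  obtain ⟨hf, rfl⟩ := exists_comp_of_par ef
  obtain ⟨hg, rfl⟩ := exists_comp_of_par eg
  have h₂ : A.tgt (A.addM h f g e) = A.src (A.addM h f' g' e') := by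
    rw [tgt_addM', src_addM']
    exact add_congr hf hg _ _
  rw [A.addM_comp _ _ _ _ _ hf hg e e' _ h₂, par_mul_par]

theorem consec_add_left {h : IsExt j k i} {x y z : A.cube i} (hxy : A.cubes.Consec h x y)
    (hyz : A.cubes.Consec h y z) : A.cubes.Consec h (A.add h x y hxy) z :=
  (A.face_add_snd _ _ _ _).trans hyz

theorem consec_add_right {h : IsExt j k i} {x y z : A.cube i} (hxy : A.cubes.Consec h x y)
    (hyz : A.cubes.Consec h y z) : A.cubes.Consec h x (A.add h y z hyz) :=
  hxy.trans (A.face_add_fst _ _ _ _).symm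

/-- The `a`-faces of a `b`-composite are the `b`-composites of the `a`-faces; the latter agree term
by term by the consecutivity in direction `a`. -/
theorem consec_add_add (ha : IsExt a ka i) (hb : IsExt b kb i) (hab : a ≠ b) {x y z t : A.cube i}
    (hxy : A.cubes.Consec ha x y) (hzt : A.cubes.Consec ha z t) (hxz : A.cubes.Consec hb x z)
    (hyt : A.cubes.Consec hb y t) :
    A.cubes.Consec ha (A.add hb x z hxz) (A.add hb y t hyt) := by
  obtain ⟨m, h₁, h₂⟩ := ha.exists_square hb hab
  have key : ∀ α {x z : A.cube i}, A.cubes.Consec hb x z →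
      A.cubes.Consec h₁ (A.cubes.face α ha x) (A.cubes.face α ha z) := by
    intro α x z e
    have e : A.cubes.face true hb x = A.cubes.face false hb z := e
    change A.cubes.face true h₁ _ = A.cubes.face false h₁ _
    rw [A.cubes.face_face _ _ h₁ ha h₂ hb, A.cubes.face_face _ _ h₁ ha h₂ hb, e]
  exact (A.face_add_ne true ha hb h₁ x z hxz (key true hxz)).trans
    ((add_congr hxy hzt _ _).trans (A.face_add_ne false ha hb h₁ y t hyt (key false hyt)).symm)

end PreChiral

/-! ### Comparisons of mixed functors and of their composites. -/

namespace MixedFunctor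

open MultCat PreChiral

variable {p : ℕ∞} {A B C : ChiralMultipleCategory.{u}} (R : MixedFunctor p A B)
  {i k ka kb : Finset ℕ+} {j a b : ℕ+}

theorem consec_obj {h : IsExt j k i} {x y : A.cube i} (e : A.cubes.Consec h x y) :
    B.cubes.Consec h (R.obj x) (R.obj y) :=
  R.toHom.consec_obj e

theorem consec_mor {h : IsExt j k i} {x y : A.map i} (e : A.maps.Consec h x y) :
    B.maps.Consec h (R.mor x) (R.mor y) :=
  R.toHom.consec_mor e

/-- The unit comparison is directed differently in the lax and in the colax case, but its domain has
the same `j`-faces in both. Together with specialness this gives the consecutivity of comparisons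
without further case distinctions. -/
theorem face_src_unit (α : Bool) (h : IsExt j k i) (t : A.cube k) :
    B.cubes.face α h (B.src (R.unit h t)) = R.obj t := by
  rcases le_or_gt p (j : ℕ) with hp | hp
  · rw [(R.unit_lax h t hp).1, B.cubes.face_deg]
  · rw [(R.unit_colax h t hp).1, R.face_obj, A.cubes.face_deg]

theorem face_fst_src_mul (h : IsExt j k i) {x y : A.cube i} (e : A.cubes.Consec h x y) :
    B.cubes.face false h (B.src (R.mul h x y e)) = B.cubes.face false h (R.obj x) := by
  rcases le_or_gt p (j : ℕ) with hp | hp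
  · rw [(R.mul_lax h x y e (R.consec_obj e) hp).1, B.face_add_fst]
  · rw [(R.mul_colax h x y e (R.consec_obj e) hp).1, R.face_obj, A.face_add_fst, R.face_obj]

theorem face_snd_src_mul (h : IsExt j k i) {x y : A.cube i} (e : A.cubes.Consec h x y) :
    B.cubes.face true h (B.src (R.mul h x y e)) = B.cubes.face true h (R.obj y) := by
  rcases le_or_gt p (j : ℕ) with hp | hp
  · rw [(R.mul_lax h x y e (R.consec_obj e) hp).1, B.face_add_snd]
  · rw [(R.mul_colax h x y e (R.consec_obj e) hp).1, R.face_obj, A.face_add_snd, R.face_obj]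

theorem consec_unit_one (h : IsExt j k i) (x : A.cube i) :
    B.maps.Consec h (R.unit h (A.cubes.face false h x)) (B.one (R.obj x)) :=
  consec_of_isSpecial (R.unit_special _ _) (isSpecial_one _ _)
    ((R.face_src_unit _ _ _).trans (by rw [B.src_one, R.face_obj]))

theorem consec_one_unit (h : IsExt j k i) (x : A.cube i) :
    B.maps.Consec h (B.one (R.obj x)) (R.unit h (A.cubes.face true h x)) :=
  consec_of_isSpecial (isSpecial_one _ _) (R.unit_special _ _)
    (Eq.trans (by rw [B.src_one, R.face_obj]) (R.face_src_unit _ _ _).symm)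

theorem consec_mul_one (h : IsExt j k i) {x y z : A.cube i} (e : A.cubes.Consec h x y)
    (e' : A.cubes.Consec h y z) : B.maps.Consec h (R.mul h x y e) (B.one (R.obj z)) :=
  consec_of_isSpecial (R.mul_special _ _ _ _) (isSpecial_one _ _)
    ((R.face_snd_src_mul h e).trans ((R.consec_obj e').trans (by rw [B.src_one])))

theorem consec_one_mul (h : IsExt j k i) {x y z : A.cube i} (e : A.cubes.Consec h x y)
    (e' : A.cubes.Consec h y z) : B.maps.Consec h (B.one (R.obj x)) (R.mul h y z e') :=
  consec_of_isSpecial (isSpecial_one _ _) (R.mul_special _ _ _ _)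
    (Eq.trans (by rw [B.src_one]; exact R.consec_obj e) (R.face_fst_src_mul h e').symm)

theorem mul_congr {h : IsExt j k i} {x y x' y' : A.cube i} (hx : x = x') (hy : y = y')
    (e : A.cubes.Consec h x y) (e' : A.cubes.Consec h x' y') : R.mul h x y e = R.mul h x' y' e' := by
  subst hx hy; rfl

/-- The `a`-face of a comparison in direction `b` is the comparison of the `a`-faces, by `mul_face`;
the two faces to be compared are comparisons of equal pairs. -/
theorem consec_mul_mul (ha : IsExt a ka i) (hb : IsExt b kb i) (hab : a ≠ b) {x y z t : A.cube i}
    (hxy : A.cubes.Consec ha x y) (hzt : A.cubes.Consec ha z t) (hxz : A.cubes.Consec hb x z)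
    (hyt : A.cubes.Consec hb y t) : B.maps.Consec ha (R.mul hb x z hxz) (R.mul hb y t hyt) := by
  obtain ⟨m, h₁, h₂⟩ := ha.exists_square hb hab
  have key : ∀ α {x z : A.cube i}, A.cubes.Consec hb x z →
      A.cubes.Consec h₁ (A.cubes.face α ha x) (A.cubes.face α ha z) := by
    intro α x z e
    have e : A.cubes.face true hb x = A.cubes.face false hb z := e
    change A.cubes.face true h₁ _ = A.cubes.face false h₁ _
    rw [A.cubes.face_face _ _ h₁ ha h₂ hb, A.cubes.face_face _ _ h₁ ha h₂ hb, e]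
  exact (R.mul_face true ha hb h₁ x z hxz (key true hxz)).trans
    ((R.mul_congr hxy hzt _ _).trans (R.mul_face false ha hb h₁ y t hyt (key false hyt)).symm)

section Par

variable {R}

/-- Domain and codomain of `f` are separate variables, so that naturality can be used at a
comparison or a component whose ends are known only up to a proved equality. The same holds for the
three lemmas that follow. -/
theorem par_unit_natural_lax (hp : p ≤ (j : ℕ)) (h : IsExt j k i) {f : A.map k} {x y : A.cube k}
    (hx : A.src f = x) (hy : A.tgt f = y) :
    par (R.unit h x) * par (R.mor (A.maps.deg h f)) =
      par (B.maps.deg h (R.mor f)) * par (R.unit h y) := by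
  subst hx hy
  exact (R.unit_natural_lax h f hp).eq

theorem par_unit_natural_colax (hp : ((j : ℕ) : ℕ∞) < p) (h : IsExt j k i) {f : A.map k}
    {x y : A.cube k} (hx : A.src f = x) (hy : A.tgt f = y) :
    par (R.mor (A.maps.deg h f)) * par (R.unit h y) =
      par (R.unit h x) * par (B.maps.deg h (R.mor f)) := by
  subst hx hy
  exact (R.unit_natural_colax h f hp).eq

theorem par_mul_natural_lax (hp : p ≤ (j : ℕ)) (h : IsExt j k i) {f g : A.map i}
    {x x' y y' : A.cube i} (hx : A.src f = x) (hy : A.src g = y) (hx' : A.tgt f = x')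
    (hy' : A.tgt g = y') (e : A.maps.Consec h f g) (hs : A.cubes.Consec h x y)
    (ht : A.cubes.Consec h x' y') :
    par (R.mul h x y hs) * par (R.mor (A.addM h f g e)) =
      par (B.addM h (R.mor f) (R.mor g) (R.consec_mor e)) * par (R.mul h x' y' ht) := by
  subst hx hy hx' hy'
  exact (R.mul_natural_lax h f g e hs ht _ hp).eq

theorem par_mul_natural_colax (hp : ((j : ℕ) : ℕ∞) < p) (h : IsExt j k i) {f g : A.map i}
    {x x' y y' : A.cube i} (hx : A.src f = x) (hy : A.src g = y) (hx' : A.tgt f = x')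
    (hy' : A.tgt g = y') (e : A.maps.Consec h f g) (hs : A.cubes.Consec h x y)
    (ht : A.cubes.Consec h x' y') :
    par (R.mor (A.addM h f g e)) * par (R.mul h x' y' ht) =
      par (R.mul h x y hs) * par (B.addM h (R.mor f) (R.mor g) (R.consec_mor e)) := by
  subst hx hy hx' hy'
  exact (R.mul_natural_colax h f g e hs ht _ hp).eq

end Par

/-- The types of the comparisons do not depend on the underlying morphism, so no heterogeneous
equality arises; all the other fields are propositions. -/
theorem ext_of {R S : MixedFunctor p A B}
    (obj : ∀ {i : Finset ℕ+} (x : A.cube i), R.obj x = S.obj x)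
    (mor : ∀ {i : Finset ℕ+} (f : A.map i), R.mor f = S.mor f)
    (unit : ∀ {j : ℕ+} {k i : Finset ℕ+} (h : IsExt j k i) (t : A.cube k),
      R.unit h t = S.unit h t)
    (mul : ∀ {j : ℕ+} {k i : Finset ℕ+} (h : IsExt j k i) (x y : A.cube i)
      (hxy : A.cubes.Consec h x y), R.mul h x y hxy = S.mul h x y hxy) : R = S := by
  have hh : R.toHom = S.toHom := Hom.ext (by funext i x; exact obj x) (by funext i x; exact mor x)
  have hu : @R.unit = @S.unit := by funext j k i h t; exact unit h t
  have hm : @R.mul = @S.mul := by funext j k i h x y e; exact mul h x y e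
  cases R; cases S
  cases hh; cases hu; cases hm
  rfl

section Comp

variable (S : MixedFunctor p B C)

/-- The unit comparison of a composite. -/
noncomputable def compUnit (h : IsExt j k i) (t : A.cube k) : C.map i :=
  if p ≤ (j : ℕ) then C.cmp (S.unit h (R.obj t)) (S.mor (R.unit h t))
  else C.cmp (S.mor (R.unit h t)) (S.unit h (R.obj t))

/-- The comparison of a composite for the compositions. -/
noncomputable def compMul (h : IsExt j k i) (x y : A.cube i) (e : A.cubes.Consec h x y) : C.map i :=
  if p ≤ (j : ℕ) then C.cmp (S.mul h (R.obj x) (R.obj y) (R.consec_obj e)) (S.mor (R.mul h x y e))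
  else C.cmp (S.mor (R.mul h x y e)) (S.mul h (R.obj x) (R.obj y) (R.consec_obj e))

variable {R S}

/-- Composability of the two comparisons is checked here, so that the junk value of `cmp` never
occurs. In the lax case the comparison of `S` comes first, in the colax case last. -/
theorem par_compUnit_lax (hp : p ≤ (j : ℕ)) (h : IsExt j k i) (t : A.cube k) :
    par (compUnit R S h t) = par (S.unit h (R.obj t)) * par (S.mor (R.unit h t)) := by
  rw [compUnit, if_pos hp, par_cmp]
  rw [(S.unit_lax h _ hp).2, S.src_mor, (R.unit_lax h t hp).1]

theorem par_compUnit_colax (hp : ((j : ℕ) : ℕ∞) < p) (h : IsExt j k i) (t : A.cube k) :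
    par (compUnit R S h t) = par (S.mor (R.unit h t)) * par (S.unit h (R.obj t)) := by
  rw [compUnit, if_neg hp.not_ge, par_cmp]
  rw [(S.unit_colax h _ hp).1, S.tgt_mor, (R.unit_colax h t hp).2]

theorem par_compMul_lax (hp : p ≤ (j : ℕ)) (h : IsExt j k i) {x y : A.cube i}
    (e : A.cubes.Consec h x y) : par (compMul R S h x y e) =
      par (S.mul h (R.obj x) (R.obj y) (R.consec_obj e)) * par (S.mor (R.mul h x y e)) := by
  rw [compMul, if_pos hp, par_cmp]
  rw [(S.mul_lax h _ _ _ (S.consec_obj (R.consec_obj e)) hp).2, S.src_mor,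
    (R.mul_lax h x y e (R.consec_obj e) hp).1]

theorem par_compMul_colax (hp : ((j : ℕ) : ℕ∞) < p) (h : IsExt j k i) {x y : A.cube i}
    (e : A.cubes.Consec h x y) : par (compMul R S h x y e) =
      par (S.mor (R.mul h x y e)) * par (S.mul h (R.obj x) (R.obj y) (R.consec_obj e)) := by
  rw [compMul, if_neg hp.not_ge, par_cmp]
  rw [(S.mul_colax h _ _ _ (S.consec_obj (R.consec_obj e)) hp).1, S.tgt_mor,
    (R.mul_colax h x y e (R.consec_obj e) hp).2]

theorem compUnit_lax (hp : p ≤ (j : ℕ)) (h : IsExt j k i) (t : A.cube k) :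
    C.IsHom (compUnit R S h t) (C.cubes.deg h (S.obj (R.obj t))) (S.obj (R.obj (A.cubes.deg h t))) :=
  ⟨(src_of_par (par_compUnit_lax hp h t)).trans (S.unit_lax h _ hp).1,
    (tgt_of_par (par_compUnit_lax hp h t)).trans (by rw [S.tgt_mor, (R.unit_lax h t hp).2])⟩

theorem compUnit_colax (hp : ((j : ℕ) : ℕ∞) < p) (h : IsExt j k i) (t : A.cube k) :
    C.IsHom (compUnit R S h t) (S.obj (R.obj (A.cubes.deg h t))) (C.cubes.deg h (S.obj (R.obj t))) :=
  ⟨(src_of_par (par_compUnit_colax hp h t)).trans (by rw [S.src_mor, (R.unit_colax h t hp).1]),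
    (tgt_of_par (par_compUnit_colax hp h t)).trans (S.unit_colax h _ hp).2⟩

theorem compMul_lax (hp : p ≤ (j : ℕ)) (h : IsExt j k i) {x y : A.cube i}
    (e : A.cubes.Consec h x y) (e' : C.cubes.Consec h (S.obj (R.obj x)) (S.obj (R.obj y))) :
    C.IsHom (compMul R S h x y e) (C.add h (S.obj (R.obj x)) (S.obj (R.obj y)) e')
      (S.obj (R.obj (A.add h x y e))) :=
  ⟨(src_of_par (par_compMul_lax hp h e)).trans (S.mul_lax h _ _ _ _ hp).1,
    (tgt_of_par (par_compMul_lax hp h e)).trans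
      (by rw [S.tgt_mor, (R.mul_lax h x y e (R.consec_obj e) hp).2])⟩

theorem compMul_colax (hp : ((j : ℕ) : ℕ∞) < p) (h : IsExt j k i) {x y : A.cube i}
    (e : A.cubes.Consec h x y) (e' : C.cubes.Consec h (S.obj (R.obj x)) (S.obj (R.obj y))) :
    C.IsHom (compMul R S h x y e) (S.obj (R.obj (A.add h x y e)))
      (C.add h (S.obj (R.obj x)) (S.obj (R.obj y)) e') :=
  ⟨(src_of_par (par_compMul_colax hp h e)).trans
      (by rw [S.src_mor, (R.mul_colax h x y e (R.consec_obj e) hp).1]),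
    (tgt_of_par (par_compMul_colax hp h e)).trans (S.mul_colax h _ _ _ _ hp).2⟩

theorem compUnit_special (h : IsExt j k i) (t : A.cube k) : C.IsSpecial h (compUnit R S h t) := by
  rcases le_or_gt p (j : ℕ) with hp | hp
  · exact (S.unit_special _ _).of_par ((R.unit_special _ _).mor S.toHom) (par_compUnit_lax hp h t)
  · exact ((R.unit_special _ _).mor S.toHom).of_par (S.unit_special _ _) (par_compUnit_colax hp h t)

theorem compMul_special (h : IsExt j k i) {x y : A.cube i} (e : A.cubes.Consec h x y) :
    C.IsSpecial h (compMul R S h x y e) := by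
  rcases le_or_gt p (j : ℕ) with hp | hp
  · exact (S.mul_special _ _ _ _).of_par ((R.mul_special _ _ _ _).mor S.toHom)
      (par_compMul_lax hp h e)
  · exact ((R.mul_special _ _ _ _).mor S.toHom).of_par (S.mul_special _ _ _ _)
      (par_compMul_colax hp h e)

/-- Faces in another direction preserve the product defining the comparison, and each factor is
consistent with them. -/
theorem compUnit_face (α : Bool) {l : ℕ+} {m n : Finset ℕ+} (hl : IsExt l k i) (hj : IsExt j n i)
    (hj' : IsExt j m k) (hl' : IsExt l m n) (t : A.cube n) :
    C.maps.face α hl (compUnit R S hj t) = compUnit R S hj' (A.cubes.face α hl' t) := by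
  apply par_injective
  rcases le_or_gt p (j : ℕ) with hp | hp
  · rw [par_face α hl (par_compUnit_lax hp hj t), par_compUnit_lax hp, S.unit_face α hl hj hj' hl',
      S.face_mor, R.unit_face α hl hj hj' hl', R.face_obj]
  · rw [par_face α hl (par_compUnit_colax hp hj t), par_compUnit_colax hp,
      S.unit_face α hl hj hj' hl', S.face_mor, R.unit_face α hl hj hj' hl', R.face_obj]

theorem compMul_face (α : Bool) {l : ℕ+} {m n : Finset ℕ+} (hl : IsExt l k i) (hj : IsExt j n i)
    (hj' : IsExt j m k) {x y : A.cube i} (e : A.cubes.Consec hj x y)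
    (e' : A.cubes.Consec hj' (A.cubes.face α hl x) (A.cubes.face α hl y)) :
    C.maps.face α hl (compMul R S hj x y e) =
      compMul R S hj' (A.cubes.face α hl x) (A.cubes.face α hl y) e' := by
  apply par_injective
  have e'' : B.cubes.Consec hj' (B.cubes.face α hl (R.obj x)) (B.cubes.face α hl (R.obj y)) := by
    rw [R.face_obj, R.face_obj]
    exact R.consec_obj e'
  rcases le_or_gt p (j : ℕ) with hp | hp
  · rw [par_face α hl (par_compMul_lax hp hj e), par_compMul_lax hp,
      S.mul_face α hl hj hj' _ _ _ e'', S.face_mor, R.mul_face α hl hj hj' _ _ _ e']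
    simp only [R.face_obj]
  · rw [par_face α hl (par_compMul_colax hp hj e), par_compMul_colax hp,
      S.mul_face α hl hj hj' _ _ _ e'', S.face_mor, R.mul_face α hl hj hj' _ _ _ e']
    simp only [R.face_obj]

end Comp

end MixedFunctor

/-! ### Coherence of composite mixed functors. -/

namespace MixedFunctor

open MultCat PreChiral

variable {p : ℕ∞} {A B C : ChiralMultipleCategory.{u}}

/-- The interchanger axiom of a composite, colax in one direction and lax in the other. Here `e₁` is
the axiom of the outer functor, `e₂` the image of the axiom of the inner one, both containing the
image `Y` of the middle interchanger; `e₃` and `e₄` are naturality equations for the outer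
comparisons, which bring the two hexagons together. -/
theorem mixed_pasting {M : Type u} [Semigroup M] {A₁ A₂ X B₁ B₂ K Y N P Q U V W N' K' : M}
    (e₁ : A₂ * (X * B₁) = K * (Y * N)) (e₂ : P * (Y * Q) = U * (V * W)) (e₃ : Q * N' = N * B₂)
    (e₄ : K' * P = A₁ * K) : A₁ * A₂ * (X * (B₁ * B₂)) = K' * U * (V * (W * N')) :=
  calc A₁ * A₂ * (X * (B₁ * B₂)) = A₁ * (A₂ * (X * B₁)) * B₂ := by simp only [mul_assoc]
    _ = A₁ * K * (Y * (N * B₂)) := by rw [e₁]; simp only [mul_assoc]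
    _ = K' * (P * (Y * Q)) * N' := by rw [← e₄, ← e₃]; simp only [mul_assoc]
    _ = K' * U * (V * (W * N')) := by rw [e₂]; simp only [mul_assoc]

/-- The composite of two mixed functors. -/
noncomputable def comp (R : MixedFunctor p A B) (S : MixedFunctor p B C) : MixedFunctor p A C where
  toHom := R.toHom.comp S.toHom
  unit h t := compUnit R S h t
  mul h x y e := compMul R S h x y e
  unit_lax h t hp := compUnit_lax hp h t
  unit_colax h t hp := compUnit_colax hp h t
  mul_lax h x y e e' hp := compMul_lax hp h e e'
  mul_colax h x y e e' hp := compMul_colax hp h e e'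
  unit_special h t := compUnit_special h t
  mul_special h x y e := compMul_special h e
  unit_face α _ _ _ _ _ _ hl hj hj' hl' t := compUnit_face α hl hj hj' hl' t
  mul_face α _ _ _ _ _ _ hl hj hj' x y e e' := compMul_face α hl hj hj' e e'
  unit_natural_lax {j k i} h f hp := by
    -- The pattern of all the axioms below: `e₁` is the axiom of `S` at the image of `R`, and `e₂`
    -- is the image under `S` of the axiom of `R`. What remains is associativity.
    have e₁ := (S.unit_natural_lax h (R.mor f) hp).eq
    have e₂ := ((R.unit_natural_lax h f hp).map S.toHom).eq
    simp only [pprod, List.map, R.src_mor, R.tgt_mor] at e₁ e₂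
    refine commutes_two ?_ ?_
    · rw [(compUnit_lax hp h _).2, Hom.src_mor, A.src_deg, Hom.comp_obj]
    · simp only [pprod, Hom.comp_mor, par_compUnit_lax hp]
      grind
  unit_natural_colax {j k i} h f hp := by
    have e₁ := (S.unit_natural_colax h (R.mor f) hp).eq
    have e₂ := ((R.unit_natural_colax h f hp).map S.toHom).eq
    simp only [pprod, List.map, R.src_mor, R.tgt_mor] at e₁ e₂
    refine commutes_two ?_ ?_
    · rw [(compUnit_colax hp h _).1, Hom.tgt_mor, A.tgt_deg, Hom.comp_obj]
    · simp only [pprod, Hom.comp_mor, par_compUnit_colax hp]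
      grind
  mul_natural_lax {j k i} h f g hfg hs ht hR hp := by
    have e₁ := par_mul_natural_lax (R := S) hp h (R.src_mor f) (R.src_mor g) (R.tgt_mor f)
      (R.tgt_mor g) (R.consec_mor hfg) (R.consec_obj hs) (R.consec_obj ht)
    have e₂ := ((R.mul_natural_lax h f g hfg hs ht (R.consec_mor hfg) hp).map S.toHom).eq
    simp only [pprod, List.map] at e₂
    refine commutes_two ?_ ?_
    · rw [(compMul_lax hp h _ (S.consec_obj (R.consec_obj hs))).2, Hom.src_mor, src_addM',
        Hom.comp_obj]
    · simp only [pprod, Hom.comp_mor, par_compMul_lax hp]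
      grind
  mul_natural_colax {j k i} h f g hfg hs ht hR hp := by
    have e₁ := par_mul_natural_colax (R := S) hp h (R.src_mor f) (R.src_mor g) (R.tgt_mor f)
      (R.tgt_mor g) (R.consec_mor hfg) (R.consec_obj hs) (R.consec_obj ht)
    have e₂ := ((R.mul_natural_colax h f g hfg hs ht (R.consec_mor hfg) hp).map S.toHom).eq
    simp only [pprod, List.map] at e₂
    refine commutes_two ?_ ?_
    · rw [(compMul_colax hp h _ (S.consec_obj (R.consec_obj ht))).1, Hom.tgt_mor, tgt_addM',
        Hom.comp_obj]
    · simp only [pprod, Hom.comp_mor, par_compMul_colax hp]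
      grind
  lam_lax {j k i} h x hx hR hp := by
    have hy := consec_deg_face h (R.obj x)
    have e₁ := (S.lam_lax h (R.obj x) hy (S.consec_unit_one _ _) hp).eq
    have e₂ := ((R.lam_lax h x hx (R.consec_unit_one _ _) hp).map S.toHom).eq
    -- Naturality of the comparison of `S`, at the unit comparison of `R` paired with an identity,
    -- glues `e₁` to `e₂`. Then `e₄` splits the sum of the composite unit comparison with an
    -- identity.
    have e₃ := par_mul_natural_lax (R := S) hp h (R.unit_lax h (A.cubes.face false h x) hp).1
      (B.src_one (R.obj x)) (R.unit_lax h (A.cubes.face false h x) hp).2 (B.tgt_one (R.obj x))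
      (R.consec_unit_one _ _) (by rw [← R.face_obj]; exact hy) (R.consec_obj hx)
    have e₄ := par_addM (par_compUnit_lax (S := S) hp h (A.cubes.face false h x))
      (one_mul_par (C.src_one (S.obj (R.obj x)))).symm hR
      (by rw [← R.face_obj]; exact S.consec_unit_one _ _)
      (S.mor_one _ ▸ S.consec_mor (R.consec_unit_one _ _))
    refine commutes_one ?_
    simp only [pprod, List.map, R.face_obj, S.mor_one, Hom.comp_mor, Hom.comp_obj,
      par_compMul_lax hp] at e₁ e₂ e₃ e₄ ⊢
    rw [e₄]
    grind
  lam_colax {j k i} h x hx hR hp := by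
    have hy := consec_deg_face h (R.obj x)
    have e₁ := (S.lam_colax h (R.obj x) hy (S.consec_unit_one _ _) hp).eq
    have e₂ := ((R.lam_colax h x hx (R.consec_unit_one _ _) hp).map S.toHom).eq
    have e₃ := par_mul_natural_colax (R := S) hp h (R.unit_colax h (A.cubes.face false h x) hp).1
      (B.src_one (R.obj x)) (R.unit_colax h (A.cubes.face false h x) hp).2 (B.tgt_one (R.obj x))
      (R.consec_unit_one _ _) (R.consec_obj hx) (by rw [← R.face_obj]; exact hy)
    have e₄ := par_addM (par_compUnit_colax (S := S) hp h (A.cubes.face false h x))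
      (one_mul_par (C.src_one (S.obj (R.obj x)))).symm hR
      (S.mor_one _ ▸ S.consec_mor (R.consec_unit_one _ _))
      (by rw [← R.face_obj]; exact S.consec_unit_one _ _)
    refine commutes_one ?_
    simp only [pprod, List.map, R.face_obj, S.mor_one, Hom.comp_mor, Hom.comp_obj,
      par_compMul_colax hp] at e₁ e₂ e₃ e₄ ⊢
    rw [e₄]
    grind
  rho_lax {j k i} h x hx hR hp := by
    have hy := consec_face_deg h (R.obj x)
    have e₁ := (S.rho_lax h (R.obj x) hy (S.consec_one_unit _ _) hp).eq
    have e₂ := ((R.rho_lax h x hx (R.consec_one_unit _ _) hp).map S.toHom).eq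
    have e₃ := par_mul_natural_lax (R := S) hp h (B.src_one (R.obj x))
      (R.unit_lax h (A.cubes.face true h x) hp).1 (B.tgt_one (R.obj x))
      (R.unit_lax h (A.cubes.face true h x) hp).2 (R.consec_one_unit _ _) (by rw [← R.face_obj]; exact hy)
      (R.consec_obj hx)
    have e₄ := par_addM (one_mul_par (C.src_one (S.obj (R.obj x)))).symm
      (par_compUnit_lax (S := S) hp h (A.cubes.face true h x)) hR
      (by rw [← R.face_obj]; exact S.consec_one_unit _ _)
      (S.mor_one _ ▸ S.consec_mor (R.consec_one_unit _ _))
    refine commutes_one ?_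
    simp only [pprod, List.map, R.face_obj, S.mor_one, Hom.comp_mor, Hom.comp_obj,
      par_compMul_lax hp] at e₁ e₂ e₃ e₄ ⊢
    rw [e₄]
    grind
  rho_colax {j k i} h x hx hR hp := by
    have hy := consec_face_deg h (R.obj x)
    have e₁ := (S.rho_colax h (R.obj x) hy (S.consec_one_unit _ _) hp).eq
    have e₂ := ((R.rho_colax h x hx (R.consec_one_unit _ _) hp).map S.toHom).eq
    have e₃ := par_mul_natural_colax (R := S) hp h (B.src_one (R.obj x))
      (R.unit_colax h (A.cubes.face true h x) hp).1 (B.tgt_one (R.obj x))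
      (R.unit_colax h (A.cubes.face true h x) hp).2 (R.consec_one_unit _ _) (R.consec_obj hx)
      (by rw [← R.face_obj]; exact hy)
    have e₄ := par_addM (one_mul_par (C.src_one (S.obj (R.obj x)))).symm
      (par_compUnit_colax (S := S) hp h (A.cubes.face true h x)) hR
      (S.mor_one _ ▸ S.consec_mor (R.consec_one_unit _ _))
      (by rw [← R.face_obj]; exact S.consec_one_unit _ _)
    refine commutes_one ?_
    simp only [pprod, List.map, R.face_obj, S.mor_one, Hom.comp_mor, Hom.comp_obj,
      par_compMul_colax hp] at e₁ e₂ e₃ e₄ ⊢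
    rw [e₄]
    grind
  kap_lax {j k i} h x y z hxy hyz h₁ h₂ h₃ h₄ h₅ h₆ hp := by
    have r₁ := R.consec_obj hxy
    have r₂ := R.consec_obj hyz
    have e₁ := (S.kap_lax h (R.obj x) (R.obj y) (R.obj z) r₁ r₂ h₁ h₂ (S.consec_mul_one h r₁ r₂)
      (consec_add_left r₁ r₂) (S.consec_one_mul h r₁ r₂) (consec_add_right r₁ r₂) hp).eq
    have e₂ := ((R.kap_lax h x y z hxy hyz r₁ r₂ (R.consec_mul_one h hxy hyz) h₄
      (R.consec_one_mul h hxy hyz) h₆ hp).map S.toHom).eq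
    have m₁ := R.mul_lax h x y hxy r₁ hp
    have m₂ := R.mul_lax h y z hyz r₂ hp
    -- The associator axiom has two bracketings, so naturality of the comparison of `S` is used
    -- twice: with the comparison of `R` on the left and on the right of an identity.
    have e₃ := par_mul_natural_lax (R := S) hp h m₁.1 (B.src_one (R.obj z)) m₁.2
      (B.tgt_one (R.obj z)) (R.consec_mul_one h hxy hyz) (consec_add_left r₁ r₂) (R.consec_obj h₄)
    have e₄ := par_mul_natural_lax (R := S) hp h (B.src_one (R.obj x)) m₂.1
      (B.tgt_one (R.obj x)) m₂.2 (R.consec_one_mul h hxy hyz) (consec_add_right r₁ r₂)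
      (R.consec_obj h₆)
    have e₅ := par_addM (par_compMul_lax (S := S) hp h hxy)
      (one_mul_par (C.src_one (S.obj (R.obj z)))).symm h₃ (S.consec_mul_one h r₁ r₂)
      (S.mor_one _ ▸ S.consec_mor (R.consec_mul_one h hxy hyz))
    have e₆ := par_addM (one_mul_par (C.src_one (S.obj (R.obj x)))).symm
      (par_compMul_lax (S := S) hp h hyz) h₅ (S.consec_one_mul h r₁ r₂)
      (S.mor_one _ ▸ S.consec_mor (R.consec_one_mul h hxy hyz))
    refine commutes_three ?_ ?_ ?_
    · rw [(C.kap_isHom h _ _ _ h₁ h₂ (consec_add_right h₁ h₂) (consec_add_left h₁ h₂)).2, src_addM']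
      exact add_congr (compMul_lax hp h hxy h₁).1.symm (C.src_one _).symm _ _
    · rw [tgt_addM', (compMul_lax hp h h₄ (S.consec_obj (R.consec_obj h₄))).1]
      exact add_congr (compMul_lax hp h hxy h₁).2 (C.tgt_one _) _ _
    simp only [pprod, List.map, S.mor_one, Hom.comp_mor, Hom.comp_obj,
      par_compMul_lax hp] at e₁ e₂ e₃ e₄ e₅ e₆ ⊢
    rw [e₅, e₆]
    grind
  kap_colax {j k i} h x y z hxy hyz h₁ h₂ h₃ h₄ h₅ h₆ hp := by
    have r₁ := R.consec_obj hxy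
    have r₂ := R.consec_obj hyz
    have e₁ := (S.kap_colax h (R.obj x) (R.obj y) (R.obj z) r₁ r₂ h₁ h₂ (S.consec_mul_one h r₁ r₂)
      (consec_add_left r₁ r₂) (S.consec_one_mul h r₁ r₂) (consec_add_right r₁ r₂) hp).eq
    have e₂ := ((R.kap_colax h x y z hxy hyz r₁ r₂ (R.consec_mul_one h hxy hyz) h₄
      (R.consec_one_mul h hxy hyz) h₆ hp).map S.toHom).eq
    have m₁ := R.mul_colax h x y hxy r₁ hp
    have m₂ := R.mul_colax h y z hyz r₂ hp
    have e₃ := par_mul_natural_colax (R := S) hp h m₁.1 (B.src_one (R.obj z)) m₁.2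
      (B.tgt_one (R.obj z)) (R.consec_mul_one h hxy hyz) (R.consec_obj h₄) (consec_add_left r₁ r₂)
    have e₄ := par_mul_natural_colax (R := S) hp h (B.src_one (R.obj x)) m₂.1
      (B.tgt_one (R.obj x)) m₂.2 (R.consec_one_mul h hxy hyz) (R.consec_obj h₆)
      (consec_add_right r₁ r₂)
    have e₅ := par_addM (par_compMul_colax (S := S) hp h hxy)
      (one_mul_par (C.src_one (S.obj (R.obj z)))).symm h₃
      (S.mor_one _ ▸ S.consec_mor (R.consec_mul_one h hxy hyz)) (S.consec_mul_one h r₁ r₂)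
    have e₆ := par_addM (one_mul_par (C.src_one (S.obj (R.obj x)))).symm
      (par_compMul_colax (S := S) hp h hyz) h₅
      (S.mor_one _ ▸ S.consec_mor (R.consec_one_mul h hxy hyz)) (S.consec_one_mul h r₁ r₂)
    refine commutes_three ?_ ?_ ?_
    · rw [src_addM', (compMul_colax hp h h₆ (S.consec_obj (R.consec_obj h₆))).2]
      exact add_congr (C.src_one _).symm (compMul_colax hp h hyz h₂).1.symm _ _
    · rw [(C.kap_isHom h _ _ _ h₁ h₂ (consec_add_right h₁ h₂) (consec_add_left h₁ h₂)).1, tgt_addM']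
      exact add_congr (C.tgt_one _) (compMul_colax hp h hyz h₂).2 _ _
    simp only [pprod, List.map, S.mor_one, Hom.comp_mor, Hom.comp_obj,
      par_compMul_colax hp] at e₁ e₂ e₃ e₄ e₅ e₆ ⊢
    rw [e₅, e₆]
    grind
  chi_lax_lax {a b ka kb i} hab ha hb x y z t hxy hzt hxz hyt hxy' hzt' hxz' hyt' h₁ h₂ h₃ h₄ hp := by
    -- From `p ≤ a < b`, the second direction is lax as well.
    have hp' : p ≤ (b : ℕ) := hp.trans (by exact_mod_cast hab.le)
    have r₁ := R.consec_obj hxy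
    have r₂ := R.consec_obj hzt
    have r₃ := R.consec_obj hxz
    have r₄ := R.consec_obj hyt
    have ra := consec_add_add ha hb hab.ne r₁ r₂ r₃ r₄
    have rb := consec_add_add hb ha hab.ne' r₃ r₄ r₁ r₂
    have sa := S.consec_mul_mul ha hb hab.ne r₁ r₂ r₃ r₄
    have sb := S.consec_mul_mul hb ha hab.ne' r₃ r₄ r₁ r₂
    have ta := R.consec_mul_mul ha hb hab.ne hxy hzt hxz hyt
    have tb := R.consec_mul_mul hb ha hab.ne' hxz hyt hxy hzt
    have e₁ := (S.chi_lax_lax hab ha hb (R.obj x) (R.obj y) (R.obj z) (R.obj t) r₁ r₂ r₃ r₄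
      hxy' hzt' hxz' hyt' sa ra sb rb hp).eq
    have e₂ := ((R.chi_lax_lax hab ha hb x y z t hxy hzt hxz hyt r₁ r₂ r₃ r₄ ta h₂ tb h₄
      hp).map S.toHom).eq
    have mxy := R.mul_lax ha x y hxy r₁ hp
    have mzt := R.mul_lax ha z t hzt r₂ hp
    have mxz := R.mul_lax hb x z hxz r₃ hp'
    have myt := R.mul_lax hb y t hyt r₄ hp'
    -- Both directions contribute a naturality equation: the comparison of `S` in direction `a` is
    -- natural at the `b`-comparisons of `R`, and that in direction `b` at its `a`-comparisons.
    have e₃ := par_mul_natural_lax (R := S) hp ha mxz.1 myt.1 mxz.2 myt.2 ta ra (R.consec_obj h₂)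
    have e₄ := par_mul_natural_lax (R := S) hp' hb mxy.1 mzt.1 mxy.2 mzt.2 tb rb (R.consec_obj h₄)
    have e₅ := par_addM (par_compMul_lax (S := S) hp' hb hxz) (par_compMul_lax (S := S) hp' hb hyt)
      h₁ sa (S.consec_mor ta)
    have e₆ := par_addM (par_compMul_lax (S := S) hp ha hxy) (par_compMul_lax (S := S) hp ha hzt)
      h₃ sb (S.consec_mor tb)
    refine commutes_three ?_ ?_ ?_
    · rw [(C.chi_isHom hab ha hb _ _ _ _ hxy' hzt' hxz' hyt'
        (consec_add_add hb ha hab.ne' hxz' hyt' hxy' hzt')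
        (consec_add_add ha hb hab.ne hxy' hzt' hxz' hyt')).2, src_addM']
      exact add_congr (compMul_lax hp' hb hxz hxz').1.symm (compMul_lax hp' hb hyt hyt').1.symm _ _
    · rw [tgt_addM', (compMul_lax hp ha h₂ (S.consec_obj (R.consec_obj h₂))).1]
      exact add_congr (compMul_lax hp' hb hxz hxz').2 (compMul_lax hp' hb hyt hyt').2 _ _
    simp only [pprod, List.map, Hom.comp_mor, Hom.comp_obj,
      par_compMul_lax hp, par_compMul_lax hp'] at e₁ e₂ e₃ e₄ e₅ e₆ ⊢
    rw [e₅, e₆]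
    grind
  chi_colax_lax {a b ka kb i} hab ha hb x y z t hxy hzt hxz hyt hxy' hzt' hxz' hyt' h₁ h₂ h₃ h₄ hp hp' := by
    have r₁ := R.consec_obj hxy
    have r₂ := R.consec_obj hzt
    have r₃ := R.consec_obj hxz
    have r₄ := R.consec_obj hyt
    have ra := consec_add_add ha hb hab.ne r₁ r₂ r₃ r₄
    have rb := consec_add_add hb ha hab.ne' r₃ r₄ r₁ r₂
    have sa := S.consec_mul_mul ha hb hab.ne r₁ r₂ r₃ r₄
    have sb := S.consec_mul_mul hb ha hab.ne' r₃ r₄ r₁ r₂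
    have ta := R.consec_mul_mul ha hb hab.ne hxy hzt hxz hyt
    have tb := R.consec_mul_mul hb ha hab.ne' hxz hyt hxy hzt
    have e₁ := (S.chi_colax_lax hab ha hb (R.obj x) (R.obj y) (R.obj z) (R.obj t) r₁ r₂ r₃ r₄
      hxy' hzt' hxz' hyt' sa ra sb rb hp hp').eq
    have e₂ := ((R.chi_colax_lax hab ha hb x y z t hxy hzt hxz hyt r₁ r₂ r₃ r₄ ta h₂ tb h₄
      hp hp').map S.toHom).eq
    have mxy := R.mul_colax ha x y hxy r₁ hp
    have mzt := R.mul_colax ha z t hzt r₂ hp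
    have mxz := R.mul_lax hb x z hxz r₃ hp'
    have myt := R.mul_lax hb y t hyt r₄ hp'
    have e₃ := par_mul_natural_colax (R := S) hp ha mxz.1 myt.1 mxz.2 myt.2 ta ra (R.consec_obj h₂)
    have e₄ := par_mul_natural_lax (R := S) hp' hb mxy.1 mzt.1 mxy.2 mzt.2 tb (R.consec_obj h₄) rb
    have e₅ := par_addM (par_compMul_lax (S := S) hp' hb hxz)
      (par_compMul_lax (S := S) hp' hb hyt) h₁ sa (S.consec_mor ta)
    have e₆ := par_addM (par_compMul_colax (S := S) hp ha hxy)
      (par_compMul_colax (S := S) hp ha hzt) h₃ (S.consec_mor tb) sb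
    refine commutes_three ?_ ?_ ?_
    · rw [tgt_addM', (C.chi_isHom hab ha hb _ _ _ _ hxy' hzt' hxz' hyt'
        (consec_add_add hb ha hab.ne' hxz' hyt' hxy' hzt')
        (consec_add_add ha hb hab.ne hxy' hzt' hxz' hyt')).1]
      exact add_congr (compMul_colax hp ha hxy hxy').2 (compMul_colax hp ha hzt hzt').2 _ _
    · rw [(C.chi_isHom hab ha hb _ _ _ _ hxy' hzt' hxz' hyt'
        (consec_add_add hb ha hab.ne' hxz' hyt' hxy' hzt')
        (consec_add_add ha hb hab.ne hxy' hzt' hxz' hyt')).2, src_addM']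
      exact add_congr (compMul_lax hp' hb hxz hxz').1.symm (compMul_lax hp' hb hyt hyt').1.symm _ _
    simp only [pprod, List.map, Hom.comp_mor, Hom.comp_obj,
      par_compMul_colax hp, par_compMul_lax hp'] at e₁ e₂ e₃ e₄ e₅ e₆ ⊢
    rw [e₅, e₆]
    exact mixed_pasting e₁ e₂ e₃ e₄
  chi_colax_colax {a b ka kb i} hab ha hb x y z t hxy hzt hxz hyt hxy' hzt' hxz' hyt' h₁ h₂ h₃ h₄ hp' := by
    have hp : ((a : ℕ) : ℕ∞) < p := lt_trans (by exact_mod_cast hab) hp'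
    have r₁ := R.consec_obj hxy
    have r₂ := R.consec_obj hzt
    have r₃ := R.consec_obj hxz
    have r₄ := R.consec_obj hyt
    have ra := consec_add_add ha hb hab.ne r₁ r₂ r₃ r₄
    have rb := consec_add_add hb ha hab.ne' r₃ r₄ r₁ r₂
    have sa := S.consec_mul_mul ha hb hab.ne r₁ r₂ r₃ r₄
    have sb := S.consec_mul_mul hb ha hab.ne' r₃ r₄ r₁ r₂
    have ta := R.consec_mul_mul ha hb hab.ne hxy hzt hxz hyt
    have tb := R.consec_mul_mul hb ha hab.ne' hxz hyt hxy hzt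
    have e₁ := (S.chi_colax_colax hab ha hb (R.obj x) (R.obj y) (R.obj z) (R.obj t) r₁ r₂ r₃ r₄
      hxy' hzt' hxz' hyt' sa ra sb rb hp').eq
    have e₂ := ((R.chi_colax_colax hab ha hb x y z t hxy hzt hxz hyt r₁ r₂ r₃ r₄ ta h₂ tb h₄
      hp').map S.toHom).eq
    have mxy := R.mul_colax ha x y hxy r₁ hp
    have mzt := R.mul_colax ha z t hzt r₂ hp
    have mxz := R.mul_colax hb x z hxz r₃ hp'
    have myt := R.mul_colax hb y t hyt r₄ hp'
    have e₃ := par_mul_natural_colax (R := S) hp ha mxz.1 myt.1 mxz.2 myt.2 ta (R.consec_obj h₂) ra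
    have e₄ := par_mul_natural_colax (R := S) hp' hb mxy.1 mzt.1 mxy.2 mzt.2 tb (R.consec_obj h₄) rb
    have e₅ := par_addM (par_compMul_colax (S := S) hp' hb hxz)
      (par_compMul_colax (S := S) hp' hb hyt) h₁ (S.consec_mor ta) sa
    have e₆ := par_addM (par_compMul_colax (S := S) hp ha hxy)
      (par_compMul_colax (S := S) hp ha hzt) h₃ (S.consec_mor tb) sb
    refine commutes_three ?_ ?_ ?_
    · rw [src_addM', (compMul_colax hp' hb h₄ (S.consec_obj (R.consec_obj h₄))).2]
      exact add_congr (compMul_colax hp ha hxy hxy').1.symm (compMul_colax hp ha hzt hzt').1.symm _ _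
    · rw [(C.chi_isHom hab ha hb _ _ _ _ hxy' hzt' hxz' hyt'
        (consec_add_add hb ha hab.ne' hxz' hyt' hxy' hzt')
        (consec_add_add ha hb hab.ne hxy' hzt' hxz' hyt')).1, tgt_addM']
      exact add_congr (compMul_colax hp ha hxy hxy').2 (compMul_colax hp ha hzt hzt').2 _ _
    simp only [pprod, List.map, Hom.comp_mor, Hom.comp_obj,
      par_compMul_colax hp, par_compMul_colax hp'] at e₁ e₂ e₃ e₄ e₅ e₆ ⊢
    rw [e₅, e₆]
    grind
  unit_strict h0 {j k i} h t := by
    -- For `p = 0` every direction is lax, so the lax formula applies, and both factors of the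
    -- comparison are identities.
    have hp : p ≤ (j : ℕ) := h0 ▸ zero_le
    apply par_injective
    rw [par_compUnit_lax hp, R.unit_strict h0, S.mor_one, par_mul_one (S.unit_lax h _ hp).2,
      S.unit_strict h0, Hom.comp_obj]
  mul_strict h0 {j k i} h x y e e' := by
    have hp : p ≤ (j : ℕ) := h0 ▸ zero_le
    apply par_injective
    rw [par_compMul_lax hp, R.mul_strict h0 h x y e (R.consec_obj e), S.mor_one,
      par_mul_one (S.mul_lax h _ _ _ e' hp).2, S.mul_strict h0 h _ _ _ e']
    rfl

end MixedFunctor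

theorem MultCat.Hom.id_obj {A : MultCat.{u}} {i : Finset ℕ+} (x : A.cube i) :
    (Hom.id A).obj x = x := rfl

theorem MultCat.Hom.id_mor {A : MultCat.{u}} {i : Finset ℕ+} (f : A.map i) :
    (Hom.id A).mor f = f := rfl

/-! ### Identities, uniqueness of composites, and the category laws of `p`-morphisms. -/

namespace MixedFunctor

open MultCat PreChiral

variable {p : ℕ∞} {A B C D : ChiralMultipleCategory.{u}}

/-- The identity mixed functor. -/
def id (p : ℕ∞) (A : ChiralMultipleCategory.{u}) : MixedFunctor p A A where
  toHom := Hom.id A.toMultCat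
  unit h t := A.one (A.cubes.deg h t)
  mul h x y e := A.one (A.add h x y e)
  unit_lax h t _ := ⟨A.src_one _, A.tgt_one _⟩
  unit_colax h t _ := ⟨A.src_one _, A.tgt_one _⟩
  mul_lax h x y _ _ _ := ⟨A.src_one _, A.tgt_one _⟩
  mul_colax h x y _ _ _ := ⟨A.src_one _, A.tgt_one _⟩
  unit_special h t := isSpecial_one _ _
  mul_special h x y _ := isSpecial_one _ _
  unit_face α _ _ _ _ _ _ hl hj hj' hl' t := by
    rw [A.face_one, A.cubes.face_deg_ne α hj' hl hl' hj]
  mul_face α _ _ _ _ _ _ hl hj hj' x y e e' := by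
    rw [A.face_one, A.face_add_ne α hl hj hj' x y e e']
  unit_natural_lax h f _ := commutes_of_eq_par (one_mul_par (A.src_deg _ _))
    (par_mul_one (A.tgt_deg _ _))
  unit_natural_colax h f _ := commutes_of_eq_par (par_mul_one (A.tgt_deg _ _))
    (one_mul_par (A.src_deg _ _))
  mul_natural_lax h f g e _ _ _ _ := commutes_of_eq_par (one_mul_par (src_addM' e))
    (par_mul_one (tgt_addM' e))
  mul_natural_colax h f g e _ _ _ _ := commutes_of_eq_par (par_mul_one (tgt_addM' e))
    (one_mul_par (src_addM' e))
  lam_lax h x hx hR _ := commutes_one (by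
    simp only [pprod, Hom.id_obj, Hom.id_mor]
    rw [one_mul_par (A.lam_isHom h x hx).1, addM_one' _ hx]
    exact one_mul_par (A.lam_isHom h x hx).1)
  lam_colax h x hx hR _ := commutes_one (by
    simp only [pprod, Hom.id_obj, Hom.id_mor]
    rw [addM_one' _ hx]
    refine (congrArg _ (one_mul_par (A.lam_isHom h x hx).1)).trans ?_
    exact one_mul_par (A.lam_isHom h x hx).1)
  rho_lax h x hx hR _ := commutes_one (by
    simp only [pprod, Hom.id_obj, Hom.id_mor]
    rw [one_mul_par (A.rho_isHom h x hx).1, addM_one' _ hx]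
    exact one_mul_par (A.rho_isHom h x hx).1)
  rho_colax h x hx hR _ := commutes_one (by
    simp only [pprod, Hom.id_obj, Hom.id_mor]
    rw [addM_one' _ hx]
    refine (congrArg _ (one_mul_par (A.rho_isHom h x hx).1)).trans ?_
    exact one_mul_par (A.rho_isHom h x hx).1)
  kap_lax h x y z e e' _ _ _ h₄ _ h₆ _ := by
    have k := A.kap_isHom h x y z e e' h₆ h₄
    refine commutes_of_eq_par (c := A.kap h x y z e e') ?_ ?_
    · simp only [pprod, Hom.id_obj]
      rw [addM_one' _ h₄, par_mul_one (A.tgt_one _)]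
      exact par_mul_one k.2
    · simp only [pprod, Hom.id_obj, Hom.id_mor]
      rw [addM_one' _ h₆]
      exact (congrArg _ (one_mul_par k.1)).trans (one_mul_par k.1)
  kap_colax h x y z e e' _ _ _ h₄ _ h₆ _ := by
    have k := A.kap_isHom h x y z e e' h₆ h₄
    refine commutes_of_eq_par (c := A.kap h x y z e e') ?_ ?_
    · simp only [pprod, Hom.id_obj]
      rw [addM_one' _ h₆]
      exact (congrArg _ (one_mul_par k.1)).trans (one_mul_par k.1)
    · simp only [pprod, Hom.id_obj, Hom.id_mor]
      rw [addM_one' _ h₄, par_mul_one (A.tgt_one _)]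
      exact par_mul_one k.2
  chi_lax_lax hab ha hb x y z t e₁ e₂ e₃ e₄ _ _ _ _ _ h₂ _ h₄ _ := by
    have k := A.chi_isHom hab ha hb x y z t e₁ e₂ e₃ e₄ h₄ h₂
    refine commutes_of_eq_par (c := A.chi hab ha hb x y z t e₁ e₂ e₃ e₄) ?_ ?_
    · simp only [pprod, Hom.id_obj]
      rw [addM_one' _ h₂, par_mul_one (A.tgt_one _)]
      exact par_mul_one k.2
    · simp only [pprod, Hom.id_mor]
      rw [addM_one' _ h₄]
      exact (congrArg _ (one_mul_par k.1)).trans (one_mul_par k.1)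
  chi_colax_lax hab ha hb x y z t e₁ e₂ e₃ e₄ _ _ _ _ _ h₂ _ h₄ _ _ := by
    have k := A.chi_isHom hab ha hb x y z t e₁ e₂ e₃ e₄ h₄ h₂
    refine commutes_of_eq_par (c := A.chi hab ha hb x y z t e₁ e₂ e₃ e₄) ?_ ?_
    · simp only [pprod, Hom.id_obj]
      rw [addM_one' _ h₂, addM_one' _ h₄]
      exact (congrArg _ (par_mul_one k.2)).trans (one_mul_par k.1)
    · simp only [pprod, Hom.id_mor]
      exact (congrArg _ (par_mul_one k.2)).trans (one_mul_par k.1)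
  chi_colax_colax hab ha hb x y z t e₁ e₂ e₃ e₄ _ _ _ _ _ h₂ _ h₄ _ := by
    have k := A.chi_isHom hab ha hb x y z t e₁ e₂ e₃ e₄ h₄ h₂
    refine commutes_of_eq_par (c := A.chi hab ha hb x y z t e₁ e₂ e₃ e₄) ?_ ?_
    · simp only [pprod, Hom.id_obj]
      rw [addM_one' _ h₄]
      exact (congrArg _ (one_mul_par k.1)).trans (one_mul_par k.1)
    · simp only [pprod, Hom.id_mor]
      rw [addM_one' _ h₂, par_mul_one (A.tgt_one _)]
      exact par_mul_one k.2
  unit_strict _ _ _ _ _ _ := rfl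
  mul_strict _ _ _ _ _ _ _ _ _ := rfl

theorem isIdentity_id : (id p A).IsIdentity := ⟨fun _ => rfl, fun _ => rfl, fun _ _ => rfl,
  fun _ _ _ _ => rfl⟩

theorem IsIdentity.unique {R S : MixedFunctor p A A} (hR : R.IsIdentity) (hS : S.IsIdentity) :
    R = S :=
  ext_of (fun x => (hR.obj x).trans (hS.obj x).symm) (fun f => (hR.mor f).trans (hS.mor f).symm)
    (fun h t => (hR.unit h t).trans (hS.unit h t).symm)
    (fun h x y e => (hR.mul h x y e).trans (hS.mul h x y e).symm)

theorem isComposition_comp (R : MixedFunctor p A B) (S : MixedFunctor p B C) :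
    R.IsComposition S (R.comp S) where
  obj _ := rfl
  mor _ := rfl
  unit_lax h t hp := isComposite_pair_iff.2 (par_compUnit_lax hp h t)
  unit_colax h t hp := isComposite_pair_iff.2 (par_compUnit_colax hp h t)
  mul_lax h _ _ e _ hp := isComposite_pair_iff.2 (par_compMul_lax hp h e)
  mul_colax h _ _ e _ hp := isComposite_pair_iff.2 (par_compMul_colax hp h e)

namespace IsComposition

variable {R : MixedFunctor p A B} {S : MixedFunctor p B C} {T : MixedFunctor p A C}
  {i k : Finset ℕ+} {j : ℕ+}

theorem par_unit_lax (H : R.IsComposition S T) (hp : p ≤ (j : ℕ)) (h : IsExt j k i)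
    (t : A.cube k) :
    par (T.unit h t) = par (S.unit h (R.obj t)) * par (S.mor (R.unit h t)) :=
  isComposite_pair_iff.1 (H.unit_lax h t hp)

theorem par_unit_colax (H : R.IsComposition S T) (hp : ((j : ℕ) : ℕ∞) < p) (h : IsExt j k i)
    (t : A.cube k) :
    par (T.unit h t) = par (S.mor (R.unit h t)) * par (S.unit h (R.obj t)) :=
  isComposite_pair_iff.1 (H.unit_colax h t hp)

theorem par_mul_lax (H : R.IsComposition S T) (hp : p ≤ (j : ℕ)) (h : IsExt j k i)
    {x y : A.cube i} (e : A.cubes.Consec h x y) : par (T.mul h x y e) =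
      par (S.mul h (R.obj x) (R.obj y) (R.consec_obj e)) * par (S.mor (R.mul h x y e)) :=
  isComposite_pair_iff.1 (H.mul_lax h x y e _ hp)

theorem par_mul_colax (H : R.IsComposition S T) (hp : ((j : ℕ) : ℕ∞) < p) (h : IsExt j k i)
    {x y : A.cube i} (e : A.cubes.Consec h x y) : par (T.mul h x y e) =
      par (S.mor (R.mul h x y e)) * par (S.mul h (R.obj x) (R.obj y) (R.consec_obj e)) :=
  isComposite_pair_iff.1 (H.mul_colax h x y e _ hp)

/-- A mixed functor is a composite if it is so on cubes, on maps, and on the comparisons. -/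
theorem of_par (obj : ∀ {i : Finset ℕ+} (x : A.cube i), T.obj x = S.obj (R.obj x))
    (mor : ∀ {i : Finset ℕ+} (f : A.map i), T.mor f = S.mor (R.mor f))
    (unit_lax : ∀ {j : ℕ+} {k i : Finset ℕ+} (h : IsExt j k i) (t : A.cube k), p ≤ (j : ℕ) →
      par (T.unit h t) = par (S.unit h (R.obj t)) * par (S.mor (R.unit h t)))
    (unit_colax : ∀ {j : ℕ+} {k i : Finset ℕ+} (h : IsExt j k i) (t : A.cube k),
      ((j : ℕ) : ℕ∞) < p →
      par (T.unit h t) = par (S.mor (R.unit h t)) * par (S.unit h (R.obj t)))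
    (mul_lax : ∀ {j : ℕ+} {k i : Finset ℕ+} (h : IsExt j k i) (x y : A.cube i)
      (e : A.cubes.Consec h x y), p ≤ (j : ℕ) → par (T.mul h x y e) =
        par (S.mul h (R.obj x) (R.obj y) (R.consec_obj e)) * par (S.mor (R.mul h x y e)))
    (mul_colax : ∀ {j : ℕ+} {k i : Finset ℕ+} (h : IsExt j k i) (x y : A.cube i)
      (e : A.cubes.Consec h x y), ((j : ℕ) : ℕ∞) < p → par (T.mul h x y e) =
        par (S.mor (R.mul h x y e)) * par (S.mul h (R.obj x) (R.obj y) (R.consec_obj e))) :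
    R.IsComposition S T where
  obj := obj
  mor := mor
  unit_lax h t hp := isComposite_pair_iff.2 (unit_lax h t hp)
  unit_colax h t hp := isComposite_pair_iff.2 (unit_colax h t hp)
  mul_lax h x y e _ hp := isComposite_pair_iff.2 (mul_lax h x y e hp)
  mul_colax h x y e _ hp := isComposite_pair_iff.2 (mul_colax h x y e hp)

theorem unique {T' : MixedFunctor p A C} (H : R.IsComposition S T) (H' : R.IsComposition S T') :
    T = T' := by
  refine ext_of (fun x => (H.obj x).trans (H'.obj x).symm)
    (fun f => (H.mor f).trans (H'.mor f).symm) (fun {j} _ _ h t => par_injective ?_)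
    (fun {j} _ _ h x y e => par_injective ?_) <;> rcases le_or_gt p (j : ℕ) with hp | hp
  · rw [H.par_unit_lax hp, H'.par_unit_lax hp]
  · rw [H.par_unit_colax hp, H'.par_unit_colax hp]
  · rw [H.par_mul_lax hp, H'.par_mul_lax hp]
  · rw [H.par_mul_colax hp, H'.par_mul_colax hp]

end IsComposition

/-- The unit law as a relation: with `IsComposition.unique` it gives the equation required in
`Typed`. The image of an identity comparison is absorbed on the lax and on the colax side alike. -/
theorem IsIdentity.isComposition {I : MixedFunctor p A A} (H : I.IsIdentity)
    (R : MixedFunctor p A B) : I.IsComposition R R := by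
  refine .of_par (fun x => by rw [H.obj]) (fun f => by rw [H.mor]) (fun h t hp => ?_)
    (fun h t hp => ?_) (fun h x y e hp => ?_) (fun h x y e hp => ?_)
  · rw [H.obj, H.unit, R.mor_one, par_mul_one (R.unit_lax h t hp).2]
  · rw [H.obj, H.unit, R.mor_one, one_mul_par (R.unit_colax h t hp).1]
  · rw [H.mul, R.mor_one, R.mul_congr (H.obj x) (H.obj y) _ e,
      par_mul_one (R.mul_lax h x y e (R.consec_obj e) hp).2]
  · rw [H.mul, R.mor_one, R.mul_congr (H.obj x) (H.obj y) _ e,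
      one_mul_par (R.mul_colax h x y e (R.consec_obj e) hp).1]

theorem IsIdentity.isComposition_right {I : MixedFunctor p B B} (H : I.IsIdentity)
    (R : MixedFunctor p A B) : R.IsComposition I R := by
  refine .of_par (fun x => by rw [H.obj]) (fun f => by rw [H.mor]) (fun h t hp => ?_)
    (fun h t hp => ?_) (fun h x y e hp => ?_) (fun h x y e hp => ?_)
  · rw [H.mor, H.unit, one_mul_par (R.unit_lax h t hp).1]
  · rw [H.mor, H.unit, par_mul_one (R.unit_colax h t hp).2]
  · rw [H.mor, H.mul, one_mul_par (R.mul_lax h x y e (R.consec_obj e) hp).1]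
  · rw [H.mor, H.mul, par_mul_one (R.mul_colax h x y e (R.consec_obj e) hp).2]

/-- Both comparisons expand to the same product of three factors. The arguments of the comparison of
`T` agree only through the given equations for `RS`, whence the use of `mul_congr`. -/
theorem IsComposition.assoc {R : MixedFunctor p A B} {S : MixedFunctor p B C}
    {T : MixedFunctor p C D} {RS : MixedFunctor p A C} {ST : MixedFunctor p B D}
    {V : MixedFunctor p A D} (H : R.IsComposition S RS) (H' : S.IsComposition T ST)
    (K : RS.IsComposition T V) : R.IsComposition ST V := by
  refine .of_par (fun x => by rw [K.obj, H.obj, H'.obj]) (fun f => by rw [K.mor, H.mor, H'.mor])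
    (fun h t hp => ?_) (fun h t hp => ?_) (fun h x y e hp => ?_) (fun h x y e hp => ?_)
  · rw [K.par_unit_lax hp, H'.par_unit_lax hp, H'.mor, H.obj, T.par_mor (H.par_unit_lax hp h t),
      mul_assoc]
  · rw [K.par_unit_colax hp, H'.par_unit_colax hp, H'.mor, H.obj,
      T.par_mor (H.par_unit_colax hp h t), mul_assoc]
  · rw [K.par_mul_lax hp, H'.par_mul_lax hp, H'.mor, T.par_mor (H.par_mul_lax hp h e), mul_assoc,
      T.mul_congr (H.obj x) (H.obj y)]
  · rw [K.par_mul_colax hp, H'.par_mul_colax hp, H'.mor, T.par_mor (H.par_mul_colax hp h e),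
      mul_assoc, T.mul_congr (H.obj x) (H.obj y)]

end MixedFunctor

namespace MixedFunctor

open MultCat

variable {p : ℕ∞} {A : ChiralMultipleCategory.{u}} {i k : Finset ℕ+} {j : ℕ+}

theorem id_obj (x : A.cube i) : (id p A).obj x = x := rfl

theorem id_mor (f : A.map i) : (id p A).mor f = f := rfl

theorem id_unit (h : IsExt j k i) (t : A.cube k) :
    (id p A).unit h t = A.one (A.cubes.deg h t) := rfl

theorem id_mul (h : IsExt j k i) (x y : A.cube i) (e : A.cubes.Consec h x y) :
    (id p A).mul h x y e = A.one (A.add h x y e) := rfl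

end MixedFunctor

/-! ### Generalised quintets: naturality and identity squares. -/

namespace MixedSquare

open MultCat PreChiral MixedFunctor

variable {p q : ℕ∞} {A B C D : ChiralMultipleCategory.{u}} {R : MixedFunctor p A B}
  {S : MixedFunctor p C D} {U : MixedFunctor q A C} {V : MixedFunctor q B D}
  {i k : Finset ℕ+} {j : ℕ+}

theorem consec_app (φ : MixedSquare R S U V) {h : IsExt j k i} {x y : A.cube i}
    (e : A.cubes.Consec h x y) : D.maps.Consec h (φ.app x) (φ.app y) :=
  (φ.face_app _ _ _).trans ((congrArg φ.app e).trans (φ.face_app _ _ _).symm)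

theorem par_natural (φ : MixedSquare R S U V) {f : A.map i} {x y : A.cube i} (hx : A.src f = x)
    (hy : A.tgt f = y) : par (V.mor (R.mor f)) * par (φ.app y) =
      par (φ.app x) * par (S.mor (U.mor f)) := by
  subst hx hy
  exact (φ.naturality f).eq

/-- The identity square of a mixed functor, in the first direction. -/
def idFst (hpq : p < q) (U : MixedFunctor q A B) :
    MixedSquare (MixedFunctor.id p A) (MixedFunctor.id p B) U U where
  app x := B.one (U.obj x)
  src_app x := B.src_one _
  tgt_app x := B.tgt_one _
  face_app α _ _ _ h x := by rw [B.face_one, U.face_obj]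
  naturality f := commutes_of_eq_par (c := U.mor f) (par_mul_one (U.tgt_mor f))
    (one_mul_par (U.src_mor f))
  unit_lax_lax {j k i} h t hq := by
    have s := U.unit_lax h t hq
    refine commutes_of_eq_par (c := U.unit h t) ?_ ?_ <;>
      simp only [pprod, id_obj, id_mor, id_unit, U.mor_one, B.deg_one, one_mul_par (B.src_one _),
        one_mul_par s.1, par_mul_one s.2]
  unit_lax_colax {j k i} h t _ hq := by
    have s := U.unit_colax h t hq
    refine commutes_of_eq_par (c := U.unit h t) ?_ ?_ <;>
      simp only [pprod, id_obj, id_mor, id_unit, U.mor_one, B.deg_one, one_mul_par (B.src_one _),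
        one_mul_par s.1, par_mul_one s.2]
  unit_colax_colax {j k i} h t hp := by
    -- From `j < p < q`, the morphism `U` is colax in this direction; both sides of the axiom reduce
    -- to its comparison.
    have s := U.unit_colax h t (hp.trans hpq)
    refine commutes_of_eq_par (c := U.unit h t) ?_ ?_ <;>
      simp only [pprod, id_obj, id_mor, id_unit, U.mor_one, B.deg_one,
        one_mul_par s.1, par_mul_one s.2]
  mul_lax_lax {j k i} h x y e hR hU hφ hq := by
    have s := U.mul_lax h x y e hU hq
    refine commutes_of_eq_par (c := U.mul h x y e) ?_ ?_ <;>
      simp only [pprod, id_obj, id_mor, id_mul, U.mor_one, addM_one' _ hU,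
        one_mul_par (B.src_one _), one_mul_par s.1, par_mul_one s.2]
  mul_lax_colax {j k i} h x y e hR hU hφ _ hq := by
    have s := U.mul_colax h x y e hU hq
    refine commutes_of_eq_par (c := U.mul h x y e) ?_ ?_ <;>
      simp only [pprod, id_obj, id_mor, id_mul, U.mor_one, addM_one' _ hU,
        one_mul_par (B.src_one _), one_mul_par s.1, par_mul_one s.2]
  mul_colax_colax {j k i} h x y e hR hU hφ hp := by
    have s := U.mul_colax h x y e hU (hp.trans hpq)
    refine commutes_of_eq_par (c := U.mul h x y e) ?_ ?_ <;>
      simp only [pprod, id_obj, id_mor, id_mul, U.mor_one, addM_one' _ hU,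
        one_mul_par s.1, par_mul_one s.2]
  app_strict _ _ _ := rfl

/-- The identity square of a mixed functor, in the second direction. -/
def idSnd (hpq : p < q) (R : MixedFunctor p A B) :
    MixedSquare R R (MixedFunctor.id q A) (MixedFunctor.id q B) where
  app x := B.one (R.obj x)
  src_app x := B.src_one _
  tgt_app x := B.tgt_one _
  face_app α _ _ _ h x := by rw [B.face_one, R.face_obj]
  naturality f := commutes_of_eq_par (c := R.mor f) (par_mul_one (R.tgt_mor f))
    (one_mul_par (R.src_mor f))
  unit_lax_lax {j k i} h t hq := by
    have s := R.unit_lax h t (hpq.le.trans hq)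
    refine commutes_of_eq_par (c := R.unit h t) ?_ ?_ <;>
      simp only [pprod, id_obj, id_mor, id_unit, R.mor_one, B.deg_one,
        one_mul_par s.1, par_mul_one s.2]
  unit_lax_colax {j k i} h t hp _ := by
    have s := R.unit_lax h t hp
    refine commutes_of_eq_par (c := R.unit h t) ?_ ?_ <;>
      simp only [pprod, id_obj, id_mor, id_unit, R.mor_one, B.deg_one, one_mul_par (B.src_one _),
        one_mul_par s.1, par_mul_one s.2]
  unit_colax_colax {j k i} h t hp := by
    have s := R.unit_colax h t hp
    refine commutes_of_eq_par (c := R.unit h t) ?_ ?_ <;>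
      simp only [pprod, id_obj, id_mor, id_unit, R.mor_one, B.deg_one, one_mul_par (B.src_one _),
        one_mul_par s.1, par_mul_one s.2]
  mul_lax_lax {j k i} h x y e hR hU hφ hq := by
    have s := R.mul_lax h x y e hR (hpq.le.trans hq)
    refine commutes_of_eq_par (c := R.mul h x y e) ?_ ?_ <;>
      simp only [pprod, id_obj, id_mor, id_mul, R.mor_one, addM_one' _ hR,
        one_mul_par s.1, par_mul_one s.2]
  mul_lax_colax {j k i} h x y e hR hU hφ hp _ := by
    have s := R.mul_lax h x y e hR hp
    refine commutes_of_eq_par (c := R.mul h x y e) ?_ ?_ <;>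
      simp only [pprod, id_obj, id_mor, id_mul, R.mor_one, addM_one' _ hR,
        one_mul_par (B.src_one _), one_mul_par s.1, par_mul_one s.2]
  mul_colax_colax {j k i} h x y e hR hU hφ hp := by
    have s := R.mul_colax h x y e hR hp
    refine commutes_of_eq_par (c := R.mul h x y e) ?_ ?_ <;>
      simp only [pprod, id_obj, id_mor, id_mul, R.mor_one, addM_one' _ hR,
        one_mul_par (B.src_one _), one_mul_par s.1, par_mul_one s.2]
  app_strict _ _ _ := rfl

end MixedSquare

/-! ### Composites of generalised quintets in both directions. -/

namespace MixedSquare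

open MultCat PreChiral MixedFunctor

variable {p q : ℕ∞} {i k : Finset ℕ+} {j : ℕ+}

section CompFst

variable {A₁ A₂ A₃ B₁ B₂ B₃ : ChiralMultipleCategory.{u}}
  {R : MixedFunctor p A₁ A₂} {R' : MixedFunctor p A₂ A₃} {S : MixedFunctor p B₁ B₂}
  {S' : MixedFunctor p B₂ B₃} {U : MixedFunctor q A₁ B₁} {V : MixedFunctor q A₂ B₂}
  {W : MixedFunctor q A₃ B₃}

/-- The components of a composite in the first direction. -/
noncomputable def compFstApp (φ : MixedSquare R S U V) (ψ : MixedSquare R' S' V W)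
    (x : A₁.cube i) : B₃.map i :=
  B₃.cmp (ψ.app (R.obj x)) (S'.mor (φ.app x))

theorem par_compFstApp (φ : MixedSquare R S U V) (ψ : MixedSquare R' S' V W) (x : A₁.cube i) :
    par (compFstApp φ ψ x) = par (ψ.app (R.obj x)) * par (S'.mor (φ.app x)) :=
  par_cmp (by rw [ψ.tgt_app, S'.src_mor, φ.src_app])

theorem src_compFstApp (φ : MixedSquare R S U V) (ψ : MixedSquare R' S' V W) (x : A₁.cube i) :
    B₃.src (compFstApp φ ψ x) = W.obj (R'.obj (R.obj x)) :=
  (src_of_par (par_compFstApp φ ψ x)).trans (ψ.src_app _)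

theorem tgt_compFstApp (φ : MixedSquare R S U V) (ψ : MixedSquare R' S' V W) (x : A₁.cube i) :
    B₃.tgt (compFstApp φ ψ x) = S'.obj (S.obj (U.obj x)) :=
  (tgt_of_par (par_compFstApp φ ψ x)).trans (by rw [S'.tgt_mor, φ.tgt_app])

/-- The composite of two squares in the first direction. -/
noncomputable def compFst (hpq : p < q) (φ : MixedSquare R S U V) (ψ : MixedSquare R' S' V W) :
    MixedSquare (R.comp R') (S.comp S') U W where
  app x := compFstApp φ ψ x
  src_app x := src_compFstApp φ ψ x
  tgt_app x := tgt_compFstApp φ ψ x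
  face_app α _ _ _ h x := par_injective (by
    rw [par_face α h (par_compFstApp φ ψ x), par_compFstApp, ψ.face_app, S'.face_mor, φ.face_app,
      R.face_obj])
  naturality f := by
    have e₁ := ψ.par_natural (R.src_mor f) (R.tgt_mor f)
    have e₂ := ((φ.naturality f).map S'.toHom).eq
    simp only [pprod, List.map] at e₂
    refine commutes_two ?_ ?_
    · rw [W.tgt_mor, src_compFstApp, ← R.tgt_mor]
      exact congrArg _ (R'.tgt_mor _)
    · change par (W.mor (R'.mor (R.mor f))) * _ = _ * par (S'.mor (S.mor (U.mor f)))
      rw [par_compFstApp, par_compFstApp]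
      grind
  unit_lax_lax {j k i} h t hq := by
    -- From `p < q ≤ j`, the horizontal morphisms are lax too. Below, `e₂` is the axiom of `ψ` at `R
    -- t` and `e₃` the image under `S'` of the axiom of `φ`. They are glued by `e₁`, naturality of
    -- `ψ` at the comparison of `R`, and `e₄`, naturality of the comparison of `S'` at `φ t`. The
    -- remaining equations expand composites. The other cases have the same ingredients.
    have hp := hpq.le.trans hq
    have e₁ := ψ.par_natural (R.unit_lax h t hp).1 (R.unit_lax h t hp).2
    have e₂ := (ψ.unit_lax_lax h (R.obj t) hq).eq
    have e₃ := ((φ.unit_lax_lax h t hq).map S'.toHom).eq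
    have e₄ := par_unit_natural_lax (R := S') hp h (φ.src_app t) (φ.tgt_app t)
    have e₅ := par_deg h (par_compFstApp φ ψ t)
    have e₆ := W.par_mor ((isComposition_comp R R').par_unit_lax hp h t)
    have e₇ := (isComposition_comp S S').par_unit_lax hp h (U.obj t)
    simp only [pprod, List.map] at e₂ e₃
    refine commutes_three ?_ ?_ ?_
    · rw [(W.unit_lax h _ hq).2, W.src_mor, ((R.comp R').unit_lax h t hp).1]
    · rw [W.tgt_mor, ((R.comp R').unit_lax h t hp).2, src_compFstApp]
      rfl
    · simp only [pprod]
      rw [par_compFstApp, e₅, e₆, e₇]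
      change par (W.unit h (R'.obj (R.obj t))) * _ = _ * (_ * par (S'.mor (S.mor (U.unit h t))))
      grind
  unit_lax_colax {j k i} h t hp hq := by
    have e₁ := ψ.par_natural (R.unit_lax h t hp).1 (R.unit_lax h t hp).2
    have e₂ := (ψ.unit_lax_colax h (R.obj t) hp hq).eq
    have e₃ := ((φ.unit_lax_colax h t hp hq).map S'.toHom).eq
    have e₄ := par_unit_natural_lax (R := S') hp h (φ.src_app t) (φ.tgt_app t)
    have e₅ := par_deg h (par_compFstApp φ ψ t)
    have e₆ := W.par_mor ((isComposition_comp R R').par_unit_lax hp h t)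
    have e₇ := (isComposition_comp S S').par_unit_lax hp h (U.obj t)
    simp only [pprod, List.map] at e₂ e₃
    refine commutes_three ?_ ?_ ?_
    · rw [(W.unit_colax h _ hq).2, B₃.src_deg, src_compFstApp]
      rfl
    · rw [((S.comp S').unit_lax h _ hp).1, B₃.tgt_deg, tgt_compFstApp]
      rfl
    · simp only [pprod]
      rw [par_compFstApp, e₅, e₆, e₇]
      change par (W.unit h (R'.obj (R.obj t))) * _ = _ * (_ * par (S'.mor (S.mor (U.unit h t))))
      grind
  unit_colax_colax {j k i} h t hp := by
    have hq := hp.trans hpq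
    have e₁ := ψ.par_natural (R.unit_colax h t hp).1 (R.unit_colax h t hp).2
    have e₂ := (ψ.unit_colax_colax h (R.obj t) hp).eq
    have e₃ := ((φ.unit_colax_colax h t hp).map S'.toHom).eq
    have e₄ := par_unit_natural_colax (R := S') hp h (φ.src_app t) (φ.tgt_app t)
    have e₅ := par_deg h (par_compFstApp φ ψ t)
    have e₆ := W.par_mor ((isComposition_comp R R').par_unit_colax hp h t)
    have e₇ := (isComposition_comp S S').par_unit_colax hp h (U.obj t)
    simp only [pprod, List.map] at e₂ e₃
    refine commutes_three ?_ ?_ ?_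
    · rw [(W.unit_colax h _ hq).1, W.tgt_mor, ((R.comp R').unit_colax h t hp).2]
    · rw [(W.unit_colax h _ hq).2, B₃.src_deg, src_compFstApp]
      rfl
    · simp only [pprod]
      rw [par_compFstApp, e₅, e₆, e₇]
      change _ * (par (W.unit h (R'.obj (R.obj t))) * _) =
        _ * (par (S'.mor (S.mor (U.unit h t))) * _)
      grind
  mul_lax_lax {j k i} h x y e hR hU hφ hq := by
    have hp := hpq.le.trans hq
    have r := R.consec_obj e
    have m := R.mul_lax h x y e r hp
    have c := φ.consec_app e
    have e₁ := ψ.par_natural m.1 m.2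
    have e₂ := (ψ.mul_lax_lax h _ _ r hR (V.consec_obj r) (ψ.consec_app r) hq).eq
    have e₃ := ((φ.mul_lax_lax h x y e r hU c hq).map S'.toHom).eq
    have e₄ := par_mul_natural_lax (R := S') hp h (φ.src_app x) (φ.src_app y) (φ.tgt_app x)
      (φ.tgt_app y) c (V.consec_obj r) (S.consec_obj hU)
    have e₅ := par_addM (par_compFstApp φ ψ x) (par_compFstApp φ ψ y) hφ (ψ.consec_app r)
      (S'.consec_mor c)
    have e₆ := W.par_mor ((isComposition_comp R R').par_mul_lax hp h e)
    have e₇ := (isComposition_comp S S').par_mul_lax hp h hU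
    simp only [pprod, List.map] at e₂ e₃
    refine commutes_three ?_ ?_ ?_
    · rw [(W.mul_lax h _ _ hR (W.consec_obj hR) hq).2, W.src_mor,
        ((R.comp R').mul_lax h x y e hR hp).1]
    · rw [W.tgt_mor, ((R.comp R').mul_lax h x y e hR hp).2, src_compFstApp]
      rfl
    · simp only [pprod]
      rw [par_compFstApp, e₅, e₆, e₇]
      change par (W.mul h (R'.obj (R.obj x)) (R'.obj (R.obj y)) hR) * _ =
        _ * (_ * par (S'.mor (S.mor (U.mul h x y e))))
      grind
  mul_lax_colax {j k i} h x y e hR hU hφ hp hq := by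
    have r := R.consec_obj e
    have m := R.mul_lax h x y e r hp
    have c := φ.consec_app e
    have e₁ := ψ.par_natural m.1 m.2
    have e₂ := (ψ.mul_lax_colax h _ _ r hR (V.consec_obj r) (ψ.consec_app r) hp hq).eq
    have e₃ := ((φ.mul_lax_colax h x y e r hU c hp hq).map S'.toHom).eq
    have e₄ := par_mul_natural_lax (R := S') hp h (φ.src_app x) (φ.src_app y) (φ.tgt_app x)
      (φ.tgt_app y) c (V.consec_obj r) (S.consec_obj hU)
    have e₅ := par_addM (par_compFstApp φ ψ x) (par_compFstApp φ ψ y) hφ (ψ.consec_app r)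
      (S'.consec_mor c)
    have e₆ := W.par_mor ((isComposition_comp R R').par_mul_lax hp h e)
    have e₇ := (isComposition_comp S S').par_mul_lax hp h hU
    simp only [pprod, List.map] at e₂ e₃
    refine commutes_three ?_ ?_ ?_
    · rw [(W.mul_colax h _ _ hR (W.consec_obj hR) hq).2, src_addM']
      exact add_congr (src_compFstApp φ ψ x).symm (src_compFstApp φ ψ y).symm _ _
    · rw [((S.comp S').mul_lax h _ _ hU ((S.comp S').consec_obj hU) hp).1, tgt_addM']
      exact add_congr (tgt_compFstApp φ ψ x) (tgt_compFstApp φ ψ y) _ _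
    · simp only [pprod]
      rw [par_compFstApp, e₅, e₆, e₇]
      change par (W.mul h (R'.obj (R.obj x)) (R'.obj (R.obj y)) hR) * _ =
        _ * (_ * par (S'.mor (S.mor (U.mul h x y e))))
      grind
  mul_colax_colax {j k i} h x y e hR hU hφ hp := by
    have hq := hp.trans hpq
    have r := R.consec_obj e
    have m := R.mul_colax h x y e r hp
    have c := φ.consec_app e
    have e₁ := ψ.par_natural m.1 m.2
    have e₂ := (ψ.mul_colax_colax h _ _ r hR (V.consec_obj r) (ψ.consec_app r) hp).eq
    have e₃ := ((φ.mul_colax_colax h x y e r hU c hp).map S'.toHom).eq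
    have e₄ := par_mul_natural_colax (R := S') hp h (φ.src_app x) (φ.src_app y) (φ.tgt_app x)
      (φ.tgt_app y) c (V.consec_obj r) (S.consec_obj hU)
    have e₅ := par_addM (par_compFstApp φ ψ x) (par_compFstApp φ ψ y) hφ (ψ.consec_app r)
      (S'.consec_mor c)
    have e₆ := W.par_mor ((isComposition_comp R R').par_mul_colax hp h e)
    have e₇ := (isComposition_comp S S').par_mul_colax hp h hU
    simp only [pprod, List.map] at e₂ e₃
    refine commutes_three ?_ ?_ ?_
    · rw [(W.mul_colax h _ _ hR (W.consec_obj hR) hq).1, W.tgt_mor,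
        ((R.comp R').mul_colax h x y e hR hp).2]
    · rw [(W.mul_colax h _ _ hR (W.consec_obj hR) hq).2, src_addM']
      exact add_congr (src_compFstApp φ ψ x).symm (src_compFstApp φ ψ y).symm _ _
    · simp only [pprod]
      rw [par_compFstApp, e₅, e₆, e₇]
      change _ * (par (W.mul h (R'.obj (R.obj x)) (R'.obj (R.obj y)) hR) * _) =
        _ * (par (S'.mor (S.mor (U.mul h x y e))) * _)
      grind
  -- For `p = 0` both components are identities, and `S'` preserves identities.
  app_strict hp {i} x := par_injective (by
    have h := ψ.app_strict hp (R.obj x)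
    rw [par_compFstApp, φ.app_strict hp, S'.mor_one, par_mul_one (by
      rw [ψ.tgt_app]), h]
    rfl)

end CompFst

section CompSnd

/-- The case where all four morphisms are colax: the axiom `e₂` of the second square and the image
`e₃` of the axiom of the first are glued along `e₁`, naturality of the second square, and `e₄`,
naturality of the outer vertical comparison. -/
theorem colax_pasting {M : Type u} [Semigroup M] {a b c d f g k l m n r s v w z : M}
    (e₁ : a * b = c * d) (e₂ : f * (g * k) = b * (m * n)) (e₃ : w * (v * l) = z * (a * f))
    (e₄ : l * g = r * s) : w * (v * r * (s * k)) = z * c * (d * m * n) :=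
  calc w * (v * r * (s * k)) = w * (v * (r * s)) * k := by simp only [mul_assoc]
    _ = w * (v * l) * (g * k) := by rw [← e₄]; simp only [mul_assoc]
    _ = z * a * (f * (g * k)) := by rw [e₃]; simp only [mul_assoc]
    _ = z * (a * b) * (m * n) := by rw [e₂]; simp only [mul_assoc]
    _ = z * c * (d * m * n) := by rw [e₁]; simp only [mul_assoc]

variable {A₁ A₂ A₃ B₁ B₂ B₃ : ChiralMultipleCategory.{u}}
  {R : MixedFunctor p A₁ B₁} {S : MixedFunctor p A₂ B₂} {T : MixedFunctor p A₃ B₃}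
  {U : MixedFunctor q A₁ A₂} {U' : MixedFunctor q A₂ A₃} {V : MixedFunctor q B₁ B₂}
  {V' : MixedFunctor q B₂ B₃}

/-- The components of a composite in the second direction. -/
noncomputable def compSndApp (φ : MixedSquare R S U V) (σ : MixedSquare S T U' V')
    (x : A₁.cube i) : B₃.map i :=
  B₃.cmp (V'.mor (φ.app x)) (σ.app (U.obj x))

theorem par_compSndApp (φ : MixedSquare R S U V) (σ : MixedSquare S T U' V') (x : A₁.cube i) :
    par (compSndApp φ σ x) = par (V'.mor (φ.app x)) * par (σ.app (U.obj x)) :=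
  par_cmp (by rw [σ.src_app, V'.tgt_mor, φ.tgt_app])

theorem src_compSndApp (φ : MixedSquare R S U V) (σ : MixedSquare S T U' V') (x : A₁.cube i) :
    B₃.src (compSndApp φ σ x) = V'.obj (V.obj (R.obj x)) :=
  (src_of_par (par_compSndApp φ σ x)).trans (by rw [V'.src_mor, φ.src_app])

theorem tgt_compSndApp (φ : MixedSquare R S U V) (σ : MixedSquare S T U' V') (x : A₁.cube i) :
    B₃.tgt (compSndApp φ σ x) = T.obj (U'.obj (U.obj x)) :=
  (tgt_of_par (par_compSndApp φ σ x)).trans (σ.tgt_app _)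

/-- The composite of two squares in the second direction. -/
noncomputable def compSnd (hpq : p < q) (φ : MixedSquare R S U V) (σ : MixedSquare S T U' V') :
    MixedSquare R T (U.comp U') (V.comp V') where
  app x := compSndApp φ σ x
  src_app x := src_compSndApp φ σ x
  tgt_app x := tgt_compSndApp φ σ x
  face_app α _ _ _ h x := par_injective (by
    rw [par_face α h (par_compSndApp φ σ x), par_compSndApp, σ.face_app, V'.face_mor, φ.face_app,
      U.face_obj])
  naturality f := by
    have e₁ := σ.par_natural (U.src_mor f) (U.tgt_mor f)
    have e₂ := ((φ.naturality f).map V'.toHom).eq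
    simp only [pprod, List.map] at e₂
    refine commutes_two ?_ ?_
    · rw [src_compSndApp, (V.comp V').tgt_mor, R.tgt_mor]
      rfl
    · change par (V'.mor (V.mor (R.mor f))) * _ = _ * par (T.mor (U'.mor (U.mor f)))
      rw [par_compSndApp, par_compSndApp]
      grind
  unit_lax_lax {j k i} h t hq := by
    have hp := hpq.le.trans hq
    -- Now the comparison of `U` is moved across `σ`, and the component `φ t` across the comparison
    -- of `V'`; the axiom of `σ` is taken at `U t`, that of `φ` is mapped by `V'`.
    have e₁ := σ.par_natural (U.unit_lax h t hq).1 (U.unit_lax h t hq).2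
    have e₂ := (σ.unit_lax_lax h (U.obj t) hq).eq
    have e₃ := ((φ.unit_lax_lax h t hq).map V'.toHom).eq
    have e₄ := par_unit_natural_lax (R := V') hq h (φ.src_app t) (φ.tgt_app t)
    have e₅ := par_deg h (par_compSndApp φ σ t)
    have e₆ := T.par_mor ((isComposition_comp U U').par_unit_lax hq h t)
    have e₇ := (isComposition_comp V V').par_unit_lax hq h (R.obj t)
    simp only [pprod, List.map] at e₂ e₃
    refine commutes_three ?_ ?_ ?_
    · rw [((V.comp V').unit_lax h _ hq).2, (V.comp V').src_mor, (R.unit_lax h t hp).1]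
    · rw [(V.comp V').tgt_mor, (R.unit_lax h t hp).2, src_compSndApp]
      rfl
    · simp only [pprod]
      rw [par_compSndApp, e₅, e₆, e₇]
      change _ * (par (V'.mor (V.mor (R.unit h t))) * _) = _ * (par (T.unit h (U'.obj (U.obj t))) * _)
      grind
  unit_lax_colax {j k i} h t hp hq := by
    have e₁ := σ.par_natural (U.unit_colax h t hq).1 (U.unit_colax h t hq).2
    have e₂ := (σ.unit_lax_colax h (U.obj t) hp hq).eq
    have e₃ := ((φ.unit_lax_colax h t hp hq).map V'.toHom).eq
    have e₄ := par_unit_natural_colax (R := V') hq h (φ.src_app t) (φ.tgt_app t)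
    have e₅ := par_deg h (par_compSndApp φ σ t)
    have e₆ := T.par_mor ((isComposition_comp U U').par_unit_colax hq h t)
    have e₇ := (isComposition_comp V V').par_unit_colax hq h (R.obj t)
    simp only [pprod, List.map] at e₂ e₃
    refine commutes_three ?_ ?_ ?_
    · rw [((V.comp V').unit_colax h _ hq).2, B₃.src_deg, src_compSndApp]
      rfl
    · rw [(T.unit_lax h _ hp).1, B₃.tgt_deg, tgt_compSndApp]
      rfl
    · simp only [pprod]
      rw [par_compSndApp, e₅, e₆, e₇]
      change _ * (_ * par (T.unit h (U'.obj (U.obj t)))) = par (V'.mor (V.mor (R.unit h t))) * _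
      grind
  unit_colax_colax {j k i} h t hp := by
    have hq := hp.trans hpq
    have e₁ := σ.par_natural (U.unit_colax h t hq).1 (U.unit_colax h t hq).2
    have e₂ := (σ.unit_colax_colax h (U.obj t) hp).eq
    have e₃ := ((φ.unit_colax_colax h t hp).map V'.toHom).eq
    have e₄ := par_unit_natural_colax (R := V') hq h (φ.src_app t) (φ.tgt_app t)
    have e₅ := par_deg h (par_compSndApp φ σ t)
    have e₆ := T.par_mor ((isComposition_comp U U').par_unit_colax hq h t)
    have e₇ := (isComposition_comp V V').par_unit_colax hq h (R.obj t)
    simp only [pprod, List.map] at e₂ e₃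
    refine commutes_three ?_ ?_ ?_
    · rw [((V.comp V').unit_colax h _ hq).1, (V.comp V').tgt_mor, (R.unit_colax h t hp).2]
    · rw [((V.comp V').unit_colax h _ hq).2, B₃.src_deg, src_compSndApp]
      rfl
    · simp only [pprod]
      rw [par_compSndApp, e₅, e₆, e₇]
      change par (V'.mor (V.mor (R.unit h t))) * _ = _ * (_ * par (T.unit h (U'.obj (U.obj t))))
      exact colax_pasting e₁ e₂ e₃ e₄
  mul_lax_lax {j k i} h x y e hR hU hφ hq := by
    have hp := hpq.le.trans hq
    have r := R.consec_obj e
    have r' := U.consec_obj e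
    have m := R.mul_lax h x y e r hp
    have m' := U.mul_lax h x y e r' hq
    have c := φ.consec_app e
    have e₁ := σ.par_natural m'.1 m'.2
    have e₂ := (σ.mul_lax_lax h _ _ r' (S.consec_obj r') hU (σ.consec_app r') hq).eq
    have e₃ := ((φ.mul_lax_lax h x y e r r' c hq).map V'.toHom).eq
    have e₄ := par_mul_natural_lax (R := V') hq h (φ.src_app x) (φ.src_app y) (φ.tgt_app x)
      (φ.tgt_app y) c (V.consec_obj r) (S.consec_obj r')
    have e₅ := par_addM (par_compSndApp φ σ x) (par_compSndApp φ σ y) hφ (V'.consec_mor c)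
      (σ.consec_app r')
    have e₆ := T.par_mor ((isComposition_comp U U').par_mul_lax hq h e)
    have e₇ := (isComposition_comp V V').par_mul_lax hq h r
    simp only [pprod, List.map] at e₂ e₃
    refine commutes_three ?_ ?_ ?_
    · rw [((V.comp V').mul_lax h _ _ hR ((V.comp V').consec_obj hR) hq).2, (V.comp V').src_mor,
        m.1]
    · rw [(V.comp V').tgt_mor, m.2, src_compSndApp]
      rfl
    · simp only [pprod]
      rw [par_compSndApp, e₅, e₆, e₇]
      change _ * (par (V'.mor (V.mor (R.mul h x y e))) * _) =
        _ * (par (T.mul h (U'.obj (U.obj x)) (U'.obj (U.obj y)) hU) * _)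
      grind
  mul_lax_colax {j k i} h x y e hR hU hφ hp hq := by
    have r := R.consec_obj e
    have r' := U.consec_obj e
    have m := R.mul_lax h x y e r hp
    have m' := U.mul_colax h x y e r' hq
    have c := φ.consec_app e
    have e₁ := σ.par_natural m'.1 m'.2
    have e₂ := (σ.mul_lax_colax h _ _ r' (S.consec_obj r') hU (σ.consec_app r') hp hq).eq
    have e₃ := ((φ.mul_lax_colax h x y e r r' c hp hq).map V'.toHom).eq
    have e₄ := par_mul_natural_colax (R := V') hq h (φ.src_app x) (φ.src_app y) (φ.tgt_app x)
      (φ.tgt_app y) c (V.consec_obj r) (S.consec_obj r')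
    have e₅ := par_addM (par_compSndApp φ σ x) (par_compSndApp φ σ y) hφ (V'.consec_mor c)
      (σ.consec_app r')
    have e₆ := T.par_mor ((isComposition_comp U U').par_mul_colax hq h e)
    have e₇ := (isComposition_comp V V').par_mul_colax hq h r
    simp only [pprod, List.map] at e₂ e₃
    refine commutes_three ?_ ?_ ?_
    · rw [((V.comp V').mul_colax h _ _ hR ((V.comp V').consec_obj hR) hq).2, src_addM']
      exact add_congr (src_compSndApp φ σ x).symm (src_compSndApp φ σ y).symm _ _
    · rw [(T.mul_lax h _ _ hU (T.consec_obj hU) hp).1, tgt_addM']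
      exact add_congr (tgt_compSndApp φ σ x) (tgt_compSndApp φ σ y) _ _
    · simp only [pprod]
      rw [par_compSndApp, e₅, e₆, e₇]
      change _ * (_ * par (T.mul h (U'.obj (U.obj x)) (U'.obj (U.obj y)) hU)) =
        par (V'.mor (V.mor (R.mul h x y e))) * _
      grind
  mul_colax_colax {j k i} h x y e hR hU hφ hp := by
    have hq := hp.trans hpq
    have r := R.consec_obj e
    have r' := U.consec_obj e
    have m := R.mul_colax h x y e r hp
    have m' := U.mul_colax h x y e r' hq
    have c := φ.consec_app e
    have e₁ := σ.par_natural m'.1 m'.2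
    have e₂ := (σ.mul_colax_colax h _ _ r' (S.consec_obj r') hU (σ.consec_app r') hp).eq
    have e₃ := ((φ.mul_colax_colax h x y e r r' c hp).map V'.toHom).eq
    have e₄ := par_mul_natural_colax (R := V') hq h (φ.src_app x) (φ.src_app y) (φ.tgt_app x)
      (φ.tgt_app y) c (V.consec_obj r) (S.consec_obj r')
    have e₅ := par_addM (par_compSndApp φ σ x) (par_compSndApp φ σ y) hφ (V'.consec_mor c)
      (σ.consec_app r')
    have e₆ := T.par_mor ((isComposition_comp U U').par_mul_colax hq h e)
    have e₇ := (isComposition_comp V V').par_mul_colax hq h r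
    simp only [pprod, List.map] at e₂ e₃
    refine commutes_three ?_ ?_ ?_
    · rw [((V.comp V').mul_colax h _ _ hR ((V.comp V').consec_obj hR) hq).1, (V.comp V').tgt_mor,
        m.2]
    · rw [((V.comp V').mul_colax h _ _ hR ((V.comp V').consec_obj hR) hq).2, src_addM']
      exact add_congr (src_compSndApp φ σ x).symm (src_compSndApp φ σ y).symm _ _
    · simp only [pprod]
      rw [par_compSndApp, e₅, e₆, e₇]
      change par (V'.mor (V.mor (R.mul h x y e))) * _ =
        _ * (_ * par (T.mul h (U'.obj (U.obj x)) (U'.obj (U.obj y)) hU))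
      exact colax_pasting e₁ e₂ e₃ e₄
  -- The second component is the identity of `V' (S (U x))`; since `φ x` is an identity, `S (U x)`
  -- equals `V (R x)`.
  app_strict hp {i} x := par_injective (by
    rw [par_compSndApp, φ.app_strict hp, V'.mor_one, one_mul_par (by
      rw [σ.src_app, ← φ.tgt_app, φ.app_strict hp, B₂.tgt_one]), σ.app_strict hp, ← φ.tgt_app,
        φ.app_strict hp, B₂.tgt_one]
    rfl)

end CompSnd

end MixedSquare

/-! ### Components of quintets over `Mlt(Cat)`. -/

namespace MultCat

variable {A B C D : MultCat.{u}} {i : Finset ℕ+}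

theorem Trans.par_natural {F G : Hom A B} (φ : Trans F G) {f : A.map i} {x y : A.cube i}
    (hx : A.src f = x) (hy : A.tgt f = y) :
    par (F.mor f) * par (φ.app y) = par (φ.app x) * par (G.mor f) := by
  subst hx hy
  have h₁ : B.tgt (F.mor f) = B.src (φ.app (A.tgt f)) := by rw [F.tgt_mor, φ.src_app]
  have h₂ : B.tgt (φ.app (A.src f)) = B.src (G.mor f) := by rw [φ.tgt_app, G.src_mor]
  rw [par_mul_par h₁, par_mul_par h₂, φ.naturality]

theorem Trans.par_comp {F G H : Hom A B} (φ : Trans F G) (ψ : Trans G H) (x : A.cube i) :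
    par ((Trans.comp φ ψ).app x) = par (φ.app x) * par (ψ.app x) :=
  (par_mul_par _).symm

end MultCat

namespace Quintet

open MultCat

variable {A₁ A₂ A₃ A₄ B₁ B₂ B₃ B₄ : MultCat.{u}}

theorem ext_app {r : A₁ ⟶ A₂} {s : B₁ ⟶ B₂} {t : A₁ ⟶ B₁} {v : A₂ ⟶ B₂} {φ ψ : r ≫ v ⟶ t ≫ s}
    (h : ∀ {i : Finset ℕ+} (x : A₁.cube i), par (Trans.app φ x) = par (Trans.app ψ x)) :
    (⟨r, s, t, v, φ⟩ : QSq MultCat.{u}) = ⟨r, s, t, v, ψ⟩ := by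
  rw [Trans.hom_ext fun x => par_injective (h x)]

/-- The unitors of this 2-category are identity transformations, so their composite has identity
components. -/
theorem app_idFst (f : A₁ ⟶ A₂) {i : Finset ℕ+} (x : A₁.cube i) :
    Trans.app ((λ_ f).hom ≫ (ρ_ f).inv) x = A₂.one (Hom.obj f x) :=
  congrArg (fun φ : Trans f f => φ.app x) (Trans.id_comp (Trans.id f))

theorem app_idSnd (f : A₁ ⟶ A₂) {i : Finset ℕ+} (x : A₁.cube i) :
    Trans.app ((ρ_ f).hom ≫ (λ_ f).inv) x = A₂.one (Hom.obj f x) :=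
  congrArg (fun φ : Trans f f => φ.app x) (Trans.id_comp (Trans.id f))

/-- The associators have identity components as well. The bicategorical pasting thus reduces to the
product of its two whiskered cells, which is the formula for the composition in `cmc`. -/
theorem app_compFst {r : A₁ ⟶ A₂} {r' : A₂ ⟶ A₃} {s : B₁ ⟶ B₂} {s' : B₂ ⟶ B₃} {t : A₁ ⟶ B₁}
    {v : A₂ ⟶ B₂} {w : A₃ ⟶ B₃} (φ : r ≫ v ⟶ t ≫ s) (ψ : r' ≫ w ⟶ v ≫ s') {i : Finset ℕ+}
    (x : A₁.cube i) :
    par (Trans.app ((α_ r r' w).hom ≫ r ◁ ψ ≫ (α_ r v s').inv ≫ φ ▷ s' ≫ (α_ t s s').hom) x) =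
      par (Trans.app ψ (Hom.obj r x)) * par (Hom.mor s' (Trans.app φ x)) := by
  have e : Trans.comp (Trans.id _) (Trans.comp (Trans.whiskerLeft r ψ) (Trans.comp (Trans.id _)
      (Trans.comp (Trans.whiskerRight φ s') (Trans.id _)))) =
      Trans.comp (Trans.whiskerLeft r ψ) (Trans.whiskerRight φ s') :=
    (Trans.id_comp _).trans (congrArg _ ((Trans.id_comp _).trans (Trans.comp_id _)))
  exact (congrArg (fun θ : Trans (Hom.comp (Hom.comp r r') w) (Hom.comp t (Hom.comp s s')) =>
    par (θ.app x)) e).trans (Trans.par_comp _ _ x)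

theorem app_compSnd {r : A₁ ⟶ B₁} {s : A₂ ⟶ B₂} {t : A₃ ⟶ B₃} {f : A₁ ⟶ A₂} {f' : A₂ ⟶ A₃}
    {v : B₁ ⟶ B₂} {v' : B₂ ⟶ B₃} (φ : r ≫ v ⟶ f ≫ s) (σ : s ≫ v' ⟶ f' ≫ t) {i : Finset ℕ+}
    (x : A₁.cube i) :
    par (Trans.app ((α_ r v v').inv ≫ φ ▷ v' ≫ (α_ f s v').hom ≫ f ◁ σ ≫ (α_ f f' t).inv) x) =
      par (Hom.mor v' (Trans.app φ x)) * par (Trans.app σ (Hom.obj f x)) := by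
  have e : Trans.comp (Trans.id _) (Trans.comp (Trans.whiskerRight φ v') (Trans.comp (Trans.id _)
      (Trans.comp (Trans.whiskerLeft f σ) (Trans.id _)))) =
      Trans.comp (Trans.whiskerRight φ v') (Trans.whiskerLeft f σ) :=
    (Trans.id_comp _).trans (congrArg _ ((Trans.id_comp _).trans (Trans.comp_id _)))
  exact (congrArg (fun θ : Trans (Hom.comp r (Hom.comp v v')) (Hom.comp (Hom.comp f f') t) =>
    par (θ.app x)) e).trans (Trans.par_comp _ _ x)

/-- After removal of the identity associators each side has three whiskered cells, and a 2-cell is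
determined by its components. The right-hand side has the same shape as the commutativity of cubes
in `cmc`, so `tv` preserves and reflects it. -/
theorem comm_iff_app {r : A₁ ⟶ A₂} {s : A₃ ⟶ A₄} {r' : B₁ ⟶ B₂} {s' : B₃ ⟶ B₄}
    {f : A₁ ⟶ A₃} {v : A₂ ⟶ A₄} {f' : B₁ ⟶ B₃} {v' : B₂ ⟶ B₄}
    {x : A₁ ⟶ B₁} {x' : A₂ ⟶ B₂} {y : A₃ ⟶ B₃} {y' : A₄ ⟶ B₄}
    {φ : r ≫ v ⟶ f ≫ s} {ψ : r' ≫ v' ⟶ f' ≫ s'} {π : r ≫ x' ⟶ x ≫ r'} {ρ : s ≫ y' ⟶ y ≫ s'}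
    {ω : f ≫ y ⟶ x ≫ f'} {ζ : v ≫ y' ⟶ x' ≫ v'} :
    φ ▷ y' ≫ (α_ f s y').hom ≫ f ◁ ρ ≫ (α_ f y s').inv ≫ ω ▷ s' =
        (α_ r v y').hom ≫ r ◁ ζ ≫ (α_ r x' v').inv ≫ π ▷ v' ≫ (α_ x r' v').hom ≫ x ◁ ψ ≫
          (α_ x f' s').inv ↔
      ∀ {i : Finset ℕ+} (z : A₁.cube i),
        par (Hom.mor y' (Trans.app φ z)) *
            (par (Trans.app ρ (Hom.obj f z)) * par (Hom.mor s' (Trans.app ω z))) =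
          par (Trans.app ζ (Hom.obj r z)) *
            (par (Hom.mor v' (Trans.app π z)) * par (Trans.app ψ (Hom.obj x z))) := by
  have e₁ : Trans.comp (Trans.whiskerRight φ y') (Trans.comp (Trans.id _)
      (Trans.comp (Trans.whiskerLeft f ρ) (Trans.comp (Trans.id _) (Trans.whiskerRight ω s')))) =
      Trans.comp (Trans.whiskerRight φ y')
        (Trans.comp (Trans.whiskerLeft f ρ) (Trans.whiskerRight ω s')) :=
    congrArg _ ((Trans.id_comp _).trans (congrArg _ (Trans.id_comp _)))
  have e₂ : Trans.comp (Trans.id _) (Trans.comp (Trans.whiskerLeft r ζ) (Trans.comp (Trans.id _)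
      (Trans.comp (Trans.whiskerRight π v') (Trans.comp (Trans.id _)
        (Trans.comp (Trans.whiskerLeft x ψ) (Trans.id _)))))) =
      Trans.comp (Trans.whiskerLeft r ζ)
        (Trans.comp (Trans.whiskerRight π v') (Trans.whiskerLeft x ψ)) :=
    (Trans.id_comp _).trans (congrArg _ ((Trans.id_comp _).trans (congrArg _
      ((Trans.id_comp _).trans (Trans.comp_id _)))))
  have h₁ : ∀ {i : Finset ℕ+} (z : A₁.cube i),
      par (Trans.app (φ ▷ y' ≫ (α_ f s y').hom ≫ f ◁ ρ ≫ (α_ f y s').inv ≫ ω ▷ s') z) =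
        par (Hom.mor y' (Trans.app φ z)) *
            (par (Trans.app ρ (Hom.obj f z)) * par (Hom.mor s' (Trans.app ω z))) := fun z =>
    (congrArg (fun θ : Trans (Hom.comp r (Hom.comp v y')) (Hom.comp x (Hom.comp f' s')) =>
      par (θ.app z)) e₁).trans ((Trans.par_comp _ _ z).trans (congrArg _ (Trans.par_comp _ _ z)))
  have h₂ : ∀ {i : Finset ℕ+} (z : A₁.cube i),
      par (Trans.app ((α_ r v y').hom ≫ r ◁ ζ ≫ (α_ r x' v').inv ≫ π ▷ v' ≫ (α_ x r' v').hom ≫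
          x ◁ ψ ≫ (α_ x f' s').inv) z) =
          par (Trans.app ζ (Hom.obj r z)) *
            (par (Hom.mor v' (Trans.app π z)) * par (Trans.app ψ (Hom.obj x z))) := fun z =>
    (congrArg (fun θ : Trans (Hom.comp r (Hom.comp v y')) (Hom.comp x (Hom.comp f' s')) =>
      par (θ.app z)) e₂).trans ((Trans.par_comp _ _ z).trans (congrArg _ (Trans.par_comp _ _ z)))
  constructor
  · intro h i z
    rw [← h₁, h, h₂]
  · intro h
    exact Trans.hom_ext fun z => par_injective ((h₁ z).trans ((h z).trans (h₂ z).symm))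

/-- Arrows and quintets over `Mlt(Cat)` satisfy the typing laws. -/
theorem typed_quintets (I : Type) [LinearOrder I] : (quintets I MultCat.{u}).Typed where
  id_dom := by rintro _ _ _ ⟨⟩; rfl
  id_cod := by rintro _ _ _ ⟨⟩; rfl
  exists_id _ A := ⟨_, IsId.mk (C := MultCat.{u}) A⟩
  id_unique := by rintro _ _ _ _ ⟨⟩ ⟨⟩; rfl
  comp_dom := by rintro _ _ _ _ ⟨⟩; rfl
  comp_cod := by rintro _ _ _ _ ⟨⟩; rfl
  exists_comp := by
    rintro _ ⟨A, B, f⟩ ⟨B', C, g⟩ h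
    cases (h : B = B')
    exact ⟨_, IsComp.mk f g⟩
  comp_unique := by rintro _ _ _ _ _ ⟨⟩ ⟨⟩; rfl
  id_comp := by
    rintro _ _ ⟨A, B, f⟩ _ ⟨⟩ ⟨⟩
    rfl
  comp_id := by
    rintro _ _ ⟨A, B, f⟩ _ ⟨⟩ ⟨⟩
    rfl
  assoc := by
    rintro _ _ _ _ _ _ _ _ ⟨⟩ ⟨⟩ ⟨⟩ ⟨⟩
    rfl
  dom_top _ := rfl
  cod_top _ := rfl
  dom_bot _ := rfl
  cod_bot _ := rfl
  exists_idFst _ U := ⟨_, IsIdFst.mk U.hom⟩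
  idFst_top := by rintro _ _ _ _ ⟨⟩; exact .mk _
  idFst_bot := by rintro _ _ _ _ ⟨⟩; exact .mk _
  idFst_left := by rintro _ _ _ _ ⟨⟩; rfl
  idFst_right := by rintro _ _ _ _ ⟨⟩; rfl
  exists_idSnd _ R := ⟨_, IsIdSnd.mk R.hom⟩
  idSnd_top := by rintro _ _ _ _ ⟨⟩; rfl
  idSnd_bot := by rintro _ _ _ _ ⟨⟩; rfl
  idSnd_left := by rintro _ _ _ _ ⟨⟩; exact .mk _
  idSnd_right := by rintro _ _ _ _ ⟨⟩; exact .mk _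
  exists_compFst := by
    rintro _ _ ⟨r, s, f, g, φ⟩ ⟨r', s', f', g', ψ⟩ _ h
    cases (h : (⟨_, _, g⟩ : QArr MultCat.{u}) = ⟨_, _, f'⟩)
    exact ⟨_, .mk _ _ _ _ _ _ _ φ ψ⟩
  compFst_top := by rintro _ _ _ _ _ ⟨⟩; exact .mk _ _
  compFst_bot := by rintro _ _ _ _ _ ⟨⟩; exact .mk _ _
  compFst_left := by rintro _ _ _ _ _ ⟨⟩; rfl
  compFst_right := by rintro _ _ _ _ _ ⟨⟩; rfl
  exists_compSnd := by
    rintro _ _ ⟨r, s, f, g, φ⟩ ⟨r', s', f', g', ψ⟩ _ h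
    cases (h : (⟨_, _, s⟩ : QArr MultCat.{u}) = ⟨_, _, r'⟩)
    exact ⟨_, .mk _ _ _ _ _ _ _ φ ψ⟩
  compSnd_top := by rintro _ _ _ _ _ ⟨⟩; rfl
  compSnd_bot := by rintro _ _ _ _ _ ⟨⟩; rfl
  compSnd_left := by rintro _ _ _ _ _ ⟨⟩; exact .mk _ _
  compSnd_right := by rintro _ _ _ _ _ ⟨⟩; exact .mk _ _

end Quintet

/-! ### Pasting of commutative cubes, and the laws of quintets over `Mlt(Cat)`. -/

namespace Quintet

open MultCat

/-- A functor acts on actual composites and not on the semigroups with zero, so the equation is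
first turned into a commutative diagram, whose arrows are consecutive, and then mapped by `k`. -/
theorem comm_map {A₁ A₂ A₃ A₄ B₁ B₂ B₃ B₄ B₅ : MultCat.{u}}
    {r : A₁ ⟶ A₂} {s : A₃ ⟶ A₄} {r' : B₁ ⟶ B₂} {s' : B₃ ⟶ B₄}
    {f : A₁ ⟶ A₃} {v : A₂ ⟶ A₄} {f' : B₁ ⟶ B₃} {v' : B₂ ⟶ B₄}
    {x : A₁ ⟶ B₁} {x' : A₂ ⟶ B₂} {y : A₃ ⟶ B₃} {y' : A₄ ⟶ B₄}
    {φ : r ≫ v ⟶ f ≫ s} {ψ : r' ≫ v' ⟶ f' ≫ s'} {π : r ≫ x' ⟶ x ≫ r'} {ρ : s ≫ y' ⟶ y ≫ s'}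
    {ω : f ≫ y ⟶ x ≫ f'} {ζ : v ≫ y' ⟶ x' ≫ v'} (k : B₄ ⟶ B₅)
    (h : ∀ {i : Finset ℕ+} (z : A₁.cube i),
      par (Hom.mor y' (Trans.app φ z)) *
          (par (Trans.app ρ (Hom.obj f z)) * par (Hom.mor s' (Trans.app ω z))) =
        par (Trans.app ζ (Hom.obj r z)) *
          (par (Hom.mor v' (Trans.app π z)) * par (Trans.app ψ (Hom.obj x z))))
    {i : Finset ℕ+} (z : A₁.cube i) :
    par (Hom.mor k (Hom.mor y' (Trans.app φ z))) *
        (par (Hom.mor k (Trans.app ρ (Hom.obj f z))) *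
          par (Hom.mor k (Hom.mor s' (Trans.app ω z)))) =
      par (Hom.mor k (Trans.app ζ (Hom.obj r z))) *
        (par (Hom.mor k (Hom.mor v' (Trans.app π z))) *
          par (Hom.mor k (Trans.app ψ (Hom.obj x z)))) := by
  have c : B₄.Commutes
      [Hom.mor y' (Trans.app φ z), Trans.app ρ (Hom.obj f z), Hom.mor s' (Trans.app ω z)]
      [Trans.app ζ (Hom.obj r z), Hom.mor v' (Trans.app π z), Trans.app ψ (Hom.obj x z)] := by
    refine commutes_three ?_ ?_ (h z)
    · rw [Hom.tgt_mor, Trans.tgt_app]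
      exact (Trans.src_app ρ _).symm
    · rw [Hom.src_mor, Trans.src_app]
      exact Trans.tgt_app ρ _
  exact (c.map k).eq

section Pasting

variable {M : Type u} [Semigroup M] {a b c d e f A B P Q N T X Y Z U V W : M}

/-- Two cubes pasted in the first direction: `E` is the image of the first cube, `E₂` the second at
a shifted cube, and `d` their shared face. The equations `n` and `n'` are naturality of faces of the
second cube at components of the first. In the next two lemmas, for the other directions, the shared
faces are `b` and `f`. -/
theorem pasting_fst (E : a * (b * c) = d * (e * f)) (E₂ : A * (B * d) = X * (Y * Z))
    (n : P * Q = B * a) (n' : N * T = Z * e) :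
    A * P * (Q * b * c) = X * (Y * N * (T * f)) :=
  calc A * P * (Q * b * c) = A * (P * Q) * (b * c) := by simp only [mul_assoc]
    _ = A * B * (a * (b * c)) := by rw [n]; simp only [mul_assoc]
    _ = A * (B * d) * (e * f) := by rw [E]; simp only [mul_assoc]
    _ = X * (Y * (Z * e) * f) := by rw [E₂]; simp only [mul_assoc]
    _ = X * (Y * N * (T * f)) := by rw [← n']; simp only [mul_assoc]

theorem pasting_mid (E : a * (b * c) = d * (e * f)) (E₂ : A * (B * V) = X * (b * Z))
    (n : P * X = Y * a) (n' : c * N = Z * T) :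
    P * A * (B * (V * T)) = Y * d * (e * (f * N)) :=
  calc P * A * (B * (V * T)) = P * (A * (B * V)) * T := by simp only [mul_assoc]
    _ = P * X * b * (Z * T) := by rw [E₂]; simp only [mul_assoc]
    _ = Y * (a * (b * c)) * N := by rw [n, ← n']; simp only [mul_assoc]
    _ = Y * d * (e * (f * N)) := by rw [E]; simp only [mul_assoc]

theorem pasting_trd (E : a * (b * c) = d * (e * f)) (E₂ : f * (B * V) = X * (Y * Z))
    (n : c * B = P * Q) (n' : e * X = N * T) :
    a * (b * P * (Q * V)) = d * N * (T * Y * Z) :=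
  calc a * (b * P * (Q * V)) = a * b * (P * Q) * V := by simp only [mul_assoc]
    _ = a * (b * c) * (B * V) := by rw [← n]; simp only [mul_assoc]
    _ = d * e * (f * (B * V)) := by rw [E]; simp only [mul_assoc]
    _ = d * (e * X) * (Y * Z) := by rw [E₂]; simp only [mul_assoc]
    _ = d * N * (T * Y * Z) := by rw [n']; simp only [mul_assoc]

end Pasting

/-- Quintets over `Mlt(Cat)` form a lawful quintet system. -/
theorem lawful_quintets (I : Type) [LinearOrder I] : (quintets I MultCat.{u}).Lawful where
  toTyped := typed_quintets I
  -- In a strict 2-category of actual arrows each of these relations is the graph of an operation,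
  -- so eliminating two instances identifies their results.
  idFst_unique := by rintro _ _ _ _ _ ⟨⟩ ⟨⟩; rfl
  idSnd_unique := by rintro _ _ _ _ _ ⟨⟩ ⟨⟩; rfl
  compFst_unique := by rintro _ _ _ _ _ _ ⟨⟩ ⟨⟩; rfl
  compSnd_unique := by rintro _ _ _ _ _ _ ⟨⟩ ⟨⟩; rfl
  id_compFst := by
    rintro _ _ ⟨r, s, f, g, φ⟩ _ _ ⟨⟩ ⟨⟩
    refine ext_app fun x => (app_compFst _ φ x).trans ?_
    rw [app_idFst, Hom.mor_one]
    exact par_mul_one (Trans.tgt_app φ x)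
  compFst_id := by
    rintro _ _ ⟨r, s, f, g, φ⟩ _ _ ⟨⟩ ⟨⟩
    refine ext_app fun x => (app_compFst φ _ x).trans ?_
    rw [app_idFst]
    exact one_mul_par (Trans.src_app φ x)
  id_compSnd := by
    rintro _ _ ⟨r, s, f, g, φ⟩ _ _ ⟨⟩ ⟨⟩
    refine ext_app fun x => (app_compSnd _ φ x).trans ?_
    rw [app_idSnd, Hom.mor_one]
    exact one_mul_par (Trans.src_app φ x)
  compSnd_id := by
    rintro _ _ ⟨r, s, f, g, φ⟩ _ _ ⟨⟩ ⟨⟩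
    refine ext_app fun x => (app_compSnd φ _ x).trans ?_
    rw [app_idSnd]
    exact par_mul_one (Trans.tgt_app φ x)
  assocFst := by
    rintro _ _ _ _ _ _ _ _ _ ⟨r, r', s, s', f, v, w, φ, ψ⟩ ⟨_, r'', _, s'', _, _, _, _, χ⟩ ⟨⟩ ⟨⟩
    refine ext_app fun x => (app_compFst _ _ x).trans (Eq.trans ?_ (app_compFst _ _ x).symm)
    rw [app_compFst, Hom.par_mor s'' (app_compFst φ ψ x)]
    exact (mul_assoc _ _ _).symm
  assocSnd := by
    rintro _ _ _ _ _ _ _ _ _ ⟨r, s, t, f, f', v, v', φ, σ⟩ ⟨_, _, _, _, _, _, v'', _, χ⟩ ⟨⟩ ⟨⟩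
    refine ext_app fun x => (app_compSnd _ _ x).trans (Eq.trans ?_ (app_compSnd _ _ x).symm)
    rw [app_compSnd, Hom.par_mor v'' (app_compSnd φ σ x)]
    exact mul_assoc _ _ _
  interchange := by
    rintro _ _ _ _ _ _ _ _ _ _ _ _ ⟨r, r', s, s', f, v, w, φ, φ'⟩
      ⟨_, _, t, t', f', v', w', ψ, ψ'⟩ ⟨⟩ ⟨⟩ ⟨⟩ ⟨⟩
    refine ext_app fun x => (app_compSnd _ _ x).trans (Eq.trans ?_ (app_compFst _ _ x).symm)
    rw [app_compSnd, app_compFst, Hom.par_mor w' (app_compFst φ φ' x),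
      Hom.par_mor t' (app_compSnd φ ψ x)]
    -- The two sides differ in the order in which `ψ'` and `φ` are applied: interchange is the
    -- naturality of `ψ'` at the component `φ x`.
    have e := Trans.par_natural ψ' (Trans.src_app φ x) (Trans.tgt_app φ x)
    change par (Hom.mor w' (Hom.mor s' (Trans.app φ x))) * _ =
      _ * par (Hom.mor t' (Hom.mor v' (Trans.app φ x))) at e
    change _ * (par (Trans.app ψ' (Hom.obj s (Hom.obj f x))) * _) =
      _ * par (Trans.app ψ' (Hom.obj v (Hom.obj r x))) * _
    change _ * par (Trans.app ψ' (Hom.obj s (Hom.obj f x))) =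
      par (Trans.app ψ' (Hom.obj v (Hom.obj r x))) * _ at e
    rw [mul_assoc, ← mul_assoc _ (par (Trans.app ψ' _)), e]
    simp only [mul_assoc]
  idFst_comp := by
    rintro _ _ _ _ _ _ _ _ _ ⟨f⟩ ⟨⟩ ⟨_, g⟩ ⟨⟩ ⟨⟩
    refine ext_app fun x => Eq.trans ?_ (app_compSnd _ _ x).symm
    rw [app_idFst, app_idFst, app_idFst, Hom.mor_one]
    exact (one_mul_par (MultCat.src_one _ _)).symm
  idSnd_comp := by
    rintro _ _ _ _ _ _ _ _ _ ⟨f⟩ ⟨⟩ ⟨_, g⟩ ⟨⟩ ⟨⟩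
    refine ext_app fun x => Eq.trans ?_ (app_compFst _ _ x).symm
    rw [app_idSnd, app_idSnd, app_idSnd, Hom.mor_one]
    exact (one_mul_par (MultCat.src_one _ _)).symm
  idFst_id := by
    rintro _ _ _ _ _ _ _ ⟨A⟩ ⟨⟩ ⟨⟩ ⟨⟩
    rfl
  comm_deg_fst := by
    rintro _ _ _ _ _ _ _ ⟨r, s, f, g, ω⟩ ⟨⟩ ⟨⟩ ⟨⟩ ⟨⟩
    refine .mk _ _ _ _ _ _ _ _ _ _ _ _ _ _ _ _ _ _ (comm_iff_app.2 fun x => ?_)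
    rw [app_idFst, app_idFst, app_idFst, app_idFst, Hom.mor_one, Hom.mor_one]
    exact ((congrArg _ (one_mul_par (Trans.src_app ω x))).trans (one_mul_par (Trans.src_app ω x))).trans
      ((congrArg _ (one_mul_par (MultCat.src_one _ _))).trans
        (par_mul_one (Trans.tgt_app ω x))).symm
  comm_deg_mid := by
    rintro _ _ _ _ _ ⟨r, s, f, g, π⟩ _ _ ⟨⟩ ⟨⟩ ⟨⟩ ⟨⟩
    refine .mk _ _ _ _ _ _ _ _ _ _ _ _ _ _ _ _ _ _ (comm_iff_app.2 fun x => ?_)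
    rw [app_idSnd, app_idSnd, app_idFst, app_idFst, Hom.mor_one, Hom.mor_one]
    exact ((congrArg _ (par_mul_one (Trans.tgt_app π x))).trans (one_mul_par (Trans.src_app π x))).trans
      ((congrArg _ (par_mul_one (Trans.tgt_app π x))).trans (one_mul_par (Trans.src_app π x))).symm
  comm_deg_trd := by
    rintro _ _ _ ⟨r, s, f, g, φ⟩ _ _ _ _ ⟨⟩ ⟨⟩ ⟨⟩ ⟨⟩
    refine .mk _ _ _ _ _ _ _ _ _ _ _ _ _ _ _ _ _ _ (comm_iff_app.2 fun x => ?_)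
    rw [app_idSnd, app_idSnd, app_idSnd, app_idSnd, Hom.mor_one, Hom.mor_one]
    exact ((congrArg _ (one_mul_par (MultCat.src_one _ _))).trans
      (par_mul_one (Trans.tgt_app φ x))).trans
      ((congrArg _ (one_mul_par (Trans.src_app φ x))).trans (one_mul_par (Trans.src_app φ x))).symm
  comm_comp_fst := by
    rintro _ _ _ _ _ _ _ _ _ _ _ _ _ _ _ _ _ _
      ⟨r, s, r', s', f, v, f', v', x, x', y, y', φ, ψ, π, ρ, ω, ζ, h⟩
      ⟨r₂, s₂, r₂', s₂', _, v₂, _, v₂', _, x₂', _, y₂', φ₂, ψ₂, π₂, ρ₂, _, ξ, h₂⟩ ⟨⟩ ⟨⟩ ⟨⟩ ⟨⟩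
    refine .mk _ _ _ _ _ _ _ _ _ _ _ _ _ _ _ _ _ _ (comm_iff_app.2 fun z => ?_)
    -- The first cube is pushed forward to the final vertex, and the second is evaluated at `r z`,
    -- where the two share the component of `ζ`.
    have E := comm_map s₂' (comm_iff_app.1 h) z
    have E₂ := comm_iff_app.1 h₂ (Hom.obj r z)
    rw [Hom.par_mor _ (app_compFst φ φ₂ z), Hom.par_mor _ (app_compFst π π₂ z), app_compFst,
      app_compFst]
    exact pasting_fst E E₂ (Trans.par_natural ρ₂ (Trans.src_app φ z) (Trans.tgt_app φ z))
      (Trans.par_natural ψ₂ (Trans.src_app π z) (Trans.tgt_app π z))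
  comm_comp_mid := by
    rintro _ _ _ _ _ _ _ _ _ _ _ _ _ _ _ _ _ _
      ⟨r, s, r', s', f, v, f', v', x, x', y, y', φ, ψ, π, ρ, ω, ζ, h⟩
      ⟨_, t, _, t', f₂, v₂, f₂', v₂', _, _, y₂, y₂', φ₂, ψ₂, _, σ, ω₂, ζ₂, h₂⟩ ⟨⟩ ⟨⟩ ⟨⟩ ⟨⟩
    refine .mk _ _ _ _ _ _ _ _ _ _ _ _ _ _ _ _ _ _ (comm_iff_app.2 fun z => ?_)
    have E := comm_map v₂' (comm_iff_app.1 h) z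
    have E₂ := comm_iff_app.1 h₂ (Hom.obj f z)
    rw [Hom.par_mor _ (app_compFst ω ω₂ z), Hom.par_mor _ (app_compSnd φ φ₂ z), app_compSnd, app_compFst]
    exact pasting_mid E E₂ (Trans.par_natural ζ₂ (Trans.src_app φ z) (Trans.tgt_app φ z))
      (Trans.par_natural ψ₂ (Trans.src_app ω z) (Trans.tgt_app ω z))
  comm_comp_trd := by
    rintro _ _ _ _ _ _ _ _ _ _ _ _ _ _ _ _ _ _
      ⟨r, s, r', s', f, v, f', v', x, x', y, y', φ, ψ, π, ρ, ω, ζ, h⟩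
      ⟨_, _, r₂', s₂', _, _, f₂', v₂', x₂, x₂', y₂, y₂', _, χ, π₂, ρ₂, ω₂, ζ₂, h₂⟩ ⟨⟩ ⟨⟩ ⟨⟩ ⟨⟩
    refine .mk _ _ _ _ _ _ _ _ _ _ _ _ _ _ _ _ _ _ (comm_iff_app.2 fun z => ?_)
    have E := comm_map y₂' (comm_iff_app.1 h) z
    have E₂ := comm_iff_app.1 h₂ (Hom.obj x z)
    rw [Hom.par_mor _ (app_compSnd ω ω₂ z), Hom.par_mor _ (app_compSnd π π₂ z), app_compSnd,
      app_compSnd]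
    exact pasting_trd E E₂ (Trans.par_natural ρ₂ (Trans.src_app ω z) (Trans.tgt_app ω z))
      (Trans.par_natural ζ₂ (Trans.src_app π z) (Trans.tgt_app π z))

end Quintet

/-! ### Typing laws for chiral multiple categories. -/

namespace Cmc

open MultCat MixedFunctor

/-- Chiral multiple categories, mixed functors and their squares satisfy the typing laws. -/
theorem typed_cmc : cmc.{u}.Typed where
  id_dom := by rintro _ _ _ ⟨⟩; rfl
  id_cod := by rintro _ _ _ ⟨⟩; rfl
  exists_id _ A := ⟨_, IsId.mk A _ isIdentity_id⟩
  id_unique := by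
    rintro _ _ _ _ ⟨_, h⟩ ⟨_, h'⟩
    rw [h.unique h']
  comp_dom := by rintro _ _ _ _ ⟨⟩; rfl
  comp_cod := by rintro _ _ _ _ ⟨⟩; rfl
  exists_comp := by
    rintro _ ⟨A, B, f⟩ ⟨B', C, g⟩ h
    cases (h : B = B')
    exact ⟨_, IsComp.mk f g _ (isComposition_comp f g)⟩
  comp_unique := by
    rintro _ _ _ _ _ ⟨R, S, T, h⟩ ⟨_, _, T', h'⟩
    rw [h.unique h']
  id_comp := by
    rintro _ _ ⟨A, B, f⟩ _ ⟨_, h⟩ ⟨_, _, T, h'⟩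
    rw [h'.unique (h.isComposition f)]
    rfl
  comp_id := by
    rintro _ _ ⟨A, B, f⟩ _ ⟨_, h⟩ ⟨_, _, T, h'⟩
    rw [h'.unique (h.isComposition_right f)]
    rfl
  assoc := by
    rintro _ _ _ _ _ _ _ _ ⟨R, S, X, h₁⟩ ⟨_, T, Y, h₂⟩ ⟨_, _, Z, h₃⟩ ⟨_, _, W, h₄⟩
    rw [(h₁.assoc h₃ h₂).unique h₄]
  dom_top _ := rfl
  cod_top _ := rfl
  dom_bot _ := rfl
  cod_bot _ := rfl
  exists_idFst hpq U := ⟨_, IsIdFst.mk U.hom _ _ isIdentity_id isIdentity_id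
    (MixedSquare.idFst hpq U.hom) fun _ => rfl⟩
  idFst_top := by rintro _ _ _ _ ⟨_, _, _, h, h', _, _⟩; exact .mk _ _ h
  idFst_bot := by rintro _ _ _ _ ⟨_, _, _, h, h', _, _⟩; exact .mk _ _ h'
  idFst_left := by rintro _ _ _ _ ⟨⟩; rfl
  idFst_right := by rintro _ _ _ _ ⟨⟩; rfl
  exists_idSnd hpq R := ⟨_, IsIdSnd.mk R.hom _ _ isIdentity_id isIdentity_id
    (MixedSquare.idSnd hpq R.hom) fun _ => rfl⟩
  idSnd_top := by rintro _ _ _ _ ⟨⟩; rfl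
  idSnd_bot := by rintro _ _ _ _ ⟨⟩; rfl
  idSnd_left := by rintro _ _ _ _ ⟨_, _, _, h, h', _, _⟩; exact .mk _ _ h
  idSnd_right := by rintro _ _ _ _ ⟨_, _, _, h, h', _, _⟩; exact .mk _ _ h'
  exists_compFst := by
    rintro _ _ ⟨r, s, f, g, φ⟩ ⟨r', s', f', g', ψ⟩ hpq h
    cases (h : (⟨_, _, g⟩ : CmcArr.{u} _) = ⟨_, _, f'⟩)
    exact ⟨_, .mk _ _ _ _ _ _ _ _ _ (isComposition_comp r r') (isComposition_comp s s') φ ψ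
      (MixedSquare.compFst hpq φ ψ)
      fun x => isComposite_pair_iff.2 (MixedSquare.par_compFstApp φ ψ x)⟩
  compFst_top := by
    rintro _ _ _ _ _ ⟨_, _, _, _, _, _, _, _, _, h, h', _, _, _, _⟩
    exact .mk _ _ _ h
  compFst_bot := by
    rintro _ _ _ _ _ ⟨_, _, _, _, _, _, _, _, _, h, h', _, _, _, _⟩
    exact .mk _ _ _ h'
  compFst_left := by rintro _ _ _ _ _ ⟨⟩; rfl
  compFst_right := by rintro _ _ _ _ _ ⟨⟩; rfl
  exists_compSnd := by
    rintro _ _ ⟨r, s, f, g, φ⟩ ⟨r', s', f', g', ψ⟩ hpq h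
    cases (h : (⟨_, _, s⟩ : CmcArr.{u} _) = ⟨_, _, r'⟩)
    exact ⟨_, .mk _ _ _ _ _ _ _ _ _ (isComposition_comp f f') (isComposition_comp g g') φ ψ
      (MixedSquare.compSnd hpq φ ψ)
      fun x => isComposite_pair_iff.2 (MixedSquare.par_compSndApp φ ψ x)⟩
  compSnd_top := by rintro _ _ _ _ _ ⟨⟩; rfl
  compSnd_bot := by rintro _ _ _ _ _ ⟨⟩; rfl
  compSnd_left := by
    rintro _ _ _ _ _ ⟨_, _, _, _, _, _, _, _, _, h, h', _, _, _, _⟩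
    exact .mk _ _ _ h
  compSnd_right := by
    rintro _ _ _ _ _ ⟨_, _, _, _, _, _, _, _, _, h, h', _, _, _, _⟩
    exact .mk _ _ _ h'

end Cmc

/-! ### Recognition of identities and composites of quintets by components. -/

namespace Quintet

open MultCat

variable {A₁ A₂ A₃ B₁ B₂ B₃ : MultCat.{u}}

theorem isId_of_apply {r : A₁ ⟶ A₁} (ho : ∀ {i : Finset ℕ+} (x : A₁.cube i), Hom.obj r x = x)
    (hm : ∀ {i : Finset ℕ+} (f : A₁.map i), Hom.mor r f = f) : r = 𝟙 A₁ :=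
  Hom.ext (by funext i x; exact ho x) (by funext i f; exact hm f)

theorem comp_of_apply {r : A₁ ⟶ A₂} {s : A₂ ⟶ A₃} {t : A₁ ⟶ A₃}
    (ho : ∀ {i : Finset ℕ+} (x : A₁.cube i), Hom.obj t x = Hom.obj s (Hom.obj r x))
    (hm : ∀ {i : Finset ℕ+} (f : A₁.map i), Hom.mor t f = Hom.mor s (Hom.mor r f)) : t = r ≫ s :=
  Hom.ext (by funext i x; exact ho x) (by funext i f; exact hm f)

/-- The arrow `tv` of an identity `p`-morphism is equal to `𝟙`, but not syntactically. Keeping the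
boundary as variables with equations makes substitution possible before the 2-cells are compared.
The three lemmas below have this form for the same reason. -/
theorem isIdFst_of_apply {f : A₁ ⟶ A₂} {r : A₁ ⟶ A₁} {s : A₂ ⟶ A₂} (hr : r = 𝟙 A₁) (hs : s = 𝟙 A₂)
    (φ : r ≫ f ⟶ f ≫ s)
    (hφ : ∀ {i : Finset ℕ+} (x : A₁.cube i), Trans.app φ x = A₂.one (Hom.obj f x)) :
    IsIdFst ⟨A₁, A₂, f⟩ (⟨r, s, f, f, φ⟩ : QSq MultCat.{u}) := by
  subst hr hs
  have e : φ = (λ_ f).hom ≫ (ρ_ f).inv := Trans.hom_ext fun x => (hφ x).trans (app_idFst f x).symm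
  exact e ▸ .mk f

theorem isIdSnd_of_apply {r : A₁ ⟶ A₂} {f : A₁ ⟶ A₁} {g : A₂ ⟶ A₂} (hf : f = 𝟙 A₁) (hg : g = 𝟙 A₂)
    (φ : r ≫ g ⟶ f ≫ r)
    (hφ : ∀ {i : Finset ℕ+} (x : A₁.cube i), Trans.app φ x = A₂.one (Hom.obj r x)) :
    IsIdSnd ⟨A₁, A₂, r⟩ (⟨r, r, f, g, φ⟩ : QSq MultCat.{u}) := by
  subst hf hg
  have e : φ = (ρ_ r).hom ≫ (λ_ r).inv := Trans.hom_ext fun x => (hφ x).trans (app_idSnd r x).symm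
  exact e ▸ .mk r

theorem isCompFst_of_apply {r : A₁ ⟶ A₂} {r' : A₂ ⟶ A₃} {r'' : A₁ ⟶ A₃} {s : B₁ ⟶ B₂}
    {s' : B₂ ⟶ B₃} {s'' : B₁ ⟶ B₃} {t : A₁ ⟶ B₁} {v : A₂ ⟶ B₂} {w : A₃ ⟶ B₃} (hr : r'' = r ≫ r')
    (hs : s'' = s ≫ s') (φ : r ≫ v ⟶ t ≫ s) (ψ : r' ≫ w ⟶ v ≫ s') (σ : r'' ≫ w ⟶ t ≫ s'')
    (hσ : ∀ {i : Finset ℕ+} (x : A₁.cube i), par (Trans.app σ x) =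
      par (Trans.app ψ (Hom.obj r x)) * par (Hom.mor s' (Trans.app φ x))) :
    IsCompFst (⟨r, s, t, v, φ⟩ : QSq MultCat.{u}) ⟨r', s', v, w, ψ⟩ ⟨r'', s'', t, w, σ⟩ := by
  subst hr hs
  have e := Trans.hom_ext fun x => par_injective ((hσ x).trans (app_compFst φ ψ x).symm)
  exact e ▸ .mk r r' s s' t v w φ ψ

theorem isCompSnd_of_apply {r : A₁ ⟶ B₁} {s : A₂ ⟶ B₂} {t : A₃ ⟶ B₃} {f : A₁ ⟶ A₂} {f' : A₂ ⟶ A₃}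
    {f'' : A₁ ⟶ A₃} {v : B₁ ⟶ B₂} {v' : B₂ ⟶ B₃} {v'' : B₁ ⟶ B₃} (hf : f'' = f ≫ f')
    (hv : v'' = v ≫ v') (φ : r ≫ v ⟶ f ≫ s) (σ : s ≫ v' ⟶ f' ≫ t) (τ : r ≫ v'' ⟶ f'' ≫ t)
    (hτ : ∀ {i : Finset ℕ+} (x : A₁.cube i), par (Trans.app τ x) =
      par (Hom.mor v' (Trans.app φ x)) * par (Trans.app σ (Hom.obj f x))) :
    IsCompSnd (⟨r, s, f, v, φ⟩ : QSq MultCat.{u}) ⟨s, t, f', v', σ⟩ ⟨r, t, f'', v'', τ⟩ := by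
  subst hf hv
  have e := Trans.hom_ext fun x => par_injective ((hτ x).trans (app_compSnd φ σ x).symm)
  exact e ▸ .mk r s t f f' v v' φ σ

end Quintet

namespace Quintet

open MultCat

theorem Comm.eq {A₁ A₂ A₃ A₄ B₁ B₂ B₃ B₄ : MultCat.{u}}
    {r : A₁ ⟶ A₂} {s : A₃ ⟶ A₄} {r' : B₁ ⟶ B₂} {s' : B₃ ⟶ B₄}
    {f : A₁ ⟶ A₃} {v : A₂ ⟶ A₄} {f' : B₁ ⟶ B₃} {v' : B₂ ⟶ B₄}
    {x : A₁ ⟶ B₁} {x' : A₂ ⟶ B₂} {y : A₃ ⟶ B₃} {y' : A₄ ⟶ B₄}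
    {φ : r ≫ v ⟶ f ≫ s} {ψ : r' ≫ v' ⟶ f' ≫ s'} {π : r ≫ x' ⟶ x ≫ r'} {ρ : s ≫ y' ⟶ y ≫ s'}
    {ω : f ≫ y ⟶ x ≫ f'} {ζ : v ≫ y' ⟶ x' ≫ v'}
    (H : Comm ⟨r, s, f, v, φ⟩ ⟨r', s', f', v', ψ⟩ ⟨r, r', x, x', π⟩ ⟨s, s', y, y', ρ⟩
      ⟨f, f', x, y, ω⟩ ⟨v, v', x', y', ζ⟩) {i : Finset ℕ+} (z : A₁.cube i) :
    par (Hom.mor y' (Trans.app φ z)) *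
        (par (Trans.app ρ (Hom.obj f z)) * par (Hom.mor s' (Trans.app ω z))) =
      par (Trans.app ζ (Hom.obj r z)) *
        (par (Hom.mor v' (Trans.app π z)) * par (Trans.app ψ (Hom.obj x z))) := by
  cases H with
  | mk _ _ _ _ _ _ _ _ _ _ _ _ _ _ _ _ _ _ h => exact comm_iff_app.1 h z

end Quintet

/-! ### The transversal map and the reflection of commutative cubes. -/

namespace Cmc

open MultCat MixedFunctor

/-- A square with given boundary has no data besides its components: the comparisons belong to the
boundary, and coherence is a proposition. -/
theorem tvSquare_injective {p q : ℕ∞} {A B C D : ChiralMultipleCategory.{u}} {R : MixedFunctor p A B}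
    {S : MixedFunctor p C D} {U : MixedFunctor q A C} {V : MixedFunctor q B D}
    {φ ψ : MixedSquare R S U V} (h : tvSquare φ = tvSquare ψ) : φ = ψ :=
  MixedSquare.ext (congrArg (fun θ : Trans (Hom.comp R.toHom V.toHom) (Hom.comp U.toHom S.toHom) =>
    @Trans.app _ _ _ _ θ) h)

/-- The twelve boundary equations identify the edges of the six squares, comparisons included, as
the constructor of `Comm` demands. The remaining condition is an equation of components, already
contained in the image. -/
theorem comm_of_boundary {p q r : ℕ∞} {φ ψ : CmcSq.{u} p q} {π ρ : CmcSq.{u} p r}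
    {ω ζ : CmcSq.{u} q r} (b : cmc.CubeBoundary φ ψ π ρ ω ζ)
    (H : Quintet.Comm (tvSq φ) (tvSq ψ) (tvSq π) (tvSq ρ) (tvSq ω) (tvSq ζ)) :
    Comm φ ψ π ρ ω ζ := by
  obtain ⟨R, S, U, V, φ⟩ := φ
  obtain ⟨R', S', U', V', ψ⟩ := ψ
  obtain ⟨_, _, X, X', π⟩ := π
  obtain ⟨_, _, Y, Y', ρ⟩ := ρ
  obtain ⟨_, _, _, _, ω⟩ := ω
  obtain ⟨_, _, _, _, ζ⟩ := ζ
  obtain ⟨h₁, h₂, h₃, h₄, h₅, h₆, h₇, h₈, h₉, h₁₀, h₁₁, h₁₂⟩ := b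
  cases h₁
  cases h₂
  cases h₃
  cases h₄
  cases h₅
  cases h₆
  cases h₇
  cases h₈
  cases h₉
  cases h₁₀
  cases h₁₁
  cases h₁₂
  refine .mk _ _ _ _ _ _ _ _ _ _ _ _ _ _ _ _ _ _ fun z => commutes_three ?_ ?_ (H.eq z)
  · rw [Y'.tgt_mor, φ.tgt_app, ρ.src_app]
  · rw [S'.src_mor, ω.src_app, ρ.tgt_app]

/-- The transversal map, from chiral multiple categories to quintets over `Mlt(Cat)`. -/
def tvMap : QuintetSystem.FaithfulMap cmc.{u} (quintets ℕ∞ MultCat.{u}) where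
  obj A := (show ChiralMultipleCategory.{u} from A).toMultCat
  arr R := tvArr R
  sq φ := tvSq φ
  dom_arr _ := rfl
  cod_arr _ := rfl
  top_sq _ := rfl
  bot_sq _ := rfl
  left_sq _ := rfl
  right_sq _ := rfl
  isId := by
    rintro _ A _ ⟨R, h⟩
    -- Only the action on cubes and maps is compared, since `tv` forgets the comparisons of `R`.
    have e : tvHom R = 𝟙 A.toMultCat := Quintet.isId_of_apply h.obj h.mor
    change Quintet.IsId _ (⟨_, _, tvHom R⟩ : QArr MultCat.{u})
    rw [e]
    exact .mk _
  isComp := by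
    rintro _ _ _ _ ⟨R, S, T, h⟩
    have e : tvHom T = tvHom R ≫ tvHom S := Quintet.comp_of_apply h.obj h.mor
    change Quintet.IsComp _ _ (⟨_, _, tvHom T⟩ : QArr MultCat.{u})
    rw [e]
    exact .mk _ _
  isIdFst := by
    rintro _ _ _ _ ⟨U, R, S, hR, hS, φ, hφ⟩
    exact Quintet.isIdFst_of_apply (Quintet.isId_of_apply hR.obj hR.mor)
      (Quintet.isId_of_apply hS.obj hS.mor) _ hφ
  isIdSnd := by
    rintro _ _ _ _ ⟨R, U, V, hU, hV, φ, hφ⟩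
    exact Quintet.isIdSnd_of_apply (Quintet.isId_of_apply hU.obj hU.mor)
      (Quintet.isId_of_apply hV.obj hV.mor) _ hφ
  isCompFst := by
    rintro _ _ _ _ _ ⟨_, _, _, _, _, _, _, _, _, hR, hS, φ, ψ, σ, hσ⟩
    exact Quintet.isCompFst_of_apply (Quintet.comp_of_apply hR.obj hR.mor)
      (Quintet.comp_of_apply hS.obj hS.mor) _ _ _ fun x => isComposite_pair_iff.1 (hσ x)
  isCompSnd := by
    rintro _ _ _ _ _ ⟨_, _, _, _, _, _, _, _, _, hU, hV, φ, σ, τ, hτ⟩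
    exact Quintet.isCompSnd_of_apply (Quintet.comp_of_apply hU.obj hU.mor)
      (Quintet.comp_of_apply hV.obj hV.mor) _ _ _ fun x => isComposite_pair_iff.1 (hτ x)
  sq_injective := by
    rintro _ _ ⟨R, S, U, V, φ⟩ ⟨R', S', U', V', ψ⟩ h₁ h₂ h₃ h₄ h
    cases h₁
    cases h₂
    cases h₃
    cases h₄
    have h : (⟨_, _, _, _, tvSquare φ⟩ : QSq MultCat.{u}) = ⟨_, _, _, _, tvSquare ψ⟩ := h
    -- With equal boundaries, the heterogeneous equality of the two 2-cells becomes an ordinary one.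
    rw [QSq.mk.injEq] at h
    simp only [heq_eq_eq, true_and] at h
    rw [tvSquare_injective h]
  comm_iff := by
    intro p q r φ ψ π ρ ω ζ
    constructor
    · rintro ⟨_, _, _, _, _, _, _, _, _, _, _, _, _, _, _, _, _, _, h⟩
      exact ⟨⟨rfl, rfl, rfl, rfl, rfl, rfl, rfl, rfl, rfl, rfl, rfl, rfl⟩,
        .mk _ _ _ _ _ _ _ _ _ _ _ _ _ _ _ _ _ _ (Quintet.comm_iff_app.2 fun z => (h z).eq)⟩
    · rintro ⟨b, h⟩
      exact comm_of_boundary b h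

/-- Chiral multiple categories form a lawful quintet system. -/
theorem lawful_cmc : cmc.{u}.Lawful := tvMap.lawful typed_cmc (Quintet.lawful_quintets _)

end Cmc

/-! ## A chiral multiple category with scalar transversal maps -/

section Scalar

open MultCat

variable (G : Type u) [CommGroup G]

/-- The multiple set with constant value. -/
def constMultipleSet {I : Type} [DecidableEq I] (X : Type u) : MultipleSet (I := I) fun _ => X where
  face _ _ _ _ _ x := x
  deg _ x := x
  face_face := by intros; rfl
  deg_deg := by intros; rfl
  face_deg_ne := by intros; rfl
  face_deg := by intros; rfl

/-- The multiple object in `Cat` which is constant at a group. -/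
def scalarMultCat : MultCat.{u} where
  cube _ := PUnit
  map _ := G
  cubes := constMultipleSet PUnit
  maps := constMultipleSet G
  src _ := ⟨⟩
  tgt _ := ⟨⟩
  one _ := 1
  comp f g _ := f * g
  src_one _ := rfl
  tgt_one _ := rfl
  src_comp _ _ _ := rfl
  tgt_comp _ _ _ := rfl
  one_comp _ _ := one_mul _
  comp_one _ _ := mul_one _
  comp_assoc _ _ _ _ _ _ _ := mul_assoc _ _ _
  src_face _ _ _ _ _ _ := rfl
  tgt_face _ _ _ _ _ _ := rfl
  face_one _ _ _ _ _ _ := rfl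
  face_comp _ _ _ _ _ _ _ _ _ := rfl
  src_deg _ _ := rfl
  tgt_deg _ _ := rfl
  deg_one _ _ := rfl
  deg_comp _ _ _ _ _ := rfl

variable {G}

theorem scalar_commutes_two_one {i : Finset ℕ+} :
    (scalarMultCat G).Commutes (i := i) [(1 : G), (1 : G)] [(1 : G)] :=
  commutes_one ((par_mul_par rfl).trans (congrArg par (mul_one (1 : G))))

theorem scalar_commutes_swap {i : Finset ℕ+} (g : G) :
    (scalarMultCat G).Commutes (i := i) [g, (1 : G)] [(1 : G), g] :=
  commutes_two rfl ((par_mul_one rfl).trans (one_mul_par rfl).symm)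

theorem scalar_par_three {i : Finset ℕ+} (a b c : G) :
    par (A := scalarMultCat G) (i := i) a * (par (i := i) b * par (i := i) c) =
      par (i := i) ((a * (b * c) : G) : (scalarMultCat G).map i) :=
  (congrArg _ (par_mul_par rfl)).trans (par_mul_par rfl)

theorem scalar_commutes_three {i : Finset ℕ+} {a b c d e f : G}
    (h : a * (b * c) = d * (e * f)) :
    (scalarMultCat G).Commutes (i := i) [a, b, c] [d, e, f] :=
  commutes_three rfl rfl ((scalar_par_three a b c).trans
    ((congrArg par h).trans (scalar_par_three d e f).symm))

theorem scalar_commutes_rotate {i : Finset ℕ+} (g : G) :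
    (scalarMultCat G).Commutes (i := i) [(1 : G), (1 : G), g] [g, (1 : G), (1 : G)] :=
  scalar_commutes_three (by simp)

theorem scalar_isInvertible_one {i : Finset ℕ+} :
    (scalarMultCat G).IsInvertible (i := i) (1 : G) :=
  ⟨(1 : G), rfl, rfl, mul_one (1 : G), mul_one (1 : G)⟩

variable (G)

/-- The chiral multiple category with one cube and transversal maps `G`, in each multi-index. -/
def scalarChiral : ChiralMultipleCategory.{u} where
  toMultCat := scalarMultCat G
  add _ _ _ _ := ⟨⟩
  -- All faces are the identity of `G`, so consecutive maps are equal, and their sum can be their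
  -- common value.
  addM _ f _ _ := f
  src_addM _ _ _ _ _ := rfl
  tgt_addM _ _ _ _ _ := rfl
  addM_one _ _ _ _ _ := rfl
  addM_comp _ _ _ _ _ _ _ _ _ _ _ := rfl
  face_add_fst _ _ _ _ := rfl
  face_add_snd _ _ _ _ := rfl
  face_add_ne _ _ _ _ _ _ _ _ _ _ _ _ _ _ := rfl
  deg_add_ne _ _ _ _ _ _ _ := rfl
  face_addM_fst _ _ _ _ := rfl
  face_addM_snd _ _ _ h := h
  face_addM_ne _ _ _ _ _ _ _ _ _ _ _ _ _ _ := rfl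
  deg_addM_ne _ _ _ _ _ _ _ := rfl
  lam _ _ := (1 : G)
  lam_isHom _ _ _ := ⟨rfl, rfl⟩
  rho _ _ := (1 : G)
  rho_isHom _ _ _ := ⟨rfl, rfl⟩
  kap _ _ _ _ _ _ := (1 : G)
  kap_isHom _ _ _ _ _ _ _ _ := ⟨rfl, rfl⟩
  chi _ _ _ _ _ _ _ _ _ _ _ := (1 : G)
  chi_isHom _ _ _ _ _ _ _ _ _ _ _ _ _ := ⟨rfl, rfl⟩
  lam_invertible _ _ := scalar_isInvertible_one
  rho_invertible _ _ := scalar_isInvertible_one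
  kap_invertible _ _ _ _ _ _ := scalar_isInvertible_one
  lam_natural _ f _ := scalar_commutes_swap (G := G) f
  rho_natural _ f _ := scalar_commutes_swap (G := G) f
  kap_natural _ f _ _ _ _ _ _ _ _ _ _ := scalar_commutes_swap (G := G) f
  chi_natural _ _ _ f _ _ _ _ _ _ _ _ _ _ _ _ _ _ _ _ _ := scalar_commutes_swap (G := G) f
  lam_special _ _ _ := rfl
  rho_special _ _ _ := rfl
  kap_special _ _ _ _ _ _ _ := rfl
  chi_special _ _ _ _ _ _ _ _ _ _ _ := ⟨fun _ => rfl, fun _ => rfl⟩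
  lam_face _ _ _ _ _ _ _ _ _ _ _ := rfl
  lam_deg _ _ _ _ := rfl
  rho_face _ _ _ _ _ _ _ _ _ _ _ := rfl
  rho_deg _ _ _ _ := rfl
  kap_face := by intros; rfl
  kap_deg := by intros; rfl
  chi_face := by intros; rfl
  chi_deg := by intros; rfl
  pentagon := by intros; exact commutes_two rfl (congrArg _ (one_mul_par rfl).symm)
  triangle := by intros; exact scalar_commutes_two_one
  chi_kap_fst := by intros; exact scalar_commutes_rotate (1 : G)
  chi_kap_snd := by intros; exact scalar_commutes_rotate (1 : G)
  chi_lam_fst := by intros; exact scalar_commutes_two_one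
  chi_rho_fst := by intros; exact scalar_commutes_two_one
  chi_lam_snd := by intros; exact scalar_commutes_two_one
  chi_rho_snd := by intros; exact scalar_commutes_two_one
  chi_hexagon := by intros; exact scalar_commutes_rotate (1 : G)

variable {G}

/-- The square of identities whose components are a fixed scalar. -/
def scalarSquare {p q : ℕ∞} (hp : p ≠ 0) (g : G) :
    MixedSquare (MixedFunctor.id p (scalarChiral G)) (MixedFunctor.id p (scalarChiral G))
      (MixedFunctor.id q (scalarChiral G)) (MixedFunctor.id q (scalarChiral G)) where
  app _ := g
  src_app _ := rfl
  tgt_app _ := rfl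
  face_app _ _ _ _ _ _ := rfl
  -- Naturality of a constant family `g` says that `g` commutes with all of `G`; hence the group
  -- must be commutative.
  naturality f := commutes_two rfl ((par_mul_par rfl).trans
    ((congrArg par (mul_comm (G := G) f g)).trans (par_mul_par rfl).symm))
  unit_lax_lax := by intros; exact scalar_commutes_rotate g
  unit_lax_colax := by intros; exact scalar_commutes_three rfl
  unit_colax_colax := by intros; exact scalar_commutes_rotate g
  mul_lax_lax := by intros; exact scalar_commutes_rotate g
  mul_lax_colax := by intros; exact scalar_commutes_three rfl
  mul_colax_colax := by intros; exact scalar_commutes_rotate g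
  -- A `0q`-cell has identity components, so a nontrivial scalar requires `p ≠ 0`.
  app_strict h := absurd h hp

end Scalar

/-! ### A boundary in dimension three without filler. -/

section Scalar

open MultCat

variable {G : Type u} [CommGroup G]

theorem scalar_comm {p q r : ℕ∞} (hp : p ≠ 0) (hq : q ≠ 0) (g : G) :
    Cmc.Comm (p := p) (q := q) (r := r) ⟨_, _, _, _, scalarSquare hp g⟩ ⟨_, _, _, _, scalarSquare hp g⟩
      ⟨_, _, _, _, scalarSquare hp g⟩ ⟨_, _, _, _, scalarSquare hp g⟩
      ⟨_, _, _, _, scalarSquare hq g⟩ ⟨_, _, _, _, scalarSquare hq g⟩ :=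
  .mk _ _ _ _ _ _ _ _ _ _ _ _ _ _ _ _ _ _ fun _ => scalar_commutes_three rfl

/-- Five faces contribute `1` and the face `ω` contributes `g`, so commutativity reads `1 * (1 * g)
= 1 * (1 * 1)`. Evaluation at the only cube of empty index suffices. -/
theorem eq_of_scalar_comm {p q r : ℕ∞} (hp : p ≠ 0) (hq : q ≠ 0) {g : G}
    (h : Cmc.Comm (p := p) (q := q) (r := r) ⟨_, _, _, _, scalarSquare hp (1 : G)⟩
      ⟨_, _, _, _, scalarSquare hp (1 : G)⟩ ⟨_, _, _, _, scalarSquare hp (1 : G)⟩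
      ⟨_, _, _, _, scalarSquare hp (1 : G)⟩ ⟨_, _, _, _, scalarSquare hq g⟩
      ⟨_, _, _, _, scalarSquare hq (1 : G)⟩) : g = 1 := by
  have e : par (A := scalarMultCat G) (i := ∅) (1 : G) * (par (1 : G) * par g) =
      par (1 : G) * (par (1 : G) * par (1 : G)) :=
    Quintet.Comm.eq (Cmc.tvMap.comm_iff.1 h).2 (i := ∅) PUnit.unit
  have e' : (1 : G) * (1 * g) = 1 * (1 * 1) := par_injective (A := scalarMultCat G) (i := ∅)
    ((scalar_par_three _ _ _).symm.trans (e.trans (scalar_par_three _ _ _)))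
  simpa using e'

/-- The cube all of whose two-dimensional faces have components a fixed scalar. -/
def scalarCell {P : Finset ℕ∞} (hP : 0 ∉ P) (g : G) : Cell cmc.{u} P where
  obj _ _ := scalarChiral G
  arr p _ _ _ _ := ⟨_, _, MixedFunctor.id p (scalarChiral G)⟩
  sq _ _ _ _ hp _ _ _ _ := ⟨_, _, _, _, scalarSquare (fun e => hP (e ▸ hp)) g⟩
  dom_arr _ _ _ _ _ := rfl
  cod_arr _ _ _ _ _ := rfl
  top_sq _ _ _ _ _ _ _ _ _ := rfl
  bot_sq _ _ _ _ _ _ _ _ _ := rfl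
  left_sq _ _ _ _ _ _ _ _ _ := rfl
  right_sq _ _ _ _ _ _ _ _ _ := rfl
  comm _ _ _ _ _ _ _ _ _ _ _ _ _ := scalar_comm _ _ g

theorem face_scalarCell (α : Bool) {j : ℕ∞} {k P : Finset ℕ∞} (h : IsExt j k P) (hP : 0 ∉ P)
    (g : G) : Cell.face α h (scalarCell hP g) =
      scalarCell (fun e => hP (h.mem_of_mem e)) g := rfl

/-- The scalar is visible only on squares, and there are none with at most one direction. -/
theorem scalarCell_eq {P : Finset ℕ∞} (hP : 0 ∉ P) (hc : P.card ≤ 1) (g g' : G) :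
    scalarCell hP g = scalarCell hP g' :=
  Cell.ext_of (fun _ _ => rfl) (fun _ _ _ _ _ => rfl) fun p q _ hpq hp hq _ _ _ =>
    absurd (Finset.card_le_one.1 hc p hp q hq) hpq.ne

/-- A consistent family of scalar squares on the faces of a three-dimensional cube, one of which
has components `g`, the others being identities. -/
def scalarFamily (g : G) : FaceFamily Cmc.lawful_cmc.{u}.multipleCategory.toMultipleSet
    ({1, 2, 3} : Finset ℕ∞) where
  cell α j _ h := scalarCell (fun e => absurd (h.mem_of_mem e) (by decide))
    (if α = false ∧ j = 1 then g else 1)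
  consistent α β {j l m k n} hj hl hl' hj' := by
    change Cell.face β hl' (scalarCell _ _) = Cell.face α hj' (scalarCell _ _)
    rw [face_scalarCell, face_scalarCell]
    -- The consistency conditions live on faces of codimension two of a three-dimensional cube.
    -- These are edges, which do not see the scalars, so the scalars can be prescribed independently
    -- on the six faces.
    refine scalarCell_eq _ ?_ _ _
    have h₁ := Finset.card_insert_of_notMem hj.1
    have h₂ := Finset.card_insert_of_notMem hl'.1
    rw [← hj.2] at h₁
    rw [← hl'.2] at h₂
    have h₃ : ({1, 2, 3} : Finset ℕ∞).card = 3 := rfl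
    omega

/-- A filler of `scalarFamily g` would be a commutative cube with a single nontrivial face, which
forces `g = 1`. The directions `1, 2, 3` avoid `0`, and their number exceeds every `n < 3`, so one
family refutes all these bounds. -/
theorem not_coskeletalDimLE_two {n : ℕ} (hn : n < 3) :
    ¬ Cmc.lawful_cmc.{u}.multipleCategory.CoskeletalDimLE n := by
  intro H
  -- The smallest nontrivial commutative group, lifted to the required universe.
  obtain ⟨g, hg⟩ := exists_ne (1 : ULift.{u} (Multiplicative (ZMod 2)))
  obtain ⟨x, hx, -⟩ := H {1, 2, 3} (hn.trans_eq (by rfl)) (scalarFamily g)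
  -- Each square of the filler lies in the face normal to the third direction `j`, so it is
  -- prescribed by the family; the vertex `v` tells which of the two opposite faces it is.
  have key : ∀ {p q j : ℕ∞} {v : Finset ℕ∞} (hj : j ∈ ({1, 2, 3} : Finset ℕ∞)) (hpj : p ≠ j)
      (hqj : q ≠ j) (hpq : p < q) (hp : p ∈ ({1, 2, 3} : Finset ℕ∞))
      (hq : q ∈ ({1, 2, 3} : Finset ℕ∞)) (hv : v ⊆ {1, 2, 3}) (hpv : p ∉ v) (hqv : q ∉ v)
      (h0 : p ≠ 0), x.sq p q v hpq hp hq hv hpv hqv = ⟨_, _, _, _, scalarSquare h0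
        (if decide (j ∈ v) = false ∧ j = 1 then g else 1)⟩ := by
    intro p q j v hj hpj hqj hpq hp hq hv hpv hqv h0
    rw [x.sq_eq_face hj hpj hqj]
    change ((Cmc.lawful_cmc.multipleCategory.face (decide (j ∈ v)) (isExt_erase hj) x).sq _ _ _ _ _ _ _ _ _) = _
    rw [hx]
    rfl
  have c := x.comm 1 2 3 ∅ (by decide) (by decide) (by decide) (by decide) (by decide) (by decide)
    (by decide) (by decide) (by decide)
  -- Of the six squares only the one in directions `2` and `3` at the empty vertex lies in the
  -- negative face of direction `1`; it receives `g`, and the others receive `1`.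
  rw [key (j := 3) (by decide) (by decide) (by decide) _ _ _ _ _ _ (by decide),
    key (j := 3) (by decide) (by decide) (by decide) _ _ _ _ _ _ (by decide),
    key (j := 2) (by decide) (by decide) (by decide) _ _ _ _ _ _ (by decide),
    key (j := 2) (by decide) (by decide) (by decide) _ _ _ _ _ _ (by decide),
    key (j := 1) (by decide) (by decide) (by decide) _ _ _ _ _ _ (by decide),
    key (j := 1) (by decide) (by decide) (by decide) _ _ _ _ _ _ (by decide)] at c
  exact hg (eq_of_scalar_comm _ _ c)

end Scalar

theorem mainTheorem2 :
    ∃ (M : MultipleCategory (Cell cmc.{u}))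
      (N : MultipleCategory (Cell (quintets ℕ∞ MultCat.{u})))
      (tv : MultipleFunctor M N),
      cmc.{u}.IsMultipleCategoryOf M ∧
      (quintets ℕ∞ MultCat.{u}).IsMultipleCategoryOf N ∧
      IsTransversalFunctor tv ∧
      tv.IsTwoFaithful ∧
      IsLeast {n : ℕ | M.CoskeletalDimLE n} 3 :=
  ⟨Cmc.lawful_cmc.multipleCategory, (Quintet.lawful_quintets ℕ∞).multipleCategory,
    Cmc.tvMap.multipleFunctor Cmc.lawful_cmc (Quintet.lawful_quintets ℕ∞),
    Cmc.lawful_cmc.isMultipleCategoryOf, (Quintet.lawful_quintets ℕ∞).isMultipleCategoryOf,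
    ⟨fun _ _ _ => rfl, fun _ _ _ _ _ _ => rfl, fun _ _ _ _ _ _ _ _ _ _ => rfl⟩,
    Cmc.tvMap.isTwoFaithful _ _,
    ⟨Cmc.lawful_cmc.coskeletalDimLE_three, fun _ hn =>
      not_lt.1 fun h => not_coskeletalDimLE_two h hn⟩⟩
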